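/- Let $\mathcal A=\{a_0,\dots,a_p\}\subset\mathbb C$ be distinct points, $\rho_0,\dots,\rho_p\in\mathbb C$, and $\varphi=\operatorname{Re}\Phi$, $\Phi(z)=-\sum_{k=0}^p\frac{\rho_k}{2}\log(z-a_k)$, so that $\Phi'(z)=-\sum_k\frac{\rho_k/2}{z-a_k}$ is single-valued; if some $\rho_k\notin\mathbb R$, $\varphi$ is multivalued, and statements about $\varphi$ refer to its continuous branches. For a finite real Borel measure $\mu$ on $\mathbb C$ put $U^\mu(z)=\int\log\frac1{|z-x|}\,d\mu(x)$, $E(\mu)=\iint\log\frac1{|x-y|}\,d\mu(x)\,d\mu(y)$, $E_\varphi(\mu)=E(\mu)+2\int\varphi\,d\mu$, and $C^\mu(z)=\lim_{\varepsilon\to0+}\int_{|z-x|>\varepsilon}\frac{d\mu(x)}{x-z}$. A finite real measure $\mu$ with compact support, absolutely convergent energy $E(\mu)$ (in particular without point masses) and $\varphi\in L^1(|\mu|)$ (for non-real $\rho_k$: $\sum_k\operatorname{Re}\rho_k\log|z-a_k|\in L^1(|\mu|)$) is called $(\mathcal A,\varphi)$-critical if for every smooth $h:\mathbb C\to\mathbb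 C$ with $h|_{\mathcal A}=0$, $$\lim_{t\to0,\ t\in\mathbb C}\frac{E_\varphi(\mu^t)-E_\varphi(\mu)}{t}=0,$$ where $\mu^t$ is the image of $\mu$ under $x\mapsto x+t\,h(x)$ (for multivalued $\varphi$, the field is continued along the segment from $x$ to $x+t\,h(x)$, i.e. the field part of the difference is $2\int[\varphi(x+th(x))-\varphi(x)]\,d\mu(x)$). A point $z\in\operatorname{supp}\mu$ is regular if it has a simply connected open neighbourhood $B$ such that $B\cap\operatorname{supp}\mu$ is an open Jordan arc, continuously differentiable with non-vanishing derivative (so that $\operatorname{supp}\mu$ has normals at $z$). Consider the following conditions on $\mu$. (i) At every $z\in\operatorname{supp}\mu$ the total potential is well defined, i.e. $U^\mu(z)$ converges absolutely and $z\ne a_k$ whenever $\rho_k\neq0$; and $U^\mu+\varphi$ is constant on each connected component of $\operatorname{supp}\mu$ (for multivalued $\varphi$: each point $z$ of a component has a neighbourhood in which the branch of $U^\mu+\varphi$ at $z$ is constant along the component). (ii) At every regular point $z\in\operatorname{supp}\mu$ the one-sided normal derivatives exist and are equal, $$\frac{\partial}{\partial n_+}(U^\mu+\varphi)(z)=\frac{\partial}{\partial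 n_-}(U^\mu+\varphi)(z),$$ $n_\pm$ being the two opposite unit normals to $\operatorname{supp}\mu$ at $z$ ($S$-property); and if $z\in\operatorname{supp}\mu\setminus\mathcal A$ is not regular, then $U^\mu+\varphi$ is differentiable at $z$ and $\operatorname{grad}(U^\mu+\varphi)(z)=0$. Then: (1) every $(\mathcal A,\varphi)$-critical measure satisfies (i) and (ii). In particular, if all $\rho_k$ are real, then for each connected component $\Gamma$ of $\operatorname{supp}\mu$ there is a constant $w\in\mathbb R$ with $U^\mu(z)+\varphi(z)=w$ for all $z\in\Gamma$. (2) Conversely, if $\mu$ is a finite real measure whose support is a union of finitely many compact analytic arcs (images of $[0,1]$ under injective maps that are real-analytic up to the endpoints with non-vanishing derivative), and if $\mu$ satisfies (i) and (ii), then there is a rational function $R$ whose only possible poles are at points of $\mathcal A$ and of order at most $2$, such that $$\left(C^\mu(z)+\Phi'(z)\right)^2=R(z)\quad\text{for almost every } z\in\mathbb C \text{ with respect to plane Lebesgue measure.}$$ -/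

import Mathlib

open MeasureTheory Filter Topology Set
open scoped ContDiff

noncomputable section

/-! ### Measures, potentials and Cauchy transforms -/

/-- The support of a real (signed) Borel measure on the plane: the closed support of `|μ|`. -/
def realSupport (μ : SignedMeasure ℂ) : Set ℂ := μ.variation.support

/-- The logarithmic potential `U^μ(z) = ∫ log (1 / |z - x|) dμ(x)`. -/
def logPotential (μ : SignedMeasure ℂ) (z : ℂ) : ℝ :=
  ∫ᵛ x, Real.log (1 / ‖z - x‖) ∂•μ

/-- The logarithmic energy `E(μ) = ∬ log (1 / |x - y|) dμ(x) dμ(y)`. -/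
def logEnergy (μ : SignedMeasure ℂ) : ℝ :=
  ∫ᵛ y, (∫ᵛ x, Real.log (1 / ‖y - x‖) ∂•μ) ∂•μ

/-- Absolute convergence of the energy integral. The kernel is `+∞` on the diagonal
(where `Real.log` has the value `0`), so that point masses are excluded separately. -/
def HasFiniteLogEnergy (μ : SignedMeasure ℂ) : Prop :=
  (∀ z : ℂ, μ.variation {z} = 0) ∧
    Integrable (fun q : ℂ × ℂ => Real.log (1 / ‖q.1 - q.2‖)) (μ.variation.prod μ.variation)

/-- `c` is the principal value `lim_{ε → 0+} ∫_{|z - x| > ε} dμ(x) / (x - z)`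
of the Cauchy transform of `μ` at `z`. -/
def IsCauchyPV (μ : SignedMeasure ℂ) (z c : ℂ) : Prop :=
  Tendsto (fun ε : ℝ => ∫ᵛ x in {x : ℂ | ε < ‖z - x‖}, (1 / (x - z)) ∂<•μ) (𝓝[>] 0) (𝓝 c)

/-! ### The external field `φ = Re Φ`, `Φ(z) = - ∑ (ρ_k / 2) log (z - a_k)` -/

section Field

variable {n : ℕ} (a ρ : Fin n → ℂ)

/-- The derivative `Φ'(z) = - ∑ (ρ_k / 2) / (z - a_k)`, always single-valued. -/
def fieldDeriv (z : ℂ) : ℂ := -∑ k, (ρ k / 2) / (z - a k)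

/-- `z ↦ - ∑ (Re ρ_k / 2) log |z - a_k|`. If all `ρ_k` are real, this is the external field `φ`;
in general it is the single-valued part of `φ` (the rest is a combination of the
locally bounded arguments of `z - a_k`). -/
def externalField (z : ℂ) : ℝ := -∑ k, ((ρ k).re / 2) * Real.log ‖z - a k‖

/-- The increment `φ(w) - φ(z)` of the (possibly multivalued) field `φ = Re Φ` continued along
the segment from `z` to `w`. As the quotient `(w' - a_k) / (z - a_k)` runs over a segment that
starts at `1`, the continued branch of its logarithm is the principal one. -/
def fieldIncrement (z w : ℂ) : ℝ :=
  -∑ k, ((ρ k / 2) * Complex.log ((w - a k) / (z - a k))).re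

/-- For real charges the increment is the difference of the values of the field. -/
theorem fieldIncrement_eq_sub (hρ : ∀ k, (ρ k).im = 0) (z w : ℂ)
    (hz : ∀ k, ρ k ≠ 0 → z ≠ a k) (hw : ∀ k, ρ k ≠ 0 → w ≠ a k) :
    fieldIncrement a ρ z w = externalField a ρ w - externalField a ρ z := by
  unfold fieldIncrement externalField
  rw [neg_sub_neg, ← Finset.sum_sub_distrib, ← Finset.sum_neg_distrib]
  refine Finset.sum_congr rfl fun k _ => ?_
  by_cases h0 : ρ k = 0
  · simp [h0]
  have h1 : ‖z - a k‖ ≠ 0 := norm_ne_zero_iff.mpr (sub_ne_zero.mpr (hz k h0))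
  have h2 : ‖w - a k‖ ≠ 0 := norm_ne_zero_iff.mpr (sub_ne_zero.mpr (hw k h0))
  have h3 : ρ k / 2 = (((ρ k).re / 2 : ℝ) : ℂ) := by
    apply Complex.ext <;> simp [hρ k]
  rw [h3, Complex.re_ofReal_mul, Complex.log_re, norm_div, Real.log_div h2 h1]
  ring

/-! ### Critical measures -/

/-- The variation `E_φ(μ^t) - E_φ(μ)` of the weighted energy `E_φ(μ) = E(μ) + 2 ∫ φ dμ`, where
`μ^t` is the image of `μ` under `x ↦ x + t h(x)`, and `φ` is continued from `x` to `x + t h(x)`. -/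
def energyVariation (μ : SignedMeasure ℂ) (h : ℂ → ℂ) (t : ℂ) : ℝ :=
  logEnergy (μ.map (fun x => x + t * h x)) - logEnergy μ
    + 2 * ∫ᵛ x, fieldIncrement a ρ x (x + t * h x) ∂•μ

/-- A (continuous) `(A, φ)`-critical measure, `A = {a_k}`: a real measure with compact support and
finite weighted energy such that `d/dt E_φ(μ^t) = 0` at `t = 0` (with complex `t`) for every smooth
`h` that vanishes on `A`. -/
structure IsCriticalMeasure (μ : SignedMeasure ℂ) : Prop where
  compact_support : IsCompact (realSupport μ)
  finite_energy : HasFiniteLogEnergy μ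
  field_integrable : Integrable (externalField a ρ) μ.variation
  stationary : ∀ h : ℂ → ℂ, ContDiff ℝ ∞ h → (∀ k, h (a k) = 0) →
    HasDerivAt (fun t : ℂ => ((energyVariation a ρ μ h t : ℝ) : ℂ)) 0 0

/-! ### Regular points and normals -/

end Field

/-- `γ` restricted to `(-1, 1)` is a continuously differentiable open Jordan arc with nonvanishing
derivative, `γ 0 = z`, whose trace is the part of `S` in some simply connected open
neighbourhood of `z`. -/
def IsLocalArc (S : Set ℂ) (z : ℂ) (γ : ℝ → ℂ) : Prop :=
  γ 0 = z ∧ ContDiffOn ℝ 1 γ (Ioo (-1) 1) ∧ (∀ t ∈ Ioo (-1 : ℝ) 1, deriv γ t ≠ 0) ∧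
    IsEmbedding (fun t : Ioo (-1 : ℝ) 1 => γ t) ∧
    ∃ B : Set ℂ, IsOpen B ∧ SimplyConnectedSpace B ∧ z ∈ B ∧ B ∩ S = γ '' Ioo (-1) 1

/-- `z ∈ S` is a regular point of `S` if `S` is a smooth Jordan arc near `z`. -/
def IsRegularPoint (S : Set ℂ) (z : ℂ) : Prop := ∃ γ, IsLocalArc S z γ

/-- `m` is one of the two unit normal vectors to `S` at the (regular) point `z`. -/
def IsUnitNormal (S : Set ℂ) (z m : ℂ) : Prop :=
  ‖m‖ = 1 ∧ ∃ γ, IsLocalArc S z γ ∧ inner ℝ m (deriv γ 0) = 0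

/-- A (compact) analytic arc. -/
def IsAnalyticArc (Γ : Set ℂ) : Prop :=
  ∃ γ : ℝ → ℂ, AnalyticOnNhd ℝ γ (Icc 0 1) ∧ InjOn γ (Icc 0 1) ∧
    (∀ t ∈ Icc (0 : ℝ) 1, deriv γ t ≠ 0) ∧ Γ = γ '' Icc 0 1

/-! ### The conditions on the total potential `U^μ + φ` -/

section Conditions

variable {n : ℕ} (a ρ : Fin n → ℂ) (μ : SignedMeasure ℂ)

/-- The total potential is well defined and finite at `z`: the potential `U^μ(z)` converges
absolutely (the kernel being `+∞` at `x = z`), and `z` is not a singularity of `φ`. -/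
def IsPotentialDefinedAt (z : ℂ) : Prop :=
  (∀ k, ρ k ≠ 0 → z ≠ a k) ∧ μ.variation {z} = 0 ∧
    Integrable (fun x : ℂ => Real.log (1 / ‖z - x‖)) μ.variation

/-- The branch at `z` of the total potential `U^μ + φ`, up to the additive constant `φ(z)`. -/
def totalPotential (z w : ℂ) : ℝ := logPotential μ w + fieldIncrement a ρ z w

/-- The total potential is constant on `Γ`, for a field `φ` that may be multivalued: it is
defined at all points of `Γ`, and in a neighbourhood of each `z ∈ Γ` its branch at `z` is constant
on `Γ`. For real charges and connected `Γ` this says that `U^μ + φ` is constant on `Γ`. -/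
def IsPotentialConstantOn (Γ : Set ℂ) : Prop :=
  ∀ z ∈ Γ, IsPotentialDefinedAt a ρ μ z ∧
    ∀ᶠ w in 𝓝[Γ] z, totalPotential a ρ μ z w = totalPotential a ρ μ z z

/-- The total potential is constant on each connected component of the support. -/
def IsConstantOnComponents : Prop :=
  ∀ x ∈ realSupport μ, IsPotentialConstantOn a ρ μ (connectedComponentIn (realSupport μ) x)

/-- The S-property: at each regular point of the support the one-sided derivatives of the
total potential in the directions of the two normals exist and are equal. -/
def HasSProperty : Prop :=
  ∀ z ∈ realSupport μ, IsRegularPoint (realSupport μ) z →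
    ∀ m : ℂ, IsUnitNormal (realSupport μ) z m → ∃ d : ℝ,
      HasDerivWithinAt (fun s : ℝ => totalPotential a ρ μ z (z + s * m)) d (Ici 0) 0 ∧
      HasDerivWithinAt (fun s : ℝ => totalPotential a ρ μ z (z + s * (-m))) d (Ici 0) 0

/-- The gradient of the total potential vanishes at the non-regular points of the support
outside of `A`. -/
def GradientVanishesAtNonregular : Prop :=
  ∀ z ∈ realSupport μ, (∀ k, z ≠ a k) → ¬ IsRegularPoint (realSupport μ) z →
    HasGradientAt (F := ℂ) (𝕜 := ℝ) (totalPotential a ρ μ z) 0 z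

/-- `(C^μ + Φ')² = R` almost everywhere with respect to the plane Lebesgue measure. -/
def SatisfiesCauchyEquation (R : RatFunc ℂ) : Prop :=
  ∀ᵐ z : ℂ, ∃ c : ℂ, IsCauchyPV μ z c ∧ (c + fieldDeriv a ρ z) ^ 2 = R.eval (RingHom.id ℂ) z

end Conditions

end

/-! Write `μ = σ |μ|` with a measurable sign `σ`, let `A = ∏ (z - a_k)`, and let `g = C^μ + Φ'`,
which off the support is the complex gradient of the total potential `T`.

Criticality. Moving `μ` along `h` changes the energy to first order by a double integral of
difference quotients of `h`. By the Cauchy–Pompeiu formula this double integral is the pairing of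
`(C^μ)²` with `∂h/∂z̄`, which makes sense because finite energy makes `(C^μ)²` locally integrable.
Taking `h = A k` with `k` arbitrary, stationarity says that `A (C^μ)² + 2 A Φ' C^μ` is weakly
holomorphic, and Weyl's lemma makes it entire (`IsCriticalMeasure.exists_entire`). Hence `g²` agrees
almost everywhere with a meromorphic function, and the support follows the trajectories of the
quadratic differential `g² dz²`.

Local structure. At an uncharged point of the support some coordinate `w` brings this differential
to the form `(N²/4) w^(N-2) dw²` (`exists_normal_form`). In the flat coordinate `u = w^(N/2)` the
field is `±1`. A real-valued weak gradient depends on `Re u` only, so its sign can jump only across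
vertical lines, and a jump of size 2 carries mass `1/π` per unit length. A box whose mass is too
small for its height therefore has no jump (`IsFlatSystem.ae_const`). Consequently the mass near the
point sits on the `N` rays `w^N < 0` with bounded density in the flat coordinate, the potential is
continuous, and `|T - T(z₀)| = Re √(w^N)` (`IsNormalChart.eventually_abs_sub_eq`). This vanishes on
the support, which is condition (i). For `N = 2` it is a symmetric crease, which is the S-property;
for `N ≥ 3` it is `o(|z - z₀|)`, so the gradient vanishes; `N = 1` occurs only at nodes and is never
a regular point. At a charged node `g²` has a double pole and the flat coordinate is logarithmic;
boxes of one fixed size fit around all nearby points, so there is no mass nearby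
(`notMem_support_of_charged`).

Converse. On a regular arc the potential is constant in a mean sense strong enough for Schwarz
reflection (`exists_reflection`), so `g` extends analytically from each side; the S-property makes
the two extensions opposite, so `g²` extends across the arc (`IsGoodPoint.exists_sq_extension`). The
remaining points are isolated. There `∫ |g| = O(r)` over small discs allows at most a double pole of
`g²` (`hasExtension_of_lintegral_le`). Off the nodes, the absence of point masses removes the double
pole and one-sided differentiability of `T` removes the simple one
(`hasExtension_of_isFreeDirection`). Hence `A² g²` extends to an entire function of polynomial
growth, that is, to a polynomial. -/

noncomputable section

open scoped ENNReal Convolution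
open MeasureTheory Filter Topology Set Complex Metric ComplexConjugate
open Real hiding cos exp exp_add exp_log exp_nat_mul exp_ne_zero exp_neg log log_exp norm_ofNat sin sin_sq_add_cos_sq volume_ball
open ENNReal (ofReal_le_ofReal ofReal_ne_top mul_ne_top ofReal_toReal ofReal_lt_top toReal_le_of_le_ofReal coe_ne_top ofReal_coe_nnreal)
open ENNReal renaming ofReal → ennr, ofReal_mul → ennr_mul, ofReal_add → ennr_add

/-! ### The sign of a real measure; the Cauchy–Pompeiu formula -/

/-- A signed measure is its variation multiplied by a measurable sign. -/
theorem exists_sign_variation (μ : SignedMeasure ℂ) :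
    ∃ σ : ℂ → ℝ, Measurable σ ∧ (∀ x, σ x = 1 ∨ σ x = -1) ∧
      (∀ f : ℂ → ℝ, ∫ᵛ x, f x ∂•μ = ∫ x, σ x * f x ∂μ.variation) ∧
      (∀ f : ℂ → ℂ, ∫ᵛ x, f x ∂<•μ = ∫ x, (σ x : ℂ) * f x ∂μ.variation) := by
  classical
  obtain ⟨i, hi, hi2, hi3, hp, hn⟩ := μ.toJordanDecomposition_spec
  set P := μ.toJordanDecomposition.posPart with hP
  set Q := μ.toJordanDecomposition.negPart with hQ
  have hvar : μ.variation = P + Q := (SignedMeasure.totalVariation_eq_variation μ).symm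
  have hPc : P iᶜ = 0 := by
    rw [hp, SignedMeasure.toMeasureOfZeroLE_apply _ _ hi hi.compl]; simp
  have hQi : Q i = 0 := by
    rw [hn, SignedMeasure.toMeasureOfLEZero_apply _ _ hi.compl hi]; simp
  have hμ : μ = P.toSignedMeasure - Q.toSignedMeasure :=
    (SignedMeasure.toSignedMeasure_toJordanDecomposition μ).symm
  set σ : ℂ → ℝ := fun x => if x ∈ i then 1 else -1 with hσ
  have hσm : Measurable σ := Measurable.ite hi measurable_const measurable_const
  have hσ1 : ∀ x, σ x = 1 ∨ σ x = -1 := fun x => by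
    by_cases h : x ∈ i <;> simp [σ, h]
  have hσP : ∀ᵐ x ∂P, σ x = 1 := by
    filter_upwards [measure_eq_zero_iff_ae_notMem.1 hPc] with x hx
    simp only [mem_compl_iff, not_not] at hx; simp [σ, hx]
  have hσQ : ∀ᵐ x ∂Q, σ x = -1 := by
    filter_upwards [measure_eq_zero_iff_ae_notMem.1 hQi] with x hx
    simp [σ, hx]
  have key : ∀ f : ℂ → ℂ, ∫ᵛ x, f x ∂<•μ = ∫ x, (σ x : ℂ) * f x ∂μ.variation := by
    intro f; by_cases hf : Integrable f μ.variation
    · have hfP : Integrable f P := hf.mono_measure (hvar ▸ Measure.le_add_right le_rfl)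
      have hfQ : Integrable f Q := hf.mono_measure (hvar ▸ Measure.le_add_left le_rfl)
      conv_lhs => rw [hμ]
      rw [VectorMeasure.integral_sub_vectorMeasure (by rw [VectorMeasure.Integrable, Measure.variation_toSignedMeasure]; exact hfP)
        (by rw [VectorMeasure.Integrable, Measure.variation_toSignedMeasure]; exact hfQ),
        VectorMeasure.integral_toSignedMeasure, VectorMeasure.integral_toSignedMeasure, hvar]
      have h1 : (fun x => (σ x : ℂ) * f x) =ᵐ[P] f := by
        filter_upwards [hσP] with x hx; simp [hx]
      have h2 : (fun x => (σ x : ℂ) * f x) =ᵐ[Q] fun x => - f x := by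
        filter_upwards [hσQ] with x hx; simp [hx]
      rw [integral_add_measure ((integrable_congr h1).2 hfP)
        ((integrable_congr h2).2 hfQ.neg), integral_congr_ae h1, integral_congr_ae h2,
        integral_neg, sub_eq_add_neg]
    -- Multiplication by a sign preserves non-integrability, so both sides take the default value 0.
    · rw [VectorMeasure.integral_undef hf, integral_undef]; intro h; apply hf
      have := h.bdd_mul (c := 1) (f := fun x => (σ x : ℂ))
        (measurable_ofReal.comp hσm).aestronglyMeasurable
        (ae_of_all _ fun x => by rcases hσ1 x with h | h <;> simp [h])
      refine this.congr (ae_of_all _ fun x => ?_)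
      rcases hσ1 x with h | h <;> simp [h]
  refine ⟨σ, hσm, hσ1, ?_, key⟩; intro f; by_cases hf : Integrable f μ.variation
  · have hfP : Integrable f P := hf.mono_measure (hvar ▸ Measure.le_add_right le_rfl)
    have hfQ : Integrable f Q := hf.mono_measure (hvar ▸ Measure.le_add_left le_rfl)
    -- For real integrands the pairings behind `∂•` and `∂<•` coincide, so the argument for complex
    -- integrands applies again.
    have hl : (ContinuousLinearMap.lsmul ℝ ℝ : ℝ →L[ℝ] ℝ →L[ℝ] ℝ)
        = (ContinuousLinearMap.lsmul ℝ ℝ).flip := by ext; simp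
    rw [hl]; conv_lhs => rw [hμ]
    rw [VectorMeasure.integral_sub_vectorMeasure (by rw [VectorMeasure.Integrable, Measure.variation_toSignedMeasure]; exact hfP)
        (by rw [VectorMeasure.Integrable, Measure.variation_toSignedMeasure]; exact hfQ),
      VectorMeasure.integral_toSignedMeasure, VectorMeasure.integral_toSignedMeasure, hvar]
    have h1 : (fun x => σ x * f x) =ᵐ[P] f := by
      filter_upwards [hσP] with x hx; simp [hx]
    have h2 : (fun x => σ x * f x) =ᵐ[Q] fun x => - f x := by
      filter_upwards [hσQ] with x hx; simp [hx]
    rw [integral_add_measure ((integrable_congr h1).2 hfP)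
      ((integrable_congr h2).2 hfQ.neg), integral_congr_ae h1, integral_congr_ae h2,
      integral_neg, sub_eq_add_neg]
  · rw [VectorMeasure.integral_undef hf, integral_undef]; intro h; apply hf
    have := h.bdd_mul (c := 1) (f := fun x => σ x) hσm.aestronglyMeasurable
      (ae_of_all _ fun x => by rcases hσ1 x with h | h <;> simp [h])
    refine this.congr (ae_of_all _ fun x => ?_)
    rcases hσ1 x with h | h <;> simp [h]

/-- The Wirtinger derivative `∂k/∂z̄`. -/
def dbar (k : ℂ → ℂ) (z : ℂ) : ℂ :=
  (fderiv ℝ k z 1 + I * fderiv ℝ k z I) / 2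

theorem continuous_dbar {k : ℂ → ℂ} (hk : ContDiff ℝ 1 k) : Continuous (dbar k) := by
  have h := hk.continuous_fderiv one_ne_zero
  unfold dbar; exact (((h.clm_apply continuous_const).add
    (continuous_const.mul (h.clm_apply continuous_const))).div_const _)

theorem dbar_eq_zero_of_notMem_tsupport {k : ℂ → ℂ} {z : ℂ} (hz : z ∉ tsupport k) :
    dbar k z = 0 := by
  have : fderiv ℝ k z = 0 := by
    by_contra h
    exact hz (support_fderiv_subset ℝ h)
  simp [dbar, this]

theorem hasCompactSupport_dbar {k : ℂ → ℂ} (hk : HasCompactSupport k) :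
    HasCompactSupport (dbar k) :=
  HasCompactSupport.intro hk fun _ hx => dbar_eq_zero_of_notMem_tsupport hx

theorem dbar_mul_of_differentiableAt {f k : ℂ → ℂ} {z : ℂ} (hf : DifferentiableAt ℂ f z)
    (hk : DifferentiableAt ℝ k z) : dbar (fun w => f w * k w) z = f z * dbar k z := by
  have h1 := (hf.hasDerivAt.hasFDerivAt).restrictScalars ℝ
  have h2 := h1.fun_mul hk.hasFDerivAt
  unfold dbar; rw [h2.fderiv]; simp only [add_apply, smul_apply, smul_eq_mul,
    ContinuousLinearMap.coe_restrictScalars', ContinuousLinearMap.toSpanSingleton_apply]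
  linear_combination (k z * deriv f z / 2) * I_mul_I

/-- The **Cauchy–Pompeiu formula** for compactly supported functions. -/
theorem integral_dbar_div {k : ℂ → ℂ} (hk : ContDiff ℝ 1 k) (hc : HasCompactSupport k) (x : ℂ) :
    ∫ z, dbar k z / (x - z) = π * k x := by
  obtain ⟨M, hM0, hM⟩ : ∃ M : ℝ, 0 < M ∧ ∀ z, M ≤ ‖z - x‖ → z ∉ tsupport k := by
    obtain ⟨M, hM⟩ := (isBounded_iff_subset_ball x).1 hc.isCompact.isBounded
    refine ⟨max M 1, by positivity, fun z hz hzk => ?_⟩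
    have := hM hzk
    rw [mem_ball, dist_eq_norm] at this; exact absurd (le_max_left M 1) (by linarith)
  set e : ℝ → ℂ := fun θ => exp (θ * I) with he
  have hen : ∀ θ, ‖e θ‖ = 1 := fun θ => norm_exp_ofReal_mul_I θ
  have hec : Continuous e := by fun_prop
  -- In polar coordinates about `x`, `F 1` is the radial derivative of `k` and `F I` is `1/r` times
  -- its angular derivative. The integrand becomes `-(F 1 + I F I)/2`: the radial term integrates to
  -- `-k x` along each ray, and the angular term to 0 over each full circle.
  set F : ℂ → ℝ × ℝ → ℂ := fun c p => fderiv ℝ k (x + p.1 * e p.2) (c * e p.2) with hF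
  have hfc := hk.continuous_fderiv one_ne_zero
  have hFc : ∀ c, Continuous (F c) := fun c => by
    refine (hfc.comp ?_).clm_apply ?_ <;> fun_prop
  have hF0 : ∀ c (p : ℝ × ℝ), M ≤ p.1 → F c p = 0 := fun c p hp => by
    have h1 : x + p.1 * e p.2 ∉ tsupport k := hM _ (by
      simp only [add_sub_cancel_left, norm_mul, hen, norm_real, mul_one]
      exact hp.trans (le_abs_self _))
    have : fderiv ℝ k (x + p.1 * e p.2) = 0 := by
      by_contra h
      exact h1 (support_fderiv_subset ℝ h)
    simp [F, this]
  set T : Set (ℝ × ℝ) := Ioi (0 : ℝ) ×ˢ Ioo (-π) π with hT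
  have hTm : MeasurableSet T := measurableSet_Ioi.prod measurableSet_Ioo
  have hFi : ∀ c, IntegrableOn (F c) T := fun c => by
    have h1 : IntegrableOn (F c) (Icc 0 M ×ˢ Icc (-π) π) :=
      (hFc c).continuousOn.integrableOn_compact (isCompact_Icc.prod isCompact_Icc)
    have h2 : IntegrableOn (F c) (Ici M ×ˢ Icc (-π) π) := by
      refine (integrableOn_zero).congr_fun (fun p hp => ?_) (measurableSet_Ici.prod measurableSet_Icc)
      exact (hF0 c p hp.1).symm
    refine (h1.union h2).mono_set ?_; rintro ⟨r, θ⟩ ⟨h1, h2⟩; simp only [mem_Ioi] at h1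
    rcases le_total M r with h | h
    · exact Or.inr ⟨h, Ioo_subset_Icc_self h2⟩
    · exact Or.inl ⟨⟨h1.le, h⟩, Ioo_subset_Icc_self h2⟩
  have h1 : ∫ z, dbar k z / (x - z) = ∫ z, dbar k (x + z) / (-z) := by
    rw [← integral_add_left_eq_self _ x]; congr 1; ext z; congr 1; ring
  rw [h1, ← Complex.integral_comp_polarCoord_symm]
  have h2 : ∫ p in polarCoord.target, p.1 • (dbar k (x + Complex.polarCoord.symm p) /
      (-Complex.polarCoord.symm p)) = ∫ p in T, (-(1/2 : ℂ)) * (F 1 p + I * F I p) := by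
    refine setIntegral_congr_fun hTm fun p hp => ?_
    have hp1 : (p.1 : ℂ) ≠ 0 := by
      have : 0 < p.1 := hp.1
      exact_mod_cast this.ne'
    have hs : Complex.polarCoord.symm p = p.1 * e p.2 := by
      rw [Complex.polarCoord_symm_apply, he]; simp only [exp_mul_I, ofReal_cos,
        ofReal_sin]
    simp only [hs]; have hcs : e p.2 = (Real.cos p.2 : ℝ) • (1 : ℂ) + (Real.sin p.2 : ℝ) • I := by
      simp [he, exp_mul_I]
    have hcs' : I * e p.2 = (-Real.sin p.2 : ℝ) • (1 : ℂ) + (Real.cos p.2 : ℝ) • I := by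
      rw [hcs]; simp only [real_smul]; push_cast; linear_combination (sin p.2) * I_mul_I
    simp only [F, dbar, hcs', one_mul]
    have hL : ∀ L : ℂ →L[ℝ] ℂ, L (e p.2) = (Real.cos p.2 : ℝ) • L 1 + (Real.sin p.2 : ℝ) • L I := by
      intro L; rw [hcs, map_add, map_smul, map_smul]
    rw [hL, map_add, map_smul, map_smul]; set u := fderiv ℝ k (x + p.1 * e p.2) 1
    set v := fderiv ℝ k (x + p.1 * e p.2) I
    have he0 : e p.2 ≠ 0 := exp_ne_zero _
    rw [real_smul, ← mul_div_assoc, div_eq_iff (neg_ne_zero.2 (mul_ne_zero hp1 he0))]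
    rw [hcs]; simp only [real_smul]; push_cast; have hI := I_mul_I
    have hsc := sin_sq_add_cos_sq (p.2 : ℂ)
    set s := sin (p.2 : ℂ)
    set c := cos (p.2 : ℂ)
    linear_combination (-(p.1:ℂ) * (u + I * v) / 2) * hsc + (-(p.1:ℂ)*(-s*u*s + v*c*s)/2) * hI
  rw [h2, integral_const_mul, integral_add (hFi 1) ((hFi _).const_mul _), integral_const_mul]
  have hI2 : ∫ p in T, F I p = 0 := by
    rw [hT, Measure.volume_eq_prod, setIntegral_prod _ (by rw [← Measure.volume_eq_prod]; exact hFi _)]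
    refine (setIntegral_congr_fun measurableSet_Ioi (g := fun _ => (0:ℂ)) fun r hr => ?_).trans (by simp)
    have hr := hr
    have hd : ∀ θ : ℝ, HasDerivAt (fun θ : ℝ => k (x + r * e θ)) ((r : ℂ) * F I (r, θ)) θ := by
      intro θ; have h3 : HasDerivAt (fun θ : ℝ => x + r * e θ) (r * (I * e θ)) θ := by
        have : HasDerivAt e (e θ * (1 * I)) θ :=
          (((ofRealCLM.hasDerivAt (x := θ)).mul_const I)).cexp
        exact ((this.const_mul (r:ℂ)).const_add x).congr_deriv (by ring)
      have h4 := ((hk.differentiable one_ne_zero) (x + r * e θ)).hasFDerivAt.comp_hasDerivAt θ h3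
      refine h4.congr_deriv ?_; simp only [F]
      rw [show (r:ℂ) * (I * e θ) = r • (I * e θ) by simp, map_smul]; simp
    have h5 : ∫ θ in (-π)..Real.pi, (r : ℂ) * F I (r, θ) = 0 := by
      rw [intervalIntegral.integral_eq_sub_of_hasDerivAt (fun θ _ => hd θ)]
      · simp [he, exp_neg]
      · exact (continuous_const.mul ((hFc _).comp (by fun_prop))).intervalIntegrable _ _
    rw [intervalIntegral.integral_const_mul, intervalIntegral.integral_of_le (by linarith [pi_pos]),
      integral_Ioc_eq_integral_Ioo] at h5
    exact (mul_eq_zero.1 h5).resolve_left (by exact_mod_cast hr.ne')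
  have hI1 : ∫ p in T, F 1 p = - (2 * π * k x) := by
    have hFi1 := hFi 1
    rw [IntegrableOn, hT, Measure.volume_eq_prod, ← Measure.prod_restrict] at hFi1
    rw [hT, Measure.volume_eq_prod, ← Measure.prod_restrict, integral_prod_symm _ hFi1]
    have : ∀ θ : ℝ, ∫ r in Ioi (0:ℝ), F 1 (r, θ) = - k x := by
      intro θ; have hd : ∀ r : ℝ, HasDerivAt (fun r : ℝ => k (x + r * e θ)) (F 1 (r, θ)) r := by
        intro r; have h3 := ((ofRealCLM.hasDerivAt (x := r)).mul_const (e θ)).const_add x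
        exact ((hk.differentiable one_ne_zero) (x + r * e θ)).hasFDerivAt.comp_hasDerivAt r h3
      have hz : ∀ r, M < r → F 1 (r, θ) = 0 := fun r hr => hF0 1 _ hr.le
      have h6 : ∫ r in Ioi (0:ℝ), F 1 (r, θ) = ∫ r in (0:ℝ)..M, F 1 (r, θ) := by
        rw [intervalIntegral.integral_of_le hM0.le]
        refine (setIntegral_eq_of_subset_of_forall_sdiff_eq_zero measurableSet_Ioi
          (fun r hr => hr.1) fun r hr => ?_)
        refine hz r ?_; by_contra h
        exact hr.2 ⟨hr.1, not_lt.1 h⟩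
      rw [h6, intervalIntegral.integral_eq_sub_of_hasDerivAt (fun r _ => hd r)]
      · have h7 : x + M * e θ ∉ tsupport k := hM _ (by
          simp [hen, abs_of_pos hM0])
        rw [image_eq_zero_of_notMem_tsupport h7]; simp
      · exact ((hFc _).comp (by fun_prop)).intervalIntegrable _ _
    simp only [this]; rw [setIntegral_const, volume_real_Ioo_of_le (by linarith [pi_pos])]
    simp only [real_smul]; push_cast; ring
  rw [hI1, hI2]; ring

/-! ### Area integrals of Cauchy kernels; the Cauchy transform -/

section

theorem lintegral_comp_norm_complex {f : ℝ → ℝ≥0∞} (hf : Measurable f) :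
    ∫⁻ z : ℂ, f ‖z‖ = ennr (2 * π) *
      ∫⁻ r in Ioi (0 : ℝ), ennr r * f r := by
  rw [← Complex.lintegral_comp_polarCoord_symm]
  have h1 : ∫⁻ p in polarCoord.target, ennr p.1 • f ‖Complex.polarCoord.symm p‖ =
      ∫⁻ p in Ioi (0 : ℝ) ×ˢ Ioo (-π) π, ennr p.1 * f p.1 := by
    refine setLIntegral_congr_fun (measurableSet_Ioi.prod measurableSet_Ioo) fun p hp => ?_
    have : 0 < p.1 := hp.1
    simp only [norm_polarCoord_symm, abs_of_pos this, smul_eq_mul]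
  rw [h1, Measure.volume_eq_prod, ← Measure.prod_restrict,
    lintegral_prod _ (by fun_prop)]
  simp only [lintegral_const, Measure.restrict_apply MeasurableSet.univ, univ_inter, volume_Ioo]
  rw [lintegral_mul_const _ (by fun_prop), mul_comm]
  congr 2; ring

/-- The bound is uniform in `x`. If `x` is at distance at least `2M` from the centre, the integrand
is at most `1/M` on the ball; otherwise the ball lies in the disc of radius `3M` about `x`, whose
integral is exactly `6πM`. -/
theorem lintegral_ball_inv_norm_sub_le (c x : ℂ) {M : ℝ} (hM : 0 < M) :
    ∫⁻ z in ball c M, ennr (1 / ‖z - x‖) ≤ ennr (6 * π * M) := by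
  rcases le_or_gt (2 * M) ‖x - c‖ with h | h
  · calc ∫⁻ z in ball c M, ennr (1 / ‖z - x‖)
        ≤ ∫⁻ z in ball c M, ennr (1 / M) := by
          refine setLIntegral_mono (by fun_prop) fun z hz => ofReal_le_ofReal ?_
          rw [mem_ball, dist_eq_norm] at hz; have : ‖x - c‖ ≤ ‖z - x‖ + ‖z - c‖ := by
            rw [norm_sub_rev z x]; exact (norm_sub_le_norm_sub_add_norm_sub x z c)
          exact one_div_le_one_div_of_le hM (by linarith)
      _ = ennr (π * M) := by
          rw [setLIntegral_const, volume_ball, ← ENNReal.ofReal_pow hM.le,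
            show (NNReal.pi : ℝ≥0∞) = ennr π by
              rw [← NNReal.coe_real_pi, ofReal_coe_nnreal],
            ← ennr_mul (by positivity), ← ennr_mul (by positivity)]
          congr 1; field_simp
      _ ≤ _ := ofReal_le_ofReal (by nlinarith [pi_pos])
  · calc ∫⁻ z in ball c M, ennr (1 / ‖z - x‖)
        ≤ ∫⁻ z in ball x (3 * M), ennr (1 / ‖z - x‖) := by
          refine lintegral_mono_set (ball_subset_ball' ?_); rw [dist_comm, dist_eq_norm]; linarith
      _ = ∫⁻ z : ℂ, (Iio (3 * M)).indicator (fun r => ennr (1 / r)) ‖z‖ := by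
          rw [← lintegral_indicator isOpen_ball.measurableSet, ← lintegral_add_right_eq_self _ x]
          congr 1; ext z
          simp only [indicator, mem_ball, dist_eq_norm, mem_Iio, add_sub_cancel_right]
      _ = ennr (2 * π) * ∫⁻ r in Ioi (0 : ℝ), ennr r *
            (Iio (3 * M)).indicator (fun r => ennr (1 / r)) r :=
          lintegral_comp_norm_complex (Measurable.indicator (by fun_prop) measurableSet_Iio)
      _ ≤ ennr (2 * π) * ∫⁻ r in Ioi (0 : ℝ), (Iio (3 * M)).indicator 1 r := by
          refine mul_le_mul' le_rfl ?_
          refine setLIntegral_mono (measurable_one.indicator measurableSet_Iio) fun r hr => ?_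
          have hr : 0 < r := hr
          by_cases h : r ∈ Iio (3 * M)
          · rw [indicator_of_mem h, indicator_of_mem h, ← ennr_mul hr.le]; simp [hr.ne']
          · simp [h]
      _ = ennr (6 * π * M) := by
          rw [lintegral_indicator_one measurableSet_Iio, Measure.restrict_apply measurableSet_Iio,
            Iio_inter_Ioi, volume_Ioo, ← ennr_mul (by positivity)]
          congr 1; ring

/-- With `d = |x - y|`, the farther of the two points is at distance at least `max r (d/2)` from
`z`, where `r` is the distance to the nearer one. So the integrand is at most `k(r) = 1/(r max(r,
d/2))`, whose radial integral over radii up to `2M` is `2π (1 + log (4M/d))`. This logarithm is what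
converts finite energy into local integrability of the squared Cauchy transform. -/
theorem lintegral_ball_inv_mul_inv_le {x y : ℂ} {M : ℝ} (hM : 0 < M) (hx : ‖x‖ < M) (hy : ‖y‖ < M)
    (hxy : x ≠ y) : ∫⁻ z in ball 0 M, ennr (1 / (‖z - x‖ * ‖z - y‖)) ≤
      ennr (4 * π * (1 + Real.log (4 * M / ‖x - y‖))) := by
  set d := ‖x - y‖ with hd
  have hd0 : 0 < d := norm_pos_iff.2 (sub_ne_zero.2 hxy)
  have hdM : d < 2 * M := (norm_sub_le x y).trans_lt (by linarith)
  set k : ℝ → ℝ := fun r => 1 / (r * max r (d / 2)) with hk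
  have hkm : Measurable k := by fun_prop
  have hmain : ∀ u : ℂ, ‖u‖ < M → ∫⁻ z in ball 0 M, ennr (k ‖z - u‖) ≤
      ennr (2 * π * (1 + Real.log (4 * M / d))) := by
    intro u hu
    calc ∫⁻ z in ball 0 M, ennr (k ‖z - u‖)
        ≤ ∫⁻ z in ball u (2 * M), ennr (k ‖z - u‖) := by
          refine lintegral_mono_set (ball_subset_ball' ?_)
          rw [dist_comm, dist_zero_right]; linarith
      _ = ∫⁻ z : ℂ, (Iio (2 * M)).indicator (fun r => ennr (k r)) ‖z‖ := by
          rw [← lintegral_indicator isOpen_ball.measurableSet, ← lintegral_add_right_eq_self _ u]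
          congr 1; ext z
          simp only [indicator, mem_ball, dist_eq_norm, mem_Iio, add_sub_cancel_right]
      _ = ennr (2 * π) * ∫⁻ r in Ioi (0 : ℝ), ennr r *
            (Iio (2 * M)).indicator (fun r => ennr (k r)) r :=
          lintegral_comp_norm_complex (Measurable.indicator (by fun_prop) measurableSet_Iio)
      _ ≤ ennr (2 * π) * ∫⁻ r in Ioc (0 : ℝ) (2 * M),
            ennr (1 / max r (d / 2)) := by
          refine mul_le_mul' le_rfl ?_
          rw [← lintegral_indicator measurableSet_Ioi, ← lintegral_indicator measurableSet_Ioc]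
          refine lintegral_mono fun r => ?_
          by_cases hr : 0 < r
          · by_cases h : r < 2 * M
            · simp only [indicator, mem_Ioi, hr, if_true, mem_Iio, h, mem_Ioc, h.le, and_self]
              rw [← ennr_mul hr.le]; refine ofReal_le_ofReal (le_of_eq ?_)
              simp only [k]; field_simp
            · simp [indicator, h]
          · simp [indicator, hr]
      _ = ennr (2 * π) * ennr (∫ r in (0:ℝ)..(2 * M), 1 / max r (d / 2)) := by
          rw [intervalIntegral.integral_of_le (by linarith), ofReal_integral_eq_lintegral_ofReal]
          · refine Continuous.integrableOn_Ioc ?_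
            exact continuous_const.div (by fun_prop) fun r => (lt_max_of_lt_right (by linarith)).ne'
          · exact ae_of_all _ fun r => by positivity
      _ = _ := by
          rw [← ennr_mul (by positivity)]
          congr 2; have hcont : Continuous fun r : ℝ => 1 / max r (d / 2) :=
            continuous_const.div (by fun_prop) fun r => (lt_max_of_lt_right (by linarith)).ne'
          rw [← intervalIntegral.integral_add_adjacent_intervals
            (hcont.intervalIntegrable 0 (d / 2)) (hcont.intervalIntegrable (d / 2) (2 * M))]
          have e1 : ∫ r in (0:ℝ)..(d / 2), 1 / max r (d / 2) = ∫ r in (0:ℝ)..(d / 2), 2 / d := by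
            refine intervalIntegral.integral_congr fun r hr => ?_
            rw [uIcc_of_le (by linarith)] at hr
            simp only [max_eq_right hr.2]; field_simp
          have e2 : ∫ r in (d / 2)..(2 * M), 1 / max r (d / 2) = ∫ r in (d / 2)..(2 * M), 1 / r := by
            refine intervalIntegral.integral_congr fun r hr => ?_
            rw [uIcc_of_le (by linarith)] at hr
            simp only [max_eq_left hr.1]
          rw [e1, e2, intervalIntegral.integral_const, integral_one_div_of_pos (by linarith) (by linarith)]
          congr 1
          · simp only [smul_eq_mul]; field_simp; ring
          · congr 1; field_simp; ring
  calc ∫⁻ z in ball 0 M, ennr (1 / (‖z - x‖ * ‖z - y‖))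
      ≤ ∫⁻ z in ball 0 M, (ennr (k ‖z - x‖) + ennr (k ‖z - y‖)) := by
        refine setLIntegral_mono (by fun_prop) fun z _ => ?_
        rw [← ennr_add (by simp only [k]; positivity) (by simp only [k]; positivity)]
        refine ofReal_le_ofReal ?_; have htri : d ≤ ‖z - x‖ + ‖z - y‖ := by
          rw [hd, norm_sub_rev z x]; exact norm_sub_le_norm_sub_add_norm_sub x z y
        have aux : ∀ a b : ℝ, 0 ≤ a → a ≤ b → d ≤ a + b → 1 / (a * b) ≤ k a := by
          intro a b ha hab h; rcases ha.eq_or_lt with rfl | ha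
          · simp [k]
          · refine one_div_le_one_div_of_le (mul_pos ha (lt_max_of_lt_left ha)) ?_
            exact mul_le_mul_of_nonneg_left (max_le hab (by linarith)) ha.le
        have hk0 : ∀ a : ℝ, 0 ≤ a → 0 ≤ k a := fun a ha => by simp only [k]; positivity
        rcases le_total ‖z - x‖ ‖z - y‖ with h | h
        · linarith [aux _ _ (norm_nonneg (z - x)) h htri, hk0 _ (norm_nonneg (z - y))]
        · have := aux _ _ (norm_nonneg (z - y)) h (by linarith)
          rw [mul_comm] at this; linarith [hk0 _ (norm_nonneg (z - x))]
    _ = (∫⁻ z in ball 0 M, ennr (k ‖z - x‖)) +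
          ∫⁻ z in ball 0 M, ennr (k ‖z - y‖) := lintegral_add_left (by fun_prop) _
    _ ≤ _ := by
        refine (add_le_add (hmain x hx) (hmain y hy)).trans ?_; rw [← ennr_add]
        · refine ofReal_le_ofReal (le_of_eq (by ring))
        all_goals
          have : 0 ≤ Real.log (4 * M / d) := log_nonneg (by rw [le_div_iff₀ hd0]; linarith)
          positivity

/-- The Cauchy transform `∫ σ(x) / (x - z) dν(x)`. -/
def cauchyTransform (ν : Measure ℂ) (σ : ℂ → ℝ) (z : ℂ) : ℂ := ∫ x, (σ x : ℂ) / (x - z) ∂ν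

section Cauchy

variable {ν : Measure ℂ} [IsFiniteMeasure ν] {σ : ℂ → ℝ}

theorem integrable_prod_div_sub (hσ : Measurable σ) (hσ1 : ∀ x, |σ x| = 1) (c : ℂ) {M : ℝ}
    (hM : 0 < M) : Integrable (fun q : ℂ × ℂ => (σ q.1 : ℂ) / (q.1 - q.2))
      (ν.prod (volume.restrict (ball c M))) := by
  refine ⟨(by fun_prop : Measurable _).aestronglyMeasurable, ?_⟩
  rw [hasFiniteIntegral_def, lintegral_prod _ (by fun_prop)]
  calc _ ≤ ∫⁻ _, ennr (6 * π * M) ∂ν := by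
        refine lintegral_mono fun x => ?_
        refine le_trans (le_of_eq ?_) (lintegral_ball_inv_norm_sub_le c x hM)
        refine lintegral_congr fun z => ?_
        rw [← ofReal_norm, norm_div, norm_real, norm_eq_abs, hσ1, norm_sub_rev]
    _ < ⊤ := by
        rw [lintegral_const]; exact ENNReal.mul_lt_top ofReal_lt_top (measure_lt_top _ _)

theorem integrableOn_ball_cauchyTransform (hσ : Measurable σ) (hσ1 : ∀ x, |σ x| = 1) (c : ℂ) (M : ℝ) :
    IntegrableOn (cauchyTransform ν σ) (ball c M) := by
  rcases le_or_gt M 0 with h | h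
  · simp [ball_eq_empty.2 h]
  · exact (integrable_prod_div_sub hσ hσ1 c h).integral_prod_right

theorem integral_norm_cauchyTransform_le (hσ : Measurable σ) (hσ1 : ∀ x, |σ x| = 1) (c : ℂ) {M : ℝ}
    (hM : 0 < M) : ∫ z in ball c M, ‖cauchyTransform ν σ z‖ ≤
      6 * π * M * ν.real univ := by
  rw [integral_norm_eq_lintegral_enorm (integrableOn_ball_cauchyTransform hσ hσ1 c M).1]
  refine toReal_le_of_le_ofReal (by positivity) ?_
  calc ∫⁻ z in ball c M, ‖cauchyTransform ν σ z‖ₑ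
      ≤ ∫⁻ z in ball c M, ∫⁻ x, ‖(σ x : ℂ) / (x - z)‖ₑ ∂ν :=
        lintegral_mono fun z => enorm_integral_le_lintegral_enorm _
    _ = ∫⁻ x, (∫⁻ z in ball c M, ‖(σ x : ℂ) / (x - z)‖ₑ) ∂ν := by
        rw [lintegral_lintegral_swap (by fun_prop)]
    _ ≤ ∫⁻ _, ennr (6 * π * M) ∂ν := by
        refine lintegral_mono fun x => ?_
        refine le_trans (le_of_eq ?_) (lintegral_ball_inv_norm_sub_le c x hM)
        refine lintegral_congr fun z => ?_
        rw [← ofReal_norm, norm_div, norm_real, norm_eq_abs, hσ1, norm_sub_rev]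
    _ = _ := by
        rw [lintegral_const, ennr_mul (p := 6 * π * M) (by positivity), Measure.real,
          ofReal_toReal (measure_ne_top _ _)]

/-- In the sense of distributions, `∂C/∂z̄ = -π σ ν`. -/
theorem integral_cauchyTransform_mul_dbar (hσ : Measurable σ) (hσ1 : ∀ x, |σ x| = 1)
    {k : ℂ → ℂ} (hk : ContDiff ℝ 1 k) (hc : HasCompactSupport k) :
    ∫ z, cauchyTransform ν σ z * dbar k z = π * ∫ x, (σ x : ℂ) * k x ∂ν := by
  obtain ⟨M, hM0, hM⟩ : ∃ M : ℝ, 0 < M ∧ tsupport k ⊆ ball 0 M := by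
    obtain ⟨M, hM⟩ := (isBounded_iff_subset_ball 0).1 hc.isCompact.isBounded
    exact ⟨max M 1, by positivity, hM.trans (ball_subset_ball (le_max_left _ _))⟩
  have hd := continuous_dbar hk
  obtain ⟨D, hD⟩ := (hasCompactSupport_dbar hc).exists_bound_of_continuous hd
  have hz : ∀ z, z ∉ ball (0:ℂ) M → dbar k z = 0 := fun z hz =>
    dbar_eq_zero_of_notMem_tsupport fun h => hz (hM h)
  have hint : Integrable (fun q : ℂ × ℂ => (σ q.1 : ℂ) / (q.1 - q.2) * dbar k q.2)
      (ν.prod (volume.restrict (ball 0 M))) :=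
    (integrable_prod_div_sub hσ hσ1 0 hM0).mul_bdd (c := D)
      ((hd.comp continuous_snd).measurable.aestronglyMeasurable)
      (ae_of_all _ fun q => hD q.2)
  calc ∫ z, cauchyTransform ν σ z * dbar k z
      = ∫ z in ball 0 M, ∫ x, (σ x : ℂ) / (x - z) * dbar k z ∂ν := by
        rw [setIntegral_eq_integral_of_forall_compl_eq_zero]
        · congr 1; ext z; rw [integral_mul_const]; rfl
        · intro z h; simp [hz z h]
    _ = ∫ x, (∫ z in ball 0 M, (σ x : ℂ) / (x - z) * dbar k z) ∂ν := by
        rw [integral_integral_swap]; exact hint.swap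
    _ = ∫ x, (σ x : ℂ) * (π * k x) ∂ν := by
        congr 1; ext x; rw [← integral_dbar_div hk hc x, ← integral_const_mul,
          setIntegral_eq_integral_of_forall_compl_eq_zero]
        · congr 1; ext z; ring
        · intro z h; simp [hz z h]
    _ = _ := by rw [← integral_const_mul]; congr 1; ext x; ring

end Cauchy

end

/-! ### Finite energy and the square of the Cauchy transform -/

section

instance isFiniteMeasure_variation (μ : SignedMeasure ℂ) : IsFiniteMeasure μ.variation := by
  rw [← SignedMeasure.totalVariation_eq_variation]; infer_instance

section Energy

variable {ν : Measure ℂ} [IsFiniteMeasure ν] {σ : ℂ → ℝ}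

theorem ae_prod_fst_ne_snd (hpt : ∀ z, ν {z} = 0) : ∀ᵐ q ∂ν.prod ν, q.1 ≠ q.2 := by
  have hm : MeasurableSet {q : ℂ × ℂ | q.1 = q.2} := measurableSet_eq_fun measurable_fst measurable_snd
  have : ν.prod ν {q | q.1 = q.2} = 0 := by
    rw [Measure.prod_apply hm]; refine (lintegral_congr fun x => ?_).trans lintegral_zero
    convert hpt x using 2; ext y; simp [eq_comm]
  exact measure_eq_zero_iff_ae_notMem.1 this

theorem integrable_prod_inv_mul_inv (hσ : Measurable σ) (hσ1 : ∀ x, |σ x| = 1)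
    (hpt : ∀ z, ν {z} = 0)
    (hE : Integrable (fun q : ℂ × ℂ => Real.log (1 / ‖q.1 - q.2‖)) (ν.prod ν))
    {M : ℝ} (hM : 0 < M) (hsupp : ∀ᵐ x ∂ν, ‖x‖ < M) :
    Integrable (fun q : (ℂ × ℂ) × ℂ => (σ q.1.1 : ℂ) * σ q.1.2 / ((q.1.1 - q.2) * (q.1.2 - q.2)))
      ((ν.prod ν).prod (volume.restrict (ball 0 M))) := by
  refine ⟨(by fun_prop : Measurable _).aestronglyMeasurable, ?_⟩
  rw [hasFiniteIntegral_def, lintegral_prod _ (by fun_prop)]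
  have hI : Integrable (fun q : ℂ × ℂ => 4 * π * (1 + (Real.log (4 * M) +
      Real.log (1 / ‖q.1 - q.2‖)))) (ν.prod ν) :=
    ((integrable_const _).add ((integrable_const _).add hE)).const_mul _
  have h1 : ∀ᵐ q ∂ν.prod ν, ‖q.1‖ < M := Measure.quasiMeasurePreserving_fst.ae hsupp
  have h2 : ∀ᵐ q ∂ν.prod ν, ‖q.2‖ < M := Measure.quasiMeasurePreserving_snd.ae hsupp
  calc _ ≤ ∫⁻ q, ennr (4 * π * (1 + (Real.log (4 * M) +
            Real.log (1 / ‖q.1 - q.2‖)))) ∂ν.prod ν := by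
        refine lintegral_mono_ae ?_
        filter_upwards [h1, h2, ae_prod_fst_ne_snd hpt] with q hq1 hq2 hne
        have hd := norm_ne_zero_iff.2 (sub_ne_zero.2 hne)
        refine le_trans (le_of_eq ?_) ((lintegral_ball_inv_mul_inv_le hM hq1 hq2 hne).trans
          (le_of_eq ?_))
        · refine lintegral_congr fun z => ?_
          rw [← ofReal_norm, norm_div, norm_mul, norm_mul, norm_real, norm_real,
            norm_eq_abs, norm_eq_abs, hσ1, hσ1, norm_sub_rev, norm_sub_rev q.2 z, one_mul]
        · rw [div_eq_mul_one_div (4 * M), Real.log_mul (by positivity) (by positivity)]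
    _ ≤ _ := lintegral_ofReal_le_lintegral_enorm _
    _ < ⊤ := hI.2

theorem integrableOn_ball_cauchyTransform_sq (hσ : Measurable σ) (hσ1 : ∀ x, |σ x| = 1)
    (hpt : ∀ z, ν {z} = 0)
    (hE : Integrable (fun q : ℂ × ℂ => Real.log (1 / ‖q.1 - q.2‖)) (ν.prod ν))
    {M : ℝ} (hM : 0 < M) (hsupp : ∀ᵐ x ∂ν, ‖x‖ < M) :
    IntegrableOn (fun z => cauchyTransform ν σ z ^ 2) (ball 0 M) := by
  refine (integrable_prod_inv_mul_inv hσ hσ1 hpt hE hM hsupp).integral_prod_right.congr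
    (ae_of_all _ fun z => ?_)
  simp only [cauchyTransform, sq]; rw [← integral_prod_mul]; congr 1; ext q; rw [div_mul_div_comm]

/-- The square is a double integral of `1/((x - z)(y - z))`. Splitting this into partial fractions
and applying Cauchy–Pompeiu in `z` leaves the difference quotient of `h`, which is exactly the
kernel in the first variation of the energy. The diagonal is null because there are no point masses.
-/
theorem integral_cauchyTransform_sq_mul_dbar (hσ : Measurable σ) (hσ1 : ∀ x, |σ x| = 1)
    (hpt : ∀ z, ν {z} = 0)
    (hE : Integrable (fun q : ℂ × ℂ => Real.log (1 / ‖q.1 - q.2‖)) (ν.prod ν))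
    {M : ℝ} (hM : 0 < M) (hsupp : ∀ᵐ x ∂ν, ‖x‖ < M)
    {h : ℂ → ℂ} (hk : ContDiff ℝ 1 h) (hc : HasCompactSupport h)
    (hh : tsupport h ⊆ ball 0 M) :
    ∫ z, cauchyTransform ν σ z ^ 2 * dbar h z =
      -π * ∫ q, (σ q.1 : ℂ) * σ q.2 * ((h q.1 - h q.2) / (q.1 - q.2)) ∂ν.prod ν := by
  have hd := continuous_dbar hk
  obtain ⟨D, hD⟩ := (hasCompactSupport_dbar hc).exists_bound_of_continuous hd
  have hz : ∀ z, z ∉ ball (0:ℂ) M → dbar h z = 0 := fun z hz =>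
    dbar_eq_zero_of_notMem_tsupport fun h => hz (hh h)
  have hint := (integrable_prod_inv_mul_inv hσ hσ1 hpt hE hM hsupp).mul_bdd (c := D)
      (g := fun q : (ℂ × ℂ) × ℂ => dbar h q.2)
      ((hd.comp continuous_snd).measurable.aestronglyMeasurable)
      (ae_of_all _ fun q => hD q.2)
  have hdi : ∀ x : ℂ, Integrable fun z => dbar h z / (x - z) := by
    intro x; have h1 : IntegrableOn (fun z => dbar h z / (x - z)) (ball 0 M) := by
      refine ⟨(by fun_prop : Measurable _).aestronglyMeasurable, ?_⟩
      rw [hasFiniteIntegral_def]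
      calc _ ≤ ∫⁻ z in ball 0 M, ennr D * ennr (1 / ‖z - x‖) := by
            refine lintegral_mono fun z => ?_
            rw [← ofReal_norm, norm_div, div_eq_mul_one_div, norm_sub_rev,
              ennr_mul (norm_nonneg _)]
            exact mul_le_mul' (ofReal_le_ofReal (hD z)) le_rfl
        _ < ⊤ := by
            rw [lintegral_const_mul _ (by fun_prop)]
            exact ENNReal.mul_lt_top ofReal_lt_top
              ((lintegral_ball_inv_norm_sub_le 0 x hM).trans_lt ofReal_lt_top)
    exact (integrableOn_iff_integrable_of_support_subset (fun z hzs => by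
      by_contra hzb
      exact hzs (by simp [hz z hzb]))).1 h1
  calc ∫ z, cauchyTransform ν σ z ^ 2 * dbar h z
      = ∫ z in ball 0 M, ∫ q, (σ q.1 : ℂ) * σ q.2 / ((q.1 - z) * (q.2 - z)) * dbar h z
          ∂ν.prod ν := by
        rw [setIntegral_eq_integral_of_forall_compl_eq_zero]
        · congr 1; ext z; rw [integral_mul_const]; congr 1; simp only [cauchyTransform, sq]
          rw [← integral_prod_mul]; congr 1; ext q; rw [div_mul_div_comm]
        · intro z h; simp [hz z h]
    _ = ∫ q, (∫ z in ball 0 M, (σ q.1 : ℂ) * σ q.2 / ((q.1 - z) * (q.2 - z)) * dbar h z)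
          ∂ν.prod ν := by
        rw [integral_integral_swap]; exact hint.swap
    _ = ∫ q, -π * ((σ q.1 : ℂ) * σ q.2 * ((h q.1 - h q.2) / (q.1 - q.2))) ∂ν.prod ν := by
        refine integral_congr_ae ?_; filter_upwards [ae_prod_fst_ne_snd hpt] with q hne
        have hne' := sub_ne_zero.2 hne
        rw [setIntegral_eq_integral_of_forall_compl_eq_zero (fun z h => by simp [hz z h])]
        have e1 : ∀ᵐ z : ℂ, (σ q.1 : ℂ) * σ q.2 / ((q.1 - z) * (q.2 - z)) * dbar h z =
            -((σ q.1 : ℂ) * σ q.2 / (q.1 - q.2)) * (dbar h z / (q.1 - z) - dbar h z / (q.2 - z)) := by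
          filter_upwards [(Set.finite_singleton q.1).countable.ae_notMem volume,
            (Set.finite_singleton q.2).countable.ae_notMem volume] with z h1 h2
          have h1' := sub_ne_zero.2 fun e => h1 e.symm
          have h2' := sub_ne_zero.2 fun e => h2 e.symm
          field_simp; ring
        rw [integral_congr_ae e1, integral_const_mul, integral_sub (hdi _) (hdi _),
          integral_dbar_div hk hc, integral_dbar_div hk hc]
        field_simp
    _ = _ := integral_const_mul _ _

end Energy

/-- The energy of an image measure as a double integral. -/
theorem logEnergy_map_eq {μ : SignedMeasure ℂ} {σ : ℂ → ℝ} (hσ : Measurable σ)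
    (hσ1 : ∀ x, |σ x| = 1)
    (hμ : ∀ f : ℂ → ℝ, ∫ᵛ x, f x ∂•μ = ∫ x, σ x * f x ∂μ.variation)
    {f : ℂ → ℂ} (hf : Measurable f)
    (hE : Integrable (fun q : ℂ × ℂ => Real.log (1 / ‖f q.1 - f q.2‖))
      (μ.variation.prod μ.variation)) :
    logEnergy (μ.map f) = ∫ q, σ q.1 * σ q.2 * Real.log (1 / ‖f q.1 - f q.2‖)
      ∂μ.variation.prod μ.variation := by
  obtain ⟨σ', hσ', hσ1', hμ', -⟩ := exists_sign_variation (μ.map f)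
  set G : ℂ → ℝ := fun y => ∫ᵛ x, Real.log (1 / ‖y - x‖) ∂•(μ.map f) with hG
  have hGm : StronglyMeasurable G := by
    have : G = fun y => ∫ x, σ' x * Real.log (1 / ‖y - x‖) ∂(μ.map f).variation := by
      ext y; exact hμ' _
    rw [this]
    refine StronglyMeasurable.integral_prod_right (f := fun y x => σ' x * Real.log (1 / ‖y - x‖)) ?_
    exact (by fun_prop : Measurable _).stronglyMeasurable
  have hI := hE.bdd_mul (c := 1) (hσ.comp measurable_snd).aestronglyMeasurable
      (ae_of_all _ fun q => by simp [hσ1])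
  have hGf : ∀ᵐ y ∂μ.variation, G (f y) = ∫ x, σ x * Real.log (1 / ‖f y - f x‖) ∂μ.variation := by
    filter_upwards [hE.prod_right_ae] with y hy
    rw [← hμ]
    exact VectorMeasure.integral_map hf (by fun_prop : Measurable _).aestronglyMeasurable hy
  have hGi := hI.integral_prod_left.congr (by
    filter_upwards [hGf] with y hy; exact hy.symm)
  have h1 : logEnergy (μ.map f) = ∫ᵛ y, G (f y) ∂•μ :=
    VectorMeasure.integral_map hf hGm.aestronglyMeasurable hGi
  rw [h1, hμ, integral_prod]
  · refine integral_congr_ae ?_; filter_upwards [hGf] with y hy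
    simp only [hy]; rw [← integral_const_mul]; congr 1; ext x; ring
  · exact (hI.bdd_mul (c := 1) (hσ.comp measurable_fst).aestronglyMeasurable
      (ae_of_all _ fun q => by simp [hσ1])).congr
      (ae_of_all _ fun q => by simp only [Function.comp]; ring)

end

/-! ### The first variation of the energy -/

theorem norm_log_one_add_sub_self_le_sq {w : ℂ} (hw : ‖w‖ ≤ 1 / 2) :
    ‖log (1 + w) - w‖ ≤ ‖w‖ ^ 2 := by
  refine (norm_log_one_add_sub_self_le (by linarith)).trans ?_
  have h1 : (1 - ‖w‖)⁻¹ ≤ 2 := by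
    rw [inv_le_comm₀ (by linarith) (by norm_num)]; linarith
  nlinarith [sq_nonneg ‖w‖]

/-- The first-order condition satisfied by a critical measure. -/
theorem IsCriticalMeasure.integral_eq {n : ℕ} {a ρ : Fin n → ℂ} {μ : SignedMeasure ℂ}
    (hc : IsCriticalMeasure a ρ μ) {σ : ℂ → ℝ} (hσ : Measurable σ) (hσ1 : ∀ x, |σ x| = 1)
    (hμ : ∀ f : ℂ → ℝ, ∫ᵛ x, f x ∂•μ = ∫ x, σ x * f x ∂μ.variation)
    {h : ℂ → ℂ} (hs : ContDiff ℝ ∞ h) (hcs : HasCompactSupport h) (ha : ∀ k, h (a k) = 0) :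
    ∫ q, (σ q.1 : ℂ) * σ q.2 * ((h q.1 - h q.2) / (q.1 - q.2)) ∂μ.variation.prod μ.variation =
      2 * ∫ x, (σ x : ℂ) * (fieldDeriv a ρ x * h x) ∂μ.variation := by
  set ν := μ.variation with hν
  obtain ⟨L, hL⟩ := hs.lipschitzWith_of_hasCompactSupport hcs (by simp)
  have hhm := hs.continuous.measurable
  -- The displaced points satisfy `(x + t h x) - (y + t h y) = (x - y)(1 + t D)`, so the energy
  -- changes by the integral of `-log |1 + t D|`. On the diagonal `D = 0` by the convention for
  -- division by zero, in agreement with the default value of the kernel there.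
  set D : ℂ × ℂ → ℂ := fun q => (h q.1 - h q.2) / (q.1 - q.2) with hD
  have hDm : Measurable D := by fun_prop
  have hquot : ∀ x y : ℂ, ‖(h x - h y) / (x - y)‖ ≤ L := fun x y => by
    rw [norm_div]; refine div_le_of_le_mul₀ (norm_nonneg _) L.2 ?_
    simpa [dist_eq_norm] using hL.dist_le_mul x y
  have hDL : ∀ q, ‖D q‖ ≤ L := fun q => hquot _ _
  -- Because `h` vanishes at the nodes, this is a difference quotient of `h` as well and obeys the
  -- same Lipschitz bound; the field increment is the integral of logarithms of `1 + t H`.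
  set H : Fin n → ℂ → ℂ := fun k x => h x / (x - a k) with hH
  have hHm : ∀ k, Measurable (H k) := fun k => by fun_prop
  have hHL : ∀ k x, ‖H k x‖ ≤ L := fun k x => by
    simpa [H, ha k] using hquot x (a k)
  have hσc := measurable_ofReal.comp hσ
  have hσn : ∀ x, ‖(σ x : ℂ)‖ = 1 := fun x => by simp [hσ1]
  set S : ℂ × ℂ → ℂ := fun q => (σ q.1 : ℂ) * σ q.2 with hS
  have hSm : Measurable S := by fun_prop
  have hSn : ∀ q, ‖S q‖ = 1 := fun q => by simp [S, hσ1]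
  -- integrability of bounded functions
  have hib : ∀ {α : Type} [MeasurableSpace α] (m : Measure α) [IsFiniteMeasure m] (f : α → ℂ) (C : ℝ),
      Measurable f → (∀ x, ‖f x‖ ≤ C) → Integrable f m := fun m _ f C hf hC =>
    Integrable.of_bound hf.aestronglyMeasurable C (ae_of_all _ hC)
  set J1 := ∫ q, S q * D q ∂ν.prod ν with hJ1
  set J2 := ∫ x, (σ x : ℂ) * ∑ k, ρ k / 2 * H k x ∂ν with hJ2
  set P1 : ℂ → ℂ := fun t => ∫ q, S q * log (1 + t * D q) ∂ν.prod ν with hP1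
  set P2 : ℂ → ℂ := fun t => ∫ x, (σ x : ℂ) * ∑ k, ρ k / 2 * log (1 + t * H k x) ∂ν with hP2
  have hsmall : ∀ {t w : ℂ}, ‖t‖ * L ≤ 1 / 2 → ‖w‖ ≤ L → ‖t * w‖ ≤ 1 / 2 := fun {t w} ht hw => by
    rw [norm_mul]; exact (mul_le_mul_of_nonneg_left hw (norm_nonneg _)).trans ht
  have hlog : ∀ {t w : ℂ}, ‖t‖ * L ≤ 1 / 2 → ‖w‖ ≤ L →
      ‖log (1 + t * w) - t * w‖ ≤ (L : ℝ) ^ 2 * ‖t‖ ^ 2 := fun {t w} ht hw => by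
    refine (norm_log_one_add_sub_self_le_sq (hsmall ht hw)).trans ?_
    rw [norm_mul, mul_pow, mul_comm]; gcongr
  have hlog1 : ∀ {t w : ℂ}, ‖t‖ * L ≤ 1 / 2 → ‖w‖ ≤ L → ‖log (1 + t * w)‖ ≤ 1 :=
    fun {t w} ht hw => by
      have h1 := norm_log_one_add_sub_self_le_sq (hsmall ht hw)
      have h2 := hsmall ht hw
      have h3 : ‖log (1 + t * w)‖ ≤ ‖log (1 + t * w) - t * w‖ + ‖t * w‖ := by
        simpa using norm_add_le (log (1 + t * w) - t * w) (t * w)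
      nlinarith [norm_nonneg (t * w)]
  -- integrability
  have iP1 : ∀ t : ℂ, ‖t‖ * L ≤ 1 / 2 → Integrable (fun q => S q * log (1 + t * D q)) (ν.prod ν) :=
    fun t ht => hib _ _ 1 (by fun_prop) fun q => by
      rw [norm_mul, hSn, one_mul]; exact hlog1 ht (hDL q)
  have iP2 : ∀ t : ℂ, ‖t‖ * L ≤ 1 / 2 →
      Integrable (fun x => (σ x : ℂ) * ∑ k, ρ k / 2 * log (1 + t * H k x)) ν :=
    fun t ht => hib _ _ (∑ k, ‖ρ k / 2‖) (by fun_prop) fun x => by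
      rw [norm_mul, hσn, one_mul]; refine (norm_sum_le _ _).trans (Finset.sum_le_sum fun k _ => ?_)
      rw [norm_mul]; exact mul_le_of_le_one_right (norm_nonneg _) (hlog1 ht (hHL k x))
  have iJ1 : Integrable (fun q => S q * D q) (ν.prod ν) :=
    hib _ _ L (by fun_prop) fun q => by rw [norm_mul, hSn, one_mul]; exact hDL q
  have iJ2 : Integrable (fun x => (σ x : ℂ) * ∑ k, ρ k / 2 * H k x) ν :=
    hib _ _ (∑ k, ‖ρ k / 2‖ * L) (by fun_prop) fun x => by
      rw [norm_mul, hσn, one_mul]; refine (norm_sum_le _ _).trans (Finset.sum_le_sum fun k _ => ?_)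
      rw [norm_mul]; exact mul_le_mul_of_nonneg_left (hHL k x) (norm_nonneg _)
  -- expansions
  set K1 : ℝ := (L : ℝ) ^ 2 * (ν.prod ν).real univ with hK1
  set K2 : ℝ := (∑ k, ‖ρ k / 2‖ * (L : ℝ) ^ 2) * ν.real univ with hK2
  have b1 : ∀ t : ℂ, ‖t‖ * L ≤ 1 / 2 → ‖P1 t - t * J1‖ ≤ K1 * ‖t‖ ^ 2 := by
    intro t ht; have : P1 t - t * J1 = ∫ q, S q * (log (1 + t * D q) - t * D q) ∂ν.prod ν := by
      rw [hP1, hJ1, ← integral_const_mul, ← integral_sub (iP1 t ht) (iJ1.const_mul t)]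
      congr 1; ext q; ring
    rw [this]
    refine (norm_integral_le_of_norm_le_const (C := (L : ℝ) ^ 2 * ‖t‖ ^ 2) (ae_of_all _ fun q => ?_)).trans
      (le_of_eq (by rw [hK1]; ring))
    rw [norm_mul, hSn, one_mul]; exact hlog ht (hDL q)
  have b2 : ∀ t : ℂ, ‖t‖ * L ≤ 1 / 2 → ‖P2 t - t * J2‖ ≤ K2 * ‖t‖ ^ 2 := by
    intro t ht
    have : P2 t - t * J2 = ∫ x, (σ x : ℂ) * ∑ k, ρ k / 2 * (log (1 + t * H k x) - t * H k x) ∂ν := by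
      rw [hP2, hJ2, ← integral_const_mul, ← integral_sub (iP2 t ht) (iJ2.const_mul t)]
      congr 1; ext x; rw [mul_left_comm, ← mul_sub, Finset.mul_sum, ← Finset.sum_sub_distrib]
      congr 1; exact Finset.sum_congr rfl fun k _ => by ring
    rw [this]
    refine (norm_integral_le_of_norm_le_const (C := ∑ k, ‖ρ k / 2‖ * ((L : ℝ) ^ 2 * ‖t‖ ^ 2))
      (ae_of_all _ fun x => ?_)).trans
      (le_of_eq (by rw [hK2]; simp only [← mul_assoc, ← Finset.sum_mul]; ring))
    rw [norm_mul, hσn, one_mul]; refine (norm_sum_le _ _).trans (Finset.sum_le_sum fun k _ => ?_)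
    rw [norm_mul]; exact mul_le_mul_of_nonneg_left (hlog ht (hHL k x)) (norm_nonneg _)
  -- the energy variation
  have hE0 := hc.finite_energy.2
  have hEV : ∀ t : ℂ, ‖t‖ * L ≤ 1 / 2 → energyVariation a ρ μ h t = -(P1 t + 2 * P2 t).re := by
    intro t ht; have hne : ∀ {w : ℂ}, ‖w‖ ≤ L → (1 + t * w) ≠ 0 := fun {w} hw h0 => by
      have h1 := hsmall ht hw
      have : t * w = -1 := by linear_combination h0
      rw [this] at h1; norm_num at h1
    have hpt : ∀ q : ℂ × ℂ, Real.log (1 / ‖(q.1 + t * h q.1) - (q.2 + t * h q.2)‖) =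
        Real.log (1 / ‖q.1 - q.2‖) - (log (1 + t * D q)).re := by
      intro q; rw [log_re]; by_cases hq : q.1 = q.2
      · simp [hD, hq]
      · have hq' := sub_ne_zero.2 hq
        have : (q.1 + t * h q.1) - (q.2 + t * h q.2) = (q.1 - q.2) * (1 + t * D q) := by
          simp only [hD]; field_simp; ring
        rw [this, norm_mul, one_div, one_div, Real.log_inv, Real.log_inv, Real.log_mul
          (norm_ne_zero_iff.2 hq') (norm_ne_zero_iff.2 (hne (hDL q)))]
        ring
    have iL : Integrable (fun q => (log (1 + t * D q)).re) (ν.prod ν) :=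
      (hib _ _ 1 (by fun_prop : Measurable fun q => log (1 + t * D q))
        fun q => hlog1 ht (hDL q)).re
    have hEt : Integrable (fun q : ℂ × ℂ =>
        Real.log (1 / ‖(q.1 + t * h q.1) - (q.2 + t * h q.2)‖)) (ν.prod ν) := by
      simp only [hpt]; exact hE0.sub iL
    have e1 := logEnergy_map_eq hσ hσ1 hμ (f := fun x => x + t * h x) (by fun_prop) hEt
    have e2 := logEnergy_map_eq hσ hσ1 hμ (f := id) measurable_id hE0
    rw [VectorMeasure.map_id] at e2; simp only [id] at e2
    have e3 : ∫ᵛ x, fieldIncrement a ρ x (x + t * h x) ∂•μ = -(P2 t).re := by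
      rw [hμ, hP2, ← RCLike.re_eq_complex_re, ← integral_re (iP2 t ht), ← integral_neg]
      congr 1; ext x; rw [RCLike.re_eq_complex_re, re_ofReal_mul, fieldIncrement, re_sum, mul_neg]
      congr 2; refine Finset.sum_congr rfl fun k _ => ?_
      congr 2; by_cases hx : x = a k
      · simp [hH, hx, ha]
      · have hx' := sub_ne_zero.2 hx
        congr 1; simp only [hH]; field_simp; ring
    have hdiff : Integrable (fun q : ℂ × ℂ => σ q.1 * σ q.2 * Real.log (1 / ‖q.1 - q.2‖)) (ν.prod ν) :=
      hE0.bdd_mul (c := 1) (by fun_prop : Measurable _).aestronglyMeasurable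
        (ae_of_all _ fun q => by simp [hσ1])
    have iL2 : Integrable (fun q : ℂ × ℂ => σ q.1 * σ q.2 * (log (1 + t * D q)).re) (ν.prod ν) :=
      iL.bdd_mul (c := 1) (by fun_prop : Measurable _).aestronglyMeasurable
        (ae_of_all _ fun q => by simp [hσ1])
    have e4 : ∫ q, σ q.1 * σ q.2 * (log (1 + t * D q)).re ∂ν.prod ν = (P1 t).re := by
      rw [hP1, ← RCLike.re_eq_complex_re, ← integral_re (iP1 t ht)]; congr 1; ext q
      rw [RCLike.re_eq_complex_re, hS]; simp only [← ofReal_mul, re_ofReal_mul]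
    rw [energyVariation, e1, e2, e3]; simp only [hpt, mul_sub]; rw [integral_sub hdiff iL2, e4]
    simp only [add_re, mul_re, re_ofNat, im_ofNat]; ring
  -- conclusion
  set J := J1 + 2 * J2 with hJ
  -- To first order the variation is `-Re (t J)`. Along `t = s conj J` with `s` real this is `-s
  -- ‖J‖²`, so a vanishing derivative forces `J = 0`.
  have hbound : ∀ t : ℂ, ‖t‖ * L ≤ 1 / 2 →
      |energyVariation a ρ μ h t + (t * J).re| ≤ (K1 + 2 * K2) * ‖t‖ ^ 2 := by
    intro t ht; have : energyVariation a ρ μ h t + (t * J).re =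
        -((P1 t - t * J1) + 2 * (P2 t - t * J2)).re := by
      rw [hEV t ht, hJ]; simp only [add_re, sub_re, mul_add, mul_re, re_ofNat, im_ofNat,
        mul_im]
      ring
    rw [this, abs_neg]; refine (abs_re_le_norm _).trans ((norm_add_le _ _).trans ?_)
    rw [norm_mul, norm_ofNat]; linarith [b1 t ht, b2 t ht]
  have hJ0 : J = 0 := by
    have hder := hc.stationary h hs ha
    have hEV0 : energyVariation a ρ μ h 0 = 0 := by
      rw [hEV 0 (by simp)]; simp [hP1, hP2]
    -- restrict to the real line in the direction of `conj J`
    have h1 : Tendsto (fun s : ℝ => s⁻¹ * energyVariation a ρ μ h (s * conj J)) (𝓝[≠] 0) (𝓝 0) := by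
      have hd : HasDerivAt (fun s : ℝ => ((s : ℂ) * conj J)) (1 * conj J) 0 :=
        (ofRealCLM.hasDerivAt (x := (0:ℝ))).mul_const _
      have h2 := HasDerivAt.scomp_of_eq (x := (0:ℝ)) (h := fun s : ℝ => ((s : ℂ) * conj J)) hder hd
        (by simp)
      rw [hasDerivAt_iff_tendsto_slope] at h2; simp only [smul_zero] at h2
      have h3 := (continuous_re.tendsto _).comp h2
      rw [zero_re] at h3; refine h3.congr fun s => ?_
      simp [slope, hEV0, Function.comp]
    have h2 : Tendsto (fun s : ℝ => (K1 + 2 * K2) * |s| * ‖J‖ ^ 2) (𝓝[≠] 0) (𝓝 0) := by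
      have : Continuous fun s : ℝ => (K1 + 2 * K2) * |s| * ‖J‖ ^ 2 := by fun_prop
      simpa using (this.tendsto 0).mono_left nhdsWithin_le_nhds
    have hev : ∀ᶠ s : ℝ in 𝓝[≠] 0, |s⁻¹ * energyVariation a ρ μ h (s * conj J) + ‖J‖ ^ 2| ≤
        (K1 + 2 * K2) * |s| * ‖J‖ ^ 2 := by
      have hc0 : Tendsto (fun s : ℝ => ‖(s : ℂ) * conj J‖ * L) (𝓝[≠] 0) (𝓝 0) := by
        have : Continuous fun s : ℝ => ‖(s : ℂ) * conj J‖ * L := by fun_prop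
        simpa using (this.tendsto 0).mono_left nhdsWithin_le_nhds
      filter_upwards [hc0.eventually_le_const (by norm_num : (0:ℝ) < 1 / 2), self_mem_nhdsWithin] with s hs hs0
      have hs0 : s ≠ 0 := hs0
      have hb := hbound _ hs
      have e : ((s : ℂ) * conj J * J).re = s * ‖J‖ ^ 2 := by
        rw [mul_assoc, re_ofReal_mul, ← normSq_eq_conj_mul_self, ofReal_re,
          normSq_eq_norm_sq]
      rw [e, norm_mul, norm_real, RCLike.norm_conj, norm_eq_abs] at hb
      have hsp : 0 < |s| := abs_pos.2 hs0
      have : s⁻¹ * energyVariation a ρ μ h (s * conj J) + ‖J‖ ^ 2 =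
          s⁻¹ * (energyVariation a ρ μ h (s * conj J) + s * ‖J‖ ^ 2) := by field_simp
      rw [this, abs_mul, abs_inv, inv_mul_le_iff₀ hsp]; refine hb.trans (le_of_eq (by ring))
    have h3 := le_of_tendsto_of_tendsto ((h1.add_const _).abs) h2 hev
    simpa using h3
  have hfin : J2 = -∫ x, (σ x : ℂ) * (fieldDeriv a ρ x * h x) ∂ν := by
    rw [hJ2, ← integral_neg]; congr 1; ext x
    rw [fieldDeriv, neg_mul, mul_neg, neg_neg, Finset.sum_mul]; congr 1
    exact Finset.sum_congr rfl fun k _ => by simp only [hH]; ring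
  have : J1 = -2 * J2 := by linear_combination hJ0
  rw [this, hfin]; ring

/-! ### Weyl's lemma for the Cauchy–Riemann equation -/

theorem contDiff_dbar {k : ℂ → ℂ} (hk : ContDiff ℝ ∞ k) : ContDiff ℝ ∞ (dbar k) := by
  have h := hk.fderiv_right (m := ∞) (by simp)
  unfold dbar; exact ((h.clm_apply contDiff_const).add
    (contDiff_const.mul (h.clm_apply contDiff_const))).div_const _

theorem dbar_comp_const_sub {k : ℂ → ℂ} (hk : Differentiable ℝ k) (x t : ℂ) :
    dbar (fun s => k (x - s)) t = - dbar k (x - t) := by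
  have h1 : HasFDerivAt (fun s => k (x - s)) ((fderiv ℝ k (x - t)).comp
      (-(ContinuousLinearMap.id ℝ ℂ))) t :=
    (hk (x - t)).hasFDerivAt.comp t ((hasFDerivAt_id t).const_sub x)
  simp only [dbar, h1.fderiv, ContinuousLinearMap.comp_apply, neg_apply,
    ContinuousLinearMap.id_apply, map_neg]
  ring

theorem dbar_comp_sub_const {k : ℂ → ℂ} (hk : Differentiable ℝ k) (x t : ℂ) :
    dbar (fun s => k (s - x)) t = dbar k (t - x) := by
  have h1 : HasFDerivAt (fun s => k (s - x)) ((fderiv ℝ k (t - x)).comp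
      (ContinuousLinearMap.id ℝ ℂ)) t :=
    (hk (t - x)).hasFDerivAt.comp t ((hasFDerivAt_id t).sub_const x)
  simp only [dbar, h1.fderiv, ContinuousLinearMap.comp_apply, ContinuousLinearMap.id_apply]

/-- Convolution of complex-valued functions on the plane. -/
abbrev mulConv (f φ : ℂ → ℂ) : ℂ → ℂ := f ⋆[.mul ℝ ℂ, volume] φ

theorem mulConv_apply (f φ : ℂ → ℂ) (x : ℂ) : mulConv f φ x = ∫ t, f t * φ (x - t) := rfl

theorem hasFDerivAt_convolution_mul {𝕜 : Type*} [RCLike 𝕜] {f φ : ℂ → 𝕜}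
    (hf : LocallyIntegrable f) (hφ : ContDiff ℝ 1 φ) (hc : HasCompactSupport φ) (x : ℂ) :
    ∃ L : ℂ →L[ℝ] 𝕜, HasFDerivAt (f ⋆[.mul ℝ 𝕜, volume] φ) L x ∧
      ∀ v, L v = ∫ t, f t * fderiv ℝ φ (x - t) v := by
  refine ⟨_, hc.hasFDerivAt_convolution_right _ hf hφ x, fun v => ?_⟩
  rw [convolution_precompR_apply _ hf (hc.fderiv ℝ) (hφ.continuous_fderiv one_ne_zero)]; rfl

theorem exists_contDiffBump_seq : ∃ φ : ℕ → ContDiffBump (0 : ℂ),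
    Tendsto (fun n => (φ n).rOut) atTop (𝓝 0) ∧ ∀ n, (φ n).rOut ≤ 2 * (φ n).rIn := by
  refine ⟨fun n => ⟨1 / ((n : ℝ) + 1), 2 * (1 / ((n : ℝ) + 1)), by positivity, by
    have : (0:ℝ) < 1 / ((n : ℝ) + 1) := by positivity
    linarith⟩, ?_, fun n => le_rfl⟩
  simpa using (tendsto_one_div_add_atTop_nhds_zero_nat (𝕜 := ℝ)).const_mul 2

theorem integrable_mul_of_locallyIntegrable {f φ : ℂ → ℂ} (hf : LocallyIntegrable f)
    (hφ : Continuous φ) (hc : HasCompactSupport φ) : Integrable fun t => f t * φ t := by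
  simpa [smul_eq_mul, mul_comm] using hf.integrable_smul_left_of_hasCompactSupport hφ hc

/-- The weak equation tested against `t ↦ φ (x - t)` is the Cauchy–Riemann equation of the
convolution at `x`. -/
theorem differentiable_mulConv {f : ℂ → ℂ} (hf : LocallyIntegrable f)
    (h : ∀ k : ℂ → ℂ, ContDiff ℝ ∞ k → HasCompactSupport k → ∫ z, f z * dbar k z = 0)
    {φ : ℂ → ℂ} (hφ : ContDiff ℝ ∞ φ) (hc : HasCompactSupport φ) :
    Differentiable ℂ (mulConv f φ) := by
  intro x; obtain ⟨L, hL, hLv⟩ := hasFDerivAt_convolution_mul hf (hφ.of_le (by simp)) hc x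
  rw [differentiableAt_complex_iff_differentiableAt_real]; refine ⟨hL.differentiableAt, ?_⟩
  rw [hL.fderiv]; have hφ1 : ContDiff ℝ 1 φ := hφ.of_le (by simp)
  have hx : ∀ v, Integrable fun t => f t * fderiv ℝ φ (x - t) v := fun v => by
    refine integrable_mul_of_locallyIntegrable hf
      (((hφ1.continuous_fderiv one_ne_zero).comp (by fun_prop)).clm_apply continuous_const) ?_
    have h1 := (hc.fderiv ℝ).comp_left (g := fun L : ℂ →L[ℝ] ℂ => L v) rfl
    exact h1.comp_homeomorph (Homeomorph.subLeft x)
  have h0 := h (fun t => φ (x - t)) (hφ.comp (contDiff_const.sub contDiff_id))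
    (hc.comp_homeomorph (Homeomorph.subLeft x))
  simp only [dbar_comp_const_sub (hφ1.differentiable one_ne_zero)] at h0
  have h1 : ∫ z, f z * -dbar φ (x - z) = -(1/2) * (L 1 + I * L I) := by
    rw [hLv, hLv, ← integral_const_mul, ← integral_add (hx 1) ((hx _).const_mul _),
      ← integral_const_mul]
    congr 1; ext t; simp only [dbar]; ring
  rw [h1] at h0; rw [smul_eq_mul]; have h2 : L 1 + I * L I = 0 := by linear_combination -2 * h0
  linear_combination (-I) * h2 + (L I) * I_mul_I

/-- Both sides are `f` convolved with `φ * ψ`. The lemma exchanges a mollifier with the reproducing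
kernel. -/
theorem mulConv_right_comm {f φ ψ : ℂ → ℂ} (hf : LocallyIntegrable f) (hφ : Continuous φ)
    (hφc : HasCompactSupport φ) (hψ : Continuous ψ) (hψc : HasCompactSupport ψ) :
    mulConv (mulConv f φ) ψ = mulConv (mulConv f ψ) φ := by
  have key : ∀ φ ψ : ℂ → ℂ, Continuous φ → HasCompactSupport φ → Continuous ψ →
      HasCompactSupport ψ → mulConv (mulConv f φ) ψ = mulConv f (mulConv φ ψ) := by
    intro φ ψ hφ hφc hψ hψc; ext x
    refine convolution_assoc _ _ _ _ (fun a b c => by simp [mul_assoc]) hf.aestronglyMeasurable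
      hφ.aestronglyMeasurable hψ.aestronglyMeasurable ?_ ?_ ?_
    · exact ae_of_all _ fun y => hφc.convolutionExists_right _ hf hφ y
    · exact ae_of_all _ fun y => hψc.norm.convolutionExists_right _
        hφ.norm.locallyIntegrable hψ.norm y
    · refine HasCompactSupport.convolutionExists_right _ (hφc.norm.convolution _ hψc.norm)
        (fun x => let ⟨s, hs, hi⟩ := hf x; ⟨s, hs, hi.norm⟩) ?_ x
      exact hψc.norm.continuous_convolution_right _ hφ.norm.locallyIntegrable hψ.norm
  rw [key φ ψ hφ hφc hψ hψc, key ψ φ hψ hψc hφ hφc]; congr 1; rw [mulConv, ← convolution_flip]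
  congr 1; ext; simp

/-- A smooth compactly supported kernel reproducing all entire functions. -/
theorem exists_reproducing_kernel : ∃ ψ : ℂ → ℂ, ContDiff ℝ ∞ ψ ∧ HasCompactSupport ψ ∧
    ∀ F : ℂ → ℂ, Differentiable ℂ F → mulConv F ψ = F := by
  let χ : ContDiffBump (0 : ℂ) := ⟨1, 2, by norm_num, by norm_num⟩
  set X : ℂ → ℂ := fun z => (χ z : ℂ) with hX
  have hXs : ContDiff ℝ ∞ X := ofRealCLM.contDiff.comp χ.contDiff
  have hXc := χ.hasCompactSupport.comp_left ofReal_zero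
  have hX1 : ∀ z ∈ ball (0:ℂ) 1, dbar X z = 0 := by
    intro z hz; have : X =ᶠ[𝓝 z] fun _ => 1 := by
      filter_upwards [isOpen_ball.mem_nhds hz] with w hw
      simp only [X]; rw [χ.one_of_mem_closedBall (ball_subset_closedBall hw)]; simp
    simp [dbar, this.fderiv_eq]
  -- The apparent singularity at 0 is absent because `X = 1` near 0. Cauchy–Pompeiu at `x` for the
  -- product of an entire `F` with `X (· - x)` expresses `F x` as the convolution of `F` with this
  -- kernel.
  refine ⟨fun w => dbar X (-w) / (π * w), ?_, ?_, ?_⟩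
  · rw [contDiff_iff_contDiffAt]; intro w; by_cases hw : w ∈ ball (0:ℂ) 1
    · have : (fun w => dbar X (-w) / (π * w)) =ᶠ[𝓝 w] fun _ => 0 := by
        filter_upwards [isOpen_ball.mem_nhds hw] with u hu
        rw [hX1 (-u) (by simpa using hu), zero_div]
      exact contDiffAt_const.congr_of_eventuallyEq this
    · have hw0 : w ≠ 0 := fun h => hw (by simp [h])
      simp only [div_eq_mul_inv]; exact ((contDiff_dbar hXs).comp contDiff_neg).contDiffAt.mul
        ((contDiffAt_const.mul contDiffAt_id).inv
          (mul_ne_zero (by exact_mod_cast pi_ne_zero) hw0))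
  · have h1 := (hasCompactSupport_dbar hXc).comp_homeomorph (Homeomorph.neg ℂ)
    simp only [div_eq_mul_inv]; exact h1.mul_right
  · intro F hF; ext x; have hFr := (hF.contDiff (n := 1)).restrict_scalars ℝ
    have hXx : ContDiff ℝ 1 fun s => X (s - x) :=
      (hXs.of_le (by simp)).comp (contDiff_id.sub contDiff_const)
    have h1 := integral_dbar_div (hFr.mul hXx)
      ((hXc.comp_homeomorph (Homeomorph.subRight x)).mul_left (f := F)) x
    have hXd := hXs.differentiable (by simp)
    have hX0 : X 0 = 1 := by
      simp only [X]; rw [χ.one_of_mem_closedBall (by simp [χ])]; simp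
    simp only [sub_self, hX0, mul_one] at h1; rw [mulConv_apply]
    have hpi : (π : ℂ) ≠ 0 := by exact_mod_cast pi_ne_zero
    apply mul_left_cancel₀ hpi; rw [← h1, ← integral_const_mul]; congr 1; ext t
    rw [show (fun s => F s * X (s - x)) = fun w => F w * (fun s => X (s - x)) w from rfl] at *
    rw [dbar_mul_of_differentiableAt (hF t) ((hXx.differentiable one_ne_zero) t),
      dbar_comp_sub_const hXd, neg_sub]
    rcases eq_or_ne x t with rfl | hxt
    · simp
    · have := sub_ne_zero.mpr hxt
      field_simp

/-- **Weyl's lemma** for the Cauchy–Riemann equation on the plane. -/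
theorem exists_entire_ae_eq {f : ℂ → ℂ} (hf : LocallyIntegrable f)
    (h : ∀ k : ℂ → ℂ, ContDiff ℝ ∞ k → HasCompactSupport k → ∫ z, f z * dbar k z = 0) :
    ∃ F : ℂ → ℂ, Differentiable ℂ F ∧ f =ᵐ[volume] F := by
  obtain ⟨ψ, hψ, hψc, hrep⟩ := exists_reproducing_kernel
  -- The mollifications of `f` are entire, hence reproduced by `ψ`; by commutation they are also the
  -- mollifications of `f * ψ`. They tend to `f` almost everywhere and to `f * ψ` everywhere.
  refine ⟨mulConv f ψ, differentiable_mulConv hf h hψ hψc, ?_⟩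
  obtain ⟨φ, hφ0, hφ2⟩ := exists_contDiffBump_seq
  set Φ : ℕ → ℂ → ℂ := fun n z => ((φ n).normed volume z : ℂ) with hΦ
  have hΦs : ∀ n, ContDiff ℝ ∞ (Φ n) := fun n => ofRealCLM.contDiff.comp (φ n).contDiff_normed
  have hΦc : ∀ n, HasCompactSupport (Φ n) := fun n =>
    (φ n).hasCompactSupport_normed.comp_left ofReal_zero
  have heq : ∀ (g : ℂ → ℂ) n x, ((φ n).normed volume ⋆[ContinuousLinearMap.lsmul ℝ ℝ, volume] g) x =
      mulConv g (Φ n) x := by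
    intro g n x; rw [convolution_lsmul_swap, mulConv_apply]; congr 1; ext t; simp [Φ, mul_comm]
  have hlim := ContDiffBump.ae_convolution_tendsto_right_of_locallyIntegrable (K := 2) hφ0
    (Eventually.of_forall hφ2) hf
  filter_upwards [hlim] with x hx
  have hcont := (differentiable_mulConv hf h hψ hψc).continuous
  have hx2 := ContDiffBump.convolution_tendsto_right_of_continuous (μ := volume) hφ0 hcont x
  refine tendsto_nhds_unique hx (hx2.congr fun n => ?_)
  rw [heq, heq, ← mulConv_right_comm hf (hΦs n).continuous (hΦc n) hψ.continuous hψc,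
    hrep _ (differentiable_mulConv hf h (hΦs n) (hΦc n))]

/-! ### The total field and its quadratic equation -/

section

section

variable {ν : Measure ℂ} [IsFiniteMeasure ν] {σ : ℂ → ℝ}

theorem locallyIntegrable_cauchyTransform (hσ : Measurable σ) (hσ1 : ∀ x, |σ x| = 1) :
    LocallyIntegrable (cauchyTransform ν σ) := fun x =>
  ⟨ball x 1, ball_mem_nhds x one_pos, integrableOn_ball_cauchyTransform hσ hσ1 x 1⟩

end

section

variable {n : ℕ} (a ρ : Fin n → ℂ)

theorem fieldDeriv_eq_sum_cauchyTransform (z : ℂ) : fieldDeriv a ρ z =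
    ∑ k, (ρ k / 2) * cauchyTransform (Measure.dirac (a k)) (fun _ => 1) z := by
  rw [fieldDeriv, ← Finset.sum_neg_distrib]; refine Finset.sum_congr rfl fun k _ => ?_
  simp only [cauchyTransform, integral_dirac, ofReal_one]
  rw [← neg_sub (a k) z, div_neg, neg_neg, mul_one_div]

theorem locallyIntegrable_fieldDeriv : LocallyIntegrable (fieldDeriv a ρ) := by
  rw [funext (fieldDeriv_eq_sum_cauchyTransform a ρ)]
  refine LocallyIntegrable.congr (f := ∑ k, (ρ k / 2) •
    cauchyTransform (Measure.dirac (a k)) (fun _ => 1)) ?_ (ae_of_all _ fun z => by simp)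
  exact locallyIntegrable_finsetSum' _ fun k _ =>
    (locallyIntegrable_cauchyTransform measurable_const (fun _ => abs_one)).smul _

/-- The complex gradient `C^μ + Φ'` of the total potential of `σ ν`. -/
def totalField (ν : Measure ℂ) (σ : ℂ → ℝ) (z : ℂ) : ℂ := cauchyTransform ν σ z + fieldDeriv a ρ z

variable {ν : Measure ℂ} [IsFiniteMeasure ν] {σ : ℂ → ℝ}

theorem locallyIntegrable_totalField (hσ : Measurable σ) (hσ1 : ∀ x, |σ x| = 1) :
    LocallyIntegrable (totalField a ρ ν σ) :=
  (locallyIntegrable_cauchyTransform hσ hσ1).add (locallyIntegrable_fieldDeriv a ρ)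

/-- `Φ'` is a combination of Cauchy transforms of unit masses at the nodes. A test function that
vanishes at the charged nodes does not see these masses, so only `C^μ` contributes. -/
theorem integral_totalField_mul_dbar (hσ : Measurable σ) (hσ1 : ∀ x, |σ x| = 1) {k : ℂ → ℂ}
    (hk : ContDiff ℝ 1 k) (hc : HasCompactSupport k) (ha : ∀ j, ρ j ≠ 0 → k (a j) = 0) :
    ∫ z, totalField a ρ ν σ z * dbar k z = π * ∫ x, (σ x : ℂ) * k x ∂ν := by
  have hd := continuous_dbar hk
  have hi : ∀ {f : ℂ → ℂ}, LocallyIntegrable f → Integrable fun z => f z * dbar k z :=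
    fun hf => integrable_mul_of_locallyIntegrable hf hd (hasCompactSupport_dbar hc)
  simp only [totalField, add_mul]; rw [integral_add (hi (locallyIntegrable_cauchyTransform hσ hσ1))
    (hi (locallyIntegrable_fieldDeriv a ρ)), integral_cauchyTransform_mul_dbar hσ hσ1 hk hc]
  suffices h : ∫ z, fieldDeriv a ρ z * dbar k z = 0 by rw [h, add_zero]
  simp only [fieldDeriv_eq_sum_cauchyTransform, Finset.sum_mul, mul_assoc]
  have h1 : ∀ j, Integrable fun z => cauchyTransform (Measure.dirac (a j)) (fun _ => 1) z *
    dbar k z := fun j => hi (locallyIntegrable_cauchyTransform measurable_const (fun _ => abs_one))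
  rw [integral_finsetSum _ fun j _ => (h1 j).const_mul _]
  refine Finset.sum_eq_zero fun j _ => ?_
  rw [integral_const_mul, integral_cauchyTransform_mul_dbar measurable_const
    (fun _ => abs_one) hk hc]
  by_cases h0 : ρ j = 0
  · simp [h0]
  · simp [ha j h0]

/-- The polynomial function `∏ (z - a_k)`. -/
def nodeProd (z : ℂ) : ℂ := ∏ k, (z - a k)

/-- The polynomial function `Φ'(z) ∏ (z - a_k)`. -/
def nodeField (z : ℂ) : ℂ := -∑ k, (ρ k / 2) * ∏ j ∈ Finset.univ.erase k, (z - a j)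

theorem nodeProd_ne_zero {z : ℂ} (hz : ∀ k, z ≠ a k) : nodeProd a z ≠ 0 :=
  Finset.prod_ne_zero_iff.2 fun k _ => sub_ne_zero.2 (hz k)

theorem nodeField_eq {z : ℂ} (hz : ∀ k, z ≠ a k) :
    nodeField a ρ z = nodeProd a z * fieldDeriv a ρ z := by
  rw [nodeField, fieldDeriv, mul_neg, Finset.mul_sum]; congr 1
  refine Finset.sum_congr rfl fun k _ => ?_
  rw [nodeProd, ← Finset.mul_prod_erase _ _ (Finset.mem_univ k)]; field_simp [sub_ne_zero.2 (hz k)]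

theorem differentiable_nodeProd : Differentiable ℂ (nodeProd a) := by
  unfold nodeProd; fun_prop

theorem differentiable_nodeField : Differentiable ℂ (nodeField a ρ) := by
  unfold nodeField; fun_prop

theorem ae_ne_nodes : ∀ᵐ z : ℂ, ∀ k, z ≠ a k := by
  rw [ae_all_iff]; intro k; simp [ae_iff]

variable {a ρ}

/-- The total field of a critical measure satisfies a quadratic equation with entire
coefficients. -/
theorem IsCriticalMeasure.exists_entire {μ : SignedMeasure ℂ}
    (hcr : IsCriticalMeasure a ρ μ) {σ : ℂ → ℝ} (hσ : Measurable σ) (hσ1 : ∀ x, |σ x| = 1)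
    (hμ : ∀ f : ℂ → ℝ, ∫ᵛ x, f x ∂•μ = ∫ x, σ x * f x ∂μ.variation) :
    ∃ E : ℂ → ℂ, Differentiable ℂ E ∧ ∀ᵐ z, totalField a ρ μ.variation σ z ^ 2 * nodeProd a z =
      E z + fieldDeriv a ρ z ^ 2 * nodeProd a z := by
  set ν := μ.variation with hν
  obtain ⟨hpt, hE⟩ := hcr.finite_energy
  obtain ⟨M0, hM0⟩ := (isBounded_iff_subset_ball 0).1 hcr.compact_support.isBounded
  have hsupp : ∀ M, M0 ≤ M → ∀ᵐ x ∂ν, ‖x‖ < M := fun M hM => by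
    have : ∀ᵐ x ∂ν, x ∈ ν.support := ν.support_mem_ae
    filter_upwards [this] with x hx
    have := hM0 hx
    rw [mem_ball_zero_iff] at this; linarith
  set C := cauchyTransform ν σ with hC
  have hCl : LocallyIntegrable C := locallyIntegrable_cauchyTransform hσ hσ1
  have hC2 : LocallyIntegrable fun z => C z ^ 2 := fun x => by
    set M := max (max M0 (‖x‖ + 1)) 1 with hM
    refine ⟨ball 0 M, isOpen_ball.mem_nhds ?_,
      integrableOn_ball_cauchyTransform_sq hσ hσ1 hpt hE (by positivity)
        (hsupp M ((le_max_left _ _).trans (le_max_left _ _)))⟩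
    rw [mem_ball_zero_iff]; have := (le_max_right M0 (‖x‖ + 1)).trans (le_max_left _ 1)
    linarith
  have hmul : ∀ {f F : ℂ → ℂ}, Continuous F → LocallyIntegrable f →
      LocallyIntegrable fun z => F z * f z := fun hF hf => by
    rw [← locallyIntegrableOn_univ] at hf ⊢
    exact hf.continuousOn_mul hF.continuousOn isOpen_univ.isLocallyClosed
  have hA := differentiable_nodeProd a
  have hB := differentiable_nodeField a ρ
  have h1 := hmul hA.continuous hC2
  have h2 : LocallyIntegrable fun z => 2 * nodeField a ρ z * C z :=
    hmul (continuous_const.mul hB.continuous) hCl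
  -- With `A = nodeProd a` and `B = nodeField a ρ = A Φ'`, off the nodes `A (C + Φ')² = (A C² + 2 B
  -- C) + A Φ'²`. Weyl's lemma makes the bracket entire; clearing denominators by `A` keeps it
  -- locally integrable at the nodes.
  suffices hweak : ∀ k : ℂ → ℂ, ContDiff ℝ ∞ k → HasCompactSupport k → ∫ z,
      ((fun z => nodeProd a z * C z ^ 2) + fun z => 2 * nodeField a ρ z * C z) z * dbar k z = 0 by
    obtain ⟨E, hE1, hE2⟩ := exists_entire_ae_eq (h1.add h2) hweak; refine ⟨E, hE1, ?_⟩
    filter_upwards [hE2, ae_ne_nodes a] with z hz hza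
    rw [← hz, totalField]; simp only [Pi.add_apply]; rw [nodeField_eq a ρ hza]; ring
  intro k hk hkc; have hk1 : ContDiff ℝ 1 k := hk.of_le (by simp)
  have hAr := (hA.contDiff (n := ∞)).restrict_scalars ℝ
  have hBr := (hB.contDiff (n := ∞)).restrict_scalars ℝ
  -- The factor `nodeProd` makes `h` vanish at every node, so it is an admissible displacement;
  -- being holomorphic, it passes through `dbar`.
  set h : ℂ → ℂ := fun z => nodeProd a z * k z with hh
  have hhs := hAr.mul hk
  have hhc : HasCompactSupport h := hkc.mul_left
  have hd := continuous_dbar hk1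
  have hi : ∀ {f : ℂ → ℂ}, LocallyIntegrable f → Integrable fun z => f z * dbar k z :=
    fun hf => integrable_mul_of_locallyIntegrable hf hd (hasCompactSupport_dbar hkc)
  have ha0 : ∀ j, h (a j) = 0 := fun j => by
    simp only [hh, nodeProd]; rw [Finset.prod_eq_zero (Finset.mem_univ j) (sub_self _), zero_mul]
  obtain ⟨M1, hM1⟩ := (isBounded_iff_subset_ball 0).1 hhc.isCompact.isBounded
  set M := max (max M0 M1) 1 with hM
  have e1 := integral_cauchyTransform_sq_mul_dbar hσ hσ1 hpt hE (M := M) (by positivity)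
    (hsupp M ((le_max_left _ _).trans (le_max_left _ _))) (hhs.of_le (by simp)) hhc
    (hM1.trans (ball_subset_ball ((le_max_right _ _).trans (le_max_left _ _))))
  rw [hcr.integral_eq hσ hσ1 hμ hhs hhc ha0] at e1
  have e2 := integral_cauchyTransform_mul_dbar (ν := ν) hσ hσ1
    ((hBr.of_le (by simp)).mul hk1) (hkc.mul_left (f := nodeField a ρ))
  have e3 : ∫ x, (σ x : ℂ) * (fieldDeriv a ρ x * h x) ∂ν =
      ∫ x, (σ x : ℂ) * (nodeField a ρ x * k x) ∂ν := by
    refine integral_congr_ae ?_; have : ∀ᵐ x ∂ν, ∀ j, x ≠ a j := by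
      rw [ae_all_iff]; intro j; rw [ae_iff]; simpa using hpt (a j)
    filter_upwards [this] with x hx
    rw [nodeField_eq a ρ hx, hh]; ring
  have hkd := hk1.differentiable one_ne_zero
  simp only [Pi.add_apply, add_mul]; rw [integral_add (hi h1) (hi h2)]
  have e4 : ∀ z, nodeProd a z * C z ^ 2 * dbar k z = C z ^ 2 * dbar h z := fun z => by
    rw [hh, dbar_mul_of_differentiableAt (hA z) (hkd z)]; ring
  have e5 : ∀ z, 2 * nodeField a ρ z * C z * dbar k z =
      2 * (C z * dbar (fun z => nodeField a ρ z * k z) z) := fun z => by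
    rw [dbar_mul_of_differentiableAt (hB z) (hkd z)]; ring
  simp only [e4, e5]; rw [integral_const_mul]; rw [e1, e3]; have e2' := e2
  rw [e2']; ring

end

end

section

theorem ae_re_ne_zero : ∀ᵐ u : ℂ, u.re ≠ 0 :=
  volume_preserving_equiv_real_prod.quasiMeasurePreserving.ae
    (p := fun q : ℝ × ℝ => q.1 ≠ 0)
    ((Measure.quasiMeasurePreserving_fst (μ := (volume : Measure ℝ))
      (ν := (volume : Measure ℝ))).ae (p := fun x => x ≠ 0) (by simp [ae_iff]))

/-! ### Domination of measures by duality -/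

theorem exists_smooth_bump {K U : Set ℂ} (hK : IsCompact K) (hU : IsOpen U) (hKU : K ⊆ U) :
    ∃ χ : ℂ → ℝ, ContDiff ℝ ∞ χ ∧ HasCompactSupport χ ∧ tsupport χ ⊆ U ∧
      (∀ x, χ x ∈ Icc (0:ℝ) 1) ∧ ∀ x ∈ K, χ x = 1 := by
  obtain ⟨L, hL, hKL, hLU⟩ := exists_compact_between hK hU hKU
  obtain ⟨f, hf, hr, hs, h1⟩ := exists_contMDiff_support_eq_eq_one_iff (n := (⊤ : ℕ∞))
    (modelWithCornersSelf ℝ ℂ) isOpen_interior hK.isClosed hKL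
  have ht : tsupport f ⊆ L := by
    rw [tsupport, hs]; exact closure_minimal interior_subset hL.isClosed
  exact ⟨f, hf.contDiff, hL.of_isClosed_subset (isClosed_tsupport f) ht, ht.trans hLU,
    fun x => hr (mem_range_self x), fun x hx => (h1 x).1 hx⟩

/-- On a compact set where `τ` is constant, smooth bumps that shrink to the set make the signed
integral approach `± M K`, while the right-hand side approaches `lam K`. Inner regularity passes to
measurable sets on which `τ` is constant, and a general set is split by the value of `τ`. -/
theorem measure_le_of_abs_integral_le {M lam : Measure ℂ} [IsFiniteMeasure M] [IsFiniteMeasure lam]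
    {τ : ℂ → ℝ} (hτ : Measurable τ) (hτ1 : ∀ x, τ x = 1 ∨ τ x = -1) {Q : Set ℂ} (hQ : IsOpen Q)
    (h : ∀ χ : ℂ → ℝ, ContDiff ℝ ∞ χ → HasCompactSupport χ → tsupport χ ⊆ Q →
      |∫ x, τ x * χ x ∂M| ≤ ∫ x, |χ x| ∂lam) {S : Set ℂ} (hS : MeasurableSet S) (hSQ : S ⊆ Q) :
    M S ≤ lam S := by
  have hcomp : ∀ e : ℝ, |e| = 1 → ∀ K : Set ℂ, IsCompact K → K ⊆ Q → (∀ x ∈ K, τ x = e) →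
      M K ≤ lam K := by
    intro e he K hK hKQ hKe; refine ENNReal.le_of_forall_pos_le_add fun ε hε _ => ?_
    have hε2 : (ENNReal.ofNNReal (ε / 2)) ≠ 0 := by
      simpa using hε.ne'
    obtain ⟨V1, hV1, hV1o, hV1l⟩ := K.exists_isOpen_le_add lam hε2
    obtain ⟨V2, hV2, hV2o, hV2l⟩ := K.exists_isOpen_le_add M hε2; set V := V1 ∩ V2 ∩ Q with hV
    have hVo : IsOpen V := (hV1o.inter hV2o).inter hQ
    obtain ⟨χ, h1, h2, h3, h4, h5⟩ := exists_smooth_bump hK hVo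
      (subset_inter (subset_inter hV1 hV2) hKQ)
    have hχ0 : ∀ x, x ∉ V → χ x = 0 := fun x hx =>
      image_eq_zero_of_notMem_tsupport fun h => hx (h3 h)
    have hb := h χ h1 h2 (h3.trans inter_subset_right)
    have hχm : Continuous χ := h1.continuous
    have hτχ : Integrable (fun x => τ x * χ x) M := by
      refine Integrable.of_bound (hτ.mul hχm.measurable).aestronglyMeasurable 1 (ae_of_all _ fun x => ?_)
      rw [norm_mul, norm_eq_abs, norm_eq_abs, abs_of_nonneg (h4 x).1]
      rcases hτ1 x with h | h <;> simp [h, (h4 x).2]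
    have hr1 : ∫ x, |χ x| ∂lam ≤ lam.real V := by
      calc ∫ x, |χ x| ∂lam ≤ ∫ x, V.indicator 1 x ∂lam := by
            refine integral_mono ?_ ((integrable_const (1:ℝ)).indicator hVo.measurableSet) fun x => ?_
            · refine Integrable.of_bound hχm.abs.aestronglyMeasurable 1 (ae_of_all _ fun x => ?_)
              simpa [abs_of_nonneg (h4 x).1] using (h4 x).2
            · by_cases hx : x ∈ V
              · simpa [hx, abs_of_nonneg (h4 x).1] using (h4 x).2
              · simp [hx, hχ0 x hx]
        _ = lam.real V := by rw [integral_indicator_one hVo.measurableSet]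
    have hKm := hK.measurableSet
    have hr2 : |∫ x, τ x * χ x ∂M - e * M.real K| ≤ M.real (V \ K) := by
      have e1 : e * M.real K = ∫ x, K.indicator (fun _ => e) x ∂M := by
        rw [integral_indicator_const _ hKm, smul_eq_mul, mul_comm]
      rw [e1, ← integral_sub hτχ ((integrable_const e).indicator hKm)]
      refine (abs_integral_le_integral_abs).trans ?_
      rw [← integral_indicator_one (hVo.measurableSet.diff hKm)]
      refine integral_mono (hτχ.sub ((integrable_const e).indicator hKm)).abs
        ((integrable_const (1:ℝ)).indicator (hVo.measurableSet.diff hKm)) fun x => ?_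
      by_cases hxK : x ∈ K
      · simp [hxK, h5 x hxK, hKe x hxK]
      · by_cases hxV : x ∈ V
        · simp only [hxK, not_false_eq_true, indicator_of_notMem, sub_zero, abs_mul,
            abs_of_nonneg (h4 x).1, Set.mem_sdiff, hxV, and_self, indicator_of_mem, Pi.one_apply]
          rcases hτ1 x with h | h <;> simp [h, (h4 x).2]
        · simp [hxK, hxV, hχ0 x hxV]
    have hKV := subset_inter (subset_inter hV1 hV2) hKQ
    have hr3 : M.real (V \ K) ≤ ε / 2 := by
      rw [measureReal_def, measure_sdiff hKV hKm.nullMeasurableSet (measure_ne_top _ _)]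
      refine toReal_le_of_le_ofReal (by positivity) ?_
      rw [tsub_le_iff_left, show ennr ((ε:ℝ) / 2) = (ENNReal.ofNNReal (ε / 2)) by
        rw [← NNReal.coe_two, ← NNReal.coe_div, ofReal_coe_nnreal]]
      exact (measure_mono (inter_subset_left.trans inter_subset_right)).trans hV2l
    have hr4 : lam.real V ≤ lam.real K + ε / 2 := by
      have : lam V ≤ lam K + (ENNReal.ofNNReal (ε / 2)) :=
        (measure_mono (inter_subset_left.trans inter_subset_left)).trans hV1l
      have h6 := ENNReal.toReal_mono (by finiteness) this
      rw [ENNReal.toReal_add (by finiteness) (by finiteness)] at h6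
      simpa [measureReal_def] using h6
    have hfin : M.real K ≤ lam.real K + ε := by
      have : |e * M.real K| = M.real K := by rw [abs_mul, he, one_mul, abs_of_nonneg (by positivity)]
      have h7 : |e * M.real K| ≤ |∫ x, τ x * χ x ∂M| + |∫ x, τ x * χ x ∂M - e * M.real K| := by
        have := abs_sub_abs_le_abs_sub (e * M.real K) (∫ x, τ x * χ x ∂M)
        rw [abs_sub_comm] at this; linarith
      linarith
    rw [← ENNReal.toReal_le_toReal (by finiteness) (by finiteness),
      ENNReal.toReal_add (by finiteness) (by finiteness)]
    simpa [measureReal_def] using hfin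
  have hmeas : ∀ e : ℝ, |e| = 1 → ∀ S : Set ℂ, MeasurableSet S → S ⊆ Q → (∀ x ∈ S, τ x = e) →
      M S ≤ lam S := by
    intro e he S hS hSQ hSe; refine le_of_forall_lt fun r hr => ?_
    obtain ⟨K, hKS, hK, hrK⟩ := hS.exists_lt_isCompact hr
    exact hrK.trans_le ((hcomp e he K hK (hKS.trans hSQ) fun x hx => hSe x (hKS hx)).trans
      (measure_mono hKS))
  have hT := hτ (measurableSet_singleton 1)
  rw [← measure_inter_add_sdiff S hT, ← measure_inter_add_sdiff (μ := lam) S hT]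
  refine add_le_add (hmeas 1 abs_one _ (hS.inter hT) (inter_subset_left.trans hSQ) fun x hx => hx.2)
    (hmeas (-1) (by simp) _ (hS.diff hT) (sdiff_subset.trans hSQ) fun x hx => ?_)
  exact (hτ1 x).resolve_left hx.2

/-! ### Flat systems -/

/-- The open rectangle `(a, b) × (c, d)`. -/
def openBox (a b c d : ℝ) : Set ℂ := {z | a < z.re ∧ z.re < b ∧ c < z.im ∧ z.im < d}

theorem isOpen_openBox (a b c d : ℝ) : IsOpen (openBox a b c d) := by
  unfold openBox; simp only [ofPred_and]; exact (isOpen_lt continuous_const continuous_re).inter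
    ((isOpen_lt continuous_re continuous_const).inter
    ((isOpen_lt continuous_const continuous_im).inter
    (isOpen_lt continuous_im continuous_const)))

/-- `s = ± 1` on `Q` is the complex gradient of a potential of the measure `τ M`. -/
structure IsFlatSystem (Q : Set ℂ) (s τ : ℂ → ℝ) (M : Measure ℂ) : Prop where
  isOpen : IsOpen Q
  aestronglyMeasurable : AEStronglyMeasurable s
  abs_le_one : ∀ u, |s u| ≤ 1
  eq_or_eq : ∀ᵐ u, u ∈ Q → s u = 1 ∨ s u = -1
  measurable : Measurable τ
  sign_eq : ∀ u, τ u = 1 ∨ τ u = -1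
  integral_re : ∀ χ : ℂ → ℝ, ContDiff ℝ ∞ χ → HasCompactSupport χ → tsupport χ ⊆ Q →
    ∫ u, s u * fderiv ℝ χ u 1 = 2 * π * ∫ u, τ u * χ u ∂M
  integral_im : ∀ χ : ℂ → ℝ, ContDiff ℝ ∞ χ → HasCompactSupport χ → tsupport χ ⊆ Q →
    ∫ u, s u * fderiv ℝ χ u I = 0

namespace IsFlatSystem

variable {Q : Set ℂ} {s τ : ℂ → ℝ} {M : Measure ℂ}

theorem mono (h : IsFlatSystem Q s τ M) {Q' : Set ℂ} (hQ' : IsOpen Q') (hQ : Q' ⊆ Q) :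
    IsFlatSystem Q' s τ M where
  isOpen := hQ'
  aestronglyMeasurable := h.aestronglyMeasurable
  abs_le_one := h.abs_le_one
  eq_or_eq := h.eq_or_eq.mono fun _ hx hx' => hx (hQ hx')
  measurable := h.measurable
  sign_eq := h.sign_eq
  integral_re χ h1 h2 h3 := h.integral_re χ h1 h2 (h3.trans hQ)
  integral_im χ h1 h2 h3 := h.integral_im χ h1 h2 (h3.trans hQ)

theorem locallyIntegrable (h : IsFlatSystem Q s τ M) : LocallyIntegrable s := fun x =>
  ⟨ball x 1, ball_mem_nhds x one_pos,
    Measure.integrableOn_of_bounded (M := 1) isBounded_ball.measure_lt_top.ne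
      h.aestronglyMeasurable (ae_of_all _ fun x => h.abs_le_one x)⟩

/-- Two-sided constant values on both sides of the imaginary axis give the density of the measure
on the axis. -/
theorem integral_eq_jump (h : IsFlatSystem Q s τ M) {e₁ e₂ : ℝ}
    (h1 : ∀ᵐ u : ℂ, u ∈ Q → u.re < 0 → s u = e₁) (h2 : ∀ᵐ u : ℂ, u ∈ Q → 0 < u.re → s u = e₂)
    {χ : ℂ → ℝ} (hχ : ContDiff ℝ ∞ χ) (hc : HasCompactSupport χ) (hQ : tsupport χ ⊆ Q) :
    2 * π * ∫ u, τ u * χ u ∂M = (e₁ - e₂) * ∫ η : ℝ, χ (η * I) := by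
  rw [← h.integral_re χ hχ hc hQ]; have hχ1 : ContDiff ℝ 1 χ := hχ.of_le (by simp)
  have hfc : Continuous fun u => fderiv ℝ χ u 1 :=
    (hχ1.continuous_fderiv one_ne_zero).clm_apply continuous_const
  have hfs := (hc.fderiv ℝ).comp_left (g := fun L : ℂ →L[ℝ] ℝ => L 1) rfl
  have hfi : Integrable fun u => fderiv ℝ χ u 1 := hfc.integrable_of_hasCompactSupport hfs
  have heq : ∀ᵐ u : ℂ, s u * fderiv ℝ χ u 1 =
      (if u.re < 0 then e₁ else e₂) * fderiv ℝ χ u 1 := by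
    filter_upwards [h1, h2, ae_re_ne_zero] with u z1 z2 z3
    by_cases hu : u ∈ tsupport χ
    · rcases lt_or_gt_of_ne z3 with h | h
      · rw [z1 (hQ hu) h, if_pos h]
      · rw [z2 (hQ hu) h, if_neg h.not_gt]
    · rw [fderiv_of_notMem_tsupport ℝ hu]; simp
  rw [integral_congr_ae heq]
  set f : ℝ × ℝ → ℝ := fun q => (if q.1 < 0 then e₁ else e₂) * fderiv ℝ χ (q.1 + q.2 * I) 1
    with hf
  have hsym : ∀ q : ℝ × ℝ, measurableEquivRealProd.symm q = q.1 + q.2 * I :=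
    fun q => mk_eq_add_mul_I _ _
  have hfint : Integrable f (volume.prod volume) := by
    have hb : Integrable fun u : ℂ => (if u.re < 0 then e₁ else e₂) * fderiv ℝ χ u 1 := by
      refine hfi.bdd_mul (c := max |e₁| |e₂|) ?_ (ae_of_all _ fun u => ?_)
      · exact (Measurable.ite (measurableSet_lt measurable_re measurable_const)
          measurable_const measurable_const).aestronglyMeasurable
      · split_ifs <;> simp
    have := (volume_preserving_equiv_real_prod.symm _).integrable_comp_emb
      (MeasurableEquiv.measurableEmbedding _) |>.2 hb
    refine this.congr (ae_of_all _ fun q => ?_)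
    simp [hf, hsym]
  have hcov : ∫ u : ℂ, (if u.re < 0 then e₁ else e₂) * fderiv ℝ χ u 1 =
      ∫ q, f q ∂(volume.prod volume) := by
    rw [← (volume_preserving_equiv_real_prod.symm _).integral_comp
      (MeasurableEquiv.measurableEmbedding _)]
    refine integral_congr_ae (ae_of_all _ fun q => ?_)
    simp [hf, hsym]
  rw [hcov, integral_prod_symm _ hfint, ← integral_const_mul]; congr 1; ext y
  set k : ℝ → ℝ := fun x => χ (x + y * I) with hk
  have hcl := (Homeomorph.addRight (y * I)).isClosedEmbedding.comp isometry_ofReal.isClosedEmbedding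
  have hkd : ContDiff ℝ 1 k := hχ1.comp
    (ofRealCLM.contDiff.add contDiff_const)
  have hkc := hc.comp_isClosedEmbedding hcl
  have hkder : ∀ x, deriv k x = fderiv ℝ χ (x + y * I) 1 := fun x => by
    have h3 : HasDerivAt (fun x : ℝ => (x:ℂ) + y * I) 1 x :=
      (ofRealCLM.hasDerivAt (x := x)).add_const _
    exact ((hχ1.differentiable one_ne_zero _).hasFDerivAt.comp_hasDerivAt x h3).deriv
  have hki : Integrable (deriv k) := (hkd.continuous_deriv le_rfl).integrable_of_hasCompactSupport
    hkc.deriv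
  simp only [hf, ← hkder]
  have hi : Integrable fun x => (if x < 0 then e₁ else e₂) * deriv k x := by
    refine hki.bdd_mul (c := max |e₁| |e₂|) ?_ (ae_of_all _ fun u => ?_)
    · exact (Measurable.ite measurableSet_Iio measurable_const measurable_const).aestronglyMeasurable
    · split_ifs <;> simp
  -- On each horizontal line the left half contributes `e₁ χ` and the right half `-e₂ χ`, both
  -- evaluated on the axis.
  rw [← integral_add_compl (measurableSet_Iic (a := (0:ℝ))) hi, compl_Iic,
    integral_Iic_eq_integral_Iio]
  rw [setIntegral_congr_fun (g := fun x => e₁ * deriv k x) measurableSet_Iio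
      (fun x hx => by simp only [mem_Iio] at hx; simp [hx]),
    setIntegral_congr_fun (g := fun x => e₂ * deriv k x) measurableSet_Ioi
      (fun x hx => by simp only [mem_Ioi] at hx; simp [hx.le])]
  rw [integral_const_mul, integral_const_mul, ← integral_Iic_eq_integral_Iio,
    hkc.integral_Iic_deriv_eq hkd, hkc.integral_Ioi_deriv_eq hkd]
  simp only [hk]; push_cast; ring_nf

/-- The jump formula with equal values on the two sides: without a jump there is no mass. -/
theorem measure_eq_zero_of_ae_eq [IsFiniteMeasure M] (h : IsFlatSystem Q s τ M) {e : ℝ}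
    (h1 : ∀ᵐ u : ℂ, u ∈ Q → s u = e) : M Q = 0 := by
  have := measure_le_of_abs_integral_le (lam := 0) (M := M) h.measurable h.sign_eq h.isOpen
    (fun χ hχ hc hQ => ?_) h.isOpen.measurableSet le_rfl
  · simpa using this
  have h2 := h.integral_eq_jump (e₁ := e) (e₂ := e) (h1.mono fun _ a b _ => a b)
    (h1.mono fun _ a b _ => a b) hχ hc hQ
  have : ∫ u, τ u * χ u ∂M = 0 := by
    have hp := pi_pos
    rw [sub_self, zero_mul] at h2; exact (mul_eq_zero.1 h2).resolve_left (by positivity)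
  simp [this]

/-- The length measure on the segment `i (c, d)` of the imaginary axis. -/
def _root_.axisMeasure (c d : ℝ) : Measure ℂ :=
  (volume.restrict (Ioo c d)).map fun η : ℝ => (η * I : ℂ)

instance _root_.isFiniteMeasure_axisMeasure (c d : ℝ) : IsFiniteMeasure (axisMeasure c d) := by
  unfold axisMeasure; infer_instance

/-- The jump is at most 2, so the jump formula bounds the signed integrals by `2/(2π) ≤ 1` times the
length integral of `|χ|`; duality turns this into an inequality of measures. -/
theorem measure_le_axisMeasure [IsFiniteMeasure M] {a b c d : ℝ}
    (h : IsFlatSystem (openBox a b c d) s τ M) {e₁ e₂ : ℝ} (he₁ : |e₁| ≤ 1) (he₂ : |e₂| ≤ 1)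
    (h1 : ∀ᵐ u : ℂ, u ∈ openBox a b c d → u.re < 0 → s u = e₁)
    (h2 : ∀ᵐ u : ℂ, u ∈ openBox a b c d → 0 < u.re → s u = e₂)
    {S : Set ℂ} (hS : MeasurableSet S) (hSQ : S ⊆ openBox a b c d) :
    M S ≤ axisMeasure c d S := by
  refine measure_le_of_abs_integral_le h.measurable h.sign_eq h.isOpen
    (fun χ hχ hc hQ => ?_) hS hSQ
  have h2 := h.integral_eq_jump h1 h2 hχ hc hQ
  have h3 : ∫ x, |χ x| ∂axisMeasure c d = ∫ η : ℝ, |χ (η * I)| := by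
    rw [axisMeasure, integral_map (by fun_prop) hχ.continuous.abs.aestronglyMeasurable]
    refine setIntegral_eq_integral_of_forall_compl_eq_zero fun η hη => ?_
    rw [image_eq_zero_of_notMem_tsupport (f := χ), abs_zero]; intro h0
    exact hη (by simpa [openBox] using (hQ h0).2.2)
  rw [h3]; have h4 : |∫ η : ℝ, χ (η * I)| ≤ ∫ η : ℝ, |χ (η * I)| :=
    abs_integral_le_integral_abs
  have hp := pi_gt_three
  have h5 : 2 * π * |∫ u, τ u * χ u ∂M| = |e₁ - e₂| * |∫ η : ℝ, χ (η * I)| := by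
    rw [← abs_mul, ← h2, abs_mul, abs_of_pos (by positivity : (0:ℝ) < 2 * π)]
  have h6 : |e₁ - e₂| ≤ 2 := (abs_sub _ _).trans (by linarith)
  have h7 := mul_le_mul h6 h4 (abs_nonneg _) (by norm_num)
  nlinarith [abs_nonneg (∫ u, τ u * χ u ∂M)]

end IsFlatSystem

end

/-! ### Rigidity of flat systems of small mass -/

section

namespace IsFlatSystem

variable {s τ : ℂ → ℝ} {M : Measure ℂ} {a b c d : ℝ}

/-- Both statements are the weak equations tested against a translate of the bump; the box is shrunk
by the radius of the bump so that the translate is supported in the original box. -/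
theorem fderiv_convolution [IsFiniteMeasure M] (h : IsFlatSystem (openBox a b c d) s τ M)
    (φ : ContDiffBump (0 : ℂ)) {p : ℂ}
    (hp : p ∈ openBox (a + φ.rOut) (b - φ.rOut) (c + φ.rOut) (d - φ.rOut)) :
    fderiv ℝ (s ⋆[.mul ℝ ℝ, volume] φ.normed volume) p I = 0 ∧
    ‖fderiv ℝ (s ⋆[.mul ℝ ℝ, volume] φ.normed volume) p 1‖ₑ ≤
      ennr (2 * π) * ∫⁻ t in openBox a b c d, ‖φ.normed volume (p - t)‖ₑ ∂M := by
  set Φ := φ.normed volume with hΦ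
  have hs : ContDiff ℝ ∞ Φ := φ.contDiff_normed
  have hs1 : ContDiff ℝ 1 Φ := hs.of_le (by simp)
  have hc : HasCompactSupport Φ := φ.hasCompactSupport_normed
  obtain ⟨L, hL, hLv⟩ := hasFDerivAt_convolution_mul h.locallyIntegrable hs1 hc p
  set χ : ℂ → ℝ := fun t => Φ (p - t) with hχ
  have hχs : ContDiff ℝ ∞ χ := hs.comp (contDiff_const.sub contDiff_id)
  have hχc := hc.comp_homeomorph (Homeomorph.subLeft p)
  have hχt : tsupport χ ⊆ openBox a b c d := by
    intro t ht; have h1 : p - t ∈ tsupport Φ := tsupport_comp_subset_preimage Φ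
      (f := fun t => p - t) (by fun_prop) ht
    rw [hΦ, φ.tsupport_normed_eq, mem_closedBall_zero_iff] at h1
    have h2 := (abs_re_le_norm (p - t)).trans h1
    have h3 := (abs_im_le_norm (p - t)).trans h1
    rw [sub_re, abs_le] at h2; rw [sub_im, abs_le] at h3; obtain ⟨p1, p2, p3, p4⟩ := hp
    exact ⟨by linarith, by linarith, by linarith, by linarith⟩
  have hχf : ∀ t v, fderiv ℝ χ t v = - fderiv ℝ Φ (p - t) v := fun t v => by
    have h1 : HasFDerivAt χ ((fderiv ℝ Φ (p - t)).comp (-(ContinuousLinearMap.id ℝ ℂ))) t :=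
      (hs1.differentiable one_ne_zero (p - t)).hasFDerivAt.comp t ((hasFDerivAt_id t).const_sub p)
    simp only [h1.fderiv, ContinuousLinearMap.comp_apply, neg_apply,
      ContinuousLinearMap.id_apply, map_neg]
  have hLχ : ∀ v, L v = - ∫ t, s t * fderiv ℝ χ t v := fun v => by
    rw [hLv, ← integral_neg]; congr 1; ext t; rw [hχf]; ring
  rw [hL.fderiv]; refine ⟨by rw [hLχ, h.integral_im χ hχs hχc hχt, neg_zero], ?_⟩
  rw [hLχ, h.integral_re χ hχs hχc hχt, enorm_neg, enorm_mul,
    enorm_of_nonneg (by positivity)]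
  gcongr
  rw [← setIntegral_eq_integral_of_forall_compl_eq_zero (s := openBox a b c d) fun t ht => by
    rw [image_eq_zero_of_notMem_tsupport (f := χ) fun h => ht (hχt h), mul_zero]]
  refine (enorm_integral_le_lintegral_enorm _).trans (lintegral_mono fun t => ?_)
  rw [enorm_mul]; rcases h.sign_eq t with h | h <;> simp [h, hχ]

/-- The mollified sign does not depend on `Im` inside the shrunken box, so its increment from `p` to
`q` can be taken along any horizontal line. Integrating over all admissible heights, an interval of
length `d - c - 2r`, replaces the line integral of the smoothed mass by the total mass. -/
theorem convolution_sub_le [IsFiniteMeasure M] (h : IsFlatSystem (openBox a b c d) s τ M)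
    (φ : ContDiffBump (0 : ℂ)) {p q : ℂ}
    (hp : p ∈ openBox (a + φ.rOut) (b - φ.rOut) (c + φ.rOut) (d - φ.rOut))
    (hq : q ∈ openBox (a + φ.rOut) (b - φ.rOut) (c + φ.rOut) (d - φ.rOut)) (hpq : p.re ≤ q.re) :
    (d - c - 2 * φ.rOut) * |(s ⋆[.mul ℝ ℝ, volume] φ.normed volume) q -
      (s ⋆[.mul ℝ ℝ, volume] φ.normed volume) p| ≤
      2 * π * M.real (openBox a b c d) := by
  set Φ := φ.normed volume with hΦ
  set r := φ.rOut with hr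
  have hs : ContDiff ℝ ∞ Φ := φ.contDiff_normed
  have hs1 : ContDiff ℝ 1 Φ := hs.of_le (by simp)
  have hc : HasCompactSupport Φ := φ.hasCompactSupport_normed
  set F : ℂ → ℝ := s ⋆[.mul ℝ ℝ, volume] Φ with hF
  have hFs : ContDiff ℝ 1 F := hc.contDiff_convolution_right _ h.locallyIntegrable hs1
  have hFd := hFs.differentiable one_ne_zero
  have hH := fun p hp => h.fderiv_convolution φ (p := p) hp
  set H : ℂ → ℝ≥0∞ := fun p => ∫⁻ t in openBox a b c d, ‖Φ (p - t)‖ₑ ∂M with hHdef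
  have hcH : ∀ x y : ℝ, HasDerivAt (fun x : ℝ => F (x + y * I))
      (fderiv ℝ F (x + y * I) 1) x := fun x y => by
    have h3 : HasDerivAt (fun x : ℝ => (x:ℂ) + y * I) 1 x :=
      (ofRealCLM.hasDerivAt (x := x)).add_const _
    exact (hFd _).hasFDerivAt.comp_hasDerivAt x h3
  have hcV : ∀ x y : ℝ, HasDerivAt (fun y : ℝ => F (x + y * I))
      (fderiv ℝ F (x + y * I) I) y := fun x y => by
    have h3 : HasDerivAt (fun y : ℝ => (x:ℂ) + y * I) I y := by
      have := ((ofRealCLM.hasDerivAt (x := y)).mul_const I).const_add (x:ℂ)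
      simpa using this
    exact (hFd _).hasFDerivAt.comp_hasDerivAt y h3
  have hconst : ∀ x ∈ Ioo (a + r) (b - r), ∀ y ∈ Ioo (c + r) (d - r), ∀ y' ∈ Ioo (c + r) (d - r),
      F (x + y * I) = F (x + y' * I) := by
    intro x hx y hy y' hy'
    refine isOpen_Ioo.is_const_of_deriv_eq_zero (f := fun y : ℝ => F (x + y * I))
      isPreconnected_Ioo (fun y _ => (hcV x y).differentiableAt.differentiableWithinAt)
      (fun y hy => ?_) hy hy'
    rw [(hcV x y).deriv]
    exact (hH _ ⟨by simpa using hx.1, by simpa using hx.2, by simpa using hy.1,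
      by simpa using hy.2⟩).1
  have hp' : F p = F (p.re + p.im * I) := by rw [re_add_im]
  have hq' : F q = F (q.re + q.im * I) := by rw [re_add_im]
  have hstep : ∀ y ∈ Ioo (c + r) (d - r), ‖F q - F p‖ₑ ≤
      ∫⁻ x : ℝ, ennr (2 * π) * H (x + y * I) := by
    intro y hy; rw [hp', hq', hconst p.re ⟨hp.1, hp.2.1⟩ p.im ⟨hp.2.2.1, hp.2.2.2⟩ y hy,
      hconst q.re ⟨hq.1, hq.2.1⟩ q.im ⟨hq.2.2.1, hq.2.2.2⟩ y hy,
      ← intervalIntegral.integral_eq_sub_of_hasDerivAt (fun x _ => hcH x y)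
        (Continuous.intervalIntegrable (by
          have := hFs.continuous_fderiv one_ne_zero
          fun_prop) _ _), intervalIntegral.integral_of_le hpq]
    refine (enorm_integral_le_lintegral_enorm _).trans ?_
    refine (setLIntegral_mono' measurableSet_Ioc fun x hx => (hH _ ?_).2).trans
      (setLIntegral_le_lintegral _ _)
    have h1 := hp.1; have h2 := hq.2.1
    exact ⟨by simpa using h1.trans hx.1, by simpa using hx.2.trans_lt h2, by simpa using hy.1,
      by simpa using hy.2⟩
  have hΦm := hs.continuous.measurable
  have hHm : Measurable H := by
    refine Measurable.lintegral_prod_right' (f := fun q : ℂ × ℂ => ‖Φ (q.1 - q.2)‖ₑ) ?_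
    fun_prop
  have hΦ1 : ∫⁻ p, ‖Φ p‖ₑ = 1 := by
    rw [← ofReal_integral_norm_eq_lintegral_enorm φ.integrable_normed]
    simp only [norm_of_nonneg (φ.nonneg_normed _)]; rw [φ.integral_normed]; simp
  have hHi : ∫⁻ p, H p = M (openBox a b c d) := by
    simp only [hHdef]; rw [lintegral_lintegral_swap (by fun_prop)]
    have : ∀ t, ∫⁻ p, ‖Φ (p - t)‖ₑ = 1 := fun t => by
      rw [lintegral_sub_right_eq_self (fun p => ‖Φ p‖ₑ) t, hΦ1]
    simp [this]
  have hHi2 : ∫⁻ y : ℝ, ∫⁻ x : ℝ, H (x + y * I) = M (openBox a b c d) := by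
    rw [← hHi, ← (volume_preserving_equiv_real_prod.symm _).lintegral_comp_emb
      (MeasurableEquiv.measurableEmbedding _), Measure.volume_eq_prod,
      lintegral_prod_symm (fun q => H (measurableEquivRealProd.symm q))
        ((hHm.comp (MeasurableEquiv.measurable _)).aemeasurable)]
    refine lintegral_congr fun y => lintegral_congr fun x => ?_
    congr 1; exact (mk_eq_add_mul_I _ _).symm
  have hfin : ennr (d - c - 2 * r) * ‖F q - F p‖ₑ ≤
      ennr (2 * π) * M (openBox a b c d) := by
    calc ennr (d - c - 2 * r) * ‖F q - F p‖ₑ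
        = ∫⁻ y in Ioo (c + r) (d - r), ‖F q - F p‖ₑ := by
          rw [setLIntegral_const, volume_Ioo, mul_comm]; ring_nf
      _ ≤ ∫⁻ y in Ioo (c + r) (d - r), ∫⁻ x : ℝ, ennr (2 * π) *
            H (x + y * I) := setLIntegral_mono' measurableSet_Ioo hstep
      _ ≤ ∫⁻ y : ℝ, ∫⁻ x : ℝ, ennr (2 * π) * H (x + y * I) :=
          setLIntegral_le_lintegral _ _
      _ = _ := by
          have hm : ∀ y : ℝ, Measurable fun x : ℝ => H (x + y * I) := fun y => by fun_prop
          simp only [lintegral_const_mul' _ _ ofReal_ne_top]; rw [hHi2]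
  have hdc : 0 ≤ d - c - 2 * r := by
    have := hp.2.2.1.trans hp.2.2.2; linarith
  have h9 := ENNReal.toReal_mono (by finiteness) hfin
  rw [ENNReal.toReal_mul, ENNReal.toReal_mul, ENNReal.toReal_ofReal hdc,
    ENNReal.toReal_ofReal (by positivity), toReal_enorm, norm_eq_abs] at h9
  exact h9

/-- A flat system with a small measure has a constant sign. -/
theorem ae_const [IsFiniteMeasure M] (h : IsFlatSystem (openBox a b c d) s τ M)
    (hM : π * M.real (openBox a b c d) < d - c) :
    ∃ e : ℝ, (e = 1 ∨ e = -1) ∧ ∀ᵐ x : ℂ, x ∈ openBox a b c d → s x = e := by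
  obtain ⟨φ, hφ0, hφ2⟩ := exists_contDiffBump_seq
  set G : ℕ → ℂ → ℝ := fun n => s ⋆[.mul ℝ ℝ, volume] (φ n).normed volume
  have hlim := ContDiffBump.ae_convolution_tendsto_right_of_locallyIntegrable (K := 2) hφ0
    (Eventually.of_forall hφ2) h.locallyIntegrable
  have hlim' : ∀ᵐ x, Tendsto (fun n => G n x) atTop (𝓝 (s x)) := by
    filter_upwards [hlim] with x hx
    refine hx.congr fun n => ?_
    simp only [G]; rw [convolution_lsmul_swap, convolution_def]; congr 1; ext t; simp [mul_comm]
  have hsh : ∀ p ∈ openBox a b c d, ∀ᶠ n in atTop, p ∈ openBox (a + (φ n).rOut) (b - (φ n).rOut)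
      (c + (φ n).rOut) (d - (φ n).rOut) := by
    rintro p ⟨h1, h2, h3, h4⟩
    have e : ∀ u v : ℝ, u < v → ∀ᶠ n in atTop, (φ n).rOut < v - u := fun u v huv =>
      hφ0.eventually (gt_mem_nhds (by linarith))
    filter_upwards [e _ _ h1, e _ _ h2, e _ _ h3, e _ _ h4] with n n1 n2 n3 n4
    exact ⟨by linarith, by linarith, by linarith, by linarith⟩
  -- In the limit `(d - c) |s q - s p| ≤ 2π M`, which is less than `2 (d - c)` by the smallness
  -- assumption. Two values of `±1` at distance less than 2 are equal.
  have key : ∀ p q : ℂ, p ∈ openBox a b c d → q ∈ openBox a b c d →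
      Tendsto (fun n => G n p) atTop (𝓝 (s p)) →
      Tendsto (fun n => G n q) atTop (𝓝 (s q)) → p.re ≤ q.re →
      |s q - s p| < 2 := by
    intro p q hp hq h1 h2 hpq
    have h3 : (d - c) * |s q - s p| ≤ 2 * π * M.real (openBox a b c d) := by
      have h4 : Tendsto (fun n => (d - c - 2 * (φ n).rOut) *
          |G n q - G n p|) atTop
          (𝓝 ((d - c - 2 * 0) * |s q - s p|)) :=
        (tendsto_const_nhds.sub (hφ0.const_mul 2)).mul (h2.sub h1).abs
      rw [mul_zero, sub_zero] at h4; refine le_of_tendsto h4 ?_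
      filter_upwards [hsh p hp, hsh q hq] with n n1 n2
      exact h.convolution_sub_le (φ n) n1 n2 hpq
    have hdc : 0 < d - c := by have := hp.2.2.1.trans hp.2.2.2; linarith
    have h5 : (d - c) * |s q - s p| < (d - c) * 2 := by nlinarith
    exact lt_of_mul_lt_mul_left h5 hdc.le
  have hgood : ∀ᵐ p : ℂ, p ∈ openBox a b c d → (s p = 1 ∨ s p = -1) ∧
      Tendsto (fun n => G n p) atTop (𝓝 (s p)) := by
    filter_upwards [hlim', h.eq_or_eq] with p h1 h2 h3 using ⟨h2 h3, h1⟩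
  by_cases hex : ∃ p, p ∈ openBox a b c d ∧ (s p = 1 ∨ s p = -1) ∧
      Tendsto (fun n => G n p) atTop (𝓝 (s p))
  · obtain ⟨p, hp, hp1, hp2⟩ := hex; refine ⟨s p, hp1, ?_⟩; filter_upwards [hgood] with q hq hqQ
    obtain ⟨q1, q2⟩ := hq hqQ; have h6 : |s q - s p| < 2 := by
      rcases le_total p.re q.re with h | h
      · exact key p q hp hqQ hp2 q2 h
      · rw [abs_sub_comm]; exact key q p hqQ hp q2 hp2 h
    rcases hp1 with h7 | h7 <;> rcases q1 with h8 | h8 <;> rw [h7, h8] at h6 ⊢ <;> norm_num at h6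
  · refine ⟨1, Or.inl rfl, ?_⟩; push Not at hex; filter_upwards [hgood] with q hq hqQ
    exact absurd (hq hqQ).2 (hex q hqQ (hq hqQ).1)

end IsFlatSystem

end

/-! ### Holomorphic charts and transport of the weak equation -/

section

/-- `ψ` is a biholomorphic map of the open set `Q` onto its open image, with inverse `φ`. -/
structure IsChart (Q : Set ℂ) (ψ φ : ℂ → ℂ) : Prop where
  isOpen : IsOpen Q
  isOpen_image : IsOpen (ψ '' Q)
  differentiableOn : DifferentiableOn ℂ ψ Q
  differentiableOn_inv : DifferentiableOn ℂ φ (ψ '' Q)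
  leftInv : LeftInvOn φ ψ Q

/-- For `L` the real derivative of a function, `L 1 + I L I` is twice its `dbar`. The identity is
the chain rule for `dbar` under a holomorphic map of derivative `c`, which produces the factor `conj
c`. -/
theorem real_linear_conj (L : ℂ →L[ℝ] ℂ) (c : ℂ) :
    L c + I * L (I * c) = conj c * (L 1 + I * L I) := by
  have h : ∀ w : ℂ, L w = w.re * L 1 + w.im * L I := fun w => by
    conv_lhs => rw [← re_add_im w]
    rw [map_add, show (w.re : ℂ) = w.re • (1:ℂ) by simp,
      show (w.im : ℂ) * I = w.im • I by simp, map_smul, map_smul]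
    simp
  rw [h c, h (I * c)]; have hc : conj c = c.re - c.im * I := by
    apply Complex.ext <;> simp
  rw [hc]; simp only [mul_re, I_re, I_im, mul_im]; push_cast
  linear_combination ((c.im : ℂ) * L I) * I_sq

theorem det_restrictScalars_smulRight (c : ℂ) :
    ((ContinuousLinearMap.toSpanSingleton ℂ c).restrictScalars ℝ).det = ‖c‖ ^ 2 := by
  rw [← normSq_eq_norm_sq, ← Algebra.norm_complex_apply, Algebra.norm_apply]
  rw [ContinuousLinearMap.det]; congr 1; ext <;> simp [mul_comm]

namespace IsChart

variable {Q : Set ℂ} {ψ φ : ℂ → ℂ}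

theorem injOn (h : IsChart Q ψ φ) : InjOn ψ Q := h.leftInv.injOn

theorem hasDerivAt (h : IsChart Q ψ φ) {u : ℂ} (hu : u ∈ Q) : HasDerivAt ψ (deriv ψ u) u :=
  ((h.differentiableOn u hu).differentiableAt (h.isOpen.mem_nhds hu)).hasDerivAt

theorem ae_comp (h : IsChart Q ψ φ) {p : ℂ → Prop} (hp : ∀ᵐ z, z ∈ ψ '' Q → p z) :
    ∀ᵐ u, u ∈ Q → p (ψ u) := by
  have h0 : volume ({z | ¬ (z ∈ ψ '' Q → p z)} ∩ ψ '' Q) = 0 :=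
    measure_mono_null inter_subset_left (ae_iff.1 hp)
  have h1 := addHaar_image_eq_zero_of_differentiableOn_of_addHaar_eq_zero (f := φ) volume
    ((h.differentiableOn_inv.mono inter_subset_right).restrictScalars ℝ) h0
  rw [ae_iff]; refine measure_mono_null (fun u hu => ?_) h1
  simp only [mem_ofPred_eq, Classical.not_imp] at hu
  exact ⟨ψ u, ⟨fun hh => hu.2 (hh (mem_image_of_mem _ hu.1)), mem_image_of_mem _ hu.1⟩,
    h.leftInv hu.1⟩

theorem inv_mem (h : IsChart Q ψ φ) {z : ℂ} (hz : z ∈ ψ '' Q) : φ z ∈ Q ∧ ψ (φ z) = z := by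
  obtain ⟨u, hu, rfl⟩ := hz; rw [h.leftInv hu]; exact ⟨hu, rfl⟩

theorem setIntegral_image (h : IsChart Q ψ φ) (f : ℂ → ℂ) :
    ∫ z in ψ '' Q, f z = ∫ u in Q, (‖deriv ψ u‖ ^ 2 : ℝ) * f (ψ u) := by
  rw [integral_image_eq_integral_abs_det_fderiv_smul volume h.isOpen.measurableSet
    (fun u hu => ((h.hasDerivAt hu).hasFDerivAt.restrictScalars ℝ).hasFDerivWithinAt) h.injOn]
  refine setIntegral_congr_fun h.isOpen.measurableSet fun u _ => ?_
  simp only [det_restrictScalars_smulRight, abs_of_nonneg (sq_nonneg ‖deriv ψ u‖), real_smul]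

open Classical in
/-- Transport of a test function through a chart. -/
theorem exists_test (h : IsChart Q ψ φ) {χ : ℂ → ℝ} (hχ : ContDiff ℝ ∞ χ)
    (hc : HasCompactSupport χ) (hQ : tsupport χ ⊆ Q) : ∃ X : ℂ → ℂ, ContDiff ℝ ∞ X ∧
      HasCompactSupport X ∧ tsupport X ⊆ ψ '' Q ∧ ∀ u ∈ Q, X (ψ u) = χ u := by
  set X : ℂ → ℂ := fun z => if z ∈ ψ '' Q then (χ (φ z) : ℂ) else 0 with hX
  have hcomp : IsCompact (ψ '' tsupport χ) :=
    hc.isCompact.image_of_continuousOn (h.differentiableOn.continuousOn.mono hQ)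
  have hsupp : tsupport X ⊆ ψ '' tsupport χ := by
    refine closure_minimal (fun z hz => ?_) hcomp.isClosed
    by_cases hzQ : z ∈ ψ '' Q
    · rw [Function.mem_support, hX] at hz; simp only [hzQ, if_true, ne_eq, ofReal_eq_zero] at hz
      exact ⟨φ z, subset_closure hz, (h.inv_mem hzQ).2⟩
    · exact absurd (by simp only [hX, if_neg hzQ]) hz
  have hsQ := hsupp.trans (image_mono hQ)
  refine ⟨X, ?_, hcomp.of_isClosed_subset (isClosed_tsupport X) hsupp, hsQ, fun u hu => ?_⟩
  · rw [contDiff_iff_contDiffAt]; intro z; by_cases hz : z ∈ ψ '' Q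
    · have h1 : ContDiffAt ℝ ∞ φ z :=
        ((h.differentiableOn_inv.contDiffOn h.isOpen_image (n := ∞)).contDiffAt
          (h.isOpen_image.mem_nhds hz)).restrict_scalars ℝ
      have h2 : ContDiffAt ℝ ∞ (fun z => (χ (φ z) : ℂ)) z :=
        ofRealCLM.contDiff.contDiffAt.comp z (hχ.contDiffAt.comp z h1)
      refine h2.congr_of_eventuallyEq ?_; filter_upwards [h.isOpen_image.mem_nhds hz] with w hw
      simp only [X, if_pos hw]
    · have h0 : z ∉ tsupport X := fun h => hz (hsQ h)
      have h1 : X =ᶠ[𝓝 z] fun _ => 0 := by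
        rwa [notMem_tsupport_iff_eventuallyEq] at h0
      exact contDiffAt_const.congr_of_eventuallyEq h1
  · simp only [hX, if_pos (mem_image_of_mem ψ hu), h.leftInv hu]

/-- Transport of the weak equation through a chart that trivializes the field `g`. -/
theorem exists_isFlatSystem (h : IsChart Q ψ φ) {ν : Measure ℂ} [IsFiniteMeasure ν] {σ : ℂ → ℝ}
    (hσ : Measurable σ) (hσ1 : ∀ x, σ x = 1 ∨ σ x = -1) {g : ℂ → ℂ} (hg : LocallyIntegrable g)
    (hweak : ∀ X : ℂ → ℂ, ContDiff ℝ ∞ X → HasCompactSupport X → tsupport X ⊆ ψ '' Q →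
      ∫ z, g z * dbar X z = π * ∫ x, (σ x : ℂ) * X x ∂ν)
    (hsq : ∀ᵐ u, u ∈ Q → (g (ψ u) * deriv ψ u) ^ 2 = 1) :
    ∃ (s τ : ℂ → ℝ) (M : Measure ℂ), IsFiniteMeasure M ∧ IsFlatSystem Q s τ M ∧
      (∀ᵐ u, u ∈ Q → (s u : ℂ) = g (ψ u) * deriv ψ u) ∧
      ∀ S, MeasurableSet S → S ⊆ Q → M S = ν (ψ '' S) := by
  classical
  set f : ℂ → ℂ := Q.indicator fun u => g (ψ u) * deriv ψ u with hf
  -- The truncation makes `|s| ≤ 1` hold everywhere; almost everywhere on `Q` it changes nothing,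
  -- since `f` is `±1` there.
  set s : ℂ → ℝ := fun u => max (-1) (min 1 (f u).re) with hs
  set ψ' : ℂ → ℂ := Q.piecewise ψ fun _ => 0 with hψ'
  have hQm := h.isOpen.measurableSet
  have hψ'm : Measurable ψ' :=
    h.differentiableOn.continuousOn.measurable_piecewise continuousOn_const hQm
  set φ' : ℂ → ℂ := (ψ '' Q).piecewise φ fun _ => 0 with hφ'
  have hφ'm : Measurable φ' := h.differentiableOn_inv.continuousOn.measurable_piecewise
    continuousOn_const h.isOpen_image.measurableSet
  have hfm : AEStronglyMeasurable f := by
    rw [hf, aestronglyMeasurable_indicator_iff hQm]; refine AEStronglyMeasurable.mul ?_ ?_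
    · refine (hg.aestronglyMeasurable.stronglyMeasurable_mk.measurable.comp
        hψ'm).aestronglyMeasurable.congr ?_
      rw [EventuallyEq, ae_restrict_iff' hQm]
      filter_upwards [h.ae_comp (hg.aestronglyMeasurable.ae_eq_mk.mono fun z hz _ => hz)]
        with u h1 h2
      simp only [Function.comp, hψ', piecewise_eq_of_mem _ _ _ h2, h1 h2]
    · exact ((h.differentiableOn.deriv h.isOpen).continuousOn).aestronglyMeasurable hQm
  have hsf : ∀ᵐ u, u ∈ Q → (s u : ℂ) = g (ψ u) * deriv ψ u ∧ (s u = 1 ∨ s u = -1) := by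
    filter_upwards [hsq] with u h1 h2
    have h3 : f u = g (ψ u) * deriv ψ u := by simp [hf, h2]
    rw [← h3]; rcases sq_eq_one_iff.1 (h1 h2) with h4 | h4 <;> rw [← h3] at h4 <;>
      simp [hs, h4]
  refine ⟨s, σ ∘ ψ', (ν.restrict (ψ '' Q)).map φ', inferInstance, ?_, hsf.mono fun u h1 h2 =>
    (h1 h2).1, ?_⟩
  swap
  · intro S hS hSQ; rw [Measure.map_apply hφ'm hS, Measure.restrict_apply (hφ'm hS)]; congr 1; ext z
    constructor
    · rintro ⟨h1, h2⟩; rw [mem_preimage, hφ', piecewise_eq_of_mem _ _ _ h2] at h1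
      exact ⟨φ z, h1, (h.inv_mem h2).2⟩
    · rintro ⟨u, h1, rfl⟩; have h2 := mem_image_of_mem ψ (hSQ h1)
      refine ⟨?_, h2⟩; rw [mem_preimage, hφ', piecewise_eq_of_mem _ _ _ h2, h.leftInv (hSQ h1)]
      exact h1
  -- The Jacobian `|ψ'|²` splits as `ψ' conj ψ'`: one factor turns `g` into `g ψ' = s`, the other
  -- turns `dbar X` into `dbar χ`. The real and imaginary parts of the resulting identity are the
  -- two equations of a flat system.
  have key : ∀ χ : ℂ → ℝ, ContDiff ℝ ∞ χ → HasCompactSupport χ → tsupport χ ⊆ Q →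
      ((∫ u, s u * fderiv ℝ χ u 1 : ℝ) : ℂ) + I * ((∫ u, s u * fderiv ℝ χ u I : ℝ) : ℂ) =
      2 * π * ((∫ u, (σ ∘ ψ') u * χ u ∂((ν.restrict (ψ '' Q)).map φ') : ℝ) : ℂ) := by
    intro χ hχ hc hQ; obtain ⟨X, X1, X2, X3, X4⟩ := h.exists_test hχ hc hQ
    have e1 := hweak X X1 X2 X3
    have hX0 : ∀ z, z ∉ ψ '' Q → X z = 0 := fun z hz =>
      image_eq_zero_of_notMem_tsupport fun h => hz (X3 h)
    have e2 : ∫ x, (σ x : ℂ) * X x ∂ν =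
        ((∫ u, (σ ∘ ψ') u * χ u ∂((ν.restrict (ψ '' Q)).map φ') : ℝ) : ℂ) := by
      have hm : AEStronglyMeasurable (fun u => (σ ∘ ψ') u * χ u)
          ((ν.restrict (ψ '' Q)).map φ') :=
        ((hσ.comp hψ'm).mul hχ.continuous.measurable).aestronglyMeasurable
      rw [integral_map hφ'm.aemeasurable hm,
        ← integral_complex_ofReal,
        ← setIntegral_eq_integral_of_forall_compl_eq_zero (s := ψ '' Q)
          fun z hz => by rw [hX0 z hz, mul_zero]]
      refine setIntegral_congr_fun h.isOpen_image.measurableSet fun z hz => ?_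
      obtain ⟨i1, i2⟩ := h.inv_mem hz
      simp only [Function.comp, hφ', piecewise_eq_of_mem _ _ _ hz, hψ',
        piecewise_eq_of_mem _ _ _ i1, i2]
      rw [← i2, X4 _ i1, i2]; push_cast; ring
    have hχd := hχ.differentiable (by simp)
    have hXd := X1.differentiable (by simp)
    have e3 : ∫ z, g z * dbar X z =
        ∫ u, (s u : ℂ) * ((fderiv ℝ χ u 1 : ℂ) + I * (fderiv ℝ χ u I : ℂ)) / 2 := by
      rw [← setIntegral_eq_integral_of_forall_compl_eq_zero (s := ψ '' Q)
          fun z hz => by rw [dbar_eq_zero_of_notMem_tsupport fun h => hz (X3 h), mul_zero],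
        h.setIntegral_image, ← setIntegral_eq_integral_of_forall_compl_eq_zero (s := Q)
          (f := fun u => (s u : ℂ) * ((fderiv ℝ χ u 1 : ℂ) +
            I * (fderiv ℝ χ u I : ℂ)) / 2)
          fun u hu => by rw [fderiv_of_notMem_tsupport ℝ fun h => hu (hQ h)]; simp]
      refine setIntegral_congr_ae hQm ?_; filter_upwards [hsf] with u h1 h2
      rw [(h1 h2).1]; have hψd := (h.hasDerivAt h2).hasFDerivAt.restrictScalars ℝ
      have h3 := (hXd (ψ u)).hasFDerivAt.comp u hψd
      have h4 : (fun w => X (ψ w)) =ᶠ[𝓝 u] fun w => (χ w : ℂ) := by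
        filter_upwards [h.isOpen.mem_nhds h2] with w hw using X4 w hw
      have h5 := ofRealCLM.hasFDerivAt.comp u (hχd u).hasFDerivAt
      have h6 := (h3.congr_of_eventuallyEq h4.symm).unique h5
      have h7 : ∀ v : ℂ, (fderiv ℝ χ u v : ℂ) = fderiv ℝ X (ψ u) (v * deriv ψ u) := fun v => by
        have := congrArg (fun L : ℂ →L[ℝ] ℂ => L v) h6
        simpa using this.symm
      rw [h7, h7, one_mul, real_linear_conj, dbar, ← normSq_eq_norm_sq,
        normSq_eq_conj_mul_self]
      ring
    have hi : ∀ v : ℂ, Integrable fun u => s u * fderiv ℝ χ u v := fun v => by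
      have hχ1 : ContDiff ℝ 1 χ := hχ.of_le (by simp)
      have hfc : Continuous fun u => fderiv ℝ χ u v :=
        (hχ1.continuous_fderiv one_ne_zero).clm_apply continuous_const
      have hfs := (hc.fderiv ℝ).comp_left (g := fun L : ℂ →L[ℝ] ℝ => L v) rfl
      refine (hfc.integrable_of_hasCompactSupport hfs).bdd_mul (c := 1) ?_ (ae_of_all _ fun u => ?_)
      · fun_prop
      · rw [norm_eq_abs, abs_le]; exact ⟨le_max_left _ _, max_le (by norm_num) (min_le_left _ _)⟩
    have e4 : ∫ u, (s u : ℂ) * ((fderiv ℝ χ u 1 : ℂ) + I * (fderiv ℝ χ u I : ℂ)) / 2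
        = (((∫ u, s u * fderiv ℝ χ u 1 : ℝ) : ℂ) +
          I * ((∫ u, s u * fderiv ℝ χ u I : ℝ) : ℂ)) / 2 := by
      rw [← integral_complex_ofReal, ← integral_complex_ofReal, ← integral_const_mul,
        ← integral_add (hi 1).ofReal ((hi I).ofReal.const_mul _), ← integral_div]
      congr 1; ext u; push_cast; ring
    rw [e3, e4, e2] at e1; linear_combination 2 * e1
  refine ⟨h.isOpen, ?_, fun u => ?_, hsf.mono fun u h1 h2 => (h1 h2).2, hσ.comp hψ'm,
    fun u => hσ1 _, fun χ h1 h2 h3 => ?_, fun χ h1 h2 h3 => ?_⟩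
  · fun_prop
  · rw [abs_le]; exact ⟨le_max_left _ _, max_le (by norm_num) (min_le_left _ _)⟩
  · have := congrArg re (key χ h1 h2 h3)
    simpa using this
  · have := congrArg im (key χ h1 h2 h3)
    simpa using this

end IsChart

end

/-! ### Normal forms of quadratic differentials -/

/-- Solution of the linear equation `(N / 2) e + x e' = S` regular at the origin. -/
theorem exists_solution_euler {S : ℂ → ℂ} (hS : AnalyticAt ℂ S 0) {N : ℕ} (hN : 1 ≤ N) :
    ∃ e : ℂ → ℂ, AnalyticAt ℂ e 0 ∧ ∀ᶠ x in 𝓝 0, (N / 2 : ℂ) * e x + x * deriv e x = S x := by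
  obtain ⟨r, hr, hSr⟩ : ∃ r > 0, ∀ z ∈ ball (0:ℂ) r, AnalyticAt ℂ S z := by
    obtain ⟨r, hr, h⟩ := eventually_nhds_iff_ball.1 hS.eventually_analyticAt; exact ⟨r, hr, h⟩
  have hSd : ∀ z ∈ ball (0:ℂ) r, HasDerivAt S (deriv S z) z := fun z hz =>
    (hSr z hz).differentiableAt.hasDerivAt
  have hS'c : ContinuousOn (deriv S) (ball (0:ℂ) r) := fun z hz =>
    (hSr z hz).deriv.continuousAt.continuousWithinAt
  have hSc : ContinuousOn S (ball (0:ℂ) r) := fun z hz =>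
    (hSr z hz).continuousAt.continuousWithinAt
  have hsub : closedBall (0:ℂ) (r/2) ⊆ ball 0 r :=
    closedBall_subset_ball (by linarith)
  obtain ⟨D, hD⟩ := (isCompact_closedBall (0:ℂ) (r/2)).exists_bound_of_continuousOn
    (hS'c.mono hsub)
  have hmem : ∀ x ∈ ball (0:ℂ) (r/2), ∀ t ∈ Icc (0:ℝ) 1,
      x * t ^ 2 ∈ closedBall (0:ℂ) (r/2) := by
    intro x hx t ht; rw [mem_ball_zero_iff] at hx
    rw [mem_closedBall_zero_iff, norm_mul, norm_pow, norm_real, norm_of_nonneg ht.1]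
    have : t ^ 2 ≤ 1 := pow_le_one₀ ht.1 ht.2
    nlinarith [norm_nonneg x]
  -- The solution is `e x = ∫₀¹ 2 t^(N-1) S (x t²) dt`, because `(N/2) F + x F'` is the
  -- `t`-derivative of `t^N S (x t²)`. The lower endpoint contributes nothing since `N ≥ 1`.
  set F : ℂ → ℝ → ℂ := fun x t => 2 * t ^ (N - 1) * S (x * t ^ 2) with hF
  set F' : ℂ → ℝ → ℂ := fun x t => 2 * t ^ (N + 1) * deriv S (x * t ^ 2) with hF'
  have hpath : ∀ x : ℂ, Continuous fun t : ℝ => x * (t:ℂ) ^ 2 := fun x => by fun_prop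
  have hFc : ∀ x ∈ ball (0:ℂ) (r/2), ContinuousOn (F x) (Icc 0 1) := fun x hx =>
    ContinuousOn.mul (by fun_prop) (hSc.comp (hpath x).continuousOn
      fun t ht => hsub (hmem x hx t ht))
  have hF'c : ∀ x ∈ ball (0:ℂ) (r/2), ContinuousOn (F' x) (Icc 0 1) := fun x hx =>
    ContinuousOn.mul (by fun_prop) (hS'c.comp (hpath x).continuousOn
      fun t ht => hsub (hmem x hx t ht))
  have hder : ∀ x ∈ ball (0:ℂ) (r/2), HasDerivAt (fun x => ∫ t in (0:ℝ)..1, F x t)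
      (∫ t in (0:ℝ)..1, F' x t) x := by
    intro x hx; have hae : ∀ {f : ℝ → ℂ}, ContinuousOn f (Icc 0 1) →
        AEStronglyMeasurable f (volume.restrict (uIoc (0:ℝ) 1)) := fun hf => by
      rw [uIoc_of_le zero_le_one]
      exact (hf.mono Ioc_subset_Icc_self).aestronglyMeasurable measurableSet_Ioc
    refine (intervalIntegral.hasDerivAt_integral_of_dominated_loc_of_deriv_le (F' := F')
      (bound := fun _ => 2 * D) (isOpen_ball.mem_nhds hx) ?_ ?_ ?_ ?_ ?_ ?_).2
    · filter_upwards [isOpen_ball.mem_nhds hx] with w hw using hae (hFc w hw)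
    · exact ((hFc x hx).mono (by rw [uIcc_of_le zero_le_one])).intervalIntegrable
    · exact hae (hF'c x hx)
    · refine ae_of_all _ fun t ht w hw => ?_
      rw [uIoc_of_le zero_le_one] at ht; have ht' : t ∈ Icc (0:ℝ) 1 := ⟨ht.1.le, ht.2⟩
      have h1 := hD _ (hmem w hw t ht')
      simp only [hF', norm_mul, norm_pow, norm_real, norm_of_nonneg ht'.1]
      have : t ^ (N+1) ≤ 1 := pow_le_one₀ ht'.1 ht'.2
      have h0 : 0 ≤ t ^ (N+1) := by have := ht'.1; positivity
      have h2 : ‖(2:ℂ)‖ = 2 := by simp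
      rw [h2]; nlinarith [norm_nonneg (deriv S (w * (t:ℂ) ^ 2))]
    · exact intervalIntegrable_const
    · refine ae_of_all _ fun t ht w hw => ?_
      rw [uIoc_of_le zero_le_one] at ht; have ht' : t ∈ Icc (0:ℝ) 1 := ⟨ht.1.le, ht.2⟩
      have h1 := (hSd _ (hsub (hmem w hw t ht'))).comp w ((hasDerivAt_id w).mul_const ((t:ℂ)^2))
      have h2 := h1.const_mul (2 * (t:ℂ) ^ (N - 1))
      refine h2.congr_deriv ?_; simp only [hF', one_mul]
      obtain ⟨m, rfl⟩ : ∃ m, N = m + 1 := ⟨N - 1, by omega⟩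
      simp only [Nat.add_sub_cancel]; ring
  refine ⟨fun x => ∫ t in (0:ℝ)..1, F x t, ?_, ?_⟩
  · exact DifferentiableOn.analyticAt (s := ball (0:ℂ) (r/2))
      (fun x hx => (hder x hx).differentiableAt.differentiableWithinAt)
      (ball_mem_nhds _ (by linarith))
  filter_upwards [ball_mem_nhds (0:ℂ) (half_pos hr)] with x hx
  rw [(hder x hx).deriv, ← intervalIntegral.integral_const_mul,
    ← intervalIntegral.integral_const_mul, ← intervalIntegral.integral_add]
  · have hft : ∀ t ∈ uIcc (0:ℝ) 1, HasDerivAt (fun t : ℝ => (t:ℂ) ^ N * S (x * (t:ℂ) ^ 2))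
        (N / 2 * F x t + x * F' x t) t := by
      intro t ht; rw [uIcc_of_le zero_le_one] at ht
      have h0 : HasDerivAt (fun t : ℝ => (t:ℂ)) 1 t := ofRealCLM.hasDerivAt
      have h1 := (hSd _ (hsub (hmem x hx t ht))).comp t ((h0.pow 2).const_mul x)
      refine ((h0.pow N).mul h1).congr_deriv ?_; simp only [hF, hF', Function.comp, Pi.pow_apply]
      obtain ⟨m, rfl⟩ : ∃ m, N = m + 1 := ⟨N - 1, by omega⟩
      simp only [Nat.add_sub_cancel]; push_cast; ring
    rw [intervalIntegral.integral_eq_sub_of_hasDerivAt hft]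
    · simp [show N ≠ 0 by omega]
    · refine ContinuousOn.intervalIntegrable ?_; rw [uIcc_of_le zero_le_one]
      exact (continuousOn_const.mul (hFc x hx)).add (continuousOn_const.mul (hF'c x hx))
  · refine ContinuousOn.intervalIntegrable ?_; rw [uIcc_of_le zero_le_one]
    exact continuousOn_const.mul (hFc x hx)
  · refine ContinuousOn.intervalIntegrable ?_; rw [uIcc_of_le zero_le_one]
    exact continuousOn_const.mul (hF'c x hx)

theorem exists_analytic_log {e : ℂ → ℂ} {z₀ : ℂ} (he : AnalyticAt ℂ e z₀) (h0 : e z₀ ≠ 0) :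
    ∃ l : ℂ → ℂ, AnalyticAt ℂ l z₀ ∧ ∀ᶠ z in 𝓝 z₀, exp (l z) = e z := by
  refine ⟨fun z => log (e z / e z₀) + log (e z₀), ?_, ?_⟩
  · refine AnalyticAt.add (AnalyticAt.clog (he.div analyticAt_const h0) ?_) analyticAt_const
    rw [div_self h0]; exact one_mem_slitPlane
  · filter_upwards [he.continuousAt.eventually_ne h0] with z hz
    rw [exp_add, exp_log (div_ne_zero hz h0), exp_log h0,
      div_mul_cancel₀ _ h0]

theorem exists_analytic_sqrt {u : ℂ → ℂ} {z₀ c : ℂ} (hu : AnalyticAt ℂ u z₀) (hc : c ^ 2 = u z₀)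
    (h0 : u z₀ ≠ 0) : ∃ S : ℂ → ℂ, AnalyticAt ℂ S z₀ ∧ S z₀ = c ∧ ∀ᶠ z in 𝓝 z₀, S z ^ 2 = u z := by
  obtain ⟨l, hl, hle⟩ := exists_analytic_log hu h0; have h1 := hle.self_of_nhds
  have h2 : ∀ w, exp (w / 2) ^ 2 = exp w := fun w => by
    rw [← exp_nat_mul]; congr 1; push_cast; ring
  have hne := exp_ne_zero (l z₀ / 2)
  refine ⟨fun z => c / exp (l z₀ / 2) * exp (l z / 2), ?_, ?_, ?_⟩
  · exact analyticAt_const.mul ((hl.div_const).cexp)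
  · simp only; field_simp
  · filter_upwards [hle] with z hz
    rw [mul_pow, div_pow, h2, h2, hz, h1, hc, div_self h0, one_mul]

/-- The local normal form of the quadratic differential `(z - z₀) ^ (N - 2) u(z) dz²`, namely
`c² y ^ (N - 2) dy²`. -/
theorem exists_normal_form {u : ℂ → ℂ} {z₀ : ℂ} (hu : AnalyticAt ℂ u z₀) (h0 : u z₀ ≠ 0) (N : ℕ)
    {c : ℂ} (hc : if N = 0 then c ^ 2 = u z₀ else c = N / 2) :
    ∃ y : ℂ → ℂ, AnalyticAt ℂ y z₀ ∧ y z₀ = 0 ∧ deriv y z₀ ≠ 0 ∧ ∀ᶠ z in 𝓝 z₀,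
      c ^ 2 * (z - z₀) ^ 2 * deriv y z ^ 2 * y z ^ N = (z - z₀) ^ N * u z * y z ^ 2 := by
  have hc0 : c ≠ 0 := by
    split_ifs at hc with h
    · rintro rfl; exact h0 (by rw [← hc]; simp)
    · rw [hc]; simpa using h
  obtain ⟨d, hd⟩ : ∃ d : ℂ, d ^ 2 = u z₀ := ⟨u z₀ ^ (1 / 2 : ℂ), by
    rw [← cpow_nat_mul]; simp⟩
  -- a function `l` with `(c + (z - z₀) l') exp l = √u` or `c + (z - z₀) l' = √u`
  obtain ⟨S, l, hS, hl, hSu, hlS⟩ : ∃ S l : ℂ → ℂ, AnalyticAt ℂ S z₀ ∧ AnalyticAt ℂ l z₀ ∧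
      (∀ᶠ z in 𝓝 z₀, S z ^ 2 * exp (l z / c) ^ N = u z) ∧
      (∀ᶠ z in 𝓝 z₀, c + (z - z₀) * deriv l z = S z) := by
    split_ifs at hc with h
    · obtain ⟨S, hS, hSc, hSu⟩ := exists_analytic_sqrt hu hc h0
      -- For `N = 0` the equation is `l' = (S - c)/(z - z₀)`, whose right-hand side is analytic
      -- precisely because `S z₀ = c`.
      have hT : AnalyticAt ℂ (dslope S z₀) z₀ := by
        obtain ⟨p, hp⟩ := hS; exact ⟨_, hp.has_fpower_series_dslope_fslope⟩
      obtain ⟨r, hr, h1⟩ := eventually_nhds_iff_ball.1 hT.eventually_analyticAt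
      have hTd : DifferentiableOn ℂ (dslope S z₀) (ball z₀ r) := fun z hz =>
        (h1 z hz).differentiableAt.differentiableWithinAt
      obtain ⟨l, hl⟩ := hTd.isExactOn_ball
      have hl' : ∀ z ∈ ball z₀ r, HasDerivAt l (dslope S z₀ z) z := hl
      refine ⟨S, l, hS, ?_, ?_, ?_⟩
      · exact DifferentiableOn.analyticAt (s := ball z₀ r)
          (fun x hx => (hl' x hx).differentiableAt.differentiableWithinAt)
          (ball_mem_nhds _ hr)
      · simpa [h] using hSu
      · filter_upwards [ball_mem_nhds z₀ hr] with z hz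
        rw [(hl' z hz).deriv, ← smul_eq_mul, sub_smul_dslope, hSc]; ring
    · obtain ⟨S, hS, hSc, hSu⟩ := exists_analytic_sqrt hu hd h0; have hS0 : S z₀ ≠ 0 := by
        rw [hSc]; rintro rfl; exact h0 (by rw [← hd]; simp)
      have hSt : AnalyticAt ℂ (fun x => S (z₀ + x)) 0 := by
        have : AnalyticAt ℂ S (z₀ + 0) := by rwa [add_zero]
        exact this.comp_of_eq (analyticAt_const.add analyticAt_id) rfl
      -- For `N ≥ 1` solve `c e + (z - z₀) e' = √u` and put `l = log e`; the choice `c = N/2` gives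
      -- `exp (l/c)^N = e²`.
      obtain ⟨e, he, heS⟩ := exists_solution_euler hSt (N := N) (by omega)
      set e' : ℂ → ℂ := fun z => e (z - z₀) with he'
      have he'a : AnalyticAt ℂ e' z₀ :=
        AnalyticAt.comp_of_eq he (analyticAt_id.sub analyticAt_const) (by simp)
      have hte : Tendsto (fun z => z - z₀) (𝓝 z₀) (𝓝 0) := by
        have : Continuous fun z : ℂ => z - z₀ := by fun_prop
        simpa using this.tendsto z₀
      have heS' : ∀ᶠ z in 𝓝 z₀, c * e' z + (z - z₀) * deriv e' z = S z := by
        filter_upwards [hte.eventually heS] with z hz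
        rw [hc]; have : deriv e' z = deriv e (z - z₀) := deriv_comp_sub_const _ _ _
        rw [this, he']; simpa using hz
      have he0 : e' z₀ ≠ 0 := by
        have := heS'.self_of_nhds
        rw [sub_self, zero_mul, add_zero] at this; intro h9
        exact hS0 (by rw [← this, h9, mul_zero])
      obtain ⟨l, hl, hle⟩ := exists_analytic_log he'a he0
      refine ⟨fun z => S z / e' z, l, hS.div he'a he0, hl, ?_, ?_⟩
      · filter_upwards [hSu, hle] with z h1 h2
        have h3 : exp (l z / c) ^ N = e' z ^ 2 := by
          rw [← h2, ← exp_nat_mul, ← exp_nat_mul, hc]; congr 1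
          have hN : (N:ℂ) ≠ 0 := by exact_mod_cast h
          field_simp; push_cast; ring
        have h4 : e' z ≠ 0 := by rw [← h2]; exact exp_ne_zero _
        rw [h3, ← h1]; field_simp
      · have hder : ∀ᶠ z in 𝓝 z₀, deriv e' z = e' z * deriv l z := by
          filter_upwards [hle.eventually_nhds, hl.eventually_analyticAt] with z h1 h2
          have h3 : HasDerivAt (fun w => exp (l w)) _ z := h2.differentiableAt.hasDerivAt.cexp
          rw [(h3.congr_of_eventuallyEq (h1.mono fun w hw => hw.symm)).deriv, h1.self_of_nhds]
        filter_upwards [heS', hder, he'a.continuousAt.eventually_ne he0] with z h1 h2 h3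
        rw [← h1, h2]; field_simp
  -- For `y = (z - z₀) exp (l/c)` one has `c (z - z₀) y' = (c + (z - z₀) l') y = S y` and `y^N = (z
  -- - z₀)^N exp (l/c)^N`, so the normal form reduces to `S² exp (l/c)^N = u`.
  set r : ℂ → ℂ := fun z => exp (l z / c) with hr
  have hra : AnalyticAt ℂ r z₀ := hl.div_const.cexp
  have hrder : ∀ᶠ z in 𝓝 z₀, HasDerivAt (fun z => (z - z₀) * r z)
      (r z + (z - z₀) * (r z * (deriv l z / c))) z := by
    filter_upwards [hl.eventually_analyticAt] with z hz
    have h1 : HasDerivAt r _ z := (hz.differentiableAt.hasDerivAt.div_const c).cexp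
    refine (((hasDerivAt_id z).sub_const z₀).mul h1).congr_deriv ?_; simp [hr]
  refine ⟨fun z => (z - z₀) * r z, (analyticAt_id.sub analyticAt_const).mul hra, by simp, ?_, ?_⟩
  · rw [hrder.self_of_nhds.deriv]; simp [hr]
  · filter_upwards [hrder, hSu, hlS] with z h1 h2 h3
    rw [h1.deriv, ← h2, ← h3]; simp only [hr]; field_simp; rw [mul_pow]; ring

/-- Local inversion of an analytic function with nonvanishing derivative. -/
theorem exists_local_inverse {y : ℂ → ℂ} {z₀ : ℂ} (hy : AnalyticAt ℂ y z₀)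
    (hd : deriv y z₀ ≠ 0) {U : Set ℂ} (hU : U ∈ 𝓝 z₀) :
    ∃ e : OpenPartialHomeomorph ℂ ℂ, z₀ ∈ e.source ∧ e.source ⊆ U ∧ (e : ℂ → ℂ) = y ∧
      (∀ z ∈ e.source, AnalyticAt ℂ y z ∧ deriv y z ≠ 0) ∧
      ∀ w ∈ e.target, HasDerivAt e.symm (deriv y (e.symm w))⁻¹ w := by
  have hs := hy.hasStrictDerivAt.hasStrictFDerivAt_equiv hd
  set e₀ := hs.toOpenPartialHomeomorph y with he₀
  have h1 := (eventually_mem_set.2 hU).and (hy.eventually_analyticAt.and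
      (hy.deriv.continuousAt.eventually_ne hd))
  obtain ⟨V, hV, hVo, hzV⟩ := _root_.eventually_nhds_iff.1 h1; have hee : (e₀ : ℂ → ℂ) = y := rfl
  set e := e₀.restrOpen V hVo with he
  have hes : e.source = e₀.source ∩ V := rfl
  have hprop : ∀ z ∈ e.source, AnalyticAt ℂ y z ∧ deriv y z ≠ 0 := fun z hz => (hV z hz.2).2
  refine ⟨e, ⟨hs.mem_toOpenPartialHomeomorph_source, hzV⟩, fun z hz => (hV z hz.2).1, rfl,
    hprop, fun w hw => ?_⟩
  have h2 := hprop _ (e.map_target hw)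
  exact e.hasDerivAt_symm hw h2.2 h2.1.differentiableAt.hasDerivAt

/-! ### Flat coordinates in sectors of a normal chart -/

section

/-- A left inverse that is differentiable at the image points forces `ψ' ≠ 0`, so the image is open
and nothing else has to be checked. -/
theorem IsChart.of_hasDerivAt {Q : Set ℂ} {ψ φ : ℂ → ℂ} (hQ : IsOpen Q)
    (hψ : DifferentiableOn ℂ ψ Q) (hφ : ∀ u ∈ Q, DifferentiableAt ℂ φ (ψ u))
    (hl : LeftInvOn φ ψ Q) : IsChart Q ψ φ := by
  refine ⟨hQ, ?_, hψ, ?_, hl⟩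
  · rw [isOpen_iff_mem_nhds]; rintro _ ⟨u, hu, rfl⟩
    have h1 := (hψ.analyticAt (hQ.mem_nhds hu)).hasStrictDerivAt
    have h0 : deriv ψ u ≠ 0 := by
      intro h0; have h2 := (hφ u hu).hasDerivAt.comp u h1.hasDerivAt
      have h3 : φ ∘ ψ =ᶠ[𝓝 u] id := by
        filter_upwards [hQ.mem_nhds hu] with w hw using hl hw
      have h4 := h2.unique ((hasDerivAt_id u).congr_of_eventuallyEq h3)
      simp [h0] at h4
    rw [← h1.map_nhds_eq h0]; exact image_mem_map (hQ.mem_nhds hu)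
  · rintro _ ⟨u, hu, rfl⟩; exact (hφ u hu).differentiableWithinAt

/-- The half-plane opens to a sector of angle `2π/N`, which for `N = 1` is the whole slit plane.
Since `|arg u| < π/2`, the argument `2 arg u / N` stays in `(-π, π)` even then, and the principal
powers are inverse to each other. -/
theorem cpow_two_div_cpow {N : ℕ} (hN : 1 ≤ N) {u : ℂ} (hu : 0 < u.re) :
    u ^ ((2 / N : ℝ) : ℂ) ∈ slitPlane ∧
      (u ^ ((2 / N : ℝ) : ℂ)) ^ ((N / 2 : ℝ) : ℂ) = u := by
  have h0 : u ≠ 0 := by rintro rfl; simp at hu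
  have hN' : (1:ℝ) ≤ N := by exact_mod_cast hN
  have harg := abs_arg_lt_pi_div_two_iff.2 (Or.inl hu)
  have him : (log u * ((2 / N : ℝ) : ℂ)).im = u.arg * (2 / N) := by
    rw [im_mul_ofReal, log_im]
  have hlt : |u.arg * (2 / N)| < π := by
    rw [abs_mul, abs_of_pos (by positivity : (0:ℝ) < 2 / N)]
    calc |u.arg| * (2 / N) ≤ |u.arg| * 2 := by
          gcongr; exact div_le_self (by norm_num) hN'
      _ < π := by linarith
  rw [abs_lt] at hlt
  have hlog : log (u ^ ((2 / N : ℝ) : ℂ)) = log u * ((2 / N : ℝ) : ℂ) := by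
    rw [cpow_def_of_ne_zero h0, log_exp (by rw [him]; exact hlt.1)
      (by rw [him]; exact hlt.2.le)]
  have hne : u ^ ((2 / N : ℝ) : ℂ) ≠ 0 := by
    rw [cpow_def_of_ne_zero h0]; exact exp_ne_zero _
  refine ⟨?_, ?_⟩
  · rw [mem_slitPlane_iff_arg]; refine ⟨?_, hne⟩; rw [← log_im, hlog, him]; exact hlt.2.ne
  · rw [cpow_def_of_ne_zero hne, hlog]; conv_rhs => rw [← exp_log h0]
    congr 1; have : (N:ℂ) ≠ 0 := by exact_mod_cast (by omega : N ≠ 0)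
    push_cast; field_simp

theorem cpow_two_div_pow {N : ℕ} (hN : 1 ≤ N) (u : ℂ) :
    (u ^ ((2 / N : ℝ) : ℂ)) ^ N = u ^ 2 := by
  rw [← cpow_nat_mul]; have : (N:ℂ) ≠ 0 := by exact_mod_cast (by omega : N ≠ 0)
  have h2 : (N:ℂ) * ((2 / N : ℝ) : ℂ) = (2:ℕ) := by push_cast; field_simp
  rw [h2, cpow_natCast]

theorem norm_eq_one_of_pow_eq_neg_one {N : ℕ} (hN : N ≠ 0) {θ : ℂ} (h : θ ^ N = -1) : ‖θ‖ = 1 := by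
  have := congrArg norm h
  rwa [norm_pow, norm_neg, norm_one, pow_eq_one_iff_of_nonneg (norm_nonneg _) hN] at this

/-- A local coordinate `e` at `z₀` in which the square of the field `g` is
`(N² / 4) e ^ (N - 2) (de)²`. -/
structure IsNormalChart (ν : Measure ℂ) (σ : ℂ → ℝ) (g : ℂ → ℂ) (N : ℕ) (z₀ : ℂ)
    (e : OpenPartialHomeomorph ℂ ℂ) : Prop where
  measurable : Measurable σ
  sign : ∀ x, σ x = 1 ∨ σ x = -1
  locallyIntegrable : LocallyIntegrable g
  one_le : 1 ≤ N
  mem : z₀ ∈ e.source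
  map_zero : e z₀ = 0
  hasDerivAt : ∀ z ∈ e.source, HasDerivAt e (deriv e z) z ∧ deriv e z ≠ 0
  hasDerivAt_symm : ∀ w ∈ e.target, HasDerivAt e.symm (deriv e (e.symm w))⁻¹ w
  weak : ∀ X : ℂ → ℂ, ContDiff ℝ ∞ X → HasCompactSupport X → tsupport X ⊆ e.source →
      ∫ z, g z * dbar X z = π * ∫ x, (σ x : ℂ) * X x ∂ν
  sq_eq : ∀ᵐ z, z ∈ e.source → (N:ℂ) ^ 2 * deriv e z ^ 2 * e z ^ N = 4 * g z ^ 2 * e z ^ 2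

/-- The parametrization `u ↦ e⁻¹(θ (u / κ) ^ (2 / N))` of a sector. -/
def sectorMap (e : OpenPartialHomeomorph ℂ ℂ) (N : ℕ) (θ κ u : ℂ) : ℂ :=
  e.symm (θ * (u / κ) ^ ((2 / N : ℝ) : ℂ))

/-- Continuity from above: the thin boxes leave out the axis and decrease to the empty set, whatever
mass the axis itself carries. -/
theorem exists_openBox_measure_lt (M : Measure ℂ) [IsFiniteMeasure M] (c d : ℝ) {ε : ℝ}
    (hε : 0 < ε) : ∃ δ > 0, M.real (openBox 0 δ c d) < ε ∧ M.real (openBox (-δ) 0 c d) < ε := by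
  have key : ∀ B : ℕ → Set ℂ, (∀ n, MeasurableSet (B n)) → Antitone B → (⋂ n, B n) = ∅ →
      ∀ᶠ n in atTop, M.real (B n) < ε := by
    intro B h1 h2 h3
    have := tendsto_measure_iInter_atTop (μ := M) (fun n => (h1 n).nullMeasurableSet) h2
      ⟨0, measure_ne_top _ _⟩
    rw [h3, measure_empty] at this
    have h4 := (ENNReal.tendsto_toReal ENNReal.zero_ne_top).comp this
    exact h4.eventually (gt_mem_nhds (by simpa using hε))
  have hpos : ∀ x : ℝ, 0 < x → ∃ n : ℕ, 1 / ((n:ℝ) + 1) < x := fun x hx => exists_nat_one_div_lt hx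
  have hmono : ∀ {m n : ℕ}, m ≤ n → 1 / ((n:ℝ) + 1) ≤ 1 / ((m:ℝ) + 1) := fun h =>
    Nat.one_div_le_one_div h
  have h1 := key (fun n => openBox 0 (1 / ((n:ℝ) + 1)) c d) (fun n => (isOpen_openBox _ _ _ _).measurableSet)
    (fun m n hmn z hz => ⟨hz.1, hz.2.1.trans_le (hmono hmn), hz.2.2⟩) (by
      rw [eq_empty_iff_forall_notMem]; intro z hz; rw [mem_iInter] at hz
      obtain ⟨n, hn⟩ := hpos z.re (hz 0).1; exact absurd (hz n).2.1 (not_lt.2 hn.le))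
  have h2 := key (fun n => openBox (-(1 / ((n:ℝ) + 1))) 0 c d) (fun n => (isOpen_openBox _ _ _ _).measurableSet)
    (fun m n hmn z hz => ⟨lt_of_le_of_lt (neg_le_neg (hmono hmn)) hz.1, hz.2⟩) (by
      rw [eq_empty_iff_forall_notMem]; intro z hz; rw [mem_iInter] at hz
      obtain ⟨n, hn⟩ := hpos (-z.re) (by have := (hz 0).2.1; linarith)
      have := (hz n).1
      linarith)
  obtain ⟨n, hn1, hn2⟩ := (h1.and h2).exists; exact ⟨1 / ((n:ℝ) + 1), by positivity, hn1, hn2⟩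

theorem norm_lt_of_mem_openBox {a b c d R : ℝ} {u : ℂ} (hu : u ∈ openBox a b c d)
    (ha : -(R / 2) ≤ a := by linarith) (hb : b ≤ R / 2 := by linarith)
    (hc : -(R / 2) ≤ c := by linarith) (hd : d ≤ R / 2 := by linarith) : ‖u‖ < R := by
  obtain ⟨h1, h2, h3, h4⟩ := hu
  have h5 : |u.re| < R / 2 := abs_lt.2 ⟨by linarith, by linarith⟩
  have h6 : |u.im| < R / 2 := abs_lt.2 ⟨by linarith, by linarith⟩
  exact (norm_le_abs_re_add_abs_im u).trans_lt (by linarith)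

namespace IsNormalChart

variable {ν : Measure ℂ} {σ : ℂ → ℝ} {g : ℂ → ℂ} {N : ℕ} {z₀ : ℂ}
  {e : OpenPartialHomeomorph ℂ ℂ}

theorem ne_zero (h : IsNormalChart ν σ g N z₀ e) : N ≠ 0 := (Nat.lt_of_lt_of_le one_pos h.one_le).ne'

theorem isChart_sector (h : IsNormalChart ν σ g N z₀ e) {θ κ : ℂ} (hθ : θ ≠ 0)
    (hκ : κ ≠ 0) {Q : Set ℂ} (hQ : IsOpen Q) (hQ1 : ∀ u ∈ Q, 0 < (u / κ).re)
    (hQ2 : ∀ u ∈ Q, θ * (u / κ) ^ ((2 / N : ℝ) : ℂ) ∈ e.target) :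
    IsChart Q (sectorMap e N θ κ) (fun z => κ * (e z / θ) ^ ((N / 2 : ℝ) : ℂ)) ∧
    ∀ u ∈ Q, deriv (sectorMap e N θ κ) u =
      e (sectorMap e N θ κ u) * (2 / N) / (u * deriv e (sectorMap e N θ κ u)) := by
  have hslit : ∀ u ∈ Q, u / κ ∈ slitPlane := fun u hu => Or.inl (hQ1 u hu)
  have hder : ∀ u ∈ Q, HasDerivAt (sectorMap e N θ κ) (e (sectorMap e N θ κ u) * (2 / N) /
      (u * deriv e (sectorMap e N θ κ u))) u := fun u hu => by
    have h1 : HasDerivAt (fun u => θ * (u / κ) ^ ((2 / N : ℝ) : ℂ)) _ u :=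
      (((hasDerivAt_id u).div_const κ).cpow_const (hslit u hu)).const_mul θ
    refine ((h.hasDerivAt_symm _ (hQ2 u hu)).comp u h1).congr_deriv ?_
    have h0 := slitPlane_ne_zero (hslit u hu)
    have h0' : u ≠ 0 := by rintro rfl; simp at h0
    have hey : e (sectorMap e N θ κ u) = θ * (u / κ) ^ ((2 / N : ℝ) : ℂ) :=
      e.right_inv (hQ2 u hu)
    rw [hey]; simp only [sectorMap]; have hd := (h.hasDerivAt _ (e.map_target (hQ2 u hu))).2
    simp only [id]; rw [cpow_sub _ _ h0, cpow_one]
    have hN0 : (N:ℂ) ≠ 0 := by exact_mod_cast h.ne_zero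
    push_cast; field_simp
  refine ⟨IsChart.of_hasDerivAt hQ (fun u hu => (hder u hu).differentiableAt.differentiableWithinAt)
    (fun u hu => ?_) (fun u hu => ?_), fun u hu => (hder u hu).deriv⟩
  · have h1 := (h.hasDerivAt _ (e.map_target (hQ2 u hu))).1.differentiableAt
    refine DifferentiableAt.const_mul (DifferentiableAt.cpow_const (h1.div_const θ) ?_) κ
    rw [e.right_inv (hQ2 u hu), mul_div_cancel_left₀ _ hθ]
    exact (cpow_two_div_cpow h.one_le (hQ1 u hu)).1
  · simp only [sectorMap]
    rw [e.right_inv (hQ2 u hu), mul_div_cancel_left₀ _ hθ, (cpow_two_div_cpow h.one_le (hQ1 u hu)).2,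
      mul_div_cancel₀ _ hκ]

/-- With `w = θ (u/κ)^(2/N)` the condition `θ^N = κ²` gives `w^N = u²`, so the differential `(N²/4)
w^(N-2) dw²` becomes `du²` and the field becomes `±1`. The choice `κ = 1` gives the sector around a
ray `w^N > 0`; `κ = I` gives a two-sided neighbourhood of a ray `w^N < 0`, which becomes the
positive imaginary axis. -/
theorem exists_flat_sector [IsFiniteMeasure ν] (h : IsNormalChart ν σ g N z₀ e) {θ κ : ℂ}
    (hθ : θ ≠ 0) (hκ : κ ≠ 0) (hθκ : θ ^ N = κ ^ 2)
    {Q : Set ℂ} (hQ : IsOpen Q) (hQ1 : ∀ u ∈ Q, 0 < (u / κ).re)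
    (hQ2 : ∀ u ∈ Q, θ * (u / κ) ^ ((2 / N : ℝ) : ℂ) ∈ e.target) :
    ∃ (s τ : ℂ → ℝ) (M : Measure ℂ), IsFiniteMeasure M ∧ IsFlatSystem Q s τ M ∧
      (∀ᵐ u, u ∈ Q → (s u : ℂ) = g (sectorMap e N θ κ u) * deriv (sectorMap e N θ κ) u) ∧
      ∀ S, MeasurableSet S → S ⊆ Q → M S = ν (sectorMap e N θ κ '' S) := by
  obtain ⟨hc, hd⟩ := h.isChart_sector hθ hκ hQ hQ1 hQ2
  have himg : sectorMap e N θ κ '' Q ⊆ e.source := by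
    rintro _ ⟨u, hu, rfl⟩; exact e.map_target (hQ2 u hu)
  refine hc.exists_isFlatSystem h.measurable h.sign h.locallyIntegrable (fun X h1 h2 h3 => h.weak X h1 h2 (h3.trans himg)) ?_
  filter_upwards [hc.ae_comp (h.sq_eq.mono fun z hz hz' => hz (himg hz'))] with u h1 h2
  have h3 := h1 h2
  rw [hd u h2]; have hey : e (sectorMap e N θ κ u) = θ * (u / κ) ^ ((2 / N : ℝ) : ℂ) :=
    e.right_inv (hQ2 u h2)
  have hyN : e (sectorMap e N θ κ u) ^ N = u ^ 2 := by
    rw [hey, mul_pow, cpow_two_div_pow h.one_le, hθκ, div_pow, mul_div_cancel₀ _ (pow_ne_zero 2 hκ)]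
  rw [hyN] at h3; have hd0 := (h.hasDerivAt _ (himg (mem_image_of_mem _ h2))).2
  have h0 : u ≠ 0 := by rintro rfl; have := hQ1 0 h2; simp at this
  have hN0 : (N:ℂ) ≠ 0 := by exact_mod_cast h.ne_zero
  field_simp; linear_combination -h3

theorem exists_radius (h : IsNormalChart ν σ g N z₀ e) : ∃ R > 0, ∀ θ u : ℂ,
    ‖θ‖ = 1 → ‖u‖ < R → θ * u ^ ((2 / N : ℝ) : ℂ) ∈ e.target := by
  have h1 : e.target ∈ 𝓝 0 := by
    rw [← h.map_zero]; exact e.open_target.mem_nhds (e.map_source h.mem)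
  obtain ⟨r, hr, hr1⟩ := Metric.mem_nhds_iff.1 h1; have hN' : (0:ℝ) < N := by exact_mod_cast h.one_le
  refine ⟨r ^ ((N:ℝ) / 2), by positivity, fun θ u hθ hu => hr1 ?_⟩
  rw [mem_ball_zero_iff, norm_mul, hθ, one_mul, norm_cpow_real]
  calc ‖u‖ ^ ((2:ℝ) / N) < (r ^ ((N:ℝ) / 2)) ^ ((2:ℝ) / N) :=
        rpow_lt_rpow (norm_nonneg _) hu (by positivity)
    _ = r := by rw [← rpow_mul hr.le]; field_simp; simp

/-- In the sectors where the quadratic differential is not negative there is no mass, and the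
field has a constant sign. -/
theorem exists_sector [IsFiniteMeasure ν] (h : IsNormalChart ν σ g N z₀ e) {θ : ℂ}
    (hθ : θ ^ N = 1) :
    ∃ δ > 0, ∃ s : ℝ, (s = 1 ∨ s = -1) ∧
      IsChart (openBox 0 δ (-δ) δ) (sectorMap e N θ 1)
        (fun z => 1 * (e z / θ) ^ ((N / 2 : ℝ) : ℂ)) ∧
      (∀ u ∈ openBox 0 δ (-δ) δ, sectorMap e N θ 1 u ∈ e.source) ∧
      ν (sectorMap e N θ 1 '' openBox 0 δ (-δ) δ) = 0 ∧
      ∀ᵐ u, u ∈ openBox 0 δ (-δ) δ →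
        g (sectorMap e N θ 1 u) * deriv (sectorMap e N θ 1) u = s := by
  have hθ1 := norm_eq_one_of_pow_eq_one hθ h.ne_zero
  have hθ0 : θ ≠ 0 := by rintro rfl; simp at hθ1
  obtain ⟨R, hR, hRe⟩ := h.exists_radius
  have hb : ∀ δ ≤ R / 2, 0 < δ → ∀ u ∈ openBox 0 δ (-(R / 2)) (R / 2), 0 < (u / 1).re ∧
      θ * (u / 1) ^ ((2 / N : ℝ) : ℂ) ∈ e.target := fun δ hδ hδ0 u hu => by
    rw [div_one]; exact ⟨hu.1, hRe θ u hθ1 (norm_lt_of_mem_openBox hu)⟩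
  obtain ⟨s, τ, M, hM, hf, hs, hMS⟩ := h.exists_flat_sector hθ0 one_ne_zero
    (by rw [hθ, one_pow]) (isOpen_openBox 0 (R / 2) (-(R / 2)) (R / 2))
    (fun u hu => (hb _ le_rfl (by positivity) u hu).1)
    (fun u hu => (hb _ le_rfl (by positivity) u hu).2)
  -- Rigidity compares the mass with the height of the box, here `R`. The height is kept while the
  -- width shrinks, so thinness alone makes the mass small enough.
  obtain ⟨δ', hδ', hδM, -⟩ := exists_openBox_measure_lt M (-(R/2)) (R/2) (ε := R / π)
    (by positivity)
  set δ := min δ' (R / 2) with hδ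
  have hδ0 : 0 < δ := lt_min hδ' (by positivity)
  have hsub : openBox 0 δ (-(R / 2)) (R / 2) ⊆ openBox 0 (R / 2) (-(R / 2)) (R / 2) :=
    fun u hu => ⟨hu.1, hu.2.1.trans_le (min_le_right _ _), hu.2.2⟩
  have hsub2 : openBox 0 δ (-δ) δ ⊆ openBox 0 δ (-(R / 2)) (R / 2) :=
    fun u hu => ⟨hu.1, hu.2.1, lt_of_le_of_lt (neg_le_neg (min_le_right _ _)) hu.2.2.1,
      hu.2.2.2.trans_le (min_le_right _ _)⟩
  have hf' := hf.mono (isOpen_openBox 0 δ (-(R / 2)) (R / 2)) hsub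
  have hlt : π * M.real (openBox 0 δ (-(R / 2)) (R / 2)) < R / 2 - -(R / 2) := by
    have h1 : M.real (openBox 0 δ (-(R / 2)) (R / 2)) < R / π :=
      (measureReal_mono (fun u (hu : u ∈ openBox _ _ _ _) => show u ∈ openBox _ _ _ _ from ⟨hu.1, hu.2.1.trans_le (min_le_left _ _), hu.2.2⟩)).trans_lt hδM
    rw [lt_div_iff₀ pi_pos] at h1; linarith
  obtain ⟨c, hc, hsc⟩ := hf'.ae_const hlt; have hM0 := hf'.measure_eq_zero_of_ae_eq hsc
  refine ⟨δ, hδ0, c, hc, ?_, fun u hu => ?_, ?_, ?_⟩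
  · exact (h.isChart_sector hθ0 one_ne_zero (isOpen_openBox _ _ _ _)
      (fun u hu => (hb _ le_rfl (by positivity) u (hsub (hsub2 hu))).1)
      (fun u hu => (hb _ le_rfl (by positivity) u (hsub (hsub2 hu))).2)).1
  · exact e.map_target (hb _ le_rfl (by positivity) u (hsub (hsub2 hu))).2
  · rw [← hMS _ (isOpen_openBox _ _ _ _).measurableSet (hsub2.trans hsub)]
    exact measure_mono_null hsub2 hM0
  · filter_upwards [hs, hsc] with u h1 h2 h3
    rw [← h1 (hsub (hsub2 h3)), h2 (hsub2 h3)]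

/-- On the rays where the quadratic differential is negative the mass is dominated by length. -/
theorem exists_ray [IsFiniteMeasure ν] (h : IsNormalChart ν σ g N z₀ e) {θ : ℂ}
    (hθ : θ ^ N = -1) :
    ∃ δ > 0, IsOpen (sectorMap e N θ I '' openBox (-δ) δ 0 δ) ∧
      (∀ η ∈ Ioo (0:ℝ) δ, θ * (η:ℂ) ^ ((2 / N : ℝ) : ℂ) ∈ e.target) ∧
      ∀ T, MeasurableSet T → ν (T ∩ sectorMap e N θ I '' openBox (-δ) δ 0 δ) ≤
        volume {η ∈ Ioo (0:ℝ) δ | e.symm (θ * (η:ℂ) ^ ((2 / N : ℝ) : ℂ)) ∈ T} := by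
  have hθ1 := norm_eq_one_of_pow_eq_neg_one h.ne_zero hθ
  have hθ0 : θ ≠ 0 := by rintro rfl; simp at hθ1
  obtain ⟨R, hR, hRe⟩ := h.exists_radius; have hdI : ∀ u : ℂ, (u / I).re = u.im := fun u => by
    rw [div_I]; simp
  have hb : ∀ u ∈ openBox (-(R / 2)) (R / 2) 0 (R / 2), 0 < (u / I).re ∧
      θ * (u / I) ^ ((2 / N : ℝ) : ℂ) ∈ e.target := fun u hu => by
    refine ⟨by rw [hdI]; exact hu.2.2.1, hRe θ _ hθ1 ?_⟩
    rw [norm_div, norm_I, div_one]; exact norm_lt_of_mem_openBox hu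
  obtain ⟨s, τ, M, hM, hf, hs, hMS⟩ := h.exists_flat_sector hθ0 I_ne_zero
    (by rw [hθ, I_sq]) (isOpen_openBox (-(R / 2)) (R / 2) 0 (R / 2))
    (fun u hu => (hb u hu).1) (fun u hu => (hb u hu).2)
  -- Only the thin boxes on the two sides of the ray need small mass; each gets a constant sign. The
  -- mass on the ray itself is then controlled by the jump between them.
  obtain ⟨δ', hδ', hδM, hδM'⟩ := exists_openBox_measure_lt M 0 (R/2) (ε := R / 2 / π)
    (by positivity)
  set δ := min δ' (R / 2) with hδ
  have hδ0 : 0 < δ := lt_min hδ' (by positivity)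
  have hδR : δ ≤ R / 2 := min_le_right _ _
  have hδδ : δ ≤ δ' := min_le_left _ _
  have hsub : openBox 0 δ 0 (R / 2) ⊆ openBox (-(R / 2)) (R / 2) 0 (R / 2) :=
    fun u hu => ⟨by linarith [hu.1], hu.2.1.trans_le hδR, hu.2.2⟩
  have hsub' : openBox (-δ) 0 0 (R / 2) ⊆ openBox (-(R / 2)) (R / 2) 0 (R / 2) :=
    fun u hu => ⟨by linarith [hu.1], by linarith [hu.2.1], hu.2.2⟩
  have hsub2 : openBox (-δ) δ 0 δ ⊆ openBox (-(R / 2)) (R / 2) 0 (R / 2) :=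
    fun u hu => ⟨by linarith [hu.1], by linarith [hu.2.1], hu.2.2.1, by linarith [hu.2.2.2]⟩
  have hlt : π * M.real (openBox 0 δ 0 (R / 2)) < R / 2 - 0 := by
    have h1 := (measureReal_mono (fun u (hu : u ∈ openBox _ _ _ _) => show u ∈ openBox _ _ _ _ from ⟨hu.1, hu.2.1.trans_le hδδ, hu.2.2⟩)).trans_lt hδM
    rw [lt_div_iff₀ pi_pos] at h1; linarith
  have hlt' : π * M.real (openBox (-δ) 0 0 (R / 2)) < R / 2 - 0 := by
    have h1 : M.real (openBox (-δ) 0 0 (R / 2)) < R / 2 / π :=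
      (measureReal_mono (fun u (hu : u ∈ openBox _ _ _ _) => show u ∈ openBox _ _ _ _ from ⟨by linarith [hu.1], hu.2⟩)).trans_lt hδM'
    rw [lt_div_iff₀ pi_pos] at h1; linarith
  obtain ⟨c, hc, hsc⟩ := (hf.mono (isOpen_openBox _ _ _ _) hsub).ae_const hlt
  obtain ⟨c', hc', hsc'⟩ := (hf.mono (isOpen_openBox _ _ _ _) hsub').ae_const hlt'
  have habs : ∀ x : ℝ, (x = 1 ∨ x = -1) → |x| ≤ 1 := by rintro x (rfl | rfl) <;> simp
  have hle := fun S hS hSQ => (hf.mono (isOpen_openBox _ _ _ _) hsub2).measure_le_axisMeasure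
    (habs c' hc') (habs c hc) (by
      filter_upwards [hsc'] with u h1 h2 h3
      exact h1 ⟨h2.1, h3, h2.2.2.1, h2.2.2.2.trans_le hδR⟩) (by
      filter_upwards [hsc] with u h1 h2 h3
      exact h1 ⟨h3, h2.2.1, h2.2.2.1, h2.2.2.2.trans_le hδR⟩) (S := S) hS hSQ
  obtain ⟨hch, -⟩ := h.isChart_sector hθ0 I_ne_zero (isOpen_openBox (-δ) δ 0 δ)
    (fun u hu => (hb u (hsub2 hu)).1) (fun u hu => (hb u (hsub2 hu)).2)
  refine ⟨δ, hδ0, hch.isOpen_image, fun η hη => ?_, fun T hT => ?_⟩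
  · refine hRe θ η hθ1 ?_; rw [norm_real, norm_of_nonneg hη.1.le]; linarith [hη.2]
  · classical
    set Q := openBox (-δ) δ 0 δ with hQ
    have hQm := hch.isOpen.measurableSet
    set S := Q ∩ (Q.piecewise (sectorMap e N θ I) fun _ => 0) ⁻¹' T with hS
    have hSm : MeasurableSet S := hQm.inter ((hch.differentiableOn.continuousOn.measurable_piecewise
      continuousOn_const hQm) hT)
    have hSmem : ∀ u, u ∈ S ↔ u ∈ Q ∧ sectorMap e N θ I u ∈ T := fun u => by
      simp only [hS, mem_inter_iff, mem_preimage]; refine and_congr_right fun hu => ?_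
      rw [piecewise_eq_of_mem _ _ _ hu]
    have himg : T ∩ sectorMap e N θ I '' Q = sectorMap e N θ I '' S := by
      ext z; constructor
      · rintro ⟨h1, u, h2, rfl⟩; exact ⟨u, (hSmem u).2 ⟨h2, h1⟩, rfl⟩
      · rintro ⟨u, h1, rfl⟩; exact ⟨((hSmem u).1 h1).2, u, ((hSmem u).1 h1).1, rfl⟩
    rw [himg, ← hMS S hSm (inter_subset_left.trans hsub2)]
    refine (hle S hSm inter_subset_left).trans ?_
    have hIm : Measurable fun η : ℝ => (η * I : ℂ) := by fun_prop
    rw [axisMeasure, Measure.map_apply hIm hSm, Measure.restrict_apply (hIm hSm)]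
    refine measure_mono ?_; rintro η ⟨h1, h2⟩; refine ⟨h2, ?_⟩; have h3 := ((hSmem _).1 h1).2
    rwa [sectorMap, mul_div_cancel_right₀ _ I_ne_zero] at h3

end IsNormalChart

end

/-! ### Bounded density of the mass and continuity of the potential -/

theorem exists_sector_coord {N : ℕ} (hN : 1 ≤ N) {w : ℂ} (hw : w ≠ 0)
    (hre : 0 < ((w ^ N) ^ (1 / 2 : ℂ)).re) : ∃ θ : ℂ, θ ^ N = 1 ∧
      w = θ * ((w ^ N) ^ (1 / 2 : ℂ)) ^ ((2 / N : ℝ) : ℂ) := by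
  set u := (w ^ N) ^ (1 / 2 : ℂ) with hu
  have h0 : u ≠ 0 := by intro h; rw [h] at hre; simp at hre
  have h2 : u ^ 2 = w ^ N := by
    rw [hu, ← cpow_nat_mul]; simp
  have hz : u ^ ((2 / N : ℝ) : ℂ) ≠ 0 := by
    rw [cpow_def_of_ne_zero h0]; exact exp_ne_zero _
  refine ⟨w / u ^ ((2 / N : ℝ) : ℂ), ?_, (div_mul_cancel₀ _ hz).symm⟩
  rw [div_pow, cpow_two_div_pow hN, h2, div_self (pow_ne_zero _ hw)]

theorem sqrt_re_nonneg (v : ℂ) : 0 ≤ (v ^ (1 / 2 : ℂ)).re := by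
  by_cases h0 : v = 0
  · simp [h0]
  have h2 : |(v ^ (1 / 2 : ℂ)).arg| ≤ π / 2 := by
    have h3 : (log v * (1 / 2)).im = v.arg / 2 := by
      rw [show (1 / 2 : ℂ) = ((1 / 2 : ℝ) : ℂ) by push_cast; rfl, im_mul_ofReal,
        log_im]; ring
    have h4 := abs_arg_le_pi v
    have h4' := neg_pi_lt_arg v
    have h5 := abs_le.1 h4
    have hp := pi_pos
    rw [← log_im, cpow_def_of_ne_zero h0, log_exp
      (by rw [h3]; linarith) (by rw [h3]; linarith), h3, abs_le]
    constructor <;> linarith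
  exact abs_arg_le_pi_div_two_iff.1 h2

theorem pow_eq_neg_of_sqrt_re_eq_zero {v : ℂ} (h : (v ^ (1 / 2 : ℂ)).re = 0) : v = -(‖v‖ : ℂ) := by
  have h2 : (v ^ (1 / 2 : ℂ)) ^ 2 = v := by
    rw [← cpow_nat_mul]; simp
  set u := v ^ (1 / 2 : ℂ) with hu
  have h3 : u = u.im * I := by
    apply Complex.ext <;> simp [h]
  rw [← h2, norm_pow, h3, mul_pow, I_sq, norm_mul, norm_I, mul_one,
    norm_real, norm_eq_abs]
  push_cast [← ofReal_pow, sq_abs]; ring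

theorem rpow_half_sq {x : ℝ} (hx : 0 ≤ x) (N : ℕ) : (x ^ ((N:ℝ) / 2)) ^ 2 = x ^ N := by
  rw [← rpow_natCast (x ^ ((N:ℝ) / 2)), ← rpow_mul hx]
  have : (N:ℝ) / 2 * ((2:ℕ):ℝ) = N := by push_cast; ring
  rw [this, rpow_natCast]

theorem norm_sqrt_pow (w : ℂ) (N : ℕ) : ‖(w ^ N) ^ (1 / 2 : ℂ)‖ = ‖w‖ ^ ((N:ℝ) / 2) := by
  rw [show (1 / 2 : ℂ) = ((1 / 2 : ℝ) : ℂ) by push_cast; rfl, norm_cpow_real, norm_pow,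
    ← rpow_natCast, ← rpow_mul (norm_nonneg _)]
  ring_nf

theorem finite_setOf_pow_eq {N : ℕ} (hN : 1 ≤ N) (c : ℂ) : {θ : ℂ | θ ^ N = c}.Finite := by
  refine (Multiset.finite_toSet (Polynomial.nthRoots N c)).subset fun θ hθ => ?_
  exact (Polynomial.mem_nthRoots (by omega)).2 hθ

theorem ne_of_pos_of_notMem_support {ν : Measure ℂ} {U : Set ℂ} (hU : IsOpen U) (h : ν U = 0)
    {z : ℂ} (hz : z ∈ U) : z ∉ ν.support := by
  rw [Measure.notMem_support_iff_exists]; exact ⟨U, hU.mem_nhds hz, h⟩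

/-- A point near `z₀` with `Re √(e^N) > 0` lies in one of the finitely many sectors `θ^N = 1`, which
carry no mass; any other point except `z₀` lies on one of the finitely many rays `θ^N = -1`, where
the mass is at most length in the flat coordinate `|e|^(N/2)`. The constant `K` is the number of
these rays. -/
theorem IsNormalChart.exists_density {ν : Measure ℂ} [IsFiniteMeasure ν] {σ : ℂ → ℝ} {g : ℂ → ℂ}
    {N : ℕ} {z₀ : ℂ} {e : OpenPartialHomeomorph ℂ ℂ} (h : IsNormalChart ν σ g N z₀ e)
    (hpt : ν {z₀} = 0) :
    ∃ V : Set ℂ, IsOpen V ∧ z₀ ∈ V ∧ V ⊆ e.source ∧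
      (∀ x ∈ V, 0 < ((e x ^ N) ^ (1 / 2 : ℂ)).re → x ∉ ν.support) ∧
      ∃ K : ℕ, ∀ S : Set ℝ, MeasurableSet S →
        ν (V ∩ {x | ‖e x‖ ^ ((N:ℝ) / 2) ∈ S}) ≤ K * volume S := by
  classical
  set Ωp := (finite_setOf_pow_eq h.one_le 1).toFinset with hΩp
  set Ωn := (finite_setOf_pow_eq h.one_le (-1)).toFinset with hΩn
  have hsec : ∀ θ : ℂ, ∃ δ > 0, θ ∈ Ωp → ∀ u ∈ openBox 0 δ (-δ) δ,
      sectorMap e N θ 1 u ∉ ν.support := by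
    intro θ; by_cases hθ : θ ∈ Ωp
    · obtain ⟨δ, hδ, s, -, h1, -, h2, -⟩ := h.exists_sector (θ := θ) (by simpa [hΩp] using hθ)
      exact ⟨δ, hδ, fun _ u hu => ne_of_pos_of_notMem_support h1.isOpen_image h2
        (mem_image_of_mem _ hu)⟩
    · exact ⟨1, one_pos, fun h => absurd h hθ⟩
  have hray : ∀ θ : ℂ, ∃ δ > 0, θ ∈ Ωn → IsOpen (sectorMap e N θ I '' openBox (-δ) δ 0 δ) ∧
      (∀ η ∈ Ioo (0:ℝ) δ, θ * (η:ℂ) ^ ((2 / N : ℝ) : ℂ) ∈ e.target) ∧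
      ∀ T, MeasurableSet T → ν (T ∩ sectorMap e N θ I '' openBox (-δ) δ 0 δ) ≤
        volume {η ∈ Ioo (0:ℝ) δ | e.symm (θ * (η:ℂ) ^ ((2 / N : ℝ) : ℂ)) ∈ T} := by
    intro θ; by_cases hθ : θ ∈ Ωn
    · obtain ⟨δ, hδ, h1⟩ := h.exists_ray (θ := θ) (by simpa [hΩn] using hθ)
      exact ⟨δ, hδ, fun _ => h1⟩
    · exact ⟨1, one_pos, fun h => absurd h hθ⟩
  choose δ₁ hδ₁ hsec using hsec
  choose δ₂ hδ₂ hray using hray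
  set F : ℂ → ℝ := fun x => ‖e x‖ ^ ((N:ℝ) / 2) with hF
  have hNpos : (0:ℝ) < (N:ℝ) / 2 := by have : (0:ℝ) < N := by exact_mod_cast h.one_le
                                       positivity
  have hec := e.continuousOn
  have hFc := (hec.norm).rpow_const fun x _ => Or.inr hNpos.le
  have hF0 : F z₀ = 0 := by simp only [hF, h.map_zero, norm_zero]; exact zero_rpow hNpos.ne'
  have hFat : ContinuousAt F z₀ := hFc.continuousAt (e.open_source.mem_nhds h.mem)
  have hev : ∀ᶠ x in 𝓝 z₀, x ∈ e.source ∧ (∀ θ ∈ Ωp, F x < δ₁ θ) ∧ ∀ θ ∈ Ωn, F x < δ₂ θ := by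
    refine (eventually_mem_set.2 (e.open_source.mem_nhds h.mem)).and (Eventually.and ?_ ?_)
    · refine (Filter.eventually_all_finset Ωp).2 fun θ _ => ?_
      exact hFat.eventually (gt_mem_nhds (by rw [hF0]; exact hδ₁ θ))
    · refine (Filter.eventually_all_finset Ωn).2 fun θ _ => ?_
      exact hFat.eventually (gt_mem_nhds (by rw [hF0]; exact hδ₂ θ))
  obtain ⟨V, hV, hVo, hzV⟩ := _root_.eventually_nhds_iff.1 hev
  have hsupp : ∀ x ∈ V, 0 < ((e x ^ N) ^ (1 / 2 : ℂ)).re → x ∉ ν.support := by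
    intro x hx hre; obtain ⟨hxs, hx1, -⟩ := hV x hx; have hne : e x ≠ 0 := by
      intro h0; rw [h0, zero_pow h.ne_zero] at hre
      simp at hre
    obtain ⟨θ, hθ, he⟩ := exists_sector_coord h.one_le hne hre
    have hθΩ : θ ∈ Ωp := by simpa [hΩp] using hθ
    set u := (e x ^ N) ^ (1 / 2 : ℂ) with hu
    have hn : ‖u‖ < δ₁ θ := by rw [hu, norm_sqrt_pow]; exact hx1 θ hθΩ
    have hr := (abs_re_le_norm u).trans_lt hn
    have hi := (abs_im_le_norm u).trans_lt hn
    rw [abs_lt] at hr hi; have := hsec θ hθΩ u ⟨hre, hr.2, hi.1, hi.2⟩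
    rwa [sectorMap, div_one, ← he, e.left_inv hxs] at this
  refine ⟨V, hVo, hzV, fun x hx => (hV x hx).1, hsupp, Ωn.card, fun S hS => ?_⟩
  set T := V ∩ {x | F x ∈ S} with hT
  have hTm : MeasurableSet T := by
    have hFm : Measurable (V.piecewise F fun _ => 0) :=
      (hFc.mono fun x hx => (hV x hx).1).measurable_piecewise continuousOn_const hVo.measurableSet
    have : T = V ∩ (V.piecewise F fun _ => 0) ⁻¹' S := by
      ext x; simp only [hT, mem_inter_iff, mem_ofPred_eq, mem_preimage]
      exact and_congr_right fun hx => by rw [piecewise_eq_of_mem _ _ _ hx]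
    rw [this]; exact hVo.measurableSet.inter (hFm hS)
  have hcover : T ⊆ (ν.support)ᶜ ∪ {z₀} ∪
      ⋃ θ ∈ Ωn, T ∩ sectorMap e N θ I '' openBox (-(δ₂ θ)) (δ₂ θ) 0 (δ₂ θ) := by
    intro x hx; obtain ⟨hxs, -, hx2⟩ := hV x hx.1; by_cases hxν : x ∈ ν.support
    swap
    · exact Or.inl (Or.inl hxν)
    by_cases hx0 : x = z₀
    · exact Or.inl (Or.inr hx0)
    have hne : e x ≠ 0 := fun h0 => hx0 (e.injOn hxs h.mem (h0.trans h.map_zero.symm))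
    have hre := le_antisymm (not_lt.1 fun hlt => hsupp x hx.1 hlt hxν) (sqrt_re_nonneg _)
    have hneg := pow_eq_neg_of_sqrt_re_eq_zero hre
    have hn0 : (‖e x‖ : ℂ) ≠ 0 := by simpa using hne
    set θ := e x / ‖e x‖ with hθ
    have hθN : θ ^ N = -1 := by
      rw [hθ, div_pow, hneg, norm_pow]; push_cast; rw [neg_div, div_self (pow_ne_zero _ hn0)]
    have hθΩ : θ ∈ Ωn := by simpa [hΩn] using hθN
    refine Or.inr (mem_iUnion₂.2 ⟨θ, hθΩ, hx, F x * I, ?_, ?_⟩)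
    · have hFx : 0 < F x := rpow_pos_of_pos (norm_pos_iff.2 hne) _
      have := hδ₂ θ
      refine ⟨by simpa using this, by simpa using this, by simpa using hFx, by simpa using hx2 θ hθΩ⟩
    · rw [sectorMap, mul_div_cancel_right₀ _ I_ne_zero, ← ofReal_cpow (by positivity)]
      have : F x ^ ((2:ℝ) / N) = ‖e x‖ := by
        rw [hF, ← rpow_mul (norm_nonneg _)]
        have : (N:ℝ) ≠ 0 := by exact_mod_cast h.ne_zero
        field_simp; simp
      rw [this, hθ, div_mul_cancel₀ _ hn0, e.left_inv hxs]
  have h0 := measure_union_null (Measure.measure_compl_support) hpt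
  calc ν T ≤ ν ((ν.support)ᶜ ∪ {z₀}) + ν (⋃ θ ∈ Ωn, T ∩ sectorMap e N θ I ''
          openBox (-(δ₂ θ)) (δ₂ θ) 0 (δ₂ θ)) := (measure_mono hcover).trans (measure_union_le _ _)
    _ ≤ 0 + ∑ θ ∈ Ωn, ν (T ∩ sectorMap e N θ I '' openBox (-(δ₂ θ)) (δ₂ θ) 0 (δ₂ θ)) :=
        add_le_add h0.le (measure_biUnion_finset_le _ _)
    _ ≤ ∑ θ ∈ Ωn, volume S := by
        rw [zero_add]; refine Finset.sum_le_sum fun θ hθ => ?_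
        obtain ⟨-, r2, r3⟩ := hray θ hθ; refine (r3 T hTm).trans (measure_mono ?_)
        rintro η ⟨hη, hηT⟩; have h2 : F (e.symm (θ * (η:ℂ) ^ ((2 / N : ℝ) : ℂ))) ∈ S := hηT.2
        have hθ1 := norm_eq_one_of_pow_eq_neg_one h.ne_zero (by simpa [hΩn] using hθ)
        simp only [hF] at h2
        rw [e.right_inv (r2 η hη), norm_mul, hθ1, one_mul, norm_cpow_real, norm_real,
          norm_of_nonneg hη.1.le, ← rpow_mul hη.1.le] at h2
        have : (N:ℝ) ≠ 0 := by exact_mod_cast h.ne_zero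
        rwa [show (2:ℝ) / N * (N / 2) = 1 by field_simp, rpow_one] at h2
    _ = Ωn.card * volume S := by rw [Finset.sum_const, nsmul_eq_mul]

/-- The bound does not depend on `a`: where `|a - η| ≥ D` the integrand is at most `D^(-1/2)`,
contributing `√D`, and the singularity integrated over `(-D, D]` contributes `4√D`. -/
theorem lintegral_inv_sqrt_abs_sub_le (a : ℝ) {D : ℝ} (hD : 0 < D) :
    ∫⁻ η in Icc 0 D, ennr (|a - η| ^ (-(1 / 2) : ℝ)) ≤ ennr (5 * √D) := by
  have hloc : ∫⁻ u in Ioc (-D) D, ennr (|u| ^ (-(1 / 2) : ℝ)) = ennr (4 * √D) := by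
    have h1 : ∫⁻ u in Ioc 0 D, ennr (|u| ^ (-(1 / 2) : ℝ)) = ennr (2 * √D) := by
      have h2 : IntervalIntegrable (fun u : ℝ => u ^ (-(1 / 2) : ℝ)) volume 0 D :=
        intervalIntegral.intervalIntegrable_rpow' (by norm_num)
      rw [intervalIntegrable_iff_integrableOn_Ioc_of_le hD.le] at h2
      rw [setLIntegral_congr_fun (g := fun u => ennr (u ^ (-(1 / 2) : ℝ))) measurableSet_Ioc
        (fun u hu => by simp only [abs_of_pos hu.1]),
        ← ofReal_integral_eq_lintegral_ofReal h2 ((ae_restrict_iff' measurableSet_Ioc).2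
          (ae_of_all _ fun u hu => rpow_nonneg hu.1.le _)),
        ← intervalIntegral.integral_of_le hD.le, integral_rpow (Or.inl (by norm_num))]
      congr 1; rw [sqrt_eq_rpow, zero_rpow (by norm_num)]
      norm_num; ring
    have h3 : ∫⁻ u in Ioc (-D) 0, ennr (|u| ^ (-(1 / 2) : ℝ)) = ennr (2 * √D) := by
      rw [← h1, setLIntegral_congr ((Ioo_ae_eq_Ioc (μ := volume) (a := -D) (b := (0:ℝ))).symm.trans Ioo_ae_eq_Ico),
        ← (Measure.measurePreserving_neg (volume : Measure ℝ)).setLIntegral_comp_preimage_emb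
          (MeasurableEquiv.neg ℝ).measurableEmbedding]
      simp
    rw [← Ioc_union_Ioc_eq_Ioc (b := 0) (by linarith) hD.le,
      lintegral_union measurableSet_Ioc (Ioc_disjoint_Ioc_of_le le_rfl), h1, h3,
      ← ennr_add (by positivity) (by positivity)]
    ring_nf
  have hpt : ∀ η : ℝ, ennr (|a - η| ^ (-(1 / 2) : ℝ)) ≤ ennr (D ^ (-(1 / 2) : ℝ)) +
      (Ioc (-D) D).indicator (fun u => ennr (|u| ^ (-(1 / 2) : ℝ))) (η - a) := by
    intro η; rw [abs_sub_comm]; by_cases h : η - a ∈ Ioc (-D) D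
    · rw [indicator_of_mem h]; exact le_add_self
    · rw [indicator_of_notMem h, add_zero]
      refine ofReal_le_ofReal (rpow_le_rpow_of_nonpos hD ?_ (by norm_num))
      rw [le_abs]; by_contra! h2; exact h ⟨by linarith, h2.1.le⟩
  calc ∫⁻ η in Icc 0 D, ennr (|a - η| ^ (-(1 / 2) : ℝ))
      ≤ ∫⁻ η in Icc 0 D, (ennr (D ^ (-(1 / 2) : ℝ)) +
      (Ioc (-D) D).indicator (fun u => ennr (|u| ^ (-(1 / 2) : ℝ))) (η - a)) :=
        lintegral_mono hpt
    _ = ennr (√D) + ∫⁻ η in Icc 0 D, (Ioc (-D) D).indicator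
          (fun u => ennr (|u| ^ (-(1 / 2) : ℝ))) (η - a) := by
        rw [lintegral_add_left measurable_const, setLIntegral_const, volume_Icc, sub_zero,
          ← ennr_mul (by positivity)]
        congr 2; rw [sqrt_eq_rpow]; nth_rewrite 2 [← rpow_one D]
        rw [← rpow_add hD]; norm_num
    _ ≤ ennr (√D) + ennr (4 * √D) := by
        gcongr; refine (setLIntegral_le_lintegral _ _).trans ?_
        rw [lintegral_sub_right_eq_self (fun u => (Ioc (-D) D).indicator
          (fun u => ennr (|u| ^ (-(1 / 2) : ℝ))) u) a, lintegral_indicator measurableSet_Ioc,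
          hloc]
    _ = _ := by rw [← ennr_add (by positivity) (by positivity)]; ring_nf

/-- It is applied with `s` proportional to the square of a difference of flat coordinates; the
exponent `1/4` then becomes `1/2`, which is integrable on the line. -/
theorem abs_log_le_rpow {t s : ℝ} (hs : 0 < s) (hst : s ≤ t) (ht : t ≤ 1) :
    |Real.log t| ≤ 4 * s ^ (-(1 / 4) : ℝ) := by
  have ht0 := hs.trans_le hst
  rw [abs_of_nonpos (log_nonpos ht0.le ht), ← Real.log_inv]
  calc Real.log t⁻¹ ≤ t⁻¹ ^ (1 / 4 : ℝ) / (1 / 4) :=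
        log_le_rpow_div (by positivity) (by norm_num)
    _ = 4 * t ^ (-(1 / 4) : ℝ) := by
        rw [inv_rpow ht0.le, ← rpow_neg ht0.le]; ring
    _ ≤ _ := by
        gcongr 4 * ?_; exact rpow_le_rpow_of_nonpos hs hst (by norm_num)

/-- Push `ν` forward by `F = |e|^(N/2)`; the image has density at most `K`. Since `|F z - F x|² ≤ |F
z² - F x²| = ||e z|^N - |e x|^N| ≤ N L |z - x|`, the logarithm is dominated by a multiple of `|F z -
F x|^(-1/2)`, whose integral over a short interval is small uniformly in `z`. This uniform smallness
is what makes the potential continuous. -/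
theorem IsNormalChart.exists_log_small {ν : Measure ℂ} [IsFiniteMeasure ν] {σ : ℂ → ℝ} {g : ℂ → ℂ}
    {N : ℕ} {z₀ : ℂ} {e : OpenPartialHomeomorph ℂ ℂ} (h : IsNormalChart ν σ g N z₀ e)
    (hpt : ν {z₀} = 0) {η : ℝ} (hη : 0 < η) :
    ∃ ε > 0, ∀ z ∈ ball z₀ ε,
      ∫⁻ x in ball z₀ ε, ‖Real.log ‖z - x‖‖ₑ ∂ν ≤ ennr η := by
  obtain ⟨V, hVo, hzV, hVs, -, K, hK⟩ := h.exists_density hpt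
  set F : ℂ → ℝ := fun x => ‖e x‖ ^ ((N:ℝ) / 2) with hF
  have hN0 : (0:ℝ) < N := by exact_mod_cast h.one_le
  have hNpos : (0:ℝ) < (N:ℝ) / 2 := by positivity
  have hFc := ((e.continuousOn.mono hVs).norm).rpow_const fun x _ => Or.inr hNpos.le
  have hFm : AEMeasurable F (ν.restrict V) := hFc.aemeasurable hVo.measurableSet
  have hmap : (ν.restrict V).map F ≤ (K : ℝ≥0∞) • volume := by
    refine Measure.le_iff.2 fun S hS => ?_
    rw [Measure.map_apply_of_aemeasurable hFm hS, Measure.restrict_apply' hVo.measurableSet,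
      inter_comm]
    exact hK S hS
  have hstrict := (DifferentiableOn.analyticAt (fun z hz => (h.hasDerivAt z hz).1.differentiableAt.differentiableWithinAt)
      (e.open_source.mem_nhds h.mem)).hasStrictDerivAt
  obtain ⟨L₀, U, hU, hL₀⟩ := hstrict.hasStrictFDerivAt.exists_lipschitzOnWith
  set L : ℝ := L₀ + 1 with hL
  have hLpos : 0 < L := by positivity
  have hlip : ∀ x ∈ U, ∀ y ∈ U, ‖e x - e y‖ ≤ L * ‖x - y‖ := fun x hx y hy => by
    have := hL₀.dist_le_mul x hx y hy
    rw [dist_eq_norm, dist_eq_norm] at this; nlinarith [norm_nonneg (x - y)]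
  obtain ⟨ε₁, hε₁, hball⟩ := Metric.mem_nhds_iff.1 (inter_mem (hVo.mem_nhds hzV) hU)
  set C : ℝ := 4 * (N * L) ^ (1 / 4 : ℝ) with hC
  have hCpos : 0 < C := by positivity
  have hev : ∀ᶠ ε in 𝓝[>] (0:ℝ), K * (C * (5 * √((L * ε) ^ ((N:ℝ) / 2)))) < η ∧ ε < ε₁ ∧ ε < 1 / 2 ∧
      L * ε < 1 := by
    have hc : Continuous fun ε : ℝ => K * (C * (5 * √((L * ε) ^ ((N:ℝ) / 2)))) := by
      have : Continuous fun ε : ℝ => (L * ε) ^ ((N:ℝ) / 2) :=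
        (continuous_const.mul continuous_id).rpow_const fun x => Or.inr hNpos.le
      fun_prop
    have hc2 : Continuous fun ε : ℝ => L * ε := by fun_prop
    refine Eventually.and ?_ (Eventually.and ?_ (Eventually.and ?_ ?_))
    · refine (hc.tendsto 0).mono_left nhdsWithin_le_nhds |>.eventually (gt_mem_nhds ?_)
      simpa [zero_rpow hNpos.ne'] using hη
    · exact nhdsWithin_le_nhds (gt_mem_nhds hε₁)
    · exact nhdsWithin_le_nhds (gt_mem_nhds (by norm_num))
    · refine (hc2.tendsto 0).mono_left nhdsWithin_le_nhds |>.eventually (gt_mem_nhds ?_); simp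
  obtain ⟨ε, ⟨hε2, hε3, hε4, hε5⟩, hε0⟩ := (hev.and self_mem_nhdsWithin).exists
  refine ⟨ε, hε0, fun z hz => ?_⟩
  set D := (L * ε) ^ ((N:ℝ) / 2) with hD
  have hDpos : 0 < D := by positivity
  have hsub := (ball_subset_ball hε3.le).trans hball
  have hnorm : ∀ x ∈ ball z₀ ε, ‖e x‖ ≤ L * ε := fun x hx => by
    have h1 := hlip x (hsub hx).2 z₀ (mem_of_mem_nhds hU)
    rw [h.map_zero, sub_zero] at h1; rw [mem_ball, dist_eq_norm] at hx; nlinarith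
  have hFD : ∀ x ∈ ball z₀ ε, F x ∈ Icc 0 D := fun x hx =>
    ⟨by positivity, rpow_le_rpow (norm_nonneg _) (hnorm x hx) hNpos.le⟩
  set a := F z with ha
  have hpt' : ∀ x ∈ ball z₀ ε, F x ≠ a → ‖Real.log ‖z - x‖‖ₑ ≤
      ennr (C * |a - F x| ^ (-(1 / 2) : ℝ)) := by
    intro x hx hne; have hd := abs_pos.2 (sub_ne_zero.2 hne.symm)
    have h1 : |a - F x| ^ 2 ≤ N * L * ‖z - x‖ := by
      have e1 : |a - F x| ^ 2 ≤ |a ^ 2 - F x ^ 2| := by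
        rw [sq_sub_sq, abs_mul, sq]; have ha0 : 0 ≤ a := by positivity
        have hx0 : 0 ≤ F x := by positivity
        refine mul_le_mul_of_nonneg_right ?_ (abs_nonneg _); rw [abs_of_nonneg (add_nonneg ha0 hx0)]
        exact abs_sub_le_iff.2 ⟨by linarith, by linarith⟩
      have e2 : |a ^ 2 - F x ^ 2| ≤ |‖e z‖ - ‖e x‖| * N * max |‖e z‖| |‖e x‖| ^ (N - 1) := by
        rw [ha, hF]; simp only [rpow_half_sq (norm_nonneg _)]; exact abs_pow_sub_pow_le _ _ _
      have e3 : max |‖e z‖| |‖e x‖| ^ (N - 1) ≤ 1 := by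
        refine pow_le_one₀ (by positivity) (max_le ?_ ?_) <;> rw [abs_norm]
        · exact (hnorm z hz).trans hε5.le
        · exact (hnorm x hx).trans hε5.le
      have e4 := (abs_norm_sub_norm_le _ _).trans (hlip z (hsub hz).2 x (hsub hx).2)
      calc |a - F x| ^ 2 ≤ |‖e z‖ - ‖e x‖| * N * max |‖e z‖| |‖e x‖| ^ (N - 1) := e1.trans e2
        _ ≤ |‖e z‖ - ‖e x‖| * N * 1 := by gcongr
        _ ≤ (L * ‖z - x‖) * N * 1 := by gcongr
        _ = _ := by ring
    have h2 : |a - F x| ^ 2 / (N * L) ≤ ‖z - x‖ := by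
      rw [div_le_iff₀ (by positivity)]; linarith
    have h3 : ‖z - x‖ ≤ 1 := by
      rw [mem_ball, dist_eq_norm] at hx hz; have : ‖z - x‖ ≤ ‖z - z₀‖ + ‖x - z₀‖ := by
        rw [show z - x = (z - z₀) - (x - z₀) by ring]; exact norm_sub_le _ _
      linarith
    have h4 := abs_log_le_rpow (by positivity) h2 h3
    rw [← ofReal_norm, norm_eq_abs]; refine ofReal_le_ofReal (h4.trans (le_of_eq ?_))
    rw [div_rpow (by positivity) (by positivity), ← rpow_natCast, ← rpow_mul hd.le,
      rpow_neg (by positivity : (0:ℝ) ≤ N * L), hC, div_inv_eq_mul]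
    norm_num; ring
  set G : ℝ → ℝ≥0∞ := fun t => (Icc 0 D).indicator
    (fun t => ennr (C * |a - t| ^ (-(1 / 2) : ℝ))) t with hG
  have hGm : Measurable G := Measurable.indicator (by fun_prop) measurableSet_Icc
  have hnull : ∀ᵐ x ∂ν.restrict V, F x ≠ a := by
    have : (ν.restrict V) (F ⁻¹' {a}) = 0 := by
      rw [← Measure.map_apply_of_aemeasurable hFm (measurableSet_singleton a)]
      refine le_antisymm ((hmap {a}).trans ?_) zero_le; simp
    exact measure_eq_zero_iff_ae_notMem.1 this
  calc ∫⁻ x in ball z₀ ε, ‖Real.log ‖z - x‖‖ₑ ∂ν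
      ≤ ∫⁻ x in ball z₀ ε, G (F x) ∂ν := by
        refine setLIntegral_mono_ae' measurableSet_ball ?_
        have h5 := (ae_restrict_iff' hVo.measurableSet).1 hnull
        filter_upwards [h5] with x h6 h7
        rw [hG]; simp only; rw [indicator_of_mem (hFD x h7)]; exact hpt' x h7 (h6 (hsub h7).1)
    _ ≤ ∫⁻ x in V, G (F x) ∂ν := lintegral_mono_set fun x hx => (hsub hx).1
    _ = ∫⁻ t, G t ∂((ν.restrict V).map F) := (lintegral_map' hGm.aemeasurable hFm).symm
    _ ≤ ∫⁻ t, G t ∂((K : ℝ≥0∞) • volume) := lintegral_mono' hmap le_rfl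
    _ = K * ∫⁻ t in Icc 0 D, ennr (C * |a - t| ^ (-(1 / 2) : ℝ)) := by
        rw [lintegral_smul_measure, hG, lintegral_indicator measurableSet_Icc, smul_eq_mul]
    _ = K * (ennr C * ∫⁻ t in Icc 0 D, ennr (|a - t| ^ (-(1 / 2) : ℝ))) := by
        simp only [ennr_mul hCpos.le]; rw [lintegral_const_mul' _ _ ofReal_ne_top]
    _ ≤ K * (ennr C * ennr (5 * √D)) := by
        gcongr; exact lintegral_inv_sqrt_abs_sub_le a hDpos
    _ = ennr (K * (C * (5 * √D))) := by
        rw [← ennr_mul hCpos.le, ennr_mul (Nat.cast_nonneg K),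
          ENNReal.ofReal_natCast]
    _ ≤ ennr η := ofReal_le_ofReal hε2.le

/-- The logarithmic potential of the signed measure `σ ν`. -/
def signedPotential (ν : Measure ℂ) (σ : ℂ → ℝ) (z : ℂ) : ℝ :=
  ∫ x, σ x * Real.log (1 / ‖z - x‖) ∂ν

theorem exists_log_bound_outside {ν : Measure ℂ} [IsFiniteMeasure ν] (hs : IsCompact ν.support)
    (z₀ : ℂ) {ε : ℝ} (hε : 0 < ε) : ∃ B : ℝ, ∀ z ∈ ball z₀ (ε / 2),
      ∀ᵐ x ∂ν.restrict (ball z₀ ε)ᶜ, ‖Real.log (1 / ‖z - x‖)‖ ≤ B := by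
  obtain ⟨R, hR⟩ := (isBounded_iff_subset_ball z₀).1 hs.isBounded
  refine ⟨max (-Real.log (ε / 2)) (Real.log (R + ε)), fun z hz => ?_⟩
  rw [ae_restrict_iff' measurableSet_ball.compl]; filter_upwards [ν.support_mem_ae] with x hx hx2
  have h1 := hR hx
  rw [mem_compl_iff, mem_ball, dist_eq_norm, not_lt] at hx2; rw [mem_ball, dist_eq_norm] at h1 hz
  have h2 : ε / 2 ≤ ‖z - x‖ := by
    have : ‖x - z₀‖ ≤ ‖z - z₀‖ + ‖z - x‖ := by
      rw [show x - z₀ = (z - z₀) - (z - x) by ring]; exact norm_sub_le _ _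
    linarith
  have h3 : ‖z - x‖ ≤ R + ε := by
    have : ‖z - x‖ ≤ ‖z - z₀‖ + ‖x - z₀‖ := by
      rw [show z - x = (z - z₀) - (x - z₀) by ring]; exact norm_sub_le _ _
    linarith
  have h0 : 0 < ‖z - x‖ := by linarith
  rw [one_div, Real.log_inv, norm_neg, norm_eq_abs, abs_le]; constructor
  · have := log_le_log (by positivity) h2
    have := le_max_left (-Real.log (ε / 2)) (Real.log (R + ε))
    linarith
  · exact (log_le_log h0 h3).trans (le_max_right _ _)

/-- The part of the integral near `z₀` is uniformly small by hypothesis, and the part away from `z₀`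
is continuous by dominated convergence. -/
theorem integrable_and_continuousAt_signedPotential {ν : Measure ℂ} [IsFiniteMeasure ν]
    {σ : ℂ → ℝ} (hσ : Measurable σ) (hσ1 : ∀ x, |σ x| = 1) (hs : IsCompact ν.support) {z₀ : ℂ}
    (h : ∀ η > 0, ∃ ε > 0, ∀ z ∈ ball z₀ ε,
      ∫⁻ x in ball z₀ ε, ‖Real.log ‖z - x‖‖ₑ ∂ν ≤ ennr η) :
    Integrable (fun x => Real.log (1 / ‖z₀ - x‖)) ν ∧ ContinuousAt (signedPotential ν σ) z₀ := by
  have hm : ∀ z : ℂ, Measurable fun x => Real.log (1 / ‖z - x‖) := fun z => by fun_prop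
  have hnorm : ∀ z x, ‖σ x * Real.log (1 / ‖z - x‖)‖ = ‖Real.log (1 / ‖z - x‖)‖ := fun z x => by
    rw [norm_mul, norm_eq_abs (σ x), hσ1, one_mul]
  have key : ∀ η > 0, ∃ ε > 0, ∀ z ∈ ball z₀ (ε / 2),
      Integrable (fun x => Real.log (1 / ‖z - x‖)) ν ∧
      |∫ x in ball z₀ ε, σ x * Real.log (1 / ‖z - x‖) ∂ν| ≤ η := by
    intro η hη; obtain ⟨ε, hε, h1⟩ := h η hη; refine ⟨ε, hε, fun z hz => ?_⟩
    have h2 := h1 z (ball_subset_ball (by linarith) hz)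
    have h2' : ∫⁻ x in ball z₀ ε, ‖Real.log (1 / ‖z - x‖)‖ₑ ∂ν ≤ ennr η := by
      simpa only [one_div, Real.log_inv, enorm_neg] using h2
    constructor
    · rw [← integrableOn_univ, ← union_compl_self (ball z₀ ε)]
      refine IntegrableOn.union ⟨(hm z).aestronglyMeasurable, h2'.trans_lt ofReal_lt_top⟩ ?_
      obtain ⟨B, hB⟩ := exists_log_bound_outside hs z₀ hε
      exact Integrable.of_bound (hm z).aestronglyMeasurable B (hB z hz)
    · rw [← norm_eq_abs]
      refine (norm_integral_le_lintegral_norm _).trans (toReal_le_of_le_ofReal hη.le ?_)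
      simpa only [hnorm, ofReal_norm] using h2'
  obtain ⟨ε₀, hε₀, h₀⟩ := key 1 one_pos; refine ⟨(h₀ z₀ (mem_ball_self (by linarith))).1, ?_⟩
  rw [continuousAt_iff']; intro η hη; obtain ⟨ε, hε, h1⟩ := key (η / 4) (by linarith)
  obtain ⟨B, hB⟩ := exists_log_bound_outside hs z₀ hε
  have hcont : ContinuousAt (fun z => ∫ x in (ball z₀ ε)ᶜ, σ x * Real.log (1 / ‖z - x‖) ∂ν) z₀ := by
    refine continuousAt_of_dominated (bound := fun _ => B) ?_ ?_ (integrable_const B) ?_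
    · exact Eventually.of_forall fun z => (hσ.mul (hm z)).aestronglyMeasurable
    · filter_upwards [ball_mem_nhds z₀ (half_pos hε)] with z hz
      filter_upwards [hB z hz] with x hx
      rwa [hnorm]
    · rw [ae_restrict_iff' measurableSet_ball.compl]; refine ae_of_all _ fun x hx => ?_
      have hne : z₀ - x ≠ 0 := by
        intro h0; rw [sub_eq_zero] at h0; exact hx (by rw [← h0]; exact mem_ball_self hε)
      refine continuousAt_const.mul (ContinuousAt.log ?_ (by simpa using hne))
      exact continuousAt_const.div (by fun_prop) (by simpa using hne)
  filter_upwards [continuousAt_iff'.1 hcont (η / 4) (by linarith),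
    ball_mem_nhds z₀ (half_pos hε)] with z h2 h3
  have hsplit : ∀ z ∈ ball z₀ (ε / 2), signedPotential ν σ z =
      (∫ x in ball z₀ ε, σ x * Real.log (1 / ‖z - x‖) ∂ν) +
      ∫ x in (ball z₀ ε)ᶜ, σ x * Real.log (1 / ‖z - x‖) ∂ν := fun z hz => by
    refine (integral_add_compl measurableSet_ball ?_).symm
    exact (h1 z hz).1.mono (hσ.mul (hm z)).aestronglyMeasurable
      (ae_of_all _ fun x => (hnorm z x).le)
  have h4 := (h1 z h3).2
  have h5 := (h1 z₀ (mem_ball_self (by linarith))).2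
  rw [hsplit z h3, hsplit z₀ (mem_ball_self (by linarith)), Real.dist_eq]
  rw [Real.dist_eq] at h2; rw [abs_le] at h4 h5; rw [abs_lt] at h2 ⊢; constructor <;> linarith

/-! ### Derivatives of the potential and of the external field -/

section

/-- The real linear form `v ↦ Re (v c)`. -/
def reMul (c : ℂ) : ℂ →L[ℝ] ℝ :=
  reCLM.comp ((ContinuousLinearMap.toSpanSingleton ℂ c).restrictScalars ℝ)

@[simp] theorem reMul_apply (c v : ℂ) : reMul c v = (v * c).re := by simp [reMul]

theorem norm_reMul_le (c : ℂ) : ‖reMul c‖ ≤ ‖c‖ := by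
  refine ContinuousLinearMap.opNorm_le_bound _ (norm_nonneg _) fun v => ?_
  rw [reMul_apply, norm_eq_abs, mul_comm ‖c‖, ← norm_mul]; exact abs_re_le_norm _

theorem HasDerivAt.hasFDerivAt_re {f : ℂ → ℂ} {f' z : ℂ} (h : HasDerivAt f f' z) :
    HasFDerivAt (fun w => (f w).re) (reMul f') z :=
  reCLM.hasFDerivAt.comp z (h.hasFDerivAt.restrictScalars ℝ)

theorem hasFDerivAt_log_norm_sub {z x : ℂ} (h : z ≠ x) :
    HasFDerivAt (fun z => Real.log ‖z - x‖) (reMul (1 / (z - x))) z := by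
  have h0 := sub_ne_zero.2 h
  have h1 : HasDerivAt (fun w => log ((w - x) / (z - x))) (1 / (z - x)) z := by
    refine ((((hasDerivAt_id z).sub_const x).div_const (z - x)).clog ?_).congr_deriv ?_
    · simp [h0, one_mem_slitPlane]
    · simp [h0]
  refine (h1.hasFDerivAt_re.add_const (Real.log ‖z - x‖)).congr_of_eventuallyEq ?_
  filter_upwards [eventually_ne_nhds h] with w hw
  have h2 := sub_ne_zero.2 hw
  rw [log_re, norm_div, log_div (by simpa using h2) (by simpa using h0)]
  ring

section OffSupport

variable {ν : Measure ℂ} {σ : ℂ → ℝ}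

theorem exists_ball_far {z : ℂ} (hz : z ∉ ν.support) : ∃ r > 0, ∀ᵐ x ∂ν, ∀ w ∈ ball z r,
    r ≤ ‖x - w‖ := by
  have hop := Measure.isClosed_support.isOpen_compl.mem_nhds hz
  obtain ⟨r, hr, hb⟩ := Metric.mem_nhds_iff.1 hop; refine ⟨r / 2, by linarith, ?_⟩
  filter_upwards [ν.support_mem_ae] with x hx w hw
  rw [mem_ball, dist_eq_norm] at hw; by_contra! hlt; refine hb (?_ : x ∈ ball z r) hx
  rw [mem_ball, dist_eq_norm]
  calc ‖x - z‖ = ‖(x - w) + (w - z)‖ := by congr 1; ring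
    _ ≤ ‖x - w‖ + ‖w - z‖ := norm_add_le _ _
    _ < r := by linarith

theorem differentiableAt_cauchyTransform [IsFiniteMeasure ν] (hσ : Measurable σ) (hσ1 : ∀ x, |σ x| = 1) {z : ℂ}
    (hz : z ∉ ν.support) : DifferentiableAt ℂ (cauchyTransform ν σ) z := by
  obtain ⟨r, hr, h⟩ := exists_ball_far hz
  have hm : ∀ w : ℂ, Measurable fun x => (σ x : ℂ) / (x - w) := fun w => by fun_prop
  have hm2 : Measurable fun x => (σ x : ℂ) / (x - z) ^ 2 := by fun_prop
  refine (hasDerivAt_integral_of_dominated_loc_of_deriv_le (F := fun z x => (σ x : ℂ) / (x - z))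
    (F' := fun z x => (σ x : ℂ) / (x - z) ^ 2) (bound := fun _ => 1 / r ^ 2)
    (ball_mem_nhds z hr) ?_ ?_ ?_ ?_ (integrable_const _) ?_).2.differentiableAt
  · exact Eventually.of_forall fun w => (hm w).aestronglyMeasurable
  · refine Integrable.of_bound (hm z).aestronglyMeasurable (1 / r) ?_; filter_upwards [h] with x hx
    have := hx z (mem_ball_self hr)
    rw [norm_div, norm_real, norm_eq_abs, hσ1]; exact one_div_le_one_div_of_le hr this
  · exact hm2.aestronglyMeasurable
  · filter_upwards [h] with x hx w hw
    rw [norm_div, norm_real, norm_eq_abs, hσ1, norm_pow]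
    exact one_div_le_one_div_of_le (by positivity) (pow_le_pow_left₀ hr.le (hx w hw) 2)
  · filter_upwards [h] with x hx w hw
    have h0 := norm_pos_iff.1 (hr.trans_le (hx w hw))
    refine ((hasDerivAt_const w (σ x : ℂ)).div ((hasDerivAt_id w).const_sub x) h0).congr_deriv ?_
    simp

theorem hasFDerivAt_signedPotential [IsFiniteMeasure ν] (hσ : Measurable σ) (hσ1 : ∀ x, |σ x| = 1)
    (hs : IsCompact ν.support) {z : ℂ} (hz : z ∉ ν.support) :
    HasFDerivAt (signedPotential ν σ) (reMul (cauchyTransform ν σ z)) z := by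
  obtain ⟨r, hr, h⟩ := exists_ball_far hz
  have hd : ∀ w x : ℂ, w ≠ x → HasFDerivAt (fun w => σ x * Real.log (1 / ‖w - x‖))
      (σ x • reMul (1 / (x - w))) w := fun w x hwx => by
    have h1 := ((hasFDerivAt_log_norm_sub hwx).neg).const_mul (σ x)
    simp only [one_div, Real.log_inv]; refine h1.congr_fderiv ?_
    have e : (1:ℂ) / (x - w) = -(1 / (w - x)) := by rw [← neg_sub w x, div_neg]
    rw [← one_div, e]; ext; simp; ring
  have hbd : ∀ᵐ x ∂ν, ∀ w ∈ ball z r, ‖σ x • reMul (1 / (x - w))‖ ≤ 1 / r := by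
    filter_upwards [h] with x hx w hw
    rw [norm_smul, norm_eq_abs, hσ1, one_mul]; refine (norm_reMul_le _).trans ?_
    rw [norm_div, norm_one]; exact one_div_le_one_div_of_le hr (hx w hw)
  have hFm : Measurable fun x => (σ x : ℂ) / (x - z) := by fun_prop
  have hmeas : AEStronglyMeasurable (fun x => σ x • reMul (1 / (x - z))) ν := by
    have hc : Continuous fun c : ℂ => reMul c := by
      let l : ℂ →ₗ[ℝ] (ℂ →L[ℝ] ℝ) :=
        { toFun := reMul
          map_add' := fun c d => by ext; simp; ring
          map_smul' := fun t c => by ext; simp; ring }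
      exact l.continuous_of_finiteDimensional
    have hm1 : Measurable fun x : ℂ => 1 / (x - z) := by fun_prop
    exact hσ.aestronglyMeasurable.smul
      (hc.comp_aestronglyMeasurable hm1.aestronglyMeasurable)
  have hint := Integrable.of_bound hmeas (1 / r) (hbd.mono fun x hx => hx z (mem_ball_self hr))
  have key := hasFDerivAt_integral_of_dominated_of_fderiv_le (μ := ν) (𝕜 := ℝ)
    (F := fun w x => σ x * Real.log (1 / ‖w - x‖)) (F' := fun w x => σ x • reMul (1 / (x - w)))
    (bound := fun _ => 1 / r) (x₀ := z) (ball_mem_nhds z hr) ?_ ?_ hmeas hbd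
    (integrable_const _) ?_
  · refine key.congr_fderiv ?_; ext v
    all_goals
      rw [ContinuousLinearMap.integral_apply hint, reMul_apply, cauchyTransform,
        ← integral_const_mul]
      have hi2 : ∀ c : ℂ, Integrable (fun x => c * ((σ x : ℂ) / (x - z))) ν := fun c => by
        refine (Integrable.of_bound hFm.aestronglyMeasurable (1 / r) ?_).const_mul c
        filter_upwards [h] with x hx
        rw [norm_div, norm_real, norm_eq_abs, hσ1]
        exact one_div_le_one_div_of_le hr (hx z (mem_ball_self hr))
      have h3 := reCLM.integral_comp_comm (hi2 v)
      simp only [reCLM_apply] at h3; rw [← h3]; congr 1; ext x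
      rw [smul_apply, reMul_apply, smul_eq_mul, ← re_ofReal_mul]; congr 1; ring
  · exact Eventually.of_forall fun w => (hσ.mul (by fun_prop)).aestronglyMeasurable
  · obtain ⟨R, hR⟩ := (isBounded_iff_subset_ball z).1 hs.isBounded
    refine Integrable.of_bound (hσ.mul (by fun_prop)).aestronglyMeasurable
      (max (-Real.log r) (Real.log R)) ?_
    filter_upwards [h, ν.support_mem_ae] with x hx hxs
    have h1 := hx z (mem_ball_self hr)
    have h2 := hR hxs
    rw [mem_ball, dist_eq_norm] at h2
    rw [norm_mul, norm_eq_abs, hσ1, one_mul, one_div, Real.log_inv, norm_neg,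
      norm_eq_abs, norm_sub_rev, abs_le]
    have h3 := log_le_log hr h1
    have h4 := log_le_log (hr.trans_le h1) h2.le
    exact ⟨by linarith [le_max_left (-Real.log r) (Real.log R)], h4.trans (le_max_right _ _)⟩
  · filter_upwards [h] with x hx w hw
    refine hd w x ?_; rintro rfl; have := hx w hw
    rw [sub_self, norm_zero] at this; linarith

end OffSupport

section FieldIncrement

variable {n : ℕ} (a ρ : Fin n → ℂ)

/-- The statement is local: near `z₀` the quotients stay in the slit plane, where the principal
logarithm is analytic. -/
theorem eventually_hasFDerivAt_fieldIncrement {z₀ : ℂ} (h : ∀ k, ρ k ≠ 0 → z₀ ≠ a k) :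
    ∀ᶠ w in 𝓝 z₀, HasFDerivAt (fieldIncrement a ρ z₀) (reMul (fieldDeriv a ρ w)) w := by
  have hk : ∀ k, ∀ᶠ w in 𝓝 z₀, HasDerivAt (fun w => (ρ k / 2) * log ((w - a k) / (z₀ - a k)))
      ((ρ k / 2) / (w - a k)) w := by
    intro k; by_cases h0 : ρ k = 0
    · simp [h0, hasDerivAt_const]
    have h1 := sub_ne_zero.2 (h k h0)
    have hc : ContinuousAt (fun w => (w - a k) / (z₀ - a k)) z₀ := by fun_prop
    have hev := hc.eventually (isOpen_slitPlane.mem_nhds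
        (by simp [h1, one_mem_slitPlane]))
    filter_upwards [hev] with w hw
    have h2 : w - a k ≠ 0 := fun h2 => slitPlane_ne_zero hw (by rw [h2, zero_div])
    refine ((((hasDerivAt_id w).sub_const (a k)).div_const (z₀ - a k)).clog hw |>.const_mul
      (ρ k / 2)).congr_deriv ?_
    simp only [id]; field_simp
  filter_upwards [eventually_all.2 hk] with w hw
  have h1 : HasDerivAt (fun w => -∑ k, (ρ k / 2) * log ((w - a k) / (z₀ - a k)))
      (fieldDeriv a ρ w) w := (HasDerivAt.fun_sum fun k _ => hw k).neg
  convert h1.hasFDerivAt_re using 1; ext w; simp [fieldIncrement]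

theorem fieldIncrement_self (z : ℂ) : fieldIncrement a ρ z z = 0 := by
  unfold fieldIncrement; rw [neg_eq_zero]; refine Finset.sum_eq_zero fun k _ => ?_
  by_cases h : z - a k = 0
  · simp [h]
  · rw [div_self h]; simp

theorem differentiableAt_fieldDeriv {z : ℂ} (h : ∀ k, ρ k ≠ 0 → z ≠ a k) :
    DifferentiableAt ℂ (fieldDeriv a ρ) z := by
  unfold fieldDeriv; refine (DifferentiableAt.fun_sum fun k _ => ?_).neg
  by_cases h0 : ρ k = 0
  · simp [h0]
  · exact (differentiableAt_const _).div (by fun_prop) (sub_ne_zero.2 (h k h0))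

theorem eventually_uncharged {z₀ : ℂ} (h : ∀ k, ρ k ≠ 0 → z₀ ≠ a k) :
    ∀ᶠ z in 𝓝 z₀, ∀ k, ρ k ≠ 0 → z ≠ a k := by
  refine eventually_all.2 fun k => ?_
  by_cases h0 : ρ k = 0
  · simp [h0]
  · filter_upwards [eventually_ne_nhds (h k h0)] with z hz _ using hz

end FieldIncrement

end

/-! ### Normal charts on the support; absence of charged nodes -/

section

theorem measure_eq_zero_of_integral_eq_zero {ν : Measure ℂ} [IsFiniteMeasure ν] {σ : ℂ → ℝ}
    (hσ : Measurable σ) (hσ1 : ∀ x, σ x = 1 ∨ σ x = -1) {U : Set ℂ} (hU : IsOpen U)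
    (h : ∀ X : ℂ → ℂ, ContDiff ℝ ∞ X → HasCompactSupport X → tsupport X ⊆ U →
      ∫ x, (σ x : ℂ) * X x ∂ν = 0) : ν U = 0 := by
  have := measure_le_of_abs_integral_le (lam := 0) (M := ν) hσ hσ1 hU
    (fun χ hχ hc hQ => ?_) hU.measurableSet le_rfl
  · simpa using this
  have hs : tsupport (fun x => (χ x : ℂ)) ⊆ tsupport χ :=
    closure_mono fun x hx => by simpa using hx
  have h1 := h (fun x => (χ x : ℂ)) (ofRealCLM.contDiff.comp hχ)
    (hc.comp_left ofReal_zero) (hs.trans hQ)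
  simp only [← ofReal_mul] at h1; rw [integral_complex_ofReal, ofReal_eq_zero] at h1; simp [h1]

variable {n : ℕ} {a ρ : Fin n → ℂ}

/-- Local form of the quadratic equation of the total field away from the charges. -/
theorem exists_analytic_sub_mul_sq (ha : Function.Injective a) {g E : ℂ → ℂ}
    (hE : Differentiable ℂ E)
    (hg : ∀ᵐ z, g z ^ 2 * nodeProd a z = E z + fieldDeriv a ρ z ^ 2 * nodeProd a z) {z₀ : ℂ}
    (h0 : ∀ k, ρ k ≠ 0 → z₀ ≠ a k) :
    ∃ K : ℂ → ℂ, AnalyticAt ℂ K z₀ ∧ (∀ᵐ z, (z - z₀) * g z ^ 2 = K z) ∧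
      ((∀ k, z₀ ≠ a k) → K z₀ = 0) := by
  have hΦ : AnalyticAt ℂ (fieldDeriv a ρ) z₀ := by
    obtain ⟨U, hU, hUo, hzU⟩ := _root_.eventually_nhds_iff.1 (eventually_uncharged a ρ h0)
    exact DifferentiableOn.analyticAt (fun z hz =>
      (differentiableAt_fieldDeriv a ρ (hU z hz)).differentiableWithinAt) (hUo.mem_nhds hzU)
  -- At an uncharged node `nodeProd` has a simple zero, so `g²` has at most a simple pole, which the
  -- factor `z - z₀` absorbs. At any other point `g²` is analytic and the factor gives a zero.
  by_cases hk : ∃ k, a k = z₀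
  · obtain ⟨k, hk⟩ := hk; set B : ℂ → ℂ := fun z => ∏ j ∈ Finset.univ.erase k, (z - a j) with hB
    have hBd : Differentiable ℂ B := by fun_prop
    have hB0 : B z₀ ≠ 0 := Finset.prod_ne_zero_iff.2 fun j hj => sub_ne_zero.2 fun h =>
      (Finset.ne_of_mem_erase hj) (ha (h.symm.trans hk.symm))
    refine ⟨fun z => E z / B z + (z - z₀) * fieldDeriv a ρ z ^ 2, ?_, ?_, fun h => absurd hk.symm (h k)⟩
    · exact ((hE.analyticAt z₀).div (hBd.analyticAt z₀) hB0).add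
        ((analyticAt_id.sub analyticAt_const).mul (hΦ.pow 2))
    · filter_upwards [hg, ae_ne_nodes a] with z h1 h2
      have hA : nodeProd a z = (z - z₀) * B z := by
        rw [nodeProd, ← Finset.mul_prod_erase _ _ (Finset.mem_univ k), hk]
      have hBz : B z ≠ 0 := Finset.prod_ne_zero_iff.2 fun j _ => sub_ne_zero.2 (h2 j)
      rw [hA] at h1; field_simp; linear_combination h1
  · push Not at hk; have hA0 := nodeProd_ne_zero a fun k => (hk k).symm
    refine ⟨fun z => (z - z₀) * (E z / nodeProd a z + fieldDeriv a ρ z ^ 2), ?_, ?_, fun _ => by simp⟩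
    · exact (analyticAt_id.sub analyticAt_const).mul (((hE.analyticAt z₀).div
        ((differentiable_nodeProd a).analyticAt z₀) hA0).add (hΦ.pow 2))
    · filter_upwards [hg, ae_ne_nodes a] with z h1 h2
      have hAz := nodeProd_ne_zero a h2
      field_simp; linear_combination (z - z₀) * h1

section

variable {ν : Measure ℂ} [IsFiniteMeasure ν] {σ : ℂ → ℝ}

/-- Let `K = (z - z₀) g²`. If `K` vanished near `z₀`, so would `g`, and the weak equation would
leave no mass there, contrary to `z₀` being in the support. Otherwise `K = (z - z₀)^m u` with `u z₀
≠ 0`, so `g²` has order `m - 1 = N - 2` with `N = m + 1`. Off the nodes `K z₀ = 0` gives `m ≥ 1`,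
hence `N ≥ 2`. -/
theorem exists_isNormalChart (ha : Function.Injective a) (hσ : Measurable σ)
    (hσ1 : ∀ x, σ x = 1 ∨ σ x = -1) {E : ℂ → ℂ} (hE : Differentiable ℂ E)
    (hg : ∀ᵐ z, totalField a ρ ν σ z ^ 2 * nodeProd a z =
      E z + fieldDeriv a ρ z ^ 2 * nodeProd a z) {z₀ : ℂ}
    (h0 : ∀ k, ρ k ≠ 0 → z₀ ≠ a k) (hz₀ : z₀ ∈ ν.support) :
    ∃ (N : ℕ) (e : OpenPartialHomeomorph ℂ ℂ), ((∀ k, z₀ ≠ a k) → 2 ≤ N) ∧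
      IsNormalChart ν σ (totalField a ρ ν σ) N z₀ e := by
  have hσa : ∀ x, |σ x| = 1 := fun x => by rcases hσ1 x with h | h <;> simp [h]
  set g := totalField a ρ ν σ with hgdef
  obtain ⟨K, hK, hgK, hKz⟩ := exists_analytic_sub_mul_sq ha hE hg h0
  have hev := eventually_uncharged a ρ h0
  have hweak : ∀ U : Set ℂ, (∀ z ∈ U, ∀ k, ρ k ≠ 0 → z ≠ a k) → ∀ X : ℂ → ℂ, ContDiff ℝ ∞ X →
      HasCompactSupport X → tsupport X ⊆ U →
      ∫ z, g z * dbar X z = π * ∫ x, (σ x : ℂ) * X x ∂ν := fun U hU X h1 h2 h3 =>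
    integral_totalField_mul_dbar a ρ hσ hσa (h1.of_le (by simp)) h2 fun j hj =>
      image_eq_zero_of_notMem_tsupport fun h => hU _ (h3 h) j hj rfl
  by_cases hK0 : ∀ᶠ z in 𝓝 z₀, K z = 0
  · exfalso; obtain ⟨U, hU, hUo, hzU⟩ := _root_.eventually_nhds_iff.1 (hK0.and hev)
    refine ne_of_pos_of_notMem_support hUo (measure_eq_zero_of_integral_eq_zero hσ hσ1 hUo
      fun X h1 h2 h3 => ?_) hzU hz₀
    have h4 := hweak U (fun z hz => (hU z hz).2) X h1 h2 h3
    have h5 : ∫ z, g z * dbar X z = 0 := by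
      refine integral_eq_zero_of_ae ?_; have hne : ∀ᵐ z : ℂ, z ≠ z₀ := by simp [ae_iff]
      filter_upwards [hgK, hne] with z h6 h7
      by_cases hz : z ∈ U
      · rw [(hU z hz).1] at h6; have : g z = 0 := by
          rcases mul_eq_zero.1 h6 with h | h
          · exact absurd (sub_eq_zero.1 h) h7
          · exact pow_eq_zero_iff two_ne_zero |>.1 h
        simp [this]
      · rw [dbar_eq_zero_of_notMem_tsupport fun h => hz (h3 h)]; simp
    rw [h5] at h4; have hp : (π : ℂ) ≠ 0 := by exact_mod_cast pi_ne_zero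
    exact (mul_eq_zero.1 h4.symm).resolve_left hp
  · obtain ⟨m, u, hu, hu0, hKu⟩ := (AnalyticAt.exists_eventuallyEq_pow_smul_nonzero_iff hK).2 hK0
    obtain ⟨y, hy, hy0, hyd, hyeq⟩ := exists_normal_form hu hu0 (m + 1) (c := ((m + 1 : ℕ) : ℂ) / 2)
      (by simp)
    obtain ⟨e, e1, e2, e3, e4, e5⟩ := exists_local_inverse hy hyd
      (inter_mem (inter_mem hyeq hKu) hev)
    refine ⟨m + 1, e, fun h => ?_, hσ, hσ1, locallyIntegrable_totalField a ρ hσ hσa, by omega, e1, by rw [e3, hy0], fun z hz => ?_, ?_, ?_, ?_⟩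
    · have h1 := hKu.self_of_nhds
      rw [hKz h, sub_self] at h1; rcases Nat.eq_zero_or_pos m with h2 | h2
      · simp only [h2, pow_zero, one_smul] at h1; exact absurd h1.symm hu0
      · omega
    · rw [e3]; exact ⟨(e4 z hz).1.differentiableAt.hasDerivAt, (e4 z hz).2⟩
    · rw [e3]; exact e5
    · exact hweak e.source fun z hz => (e2 hz).2
    · have hne : ∀ᵐ z : ℂ, z ≠ z₀ := by simp [ae_iff]
      filter_upwards [hgK, hne] with z h6 h7 h8
      obtain ⟨⟨h9, h10⟩, -⟩ := e2 h8
      have h9' : (((m + 1 : ℕ) : ℂ) / 2) ^ 2 * (z - z₀) ^ 2 * deriv y z ^ 2 * y z ^ (m + 1) =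
        (z - z₀) ^ (m + 1) * u z * y z ^ 2 := h9
      have h10' : K z = (z - z₀) ^ m • u z := h10
      rw [e3]; have hz0 : (z - z₀) ^ 2 ≠ 0 := pow_ne_zero _ (sub_ne_zero.2 h7)
      apply mul_left_cancel₀ hz0; rw [h10', smul_eq_mul] at h6
      linear_combination 4 * h9' - 4 * (z - z₀) * y z ^ 2 * h6

/-- The support does not contain the charged points. -/
theorem notMem_support_of_charged (ha : Function.Injective a) (hσ : Measurable σ)
    (hσ1 : ∀ x, σ x = 1 ∨ σ x = -1) (hpt : ∀ z, ν {z} = 0) {E : ℂ → ℂ} (hE : Differentiable ℂ E)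
    (hg : ∀ᵐ z, totalField a ρ ν σ z ^ 2 * nodeProd a z =
      E z + fieldDeriv a ρ z ^ 2 * nodeProd a z) {k : Fin n} (hk : ρ k ≠ 0) :
    a k ∉ ν.support := by
  have hσa : ∀ x, |σ x| = 1 := fun x => by rcases hσ1 x with h | h <;> simp [h]
  set g := totalField a ρ ν σ with hgdef
  have hgl : LocallyIntegrable g := locallyIntegrable_totalField a ρ hσ hσa
  set B : ℂ → ℂ := fun z => ∏ j ∈ Finset.univ.erase k, (z - a j) with hB
  have hBd : Differentiable ℂ B := by fun_prop
  have hB0 : B (a k) ≠ 0 := Finset.prod_ne_zero_iff.2 fun j hj => sub_ne_zero.2 fun h =>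
    (Finset.ne_of_mem_erase hj) (ha h).symm
  set F : ℂ → ℂ := fun z => -∑ j ∈ Finset.univ.erase k, (ρ j / 2) / (z - a j) with hF
  have hFa : AnalyticAt ℂ F (a k) := by
    refine (Finset.analyticAt_fun_sum _ fun j hj => ?_).neg
    exact analyticAt_const.div (analyticAt_id.sub analyticAt_const) (sub_ne_zero.2 fun h =>
      (Finset.ne_of_mem_erase hj) (ha h).symm)
  -- This is `(z - a k)² g²`, with value `(ρ k / 2)² ≠ 0` at the node: the differential has a double
  -- pole, and its normal form is `c² dy²/y²` with `c = ρ k / 2`.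
  set u : ℂ → ℂ := fun z => (z - a k) * (E z / B z) + (-(ρ k / 2) + (z - a k) * F z) ^ 2 with hu
  have hua : AnalyticAt ℂ u (a k) :=
    ((analyticAt_id.sub analyticAt_const).mul ((hE.analyticAt _).div (hBd.analyticAt _) hB0)).add
      ((analyticAt_const.add ((analyticAt_id.sub analyticAt_const).mul hFa)).pow 2)
  have huk : u (a k) = (ρ k / 2) ^ 2 := by simp [hu]
  have hc0 := div_ne_zero hk two_ne_zero
  obtain ⟨y, hy, hy0, hyd, hyeq⟩ := exists_normal_form hua (by rw [huk]; exact pow_ne_zero _ hc0) 0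
    (c := ρ k / 2) (by simp [huk])
  set c := ρ k / 2 with hc
  have hev : ∀ᶠ z in 𝓝 (a k), ∀ j, j ≠ k → z ≠ a j := by
    refine eventually_all.2 fun j => ?_
    by_cases h : j = k
    · simp [h]
    · filter_upwards [eventually_ne_nhds (fun h' => h (ha h').symm : a k ≠ a j)] with z hz _ using hz
  obtain ⟨e, e1, e2, e3, e4, e5⟩ := exists_local_inverse hy hyd (inter_mem hyeq hev)
  have hsq : ∀ᵐ z, z ∈ e.source → c ^ 2 * deriv e z ^ 2 = g z ^ 2 * e z ^ 2 := by
    filter_upwards [hg, ae_ne_nodes a] with z h1 h2 h3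
    have h4 : c ^ 2 * (z - a k) ^ 2 * deriv y z ^ 2 * y z ^ 0 = (z - a k) ^ 0 * u z * y z ^ 2 :=
      (e2 h3).1
    have hzk : z - a k ≠ 0 := sub_ne_zero.2 (h2 k)
    have hA : nodeProd a z = (z - a k) * B z := by
      rw [nodeProd, ← Finset.mul_prod_erase _ _ (Finset.mem_univ k)]
    have hBz : B z ≠ 0 := Finset.prod_ne_zero_iff.2 fun j _ => sub_ne_zero.2 (h2 j)
    have hΦ : (z - a k) * fieldDeriv a ρ z = -c + (z - a k) * F z := by
      rw [fieldDeriv, ← Finset.add_sum_erase _ _ (Finset.mem_univ k), hF]; field_simp; ring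
    rw [e3]; apply mul_left_cancel₀ (pow_ne_zero 2 hzk)
    have h5 : u z = (z - a k) ^ 2 * g z ^ 2 := by
      rw [hu]; simp only; rw [← hΦ]; rw [hA] at h1; field_simp; linear_combination -h1
    rw [h5] at h4; linear_combination h4
  -- a box of fixed size around any point close to `a k`
  have he0 : e (a k) = 0 := by rw [e3, hy0]
  obtain ⟨r, hr, hrt⟩ := Metric.mem_nhds_iff.1 (e.open_target.mem_nhds (he0 ▸ e.map_source e1))
  obtain ⟨δ, hδ, hδc⟩ : ∃ δ : ℝ, 0 < δ ∧ ∀ v ∈ openBox (-δ) δ (-δ) δ, ‖v / c‖ < 1 := by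
    refine ⟨‖c‖ / 2, by positivity, fun v hv => ?_⟩
    rw [norm_div, div_lt_one (norm_pos_iff.2 hc0)]; exact norm_lt_of_mem_openBox hv
  set Q := openBox (-δ) δ (-δ) δ with hQ
  -- the mass of punctured neighbourhoods tends to zero
  obtain ⟨t, ht, htr, htM⟩ : ∃ t > 0, t < r ∧
      π * ν.real (e.source ∩ {z | 0 < ‖e z‖ ∧ ‖e z‖ < t}) < δ - -δ := by
    have h1 := tendsto_measure_iInter_atTop (μ := ν)
      (s := fun m : ℕ => e.source ∩ e ⁻¹' {w | 0 < ‖w‖ ∧ ‖w‖ < 1 / ((m:ℝ) + 1)}) (fun m => ?_) ?_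
      ⟨0, measure_ne_top _ _⟩
    · have h2 : (⋂ m : ℕ, e.source ∩ e ⁻¹' {w | 0 < ‖w‖ ∧ ‖w‖ < 1 / ((m:ℝ) + 1)}) = ∅ := by
        rw [eq_empty_iff_forall_notMem]; intro z hz; rw [mem_iInter] at hz
        obtain ⟨m, hm⟩ := exists_nat_one_div_lt (hz 0).2.1; exact absurd (hz m).2.2 (not_lt.2 hm.le)
      rw [h2, measure_empty] at h1
      have h3 := ((ENNReal.tendsto_toReal ENNReal.zero_ne_top).comp h1).const_mul π
      simp only [ENNReal.toReal_zero, mul_zero] at h3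
      have h4 := h3.eventually (gt_mem_nhds (by linarith : (0:ℝ) < δ - -δ))
      have h5 := (tendsto_one_div_add_atTop_nhds_zero_nat (𝕜 := ℝ)).eventually (gt_mem_nhds hr)
      obtain ⟨m, h6, h7⟩ := (h4.and h5).exists; exact ⟨1 / ((m:ℝ) + 1), by positivity, h7, h6⟩
    · refine (e.continuousOn.isOpen_inter_preimage e.open_source ?_).measurableSet.nullMeasurableSet
      exact (isOpen_lt continuous_const continuous_norm).inter
        (isOpen_lt continuous_norm continuous_const)
    · exact fun m m' hm z hz => ⟨hz.1, hz.2.1, hz.2.2.trans_le (Nat.one_div_le_one_div hm)⟩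
  have hexp1 := exp_pos 1
  have hnot : ∀ z₁ ∈ e.source, 0 < ‖e z₁‖ → ‖e z₁‖ * Real.exp 1 < t → z₁ ∉ ν.support := by
    intro z₁ hz₁ hz₁0 hz₁t; have hy1 := norm_pos_iff.1 hz₁0
    -- The flat coordinate of `c² dy²/y²` is `c log y`, normalized to vanish at `z₁`. Since `dy²/y²`
    -- is invariant under scaling, the same box `Q` serves for every nearby `z₁`, while its image
    -- lies in a punctured neighbourhood of mass too small for the height of `Q`.
    set ψ : ℂ → ℂ := fun v => e.symm (e z₁ * exp (v / c)) with hψ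
    have hnorm : ∀ v ∈ Q, 0 < ‖e z₁ * exp (v / c)‖ ∧ ‖e z₁ * exp (v / c)‖ < t := by
      intro v hv; refine ⟨norm_pos_iff.2 (mul_ne_zero hy1 (exp_ne_zero _)), ?_⟩
      rw [norm_mul, norm_exp]; have h1 := exp_le_exp.2 ((re_le_norm _).trans (hδc v hv).le)
      nlinarith
    have htgt : ∀ v ∈ Q, e z₁ * exp (v / c) ∈ e.target := fun v hv =>
      hrt (by rw [mem_ball_zero_iff]; exact (hnorm v hv).2.trans htr)
    have hes : ∀ w ∈ e.target, HasDerivAt e.symm (deriv e (e.symm w))⁻¹ w := by rw [e3]; exact e5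
    have hder : ∀ v ∈ Q, HasDerivAt ψ ((deriv e (ψ v))⁻¹ * (e (ψ v) / c)) v := fun v hv => by
      have h1 := (((hasDerivAt_id v).div_const c).cexp).const_mul (e z₁)
      refine ((hes _ (htgt v hv)).comp v h1).congr_deriv ?_; have h2 := e.right_inv (htgt v hv)
      rw [h2]; simp only [hψ, id]; ring
    have hlog : ∀ v ∈ Q, log (exp (v / c)) = v / c ∧
        exp (v / c) ∈ slitPlane := fun v hv => by
      have h1 := abs_lt.1 ((abs_im_le_norm _).trans_lt (hδc v hv))
      have hp := pi_gt_three
      have h2 := log_exp (x := v / c) (by linarith) (by linarith)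
      refine ⟨h2, ?_⟩; rw [mem_slitPlane_iff_arg]; refine ⟨?_, exp_ne_zero _⟩; rw [← log_im, h2]
      linarith
    have hch : IsChart Q ψ (fun z => c * log (e z / e z₁)) := by
      refine IsChart.of_hasDerivAt (isOpen_openBox _ _ _ _)
        (fun v hv => (hder v hv).differentiableAt.differentiableWithinAt) (fun v hv => ?_)
        fun v hv => ?_
      · have h1 : DifferentiableAt ℂ e (ψ v) := by
          rw [e3]; exact (e4 _ (e.map_target (htgt v hv))).1.differentiableAt
        refine ((h1.div_const _).clog ?_).const_mul c
        have h2 : e (ψ v) = e z₁ * exp (v / c) := e.right_inv (htgt v hv)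
        rw [h2, mul_div_cancel_left₀ _ hy1]; exact (hlog v hv).2
      · have h2 : e (ψ v) = e z₁ * exp (v / c) := e.right_inv (htgt v hv)
        simp only [h2]; rw [mul_div_cancel_left₀ _ hy1, (hlog v hv).1, mul_div_cancel₀ _ hc0]
    have himg : ψ '' Q ⊆ e.source ∩ {z | 0 < ‖e z‖ ∧ ‖e z‖ < t} := by
      rintro _ ⟨v, hv, rfl⟩; have h2 : e (ψ v) = e z₁ * exp (v / c) := e.right_inv (htgt v hv)
      refine ⟨e.map_target (htgt v hv), ?_⟩; rw [mem_ofPred_eq, h2]; exact hnorm v hv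
    have hd0 : ∀ z ∈ e.source, deriv e z ≠ 0 := by rw [e3]; exact fun z hz => (e4 z hz).2
    obtain ⟨s, τ, M, hM, hf, -, hMS⟩ := hch.exists_isFlatSystem hσ hσ1 hgl (ν := ν)
      (fun X h1 h2 h3 => integral_totalField_mul_dbar a ρ hσ hσa (h1.of_le (by simp)) h2
        fun j hj => image_eq_zero_of_notMem_tsupport fun h => by
          have h4 := himg (h3 h)
          by_cases hjk : j = k
          · rw [hjk] at h4; have := h4.2.1
            rw [he0, norm_zero] at this; exact lt_irrefl _ this
          · exact (e2 h4.1).2 j hjk rfl) (by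
        filter_upwards [hch.ae_comp (hsq.mono fun z hz hz' => hz (himg hz').1)] with v h1 h2
        have h3 := h1 h2
        have h4 := hd0 _ (himg (mem_image_of_mem ψ h2)).1
        rw [(hder v h2).deriv]; field_simp; linear_combination -h3)
    have hQm : MeasurableSet Q := (isOpen_openBox _ _ _ _).measurableSet
    obtain ⟨s₀, -, hs₀⟩ := hf.ae_const (by
      refine lt_of_le_of_lt ?_ htM; rw [measureReal_def, hMS Q hQm le_rfl]
      exact mul_le_mul_of_nonneg_left (measureReal_mono himg) pi_pos.le)
    have h0 := hf.measure_eq_zero_of_ae_eq hs₀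
    rw [hMS Q hQm le_rfl] at h0; refine ne_of_pos_of_notMem_support hch.isOpen_image h0 ⟨0, ?_, ?_⟩
    · exact ⟨by simpa using hδ, by simpa using hδ, by simpa using hδ, by simpa using hδ⟩
    · simp [hψ, e.left_inv hz₁]
  have hcont : ContinuousAt (fun z => ‖e z‖ * Real.exp 1) (a k) :=
    ((e.continuousAt e1).norm).mul continuousAt_const
  have hev2 := (eventually_mem_set.2 (e.open_source.mem_nhds e1)).and
      (hcont.eventually (gt_mem_nhds (by simp only [he0, norm_zero, zero_mul]; exact ht)))
  obtain ⟨U, hU, hUo, hkU⟩ := _root_.eventually_nhds_iff.1 hev2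
  refine ne_of_pos_of_notMem_support hUo ?_ hkU
  have hsub : U ⊆ (ν.support)ᶜ ∪ {a k} := fun z hz => by
    by_cases hzk : z = a k
    · exact Or.inr hzk
    · obtain ⟨h1, h2⟩ := hU z hz; refine Or.inl (hnot z h1 (norm_pos_iff.2 fun h3 => hzk ?_) h2)
      exact e.injOn h1 e1 (h3.trans he0.symm)
  exact measure_mono_null hsub (measure_union_null (Measure.measure_compl_support) (hpt _))

end

end

/-! ### The potential in a normal chart -/

section

theorem sqrt_re_eq (v : ℂ) : (v ^ (1 / 2 : ℂ)).re = Real.sqrt ((‖v‖ + v.re) / 2) := by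
  have h2 : (v ^ (1 / 2 : ℂ)) ^ 2 = v := by rw [← cpow_nat_mul]; simp
  have h3 := sqrt_re_nonneg v
  set u := v ^ (1 / 2 : ℂ) with hu
  have h4 : (‖v‖ + v.re) / 2 = u.re ^ 2 := by
    rw [← h2, norm_pow, ← normSq_eq_norm_sq, normSq_apply, sq u, mul_re]; ring
  rw [h4, sqrt_sq h3]

theorem convex_openBox (a b c d : ℝ) : Convex ℝ (openBox a b c d) := by
  unfold openBox; simp only [ofPred_and]
  exact (convex_halfSpace_re_gt a).inter ((convex_halfSpace_re_lt b).inter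
    ((convex_halfSpace_im_gt c).inter (convex_halfSpace_im_lt d)))

/-- The principal root jumps across the negative axis, but its real part vanishes there and extends
continuously. -/
theorem continuous_sqrt_re : Continuous fun v : ℂ => (v ^ (1 / 2 : ℂ)).re := by
  simp_rw [sqrt_re_eq]; exact (((continuous_norm.add continuous_re).div_const 2)).sqrt

namespace IsNormalChart

variable {ν : Measure ℂ} {σ : ℂ → ℝ} {g : ℂ → ℂ} {N : ℕ} {z₀ : ℂ}
  {e : OpenPartialHomeomorph ℂ ℂ} {T : ℂ → ℝ}

theorem symm_zero (h : IsNormalChart ν σ g N z₀ e) : e.symm 0 = z₀ := by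
  rw [← h.map_zero, e.left_inv h.mem]

theorem continuousAt_sectorMap (h : IsNormalChart ν σ g N z₀ e) (θ : ℂ) :
    Tendsto (sectorMap e N θ 1) (𝓝 0) (𝓝 z₀) := by
  have hN' : (0:ℝ) < N := by exact_mod_cast h.one_le
  have hre : 0 < (((2 / N : ℝ) : ℂ)).re := by rw [ofReal_re]; positivity
  have hne : ((2 / N : ℝ) : ℂ) ≠ 0 := by rintro h; rw [h] at hre; simp at hre
  have h1 : ContinuousAt (fun u : ℂ => θ * (u / 1) ^ ((2 / N : ℝ) : ℂ)) 0 := by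
    refine continuousAt_const.mul ?_; simp only [div_one]
    exact continuousAt_cpow_const_of_re_pos (Or.inl le_rfl) hre
  have h2 : (0:ℂ) ∈ e.target := by rw [← h.map_zero]; exact e.map_source h.mem
  have h3 : Tendsto (fun u : ℂ => θ * (u / 1) ^ ((2 / N : ℝ) : ℂ)) (𝓝 0) (𝓝 0) := by
    have := h1.tendsto
    rwa [zero_div, zero_cpow hne, mul_zero] at this
  have h4 := (e.continuousAt_symm h2).tendsto
  rw [h.symm_zero] at h4; exact h4.comp h3

/-- In each sector the potential is an affine function of the flat coordinate. -/
theorem exists_sector_potential [IsFiniteMeasure ν] (h : IsNormalChart ν σ g N z₀ e)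
    (hTc : ContinuousAt T z₀) (hTd : ∀ᶠ w in 𝓝 z₀, w ∉ ν.support →
      HasFDerivAt T (reMul (g w)) w ∧ ContinuousAt g w) {θ : ℂ} (hθ : θ ^ N = 1) :
    ∃ δ > 0, ∃ s : ℝ, (s = 1 ∨ s = -1) ∧ ∀ u ∈ openBox 0 δ (-δ) δ,
      T (sectorMap e N θ 1 u) = T z₀ + s * u.re ∧
      g (sectorMap e N θ 1 u) * deriv (sectorMap e N θ 1) u = s := by
  obtain ⟨δ₀, hδ₀, s, hs, hch, hmem, h0, hgs⟩ := h.exists_sector hθ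
  set ψ := sectorMap e N θ 1 with hψ
  obtain ⟨r, hr, hrW⟩ := eventually_nhds_iff_ball.1
    ((h.continuousAt_sectorMap θ).eventually hTd)
  set δ := min δ₀ (r / 2) with hδ
  have hδ0 : 0 < δ := lt_min hδ₀ (by positivity)
  have hδr : δ ≤ r / 2 := min_le_right _ _
  have hsub : openBox 0 δ (-δ) δ ⊆ openBox 0 δ₀ (-δ₀) δ₀ := fun u hu =>
    ⟨hu.1, hu.2.1.trans_le (min_le_left _ _), (neg_le_neg (min_le_left _ _)).trans_lt hu.2.2.1,
      hu.2.2.2.trans_le (min_le_left _ _)⟩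
  have hd : ∀ u ∈ openBox 0 δ (-δ) δ,
      HasFDerivAt T (reMul (g (ψ u))) (ψ u) ∧ ContinuousAt g (ψ u) := fun u hu => by
    refine hrW u ?_ (ne_of_pos_of_notMem_support hch.isOpen_image h0
      (mem_image_of_mem _ (hsub hu)))
    rw [mem_ball_zero_iff]; exact norm_lt_of_mem_openBox hu
  have hQ := isOpen_openBox 0 δ (-δ) δ
  have hψa := hch.differentiableOn.analyticOnNhd hch.isOpen
  have hgs' : ∀ u ∈ openBox 0 δ (-δ) δ, g (ψ u) * deriv ψ u = s := by
    have := Measure.eqOn_open_of_ae_eq (μ := volume) (f := fun u => g (ψ u) * deriv ψ u)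
      (g := fun _ => (s:ℂ)) (U := openBox 0 δ (-δ) δ) ?_ hQ ?_ continuousOn_const
    · exact this
    · rw [Filter.EventuallyEq, ae_restrict_iff' hQ.measurableSet]
      exact hgs.mono fun u h1 h2 => h1 (hsub h2)
    · intro u hu; refine ContinuousAt.continuousWithinAt ?_
      exact ((hd u hu).2.comp (hψa u (hsub hu)).continuousAt).mul
        (hψa u (hsub hu)).deriv.continuousAt
  have hconst : ∃ c : ℝ, ∀ u ∈ openBox 0 δ (-δ) δ, T (ψ u) - s * u.re = c := by
    have hder : ∀ u ∈ openBox 0 δ (-δ) δ,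
        HasFDerivAt (fun u => T (ψ u) - s * u.re) (0 : ℂ →L[ℝ] ℝ) u := fun u hu => by
      have h1 := ((hψa u (hsub hu)).differentiableAt.hasDerivAt).hasFDerivAt.restrictScalars ℝ
      refine (((hd u hu).1.comp u h1).sub
        (reCLM.hasFDerivAt.const_mul s)).congr_fderiv ?_
      ext v; have h2 : v * deriv ψ u * g (ψ u) = s * v := by rw [← hgs' u hu]; ring
      simp [h2]
    exact hQ.exists_is_const_of_fderiv_eq_zero (𝕜 := ℝ) (convex_openBox _ _ _ _).isPreconnected
      (fun u hu => (hder u hu).differentiableAt.differentiableWithinAt)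
      fun u hu => (hder u hu).fderiv
  -- The point `z₀` corresponds to `u = 0` on the edge of the box; continuity of `T` at `z₀`
  -- identifies the constant.
  obtain ⟨c, hc⟩ := hconst; have hc' : c = T z₀ := by
    have hl1 : Tendsto (fun t : ℝ => (t : ℂ)) (𝓝[>] 0) (𝓝 0) :=
      (continuous_ofReal.tendsto' 0 0 ofReal_zero).mono_left nhdsWithin_le_nhds
    have hl2 : Tendsto (fun t : ℝ => T (ψ t) - s * (t:ℂ).re) (𝓝[>] 0) (𝓝 (T z₀ - s * (0:ℂ).re)) :=
      ((hTc.tendsto.comp (h.continuousAt_sectorMap θ)).comp hl1).sub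
        (((continuous_re.tendsto 0).comp hl1).const_mul s)
    rw [zero_re, mul_zero, sub_zero] at hl2
    refine tendsto_nhds_unique (tendsto_const_nhds.congr' ?_) hl2
    filter_upwards [Ioo_mem_nhdsGT hδ0] with t ht
    refine (hc t ⟨?_, ?_, ?_, ?_⟩).symm <;> simp [ht.1, ht.2, hδ0]
  refine ⟨δ, hδ0, s, hs, fun u hu => ⟨?_, hgs' u hu⟩⟩
  have := hc u hu
  rw [hc'] at this; linarith

/-- The oscillation of the potential at a point of the support. -/
theorem eventually_abs_sub_eq [IsFiniteMeasure ν] (h : IsNormalChart ν σ g N z₀ e)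
    (hTc : ∀ᶠ w in 𝓝 z₀, ContinuousAt T w) (hTd : ∀ᶠ w in 𝓝 z₀, w ∉ ν.support →
      HasFDerivAt T (reMul (g w)) w ∧ ContinuousAt g w) :
    ∀ᶠ z in 𝓝 z₀, |T z - T z₀| = ((e z ^ N) ^ (1 / 2 : ℂ)).re := by
  have hsec : ∀ θ ∈ {θ : ℂ | θ ^ N = 1}, ∃ δ > 0, ∀ u ∈ openBox 0 δ (-δ) δ,
      |T (sectorMap e N θ 1 u) - T z₀| = u.re := fun θ hθ => by
    obtain ⟨δ, hδ, s, hs, h1⟩ := h.exists_sector_potential hTc.self_of_nhds hTd hθ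
    refine ⟨δ, hδ, fun u hu => ?_⟩
    rw [(h1 u hu).1, add_sub_cancel_left, abs_mul, abs_of_pos hu.1]
    rcases hs with rfl | rfl <;> simp
  have hpos : ∀ᶠ z in 𝓝 z₀, 0 < ((e z ^ N) ^ (1 / 2 : ℂ)).re →
      |T z - T z₀| = ((e z ^ N) ^ (1 / 2 : ℂ)).re := by
    choose! δ hδ hδT using hsec
    have hfin := finite_setOf_pow_eq h.one_le 1
    have hcont : Tendsto (fun z => ‖e z‖ ^ ((N:ℝ) / 2)) (𝓝 z₀) (𝓝 0) := by
      have h1 := ((e.continuousAt h.mem).norm.rpow_const (p := (N:ℝ) / 2)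
        (Or.inr (by positivity))).tendsto
      rw [h.map_zero, norm_zero, zero_rpow (by
        have : (0:ℝ) < N := by exact_mod_cast h.one_le
        positivity)] at h1
      exact h1
    have hall := (Filter.eventually_all_finite hfin).2 fun θ hθ => hcont.eventually (gt_mem_nhds (hδ θ hθ : (0:ℝ) < δ θ))
    filter_upwards [hall, e.open_source.mem_nhds h.mem] with z hz hzs hre
    have hw : e z ≠ 0 := by
      intro h0; rw [h0, zero_pow h.ne_zero] at hre; simp at hre
    obtain ⟨θ, hθ, hwθ⟩ := exists_sector_coord h.one_le hw hre; have h1 := hz θ hθ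
    rw [← norm_sqrt_pow] at h1
    have h2 := hδT θ hθ ((e z ^ N) ^ (1 / 2 : ℂ)) ⟨hre, (re_le_norm _).trans_lt h1,
      (abs_lt.1 ((abs_im_le_norm _).trans_lt h1)).1,
      (abs_lt.1 ((abs_im_le_norm _).trans_lt h1)).2⟩
    rwa [sectorMap, div_one, ← hwθ, e.left_inv hzs] at h2
  -- The points not yet covered lie on the rays `e^N ≤ 0`, where the right-hand side is 0; there the
  -- identity is the limit of the one in an adjacent sector, by continuity of `T`.
  filter_upwards [hpos.eventually_nhds, hTc, e.open_source.mem_nhds h.mem] with z hz hzc hzs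
  rcases lt_or_eq_of_le (sqrt_re_nonneg (e z ^ N)) with hre | hre
  · exact hz.self_of_nhds hre
  by_cases hw : e z = 0
  · have : z = z₀ := e.injOn hzs h.mem (by rw [hw, h.map_zero])
    rw [← hre, this]; simp
  -- approach `z` along a curve on which the flat coordinate has positive real part
  set p : ℝ → ℂ := fun t => e.symm (e z * exp (t * I)) with hp
  have hpc : Tendsto p (𝓝[>] 0) (𝓝 z) := by
    have h1 : Tendsto (fun t : ℝ => e z * exp (t * I)) (𝓝 0) (𝓝 (e z)) :=
      Continuous.tendsto' (by fun_prop) _ _ (by simp)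
    have h2 := (e.continuousAt_symm (e.map_source hzs)).tendsto
    rw [e.left_inv hzs] at h2; exact (h2.comp h1).mono_left nhdsWithin_le_nhds
  have hev : ∀ᶠ t in 𝓝[>] (0:ℝ), |T (p t) - T z₀| = ((e (p t) ^ N) ^ (1 / 2 : ℂ)).re := by
    have hN' : (0:ℝ) < N := by exact_mod_cast h.one_le
    have h1 : ∀ᶠ t : ℝ in 𝓝[>] 0, e z * exp (t * I) ∈ e.target := by
      have h1 : Tendsto (fun t : ℝ => e z * exp (t * I)) (𝓝 0) (𝓝 (e z)) :=
        Continuous.tendsto' (by fun_prop) _ _ (by simp)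
      exact (h1.mono_left nhdsWithin_le_nhds).eventually_mem (e.open_target.mem_nhds (e.map_source hzs))
    filter_upwards [hpc.eventually hz, h1, Ioo_mem_nhdsGT (div_pos pi_pos hN')] with t h2 h3 h4
    refine h2 (lt_of_le_of_ne (sqrt_re_nonneg _) fun h5 => ?_)
    have h6 := pow_eq_neg_of_sqrt_re_eq_zero h5.symm
    have h7 := pow_eq_neg_of_sqrt_re_eq_zero hre.symm
    have h8 := e.right_inv h3
    rw [h8, mul_pow, norm_mul, ← exp_nat_mul] at h6; have h9 : ‖exp (N * (t * I))‖ = 1 := by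
      rw [show (N:ℂ) * (t * I) = ((N * t : ℝ) : ℂ) * I by push_cast; ring,
        norm_exp_ofReal_mul_I]
    rw [h9, mul_one, ← h7] at h6; have h10 : exp (((N * t : ℝ) : ℂ) * I) = 1 := by
      have := mul_left_cancel₀ (pow_ne_zero N hw) (h6.trans (mul_one _).symm)
      rw [← this]; push_cast; ring_nf
    have h11 := congrArg im h10
    rw [exp_ofReal_mul_I_im, one_im] at h11; have h12 := sin_pos_of_pos_of_lt_pi (mul_pos hN' h4.1)
      (by have := (lt_div_iff₀ hN').1 h4.2; linarith)
    linarith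
  have hl1 : Tendsto (fun t => |T (p t) - T z₀|) (𝓝[>] 0) (𝓝 |T z - T z₀|) :=
    ((hzc.tendsto.comp hpc).sub_const _).abs
  have hl2 := (continuous_sqrt_re.tendsto _).comp ((((e.continuousAt hzs).tendsto.comp hpc)).pow N)
  exact tendsto_nhds_unique_of_eventuallyEq hl1 hl2 hev

end IsNormalChart

end

/-! ### Regular points, creases and local arcs -/

section

theorem sqrt_sq_re (w : ℂ) : ((w ^ 2) ^ (1 / 2 : ℂ)).re = |w.re| := by
  rw [sqrt_re_eq, norm_pow, ← normSq_eq_norm_sq, normSq_apply, sq w,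
    mul_re, ← sqrt_sq_eq_abs]
  congr 1; ring

theorem hasDerivWithinAt_abs_Ici {f : ℝ → ℝ} {l : ℝ} (h : HasDerivAt f l 0) (h0 : f 0 = 0) :
    HasDerivWithinAt (fun s => |f s|) |l| (Ici 0) 0 := by
  rw [hasDerivWithinAt_iff_isLittleO]; refine (Asymptotics.IsBigO.of_bound' ?_).trans_isLittleO
    (h.hasDerivWithinAt (s := Ici 0)).isLittleO
  filter_upwards [self_mem_nhdsWithin] with s hs
  have hs' : |s| = s := abs_of_nonneg hs
  simp only [h0, abs_zero, sub_zero, smul_eq_mul, norm_eq_abs]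
  calc |(|f s| - s * |l|)| = |(|f s| - |s * l|)| := by rw [abs_mul, hs']
    _ ≤ |f s - s * l| := abs_abs_sub_abs_le_abs_sub _ _

theorem IsLocalArc.eventually_mem {S : Set ℂ} {z : ℂ} {γ : ℝ → ℂ} (h : IsLocalArc S z γ) :
    (∀ᶠ t in 𝓝 0, γ t ∈ S) ∧ HasDerivAt γ (deriv γ 0) 0 ∧ deriv γ 0 ≠ 0 := by
  obtain ⟨h0, hc, hd, -, B, -, -, -, hB⟩ := h
  have hm : Ioo (-1 : ℝ) 1 ∈ 𝓝 0 := Ioo_mem_nhds (by norm_num) (by norm_num)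
  refine ⟨?_, ((hc.contDiffAt hm).differentiableAt one_ne_zero).hasDerivAt,
    hd 0 (mem_of_mem_nhds hm)⟩
  filter_upwards [hm] with t ht
  have : γ t ∈ B ∩ S := hB ▸ mem_image_of_mem γ ht
  exact this.2

/-- A holomorphic coordinate in a neighbourhood of `z₀`. -/
structure IsHoloChart (z₀ : ℂ) (e : OpenPartialHomeomorph ℂ ℂ) : Prop where
  mem : z₀ ∈ e.source
  hasDerivAt : ∀ z ∈ e.source, HasDerivAt e (deriv e z) z ∧ deriv e z ≠ 0
  hasDerivAt_symm : ∀ w ∈ e.target, HasDerivAt e.symm (deriv e (e.symm w))⁻¹ w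

/-- The arc is the image of a vertical segment through `e z₀`, and the required neighbourhood is the
image of a disc, which is contractible. Only `Re (e z₀) = 0` is needed, not `e z₀ = 0`. -/
theorem IsHoloChart.exists_isLocalArc {S : Set ℂ} {z₀ : ℂ} {e : OpenPartialHomeomorph ℂ ℂ}
    (h : IsHoloChart z₀ e) (hs : ∀ᶠ z in 𝓝 z₀, z ∈ S ↔ (e z).re = 0) (hz : z₀ ∈ S) :
    ∃ R > 0, IsLocalArc S z₀ (fun t : ℝ => e.symm (e z₀ + t * ((R : ℝ) * I))) := by
  have hre := hs.self_of_nhds.1 hz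
  have ht := e.map_source h.mem
  have hs' := (e.continuousAt_symm ht).eventually (by rwa [e.left_inv h.mem])
  obtain ⟨R, hR, hRt⟩ := Metric.mem_nhds_iff.1 (inter_mem (e.open_target.mem_nhds ht) hs')
  have hRI : (R * I : ℂ) ≠ 0 := mul_ne_zero (by exact_mod_cast hR.ne') I_ne_zero
  have hmem : ∀ t ∈ Ioo (-1 : ℝ) 1, (e z₀ + t * (R * I) : ℂ) ∈ ball (e z₀) R :=
    fun t ht => by
      rw [mem_ball_iff_norm, add_sub_cancel_left, norm_mul, norm_mul, norm_I,
        norm_real, norm_real, norm_eq_abs, norm_eq_abs, abs_of_pos hR,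
        mul_one]
      have := abs_lt.2 ⟨ht.1, ht.2⟩
      nlinarith
  have hbt : ball (e z₀) R ⊆ e.target := fun w hw => (hRt hw).1
  have hlin : ∀ t : ℝ, HasDerivAt (fun t : ℝ => (e z₀ + t * (R * I) : ℂ))
      (R * I) t := fun t => by
    simpa using ((ofRealCLM.hasDerivAt (x := t)).mul_const (R * I : ℂ)).const_add
      (e z₀)
  refine ⟨R, hR, by simp [e.left_inv h.mem], ?_, fun t ht => ?_, ?_,
    e.symm '' ball (e z₀) R, ?_, ?_, ⟨e z₀, mem_ball_self hR, e.left_inv h.mem⟩, ?_⟩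
  · have h1 : ContDiffOn ℂ 1 e.symm e.target :=
      DifferentiableOn.contDiffOn (fun w hw =>
        (h.hasDerivAt_symm w hw).differentiableAt.differentiableWithinAt) e.open_target
    refine (h1.restrict_scalars ℝ).comp ?_ fun t ht => hbt (hmem t ht)
    exact (contDiff_const.add ((ofRealCLM.contDiff).mul contDiff_const)).contDiffOn
  · have h1 : HasDerivAt (fun t : ℝ => e.symm (e z₀ + t * (R * I))) _ t :=
      HasDerivAt.comp t (h.hasDerivAt_symm _ (hbt (hmem t ht))) (hlin t)
    rw [h1.deriv]
    exact mul_ne_zero (inv_ne_zero (h.hasDerivAt _ (e.map_target (hbt (hmem t ht)))).2) hRI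
  · let φ := e.symm.homeomorphOfImageSubsetSource hbt rfl
    have h1 : IsEmbedding fun t : Ioo (-1 : ℝ) 1 => (e z₀ + (t : ℝ) * (R * I) : ℂ) := by
      have h2 : IsEmbedding fun t : ℝ => (e z₀ + t * (R * I) : ℂ) :=
        IsEmbedding.of_leftInverse (f := fun z => ((z - e z₀) / (R * I)).re)
          (fun t => by simp only [add_sub_cancel_left, mul_div_cancel_right₀ _ hRI, ofReal_re])
          (by fun_prop) (by fun_prop)
      exact h2.comp IsEmbedding.subtypeVal
    have h2 : IsEmbedding fun t : Ioo (-1 : ℝ) 1 =>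
        (⟨e z₀ + (t : ℝ) * (R * I), hmem t t.2⟩ : ball (e z₀) R) :=
      IsEmbedding.of_comp (h1.continuous.subtype_mk _) continuous_subtype_val h1
    exact IsEmbedding.subtypeVal.comp (φ.isEmbedding.comp h2)
  · exact e.symm.isOpen_image_of_subset_source isOpen_ball hbt
  · let φ := e.symm.homeomorphOfImageSubsetSource hbt rfl
    have : ContractibleSpace (ball (e z₀) R) :=
      (convex_ball _ _).contractibleSpace ⟨e z₀, mem_ball_self hR⟩
    have := φ.symm.contractibleSpace
    infer_instance
  · ext z; constructor
    · rintro ⟨⟨w, hw, rfl⟩, hz⟩; have h1 := ((hRt hw).2.1 hz)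
      rw [e.right_inv (hbt hw)] at h1; rw [mem_ball_iff_norm] at hw
      have h2 := abs_lt.1 ((abs_im_le_norm (w - e z₀)).trans_lt hw)
      refine ⟨(w - e z₀).im / R, ⟨by rw [lt_div_iff₀ hR]; linarith, by rw [div_lt_iff₀ hR]; linarith⟩, ?_⟩
      simp only; congr 1; have hR' : (R:ℂ) ≠ 0 := by exact_mod_cast hR.ne'
      push_cast; rw [← mul_assoc, div_mul_cancel₀ _ hR']; apply Complex.ext <;> simp [h1, hre]
    · rintro ⟨t, ht, rfl⟩; refine ⟨mem_image_of_mem _ (hmem t ht), (hRt (hmem t ht)).2.2 ?_⟩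
      rw [e.right_inv (hbt (hmem t ht))]; simp [hre]

namespace IsNormalChart

variable {ν : Measure ℂ} {σ : ℂ → ℝ} {g : ℂ → ℂ} {N : ℕ} {z₀ : ℂ}
  {e : OpenPartialHomeomorph ℂ ℂ} {T : ℂ → ℝ}

theorem sectorMap_two (θ u : ℂ) : sectorMap e 2 θ 1 u = e.symm (θ * u) := by
  simp [sectorMap]

theorem sectorMap_two_eq (θ : ℂ) : sectorMap e 2 θ 1 = fun u => e.symm (θ * u) :=
  funext (sectorMap_two θ)

theorem zero_mem_target (h : IsNormalChart ν σ g N z₀ e) : (0 : ℂ) ∈ e.target := by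
  rw [← h.map_zero]; exact e.map_source h.mem

theorem eventually_sqrt_re_eq_zero [IsFiniteMeasure ν] (h : IsNormalChart ν σ g N z₀ e)
    (hpt : ν {z₀} = 0) :
    ∀ᶠ z in 𝓝 z₀, z ∈ ν.support → ((e z ^ N) ^ (1 / 2 : ℂ)).re = 0 := by
  obtain ⟨V, hV, hzV, -, hVs, -⟩ := h.exists_density hpt
  filter_upwards [hV.mem_nhds hzV] with z hz hzs
  exact le_antisymm (not_lt.1 fun h1 => hVs z hz h1 hzs) (sqrt_re_nonneg _)

/-- At a point where the quadratic differential does not vanish the potential has a crease. -/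
theorem exists_eq_add_mul_abs_re [IsFiniteMeasure ν] (h : IsNormalChart ν σ g 2 z₀ e)
    (hTc : ∀ᶠ w in 𝓝 z₀, ContinuousAt T w) (hTd : ∀ᶠ w in 𝓝 z₀, w ∉ ν.support →
      HasFDerivAt T (reMul (g w)) w ∧ ContinuousAt g w) (hz₀ : z₀ ∈ ν.support) :
    ∃ s : ℝ, s ≠ 0 ∧ ∀ᶠ z in 𝓝 z₀, T z = T z₀ + s * |(e z).re| := by
  obtain ⟨δ₁, hδ₁, s₁, hs₁, h1⟩ := h.exists_sector_potential hTc.self_of_nhds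
    hTd (θ := 1) (by simp)
  obtain ⟨δ₂, hδ₂, s₂, hs₂, h2⟩ := h.exists_sector_potential hTc.self_of_nhds
    hTd (θ := -1) (by simp)
  simp only [sectorMap_two_eq, one_mul, neg_one_mul] at h1 h2
  obtain ⟨r, hr, hrt⟩ := Metric.mem_nhds_iff.1 (e.open_target.mem_nhds h.zero_mem_target)
  obtain ⟨δ, hδ, hδ₁', hδ₂', hδr⟩ : ∃ δ > 0, δ ≤ δ₁ ∧ δ ≤ δ₂ ∧ δ ≤ r / 2 :=
    ⟨min (min δ₁ δ₂) (r / 2), lt_min (lt_min hδ₁ hδ₂) (by positivity),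
      (min_le_left _ _).trans (min_le_left _ _), (min_le_left _ _).trans (min_le_right _ _),
      min_le_right _ _⟩
  set Q := openBox (-δ) δ (-δ) δ with hQ
  have hQo : IsOpen Q := isOpen_openBox _ _ _ _
  have h0Q : (0:ℂ) ∈ Q := ⟨by simpa using hδ, by simpa using hδ, by simpa using hδ, by simpa using hδ⟩
  have hQt : Q ⊆ e.target := fun u hu => hrt (by
    rw [mem_ball_zero_iff]; exact norm_lt_of_mem_openBox hu)
  have hQ1 : ∀ u ∈ Q, 0 < u.re → u ∈ openBox 0 δ₁ (-δ₁) δ₁ := fun u hu h3 =>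
    ⟨h3, hu.2.1.trans_le hδ₁', (neg_le_neg hδ₁').trans_lt hu.2.2.1, hu.2.2.2.trans_le hδ₁'⟩
  have hQ2 : ∀ u ∈ Q, u.re < 0 → -u ∈ openBox 0 δ₂ (-δ₂) δ₂ := fun u hu h3 => by
    obtain ⟨h4, h5, h6, h7⟩ := hu
    refine ⟨?_, ?_, ?_, ?_⟩ <;> simp only [neg_re, neg_im] <;> linarith
  have hsd : ∀ u ∈ Q, HasDerivAt e.symm (deriv e.symm u) u := fun u hu =>
    (h.hasDerivAt_symm u (hQt hu)).differentiableAt.hasDerivAt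
  by_cases hs : s₁ = s₂
  · refine ⟨s₁, by rcases hs₁ with h3 | h3 <;> simp [h3], ?_⟩
    have hc := (e.continuousAt h.mem).eventually_mem (hQo.mem_nhds (by rwa [h.map_zero]))
    filter_upwards [hc, e.open_source.mem_nhds h.mem,
      h.eventually_abs_sub_eq hTc hTd] with z hz hzs habs
    rcases lt_trichotomy (e z).re 0 with h3 | h3 | h3
    · have h4 := (h2 _ (hQ2 _ hz h3)).1
      rw [neg_neg, e.left_inv hzs, neg_re] at h4; rw [h4, abs_of_neg h3, hs]
    · rw [sqrt_sq_re, h3, abs_zero, abs_eq_zero, sub_eq_zero] at habs; simp [habs, h3]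
    · have h4 := (h1 _ (hQ1 _ hz h3)).1
      rw [e.left_inv hzs] at h4; rw [h4, abs_of_pos h3]
  -- The second sector is parametrized by `-u`, so opposite signs mean that the field has the same
  -- sign on both sides of the axis. There is then no jump, hence no mass near `z₀`, although `z₀`
  -- is in the support.
  · exfalso; have hs' : s₂ = -s₁ := by
      rcases hs₁ with rfl | rfl <;> rcases hs₂ with rfl | rfl <;> first | exact absurd rfl hs | simp
    have hch := IsChart.of_hasDerivAt hQo
      (fun u hu => (hsd u hu).differentiableAt.differentiableWithinAt)
      (fun u hu => (h.hasDerivAt _ (e.map_target (hQt hu))).1.differentiableAt)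
      fun u hu => e.right_inv (hQt hu)
    have hgs : ∀ᵐ u : ℂ, u ∈ Q → g (e.symm u) * deriv e.symm u = s₁ := by
      filter_upwards [ae_re_ne_zero] with u h3 h4
      rcases h3.lt_or_gt with h5 | h5
      · have h6 := (h2 _ (hQ2 _ h4 h5)).2
        have h7 : HasDerivAt (fun u => e.symm (-u)) _ (-u) :=
          HasDerivAt.scomp (-u) (by rw [neg_neg]; exact hsd u h4) (hasDerivAt_neg (-u))
        rw [h7.deriv, neg_neg, hs'] at h6; push_cast at h6
        simp only [neg_smul, one_smul, mul_neg, neg_inj] at h6; exact h6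
      · exact (h1 _ (hQ1 _ h4 h5)).2
    obtain ⟨s, τ, M, hM, hf, hsg, hMS⟩ := hch.exists_isFlatSystem h.measurable h.sign h.locallyIntegrable (ν := ν)
      (fun X h1 h2 h3 => h.weak X h1 h2 (h3.trans (by
        rintro _ ⟨u, hu, rfl⟩; exact e.map_target (hQt hu)))) (by
        filter_upwards [hgs] with u h3 h4
        rw [h3 h4]; rcases hs₁ with rfl | rfl <;> simp)
    have h3 := hf.measure_eq_zero_of_ae_eq (e := s₁) (by
      filter_upwards [hsg, hgs] with u h3 h4 h5
      have := (h3 h5).trans (h4 h5)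
      exact_mod_cast this)
    rw [hMS Q hQo.measurableSet le_rfl] at h3
    exact ne_of_pos_of_notMem_support hch.isOpen_image h3 ⟨0, h0Q, h.symm_zero⟩ hz₀

/-- That the support lies on the axis is known. Conversely, at an axis point off the support `T`
would be differentiable, which the crease `s |Re e|` with `s ≠ 0` forbids. -/
theorem eventually_mem_support_iff [IsFiniteMeasure ν] (h : IsNormalChart ν σ g 2 z₀ e)
    (hpt : ν {z₀} = 0)
    (hTc : ∀ᶠ w in 𝓝 z₀, ContinuousAt T w) (hTd : ∀ᶠ w in 𝓝 z₀, w ∉ ν.support →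
      HasFDerivAt T (reMul (g w)) w ∧ ContinuousAt g w) (hz₀ : z₀ ∈ ν.support) :
    ∀ᶠ z in 𝓝 z₀, z ∈ ν.support ↔ (e z).re = 0 := by
  obtain ⟨s, hs, hT⟩ := h.exists_eq_add_mul_abs_re hTc hTd hz₀
  filter_upwards [h.eventually_sqrt_re_eq_zero hpt, hT.eventually_nhds, hTd,
    e.open_source.mem_nhds h.mem] with z h1 h2 h3 hzs
  refine ⟨fun h4 => by have := h1 h4; rwa [sqrt_sq_re, abs_eq_zero] at this, fun h4 => ?_⟩
  by_contra h5
  have hp : HasDerivAt (fun t : ℝ => e.symm (e z + t)) _ 0 :=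
    HasDerivAt.comp (0:ℝ) (by simpa using h.hasDerivAt_symm _ (e.map_source hzs))
      (ofRealCLM.hasDerivAt.const_add (e z))
  have hz0 : e.symm (e z + ((0:ℝ):ℂ)) = z := by simp [e.left_inv hzs]
  have h6 := HasFDerivAt.comp_hasDerivAt (0:ℝ) (by rw [hz0]; exact (h3 h5).1) hp
  have h7 : ∀ᶠ t : ℝ in 𝓝 0, T (e.symm (e z + t)) = T z₀ + s * |t| := by
    have h8 : Tendsto (fun t : ℝ => e z + (t:ℂ)) (𝓝 0) (𝓝 (e z)) :=
      Continuous.tendsto' (by fun_prop) _ _ (by simp)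
    have h9 := hp.continuousAt.tendsto
    rw [hz0] at h9
    filter_upwards [h9.eventually h2, h8.eventually_mem (e.open_target.mem_nhds (e.map_source hzs))]
      with t h10 h11
    rw [h10, e.right_inv h11, add_re, h4, zero_add, ofReal_re]
  have h8 := (h6.congr_of_eventuallyEq (h7.mono fun t ht => ht.symm)).differentiableAt
  refine not_differentiableAt_abs_zero ?_; have h9 := (h8.sub_const (T z₀)).const_mul s⁻¹
  refine h9.congr_of_eventuallyEq (Eventually.of_forall fun t => ?_)
  field_simp; simp

theorem isHoloChart (h : IsNormalChart ν σ g N z₀ e) : IsHoloChart z₀ e :=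
  ⟨h.mem, h.hasDerivAt, h.hasDerivAt_symm⟩

/-- For `N = 1` the support near `z₀` lies on the single ray `e ≤ 0` ending at `z₀`. Along a
differentiable arc through `z₀` inside the support, `Re e` has a local maximum and `Im e` vanishes,
so the velocity would be zero. -/
theorem not_isLocalArc_of_one [IsFiniteMeasure ν] (h : IsNormalChart ν σ g 1 z₀ e)
    (hs : ∀ᶠ z in 𝓝 z₀, z ∈ ν.support → ((e z ^ 1) ^ (1 / 2 : ℂ)).re = 0) (γ : ℝ → ℂ) :
    ¬ IsLocalArc ν.support z₀ γ := by
  intro hγ; obtain ⟨h1, h2, h3⟩ := hγ.eventually_mem; have h0 := hγ.1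
  have hf := HasDerivAt.comp (0:ℝ) (by rw [h0]; exact (h.hasDerivAt z₀ h.mem).1) h2
  have hev : ∀ᶠ t in 𝓝 0, e (γ t) = -(‖e (γ t)‖ : ℂ) := by
    have hc := h2.continuousAt.tendsto
    rw [h0] at hc; filter_upwards [h1, hc.eventually hs] with t h4 h5
    have := pow_eq_neg_of_sqrt_re_eq_zero (h5 h4)
    rwa [pow_one] at this
  have hne := mul_ne_zero (h.hasDerivAt z₀ h.mem).2 h3
  refine hne (Complex.ext ?_ ?_)
  · have h4 := reCLM.hasFDerivAt.comp_hasDerivAt (0:ℝ) hf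
    have h5 : IsLocalMax (fun t => (e (γ t)).re) 0 := by
      filter_upwards [hev] with t ht
      rw [h0, h.map_zero, ht]; simp
    exact h5.hasDerivAt_eq_zero h4
  · have h4 : HasDerivAt (fun t => (e (γ t)).im) (deriv e z₀ * deriv γ 0).im 0 :=
      imCLM.hasFDerivAt.comp_hasDerivAt (0:ℝ) hf
    exact h4.unique ((hasDerivAt_const (0:ℝ) (0:ℝ)).congr_of_eventuallyEq (by
      filter_upwards [hev] with t ht
      rw [ht]; simp))

/-- The oscillation is at most `|e|^(N/2)` with `N/2 > 1`, hence `o(|z - z₀|)`. -/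
theorem hasFDerivAt_zero (h : IsNormalChart ν σ g N z₀ e) (hN : 3 ≤ N)
    (hT : ∀ᶠ z in 𝓝 z₀, |T z - T z₀| = ((e z ^ N) ^ (1 / 2 : ℂ)).re) :
    HasFDerivAt T (0 : ℂ →L[ℝ] ℝ) z₀ := by
  have hN' : (3:ℝ) ≤ N := by exact_mod_cast hN
  rw [hasFDerivAt_iff_isLittleO]; simp only [zero_apply, sub_zero]
  have h1 : (fun z => e z) =O[𝓝 z₀] fun z => z - z₀ := by
    have := (h.hasDerivAt z₀ h.mem).1.isBigO_sub
    simpa only [h.map_zero, sub_zero] using this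
  have h2 : (fun z => ‖e z‖ ^ ((N:ℝ) / 2 - 1)) =o[𝓝 z₀] fun _ => (1:ℝ) := by
    rw [Asymptotics.isLittleO_one_iff]
    have h3 := ((e.continuousAt h.mem).norm.rpow_const (p := (N:ℝ) / 2 - 1)
      (Or.inr (by linarith))).tendsto
    rwa [h.map_zero, norm_zero, zero_rpow (by linarith)] at h3
  have h3 := h2.mul_isBigO h1.norm_norm
  simp only [one_mul] at h3
  refine (Asymptotics.IsBigO.of_norm_eventuallyLE ?_).trans_isLittleO h3.of_norm_right
  filter_upwards [hT] with z hz
  rw [norm_eq_abs, hz]; refine (re_le_norm _).trans ?_; rw [norm_sqrt_pow]; by_cases h0 : e z = 0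
  · rw [h0, norm_zero, zero_rpow (by linarith), mul_zero]
  · rw [← rpow_add_one (norm_ne_zero_iff.2 h0), sub_add_cancel]

end IsNormalChart

end

/-! ### Critical measures satisfy (i) and (ii) -/

section

variable {n : ℕ} {a ρ : Fin n → ℂ} {μ : SignedMeasure ℂ}

/-- The local structure of the potential of a critical measure at a point of its support. -/
theorem IsCriticalMeasure.exists_chart (hcr : IsCriticalMeasure a ρ μ) (ha : Function.Injective a)
    {z₀ : ℂ} (hz₀ : z₀ ∈ realSupport μ) :
    IsPotentialDefinedAt a ρ μ z₀ ∧ ∃ (σ : ℂ → ℝ) (g : ℂ → ℂ) (N : ℕ)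
      (e : OpenPartialHomeomorph ℂ ℂ), ((∀ k, z₀ ≠ a k) → 2 ≤ N) ∧
      IsNormalChart μ.variation σ g N z₀ e ∧
      (∀ᶠ w in 𝓝 z₀, ContinuousAt (totalPotential a ρ μ z₀) w) ∧
      ∀ᶠ w in 𝓝 z₀, w ∉ μ.variation.support →
        HasFDerivAt (totalPotential a ρ μ z₀) (reMul (g w)) w ∧ ContinuousAt g w := by
  obtain ⟨σ, hσ, hσ1, hμ, -⟩ := exists_sign_variation μ
  have hσa : ∀ x, |σ x| = 1 := fun x => by rcases hσ1 x with h | h <;> simp [h]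
  obtain ⟨E, hE, hg⟩ := hcr.exists_entire hσ hσa hμ; have hpt := hcr.finite_energy.1
  have hunch : ∀ z ∈ μ.variation.support, ∀ k, ρ k ≠ 0 → z ≠ a k := fun z hz k hk h =>
    notMem_support_of_charged ha hσ hσ1 hpt hE hg hk (h ▸ hz)
  have hU : logPotential μ = signedPotential μ.variation σ := funext fun w => hμ _
  have hic : ∀ z ∈ μ.variation.support, Integrable (fun x => Real.log (1 / ‖z - x‖)) μ.variation ∧
      ContinuousAt (logPotential μ) z := fun z hz => by
    obtain ⟨N, e, -, h⟩ := exists_isNormalChart ha hσ hσ1 hE hg (hunch z hz) hz; rw [hU]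
    exact integrable_and_continuousAt_signedPotential hσ hσa hcr.compact_support
      fun η hη => h.exists_log_small (hpt z) hη
  have hUc : ∀ z, ContinuousAt (logPotential μ) z := fun z => by
    by_cases hz : z ∈ μ.variation.support
    · exact (hic z hz).2
    · rw [hU]; exact (hasFDerivAt_signedPotential hσ hσa hcr.compact_support hz).continuousAt
  obtain ⟨N, e, hN2, h⟩ := exists_isNormalChart ha hσ hσ1 hE hg (hunch z₀ hz₀) hz₀
  have hφ := eventually_hasFDerivAt_fieldIncrement a ρ (hunch z₀ hz₀)
  refine ⟨⟨hunch z₀ hz₀, hpt z₀, (hic z₀ hz₀).1⟩, σ, _, N, e, hN2, h, ?_, ?_⟩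
  · filter_upwards [hφ] with w hw using (hUc w).add hw.continuousAt
  · filter_upwards [hφ, eventually_uncharged a ρ (hunch z₀ hz₀)] with w hw hwu hws
    refine ⟨?_, (differentiableAt_cauchyTransform hσ hσa hws).continuousAt.add
      (differentiableAt_fieldDeriv a ρ hwu).continuousAt⟩
    have h1 := hasFDerivAt_signedPotential hσ hσa hcr.compact_support hws
    rw [← hU] at h1; refine (h1.add hw).congr_fderiv ?_; ext v; simp [totalField, mul_add]

theorem IsCriticalMeasure.eventually_totalPotential_eq (hcr : IsCriticalMeasure a ρ μ)
    (ha : Function.Injective a) {z₀ : ℂ} (hz₀ : z₀ ∈ realSupport μ) :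
    ∀ᶠ w in 𝓝[realSupport μ] z₀, totalPotential a ρ μ z₀ w = totalPotential a ρ μ z₀ z₀ := by
  obtain ⟨hdef, σ, g, N, e, -, h, hTc, hTd⟩ := hcr.exists_chart ha hz₀
  rw [eventually_nhdsWithin_iff]; filter_upwards [h.eventually_abs_sub_eq hTc hTd,
    h.eventually_sqrt_re_eq_zero hdef.2.1] with w h1 h2 h3
  rwa [h2 h3, abs_eq_zero, sub_eq_zero] at h1

theorem IsCriticalMeasure.isConstantOnComponents (hcr : IsCriticalMeasure a ρ μ)
    (ha : Function.Injective a) : IsConstantOnComponents a ρ μ := fun x _ z hz => by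
  have hz' := connectedComponentIn_subset _ _ hz
  exact ⟨(hcr.exists_chart ha hz').1, (hcr.eventually_totalPotential_eq ha hz').filter_mono
    (nhdsWithin_mono _ (connectedComponentIn_subset _ _))⟩

/-- For real charges, a potential that is locally constant on a connected set is constant. -/
theorem IsConstantOnComponents.exists_eq (h : IsConstantOnComponents a ρ μ)
    (hρ : ∀ k, (ρ k).im = 0) {x : ℂ} (hx : x ∈ realSupport μ) :
    ∃ w : ℝ, ∀ z ∈ connectedComponentIn (realSupport μ) x,
      logPotential μ z + externalField a ρ z = w := by
  set Γ := connectedComponentIn (realSupport μ) x with hΓ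
  have hpre : PreconnectedSpace Γ :=
    isPreconnected_iff_preconnectedSpace.1 isPreconnected_connectedComponentIn
  have hlc : IsLocallyConstant fun z : Γ => logPotential μ z + externalField a ρ z := by
    rw [IsLocallyConstant.iff_eventually_eq]; rintro ⟨z, hz⟩; obtain ⟨h1, h2⟩ := h x hx z hz
    rw [nhds_subtype_eq_comap_nhdsWithin, eventually_comap]; filter_upwards [h2] with w h3 w' hw'
    subst hw'; have h4 := (h x hx w' w'.2).1
    simp only [totalPotential] at h3
    rw [fieldIncrement_eq_sub a ρ hρ _ _ h1.1 h4.1, fieldIncrement_self] at h3; linarith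
  refine ⟨logPotential μ x + externalField a ρ x, fun z hz => ?_⟩
  exact hlc.apply_eq_of_preconnectedSpace ⟨z, hz⟩ ⟨x, mem_connectedComponentIn hx⟩

/-- The case `N = 1` cannot occur at a regular point. For `N = 2` the crease has one-sided
derivative `s |Re (e'(z) c)|` in direction `c`, which is even in `c`; for `N ≥ 3` every directional
derivative is 0. -/
theorem IsCriticalMeasure.hasSProperty (hcr : IsCriticalMeasure a ρ μ)
    (ha : Function.Injective a) : HasSProperty a ρ μ := by
  rintro z hz ⟨γ, hγ⟩ m -
  obtain ⟨hdef, σ, g, N, e, -, h, hTc, hTd⟩ := hcr.exists_chart ha hz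
  have hline : ∀ c : ℂ, HasDerivAt (fun s : ℝ => z + s * c) c 0 := fun c => by
    simpa using ((ofRealCLM.hasDerivAt (x := (0:ℝ))).mul_const c).const_add z
  have hz0 : ∀ c : ℂ, z + ((0:ℝ):ℂ) * c = z := fun c => by simp
  obtain hN1 | hN2 | hN3 : N = 1 ∨ N = 2 ∨ 3 ≤ N := by have := h.one_le; omega
  · subst hN1; exact absurd hγ (h.not_isLocalArc_of_one
      (h.eventually_sqrt_re_eq_zero hdef.2.1) γ)
  · subst hN2; obtain ⟨s, -, hs⟩ := h.exists_eq_add_mul_abs_re hTc hTd hz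
    have key : ∀ c : ℂ, HasDerivWithinAt (fun t : ℝ => totalPotential a ρ μ z (z + t * c))
        (s * |(deriv e z * c).re|) (Ici 0) 0 := fun c => by
      have h1 := HasDerivAt.comp (0:ℝ) (by rw [hz0]; exact (h.hasDerivAt z h.mem).1) (hline c)
      have h2 := reCLM.hasFDerivAt.comp_hasDerivAt (0:ℝ) h1
      have h3 := ((hasDerivWithinAt_abs_Ici h2 (by simp [h.map_zero])).const_mul s).const_add
        (totalPotential a ρ μ z z)
      refine h3.congr_of_eventuallyEq ?_ (by simp [h.map_zero])
      have h4 := (hline c).continuousAt.tendsto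
      rw [hz0] at h4; exact (h4.eventually hs).filter_mono nhdsWithin_le_nhds
    refine ⟨_, key m, ?_⟩; have := key (-m)
    rwa [mul_neg, neg_re, abs_neg] at this
  · have h1 := h.hasFDerivAt_zero hN3 (h.eventually_abs_sub_eq hTc hTd)
    have key : ∀ c : ℂ, HasDerivWithinAt (fun t : ℝ => totalPotential a ρ μ z (z + t * c))
        0 (Ici 0) 0 := fun c => by
      have := HasFDerivAt.comp_hasDerivAt (0:ℝ) (by rw [hz0]; exact h1) (hline c)
      exact HasDerivAt.hasDerivWithinAt this
    exact ⟨0, key m, key (-m)⟩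

/-- Off the nodes `N ≥ 2`, and for `N = 2` the support is locally the whole axis of the chart, so
the point is regular. Only `N ≥ 3` remains. -/
theorem IsCriticalMeasure.gradientVanishesAtNonregular (hcr : IsCriticalMeasure a ρ μ)
    (ha : Function.Injective a) : GradientVanishesAtNonregular a ρ μ := by
  intro z hz hza hreg
  obtain ⟨hdef, σ, g, N, e, hN2, h, hTc, hTd⟩ := hcr.exists_chart ha hz
  obtain hN2' | hN3 : N = 2 ∨ 3 ≤ N := by have := hN2 hza; omega
  · subst hN2'; obtain ⟨R, -, hR⟩ := h.isHoloChart.exists_isLocalArc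
      (h.eventually_mem_support_iff hdef.2.1 hTc hTd hz) hz
    exact absurd ⟨_, hR⟩ hreg
  · have h1 := h.hasFDerivAt_zero hN3 (h.eventually_abs_sub_eq hTc hTd)
    rw [hasGradientAt_iff_hasFDerivAt, map_zero]; exact h1

end

/-! ### Analytic arcs and their straightening charts -/

section

variable {z₀ : ℂ} {e : OpenPartialHomeomorph ℂ ℂ}

/-- The holomorphic extension of a real-analytic curve. -/
theorem AnalyticAt.exists_complexification {γ : ℝ → ℂ} {t₀ : ℝ} (h : AnalyticAt ℝ γ t₀) :
    ∃ G : ℂ → ℂ, AnalyticAt ℂ G 0 ∧ ∀ᶠ s : ℝ in 𝓝 0, G s = γ (t₀ + s) := by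
  obtain ⟨p, hp⟩ := h; obtain ⟨r, hr0, hr⟩ := ENNReal.lt_iff_exists_nnreal_btwn.1 hp.radius_pos
  obtain ⟨C, -, hC⟩ := p.norm_mul_pow_le_of_lt_radius hr
  set q := FormalMultilinearSeries.ofScalars ℂ p.coeff with hq
  have hqr : 0 < q.radius := by
    refine hr0.trans_le (q.le_radius_of_bound C fun n => ?_)
    rw [hq, FormalMultilinearSeries.ofScalars_norm, ← FormalMultilinearSeries.norm_apply_eq_norm_coef]
    exact hC n
  have hqa := (q.hasFPowerSeriesOnBall hqr).hasFPowerSeriesAt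
  refine ⟨q.sum, hqa.analyticAt, ?_⟩
  have h1 : ∀ᶠ s : ℝ in 𝓝 0, HasSum (fun n => q n fun _ => (s:ℂ)) (q.sum s) := by
    have h2 := continuous_ofReal.tendsto' 0 0 ofReal_zero
    filter_upwards [h2.eventually hqa.eventually_hasSum] with s hs
    simpa using hs
  filter_upwards [h1, hp.eventually_hasSum] with s h2 h3
  have h4 : (fun n => q n fun _ => (s:ℂ)) = fun n => p n fun _ => s := by
    ext n
    rw [hq, FormalMultilinearSeries.ofScalars_apply_eq, FormalMultilinearSeries.apply_eq_pow_smul_coeff]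
    simp [mul_comm]
  rw [h4] at h2; exact h2.unique h3

/-- The chart is the inverse of `w ↦ G (-I w)`, where `G` extends the curve holomorphically; the
factor `-I` sends the point `s I` of the imaginary axis to the parameter `s`. -/
theorem exists_axis_chart {γ : ℝ → ℂ} {t₀ : ℝ} (h : AnalyticAt ℝ γ t₀) (hd : deriv γ t₀ ≠ 0) :
    ∃ e : OpenPartialHomeomorph ℂ ℂ, IsHoloChart (γ t₀) e ∧ e (γ t₀) = 0 ∧
      ∀ᶠ s : ℝ in 𝓝 0, (s * I : ℂ) ∈ e.target ∧ e.symm (s * I) = γ (t₀ + s) := by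
  obtain ⟨G, hG, hGs⟩ := h.exists_complexification; set y : ℂ → ℂ := fun w => G (-I * w) with hy
  have hya : AnalyticAt ℂ y 0 := by
    refine AnalyticAt.fun_comp (g := G) (by simpa using hG) (by fun_prop)
  have hyd : deriv y 0 ≠ 0 := by
    intro h0; have h1 : HasDerivAt (fun s : ℝ => y (s * I)) (deriv y 0 * I) 0 :=
      HasDerivAt.comp (h₂ := y) (h := fun s : ℝ => (s * I : ℂ)) (0:ℝ)
        (by rw [ofReal_zero, zero_mul]; exact hya.differentiableAt.hasDerivAt)
        (by simpa using (ofRealCLM.hasDerivAt (x := (0:ℝ))).mul_const I)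
    have h2 : HasDerivAt (fun s : ℝ => γ (t₀ + s)) (deriv γ t₀) 0 :=
      HasDerivAt.comp_const_add t₀ 0 (by simpa using h.differentiableAt.hasDerivAt)
    refine hd (h2.unique (((by simpa [h0] using h1 : HasDerivAt (fun s : ℝ => y (s * I)) 0 0)).congr_of_eventuallyEq ?_))
    filter_upwards [hGs] with s hs
    rw [← hs, hy]; simp only; congr 1; linear_combination (s:ℂ) * I_sq
  obtain ⟨f, hf0, -, hfy, hfd, hfs⟩ := exists_local_inverse hya hyd univ_mem
  have hy0 : y 0 = γ t₀ := by simpa [hy] using hGs.self_of_nhds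
  have hfz : f 0 = γ t₀ := by rw [hfy, hy0]
  have hsym : ∀ z ∈ f.target, deriv f.symm z = (deriv y (f.symm z))⁻¹ := fun z hz => (hfs z hz).deriv
  refine ⟨f.symm, ⟨by rw [← hfz]; exact f.map_source hf0, fun z hz => ?_, fun w hw => ?_⟩, ?_, ?_⟩
  · have h1 := hfd _ (f.map_target hz)
    exact ⟨(hfs z hz).differentiableAt.hasDerivAt, by rw [hsym z hz]; exact inv_ne_zero h1.2⟩
  · have hw' := hw
    have h1 := (hfd w hw').1.differentiableAt.hasDerivAt
    rw [f.symm_symm, hsym _ (f.map_source hw'), f.left_inv hw', inv_inv, hfy]; exact h1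
  · rw [← hfz, f.left_inv hf0]
  · have h1 : Tendsto (fun s : ℝ => (s * I : ℂ)) (𝓝 0) (𝓝 0) :=
      Continuous.tendsto' (by fun_prop) _ _ (by simp)
    filter_upwards [hGs, h1.eventually_mem (f.open_source.mem_nhds hf0)] with s hs hm
    refine ⟨hm, ?_⟩; rw [f.symm_symm, hfy, ← hs, hy]; simp only; congr 1
    linear_combination -(s:ℂ) * I_sq

theorem IsHoloChart.tendsto_im (h : IsHoloChart z₀ e)
    (h0 : e z₀ = 0) : Tendsto (fun z => (e z).im) (𝓝 z₀) (𝓝 0) := by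
  rw [← zero_im, ← h0]; exact (continuous_im.tendsto _).comp (e.continuousAt h.mem)

/-- `S` is an analytic arc near `z`. -/
def IsGoodPoint (S : Set ℂ) (z : ℂ) : Prop :=
  ∃ e : OpenPartialHomeomorph ℂ ℂ, IsHoloChart z e ∧ ∀ᶠ w in 𝓝 z, w ∈ S ↔ (e w).re = 0

/-- The local description of an analytic arc at one of its points. -/
theorem IsAnalyticArc.exists_chart {Γ : Set ℂ} (hΓ : IsAnalyticArc Γ) {z₀ : ℂ} (hz₀ : z₀ ∈ Γ) :
    ∃ (e : OpenPartialHomeomorph ℂ ℂ) (t₀ : ℝ), t₀ ∈ Icc (0:ℝ) 1 ∧ IsHoloChart z₀ e ∧ e z₀ = 0 ∧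
      ∀ᶠ z in 𝓝 z₀, z ∈ Γ ↔ (e z).re = 0 ∧ t₀ + (e z).im ∈ Icc (0:ℝ) 1 := by
  obtain ⟨γ, hγ, hinj, hd, rfl⟩ := hΓ; obtain ⟨t₀, ht₀, rfl⟩ := hz₀
  obtain ⟨e, he, he0, hes⟩ := exists_axis_chart (hγ t₀ ht₀) (hd t₀ ht₀)
  refine ⟨e, t₀, ht₀, he, he0, ?_⟩; obtain ⟨δ, hδ, hδs⟩ := eventually_nhds_iff_ball.1 hes
  -- By injectivity and compactness the arc does not return near `γ t₀`: nearby points of the arc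
  -- have nearby parameters, so the local chart describes the whole arc.
  have hfar : ∀ᶠ z in 𝓝 (γ t₀), ∀ t ∈ Icc (0:ℝ) 1, γ t = z → |t - t₀| < δ := by
    have hK : IsCompact (γ '' (Icc 0 1 ∩ {t | δ ≤ |t - t₀|})) := by
      refine IsCompact.image_of_continuousOn ?_ fun t ht => (hγ t ht.1).continuousAt.continuousWithinAt
      exact isCompact_Icc.inter_right (isClosed_le continuous_const (by fun_prop))
    have hn : γ t₀ ∉ γ '' (Icc 0 1 ∩ {t | δ ≤ |t - t₀|}) := by
      rintro ⟨t, ⟨ht, ht2⟩, h⟩; rw [hinj ht ht₀ h, mem_ofPred_eq, sub_self, abs_zero] at ht2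
      linarith
    filter_upwards [hK.isClosed.isOpen_compl.mem_nhds hn] with z hz t ht h
    by_contra! hlt; exact hz ⟨t, ⟨ht, hlt⟩, h⟩
  have him : ∀ᶠ z in 𝓝 (γ t₀), |(e z).im| < δ := by
    have h1 := ((continuous_im.abs.continuousAt).comp (e.continuousAt he.mem)).tendsto
    simp only [Function.comp, he0, zero_im, abs_zero] at h1; exact h1.eventually (gt_mem_nhds hδ)
  filter_upwards [hfar, him, e.open_source.mem_nhds he.mem] with z h1 h2 h3
  constructor
  · rintro ⟨t, ht, rfl⟩; have h4 := hδs (t - t₀) (by rw [mem_ball_zero_iff]; exact h1 t ht rfl)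
    rw [add_sub_cancel] at h4; rw [← h4.2, e.right_inv h4.1]; simpa using ht
  · rintro ⟨h4, h5⟩; have h6 := hδs (e z).im (by rw [mem_ball_zero_iff]; exact h2)
    refine ⟨_, h5, ?_⟩; rw [← h6.2, ← e.left_inv h3]; congr 1; rw [e.left_inv h3]
    apply Complex.ext <;> simp [h4]

theorem IsHoloChart.differentiableAt_symm
    (h : IsHoloChart z₀ e) : AnalyticAt ℂ e z₀ ∧ AnalyticAt ℂ e.symm (e z₀) := by
  constructor
  · exact DifferentiableOn.analyticAt (fun z hz => (h.hasDerivAt z hz).1.differentiableAt.differentiableWithinAt)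
      (e.open_source.mem_nhds h.mem)
  · exact DifferentiableOn.analyticAt (fun z hz => (h.hasDerivAt_symm z hz).differentiableAt.differentiableWithinAt)
      (e.open_target.mem_nhds (e.map_source h.mem))

/-- All points of a finite union of analytic arcs that are close to a given point are good. -/
theorem eventually_isGoodPoint {ι : Type*} [Finite ι] {Γ : ι → Set ℂ} (hΓ : ∀ j, IsAnalyticArc (Γ j))
    (z₀ : ℂ) : ∀ᶠ z in 𝓝[≠] z₀, z ∈ (⋃ j, Γ j) → IsGoodPoint (⋃ j, Γ j) z := by
  have hcl : ∀ j, IsClosed (Γ j) := fun j => by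
    obtain ⟨γ, hγ, -, -, h⟩ := hΓ j; rw [h]; exact (isCompact_Icc.image_of_continuousOn fun t ht =>
      (hγ t ht).continuousAt.continuousWithinAt).isClosed
  suffices H : ∀ j, ∀ᶠ z in 𝓝[≠] z₀, z ∈ Γ j → IsGoodPoint (⋃ j, Γ j) z by
    filter_upwards [eventually_all.2 H] with z hz hzS
    obtain ⟨j, hj⟩ := mem_iUnion.1 hzS; exact hz j hj
  intro j; by_cases hj : z₀ ∉ Γ j
  · filter_upwards [nhdsWithin_le_nhds ((hcl j).isOpen_compl.mem_nhds hj)] with z hz h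
    exact absurd h hz
  push Not at hj; obtain ⟨e, t₀, ht₀, he, he0, hiff⟩ := (hΓ j).exists_chart hj
  -- Along another arc through `z₀` the function `Re e` is real-analytic in the parameter. Either it
  -- vanishes identically and the arc runs inside the axis, or its zero at `z₀` is isolated and the
  -- arc meets the axis only at `z₀`.
  have hpair : ∀ l, (∀ᶠ z in 𝓝 z₀, z ∈ Γ l → (e z).re = 0) ∨
      ∀ᶠ z in 𝓝[≠] z₀, (e z).re = 0 → z ∉ Γ l := by
    intro l; by_cases hl : z₀ ∉ Γ l
    · right
      filter_upwards [nhdsWithin_le_nhds ((hcl l).isOpen_compl.mem_nhds hl)] with z hz _ using hz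
    push Not at hl; obtain ⟨f, t₁, ht₁, hf, hf0, hfiff⟩ := (hΓ l).exists_chart hl
    have hfs : f.symm 0 = z₀ := by rw [← hf0, f.left_inv hf.mem]
    have hF : AnalyticAt ℝ (fun s : ℝ => (e (f.symm (s * I))).re) 0 := by
      have h1 : AnalyticAt ℂ (fun w => e (f.symm w)) 0 := by
        refine AnalyticAt.fun_comp (by rw [hfs]; exact he.differentiableAt_symm.1) ?_
        rw [← hf0]; exact hf.differentiableAt_symm.2
      have h2 : AnalyticAt ℝ (fun s : ℝ => (s * I : ℂ)) 0 :=
        (ofRealCLM.analyticAt 0).mul analyticAt_const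
      have h3 := AnalyticAt.fun_comp (g := fun w => e (f.symm w)) (by simpa using h1.restrictScalars) h2
      exact (reCLM.analyticAt _).comp h3
    have hcoord : ∀ᶠ z in 𝓝 z₀, z ∈ Γ l → z = f.symm ((f z).im * I) := by
      filter_upwards [hfiff, f.open_source.mem_nhds hf.mem] with z h1 h2 h3
      rw [show ((f z).im * I : ℂ) = f z by apply Complex.ext <;> simp [(h1.1 h3).1],
        f.left_inv h2]
    have himl := hf.tendsto_im hf0
    rcases hF.eventually_eq_zero_or_eventually_ne_zero with h | h
    · left
      filter_upwards [hcoord, himl.eventually h] with z h1 h2 h3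
      rw [h1 h3]; exact h2
    · right
      rw [eventually_nhdsWithin_iff] at h ⊢
      filter_upwards [hcoord, himl.eventually h] with z h1 h2 h3 h4 h5
      refine h2 ?_ ?_
      · intro h0; have h0' := h0
        have h6 := h1 h5
        rw [h0', ofReal_zero, zero_mul, hfs] at h6; exact h3 h6
      · rw [← h1 h5]; exact h4
  have hpair' : ∀ l, ∀ᶠ z in 𝓝[≠] z₀, (e z).re = 0 → ∀ᶠ w in 𝓝 z, w ∈ Γ l → (e w).re = 0 := by
    intro l; rcases hpair l with h | h
    · filter_upwards [nhdsWithin_le_nhds h.eventually_nhds] with z hz _ using hz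
    · filter_upwards [h] with z hz h1
      filter_upwards [(hcl l).isOpen_compl.mem_nhds (hz h1)] with w hw h2
      exact absurd h2 hw
  -- Points of the arc near `z₀`, other than `z₀`, are interior points of the arc, even when `z₀` is
  -- an endpoint. At them the arc fills the whole axis of the chart.
  have him : ∀ᶠ z in 𝓝 z₀, t₀ + (e z).im ∈ Icc (0:ℝ) 1 → z ≠ z₀ → (e z).re = 0 →
      t₀ + (e z).im ∈ Ioo (0:ℝ) 1 := by
    have h1 := he.tendsto_im he0
    obtain ⟨δ, hδ, hδ1, hδ0⟩ : ∃ δ > 0, (t₀ ≠ 0 → δ ≤ t₀) ∧ (t₀ ≠ 1 → δ ≤ 1 - t₀) := by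
      rcases eq_or_ne t₀ 0 with h | h
      · exact ⟨1, one_pos, fun h' => absurd h h', fun _ => by rw [h]; norm_num⟩
      rcases eq_or_ne t₀ 1 with h' | h'
      · exact ⟨1, one_pos, fun _ => h'.ge, fun h'' => absurd h' h''⟩
      · have h2 := lt_of_le_of_ne ht₀.1 h.symm
        have h3 := lt_of_le_of_ne ht₀.2 h'
        exact ⟨min t₀ (1 - t₀), lt_min h2 (by linarith), fun _ => min_le_left _ _,
          fun _ => min_le_right _ _⟩
    filter_upwards [h1.eventually (ball_mem_nhds 0 hδ), e.open_source.mem_nhds he.mem]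
      with z h2 h3 h4 h5 h6
    rw [Real.dist_eq, sub_zero, abs_lt] at h2
    have h7 : (e z).im ≠ 0 := fun h7 => h5 (e.injOn h3 he.mem (by
      rw [he0]; exact Complex.ext h6 h7))
    refine ⟨lt_of_le_of_ne h4.1 fun h8 => ?_, lt_of_le_of_ne h4.2 fun h8 => ?_⟩
    · rcases eq_or_ne t₀ 0 with h | h
      · rw [h, zero_add] at h8; exact h7 h8.symm
      · have := hδ1 h; linarith
    · rcases eq_or_ne t₀ 1 with h | h
      · exact h7 (by linarith)
      · have := hδ0 h; linarith
  filter_upwards [eventually_all.2 hpair', nhdsWithin_le_nhds him, self_mem_nhdsWithin,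
    nhdsWithin_le_nhds hiff.eventually_nhds,
    nhdsWithin_le_nhds (e.open_source.mem_nhds he.mem)] with z h1 h2 h3 h4 h5 hzj
  obtain ⟨h6, h7⟩ := h4.self_of_nhds.1 hzj; refine ⟨e, ⟨h5, he.hasDerivAt, he.hasDerivAt_symm⟩, ?_⟩
  have h8 : ∀ᶠ w in 𝓝 z, t₀ + (e w).im ∈ Ioo (0:ℝ) 1 := by
    have h9 : ContinuousAt (fun w => t₀ + (e w).im) z :=
      continuousAt_const.add (continuous_im.continuousAt.comp (e.continuousAt h5))
    exact h9.eventually_mem (isOpen_Ioo.mem_nhds (h2 h7 h3 h6))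
  filter_upwards [eventually_all.2 fun l => h1 l h6, h4, h8] with w h9 h10 h11
  rw [mem_iUnion]
  exact ⟨fun ⟨l, hl⟩ => h9 l hl, fun h12 => ⟨j, h10.2 ⟨h12, Ioo_subset_Icc_self h11⟩⟩⟩

theorem IsAnalyticArc.volume_eq_zero {Γ : Set ℂ} (hΓ : IsAnalyticArc Γ) : volume Γ = 0 := by
  obtain ⟨γ, hγ, -, -, rfl⟩ := hΓ
  have h0 : volume {z : ℂ | z.re ∈ Icc (0:ℝ) 1 ∧ z.im = 0} = 0 := by
    have h1 : ∀ᵐ z : ℂ, z.im ≠ 0 := by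
      have h2 := volume_preserving_equiv_real_prod.quasiMeasurePreserving.ae
        (p := fun q : ℝ × ℝ => q.2 ≠ 0)
        ((Measure.quasiMeasurePreserving_snd (μ := (volume : Measure ℝ))
          (ν := (volume : Measure ℝ))).ae (p := fun x => x ≠ 0) (by simp [ae_iff]))
      exact h2
    exact measure_mono_null (fun z hz => by simpa using hz.2) (ae_iff.1 h1)
  have h1 := addHaar_image_eq_zero_of_differentiableOn_of_addHaar_eq_zero
    (f := fun z : ℂ => γ z.re) volume (fun z hz => ?_) h0
  · refine measure_mono_null ?_ h1; rintro _ ⟨t, ht, rfl⟩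
    exact ⟨t, ⟨by simpa using ht, by simp⟩, by simp⟩
  · refine DifferentiableAt.differentiableWithinAt ?_
    exact (hγ _ hz.1).differentiableAt.comp z reCLM.differentiableAt

end

/-! ### Schwarz reflection with boundary values in the mean -/

theorem contDiff_indicator {E : Type*} [NormedAddCommGroup E] [NormedSpace ℝ E] {P K : Set ℂ}
    (hP : IsOpen P) (hK : IsClosed K) (hKP : K ⊆ P) {f : ℂ → E} (hf : ContDiffOn ℝ 1 f P)
    (h0 : ∀ u ∈ P, u ∉ K → f u = 0) : ContDiff ℝ 1 (P.indicator f) := by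
  rw [contDiff_iff_contDiffAt]; intro u; by_cases hu : u ∈ P
  · refine (hf.contDiffAt (hP.mem_nhds hu)).congr_of_eventuallyEq ?_
    filter_upwards [hP.mem_nhds hu] with w hw using indicator_of_mem hw _
  · refine (contDiffAt_const (c := (0:E))).congr_of_eventuallyEq ?_
    filter_upwards [hK.isOpen_compl.mem_nhds fun h => hu (hKP h)] with w hw
    by_cases hwP : w ∈ P
    · rw [indicator_of_mem hwP, h0 w hwP hw]
    · exact indicator_of_notMem hwP _

theorem integral_fderiv_eq_zero {E : Type*} [NormedAddCommGroup E] [NormedSpace ℝ E]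
    {f : ℂ → E} (hf : ContDiff ℝ 1 f) (hc : HasCompactSupport f) (v : ℂ) :
    Integrable (fun u => fderiv ℝ f u v) ∧ ∫ u, fderiv ℝ f u v = 0 := by
  have hi : Integrable (fun u => fderiv ℝ f u v) :=
    ((hf.continuous_fderiv one_ne_zero).clm_apply continuous_const).integrable_of_hasCompactSupport
      ((hc.fderiv ℝ).comp_left (g := fun L : ℂ →L[ℝ] E => L v) rfl)
  refine ⟨hi, ?_⟩
  have := integral_bilinear_fderiv_right_eq_neg_left_of_integrable (μ := (volume : Measure ℂ))
    (f := fun _ => (1:ℝ)) (g := f) (v := v) (B := ContinuousLinearMap.lsmul ℝ ℝ)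
    (by simp) (by simpa using hi)
    (by simpa using hf.continuous.integrable_of_hasCompactSupport hc)
    (fun x _ => differentiableAt_const _) fun x _ => hf.differentiable one_ne_zero x
  simpa using this

theorem setIntegral_fderiv_eq_zero {E : Type*} [NormedAddCommGroup E] [NormedSpace ℝ E] {P K : Set ℂ}
    (hP : IsOpen P) (hK : IsCompact K) (hKP : K ⊆ P) {f : ℂ → E} (hf : ContDiffOn ℝ 1 f P)
    (h0 : ∀ u ∈ P, u ∉ K → f u = 0) (v : ℂ) :
    IntegrableOn (fun u => fderiv ℝ f u v) P ∧ ∫ u in P, fderiv ℝ f u v = 0 := by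
  have hg := contDiff_indicator hP hK.isClosed hKP hf h0
  have hc : HasCompactSupport (P.indicator f) := HasCompactSupport.intro hK fun u hu => by
    by_cases huP : u ∈ P
    · rw [indicator_of_mem huP, h0 u huP hu]
    · exact indicator_of_notMem huP _
  have heq : (fun u => fderiv ℝ (P.indicator f) u v) = P.indicator fun u => fderiv ℝ f u v := by
    ext u; by_cases huP : u ∈ P
    · rw [indicator_of_mem huP]; congr 1; refine Filter.EventuallyEq.fderiv_eq ?_
      filter_upwards [hP.mem_nhds huP] with w hw using indicator_of_mem hw _
    · rw [indicator_of_notMem huP]; have : P.indicator f =ᶠ[𝓝 u] fun _ => 0 := by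
        filter_upwards [hK.isClosed.isOpen_compl.mem_nhds fun h => huP (hKP h)] with w hw
        by_cases hwP : w ∈ P
        · rw [indicator_of_mem hwP, h0 w hwP hw]
        · exact indicator_of_notMem hwP _
      rw [this.fderiv_eq]; simp
  obtain ⟨h1, h2⟩ := integral_fderiv_eq_zero hg hc v; rw [heq] at h1 h2
  exact ⟨(integrable_indicator_iff hP.measurableSet).1 h1, by
    rwa [integral_indicator hP.measurableSet] at h2⟩

theorem contDiffOn_of_hasFDerivAt_reMul {P : Set ℂ} (hP : IsOpen P) {u : ℂ → ℝ} {G : ℂ → ℂ}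
    (hu : ∀ v ∈ P, HasFDerivAt u (reMul (G v)) v) (hG : ContinuousOn G P) : ContDiffOn ℝ 1 u P := by
  have h1 := (contDiffOn_succ_iff_fderiv_of_isOpen (𝕜 := ℝ) (n := 0) (f := u) hP).2
    ⟨fun v hv => (hu v hv).differentiableAt.differentiableWithinAt, by simp, ?_⟩
  · simpa using h1
  rw [contDiffOn_zero]; have hc : Continuous fun c : ℂ => reMul c := by
    let l : ℂ →ₗ[ℝ] (ℂ →L[ℝ] ℝ) :=
      { toFun := reMul
        map_add' := fun c d => by ext; simp; ring
        map_smul' := fun t c => by ext; simp; ring }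
    exact l.continuous_of_finiteDimensional
  exact (hc.comp_continuousOn hG).congr fun v hv => (hu v hv).fderiv

/-- Weak form of the reflection principle for a function `G` on a half-box which is the complex
gradient of a function `u` with constant trace on the imaginary axis. -/
theorem im_integral_mul_dbar_eq_zero {δ w : ℝ} {u : ℂ → ℝ} {G : ℂ → ℂ} {ε : ℝ → ℝ} (hδ : 0 < δ)
    (hu : ∀ ζ ∈ openBox 0 δ (-δ) δ, HasFDerivAt u (reMul (G ζ)) ζ)
    (hG : DifferentiableOn ℂ G (openBox 0 δ (-δ) δ)) (hGi : IntegrableOn G (openBox 0 δ (-δ) δ))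
    (hε : Tendsto ε (𝓝[>] 0) (𝓝 0))
    (htr : ∀ᶠ s in 𝓝[>] 0, ∫⁻ ζ in openBox 0 s (-δ) δ, ‖u ζ - w‖ₑ ≤ ennr (s * ε s))
    {k : ℂ → ℂ} (hk : ContDiff ℝ ∞ k) (hc : HasCompactSupport k)
    (hD : tsupport k ⊆ openBox (-δ) δ (-δ) δ) (hre : ∀ η : ℝ, (k (η * I)).im = 0) :
    (∫ ζ in openBox 0 δ (-δ) δ, G ζ * dbar k ζ).im = 0 := by
  set P := openBox 0 δ (-δ) δ with hPdef
  have hP : IsOpen P := isOpen_openBox _ _ _ _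
  have hk1 : ContDiff ℝ 1 k := hk.of_le (by simp)
  obtain ⟨L, hL⟩ := hk1.lipschitzWith_of_hasCompactSupport hc one_ne_zero
  let θ : ContDiffBump (0 : ℝ) := ⟨1 / 4, 1 / 2, by norm_num, by norm_num⟩
  have hθ : ContDiff ℝ ∞ θ := θ.contDiff
  have hθ1 : ContDiff ℝ 1 θ := θ.contDiff
  obtain ⟨L', hL'⟩ := hθ1.lipschitzWith_of_hasCompactSupport θ.hasCompactSupport one_ne_zero
  have hθ'b : ∀ x, |deriv θ x| ≤ L' := fun x => norm_deriv_le_of_lipschitz hL'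
  have hθin : ∀ x, |x| < 1 / 4 → θ x = 1 ∧ deriv θ x = 0 := fun x hx => by
    have h1 : ∀ y, |y| < 1 / 4 → θ y = 1 := fun y hy =>
      θ.one_of_mem_closedBall (by rw [mem_closedBall_zero_iff]; exact hy.le)
    refine ⟨h1 x hx, ?_⟩; have : (θ : ℝ → ℝ) =ᶠ[𝓝 x] fun _ => 1 := by
      filter_upwards [(continuous_abs.tendsto x).eventually (gt_mem_nhds hx)] with y hy using h1 y hy
    rw [this.deriv_eq, deriv_const]
  have hθout : ∀ x, 1 / 2 < |x| → θ x = 0 ∧ deriv θ x = 0 := fun x hx => by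
    have h1 : ∀ y, 1 / 2 < |y| → θ y = 0 := fun y hy =>
      θ.zero_of_le_dist (by rw [Real.dist_eq, sub_zero]; exact hy.le)
    refine ⟨h1 x hx, ?_⟩; have : (θ : ℝ → ℝ) =ᶠ[𝓝 x] fun _ => 0 := by
      filter_upwards [(continuous_abs.tendsto x).eventually (lt_mem_nhds hx)] with y hy using h1 y hy
    rw [this.deriv_eq, deriv_const]
  have hfd : ∀ ζ v, ‖fderiv ℝ k ζ v‖ ≤ L * ‖v‖ := fun ζ v =>
    (ContinuousLinearMap.le_opNorm _ _).trans
      (mul_le_mul_of_nonneg_right (norm_fderiv_le_of_lipschitz ℝ hL) (norm_nonneg _))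
  have hdb : ∀ ζ, ‖dbar k ζ‖ ≤ L := fun ζ => by
    have h1 := hfd ζ 1
    have h2 := hfd ζ I
    rw [norm_one, mul_one] at h1; rw [norm_I, mul_one] at h2; unfold dbar; rw [norm_div, norm_ofNat]
    have h3 := norm_add_le (fderiv ℝ k ζ 1) (I * fderiv ℝ k ζ I)
    rw [norm_mul, norm_I, one_mul] at h3; linarith
  have hIi : IntegrableOn (fun ζ => G ζ * dbar k ζ) P := by
    refine Integrable.mul_bdd (c := L) hGi (continuous_dbar hk1).aestronglyMeasurable
      (ae_of_all _ hdb)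
  set C : ℝ≥0∞ := ennr (L + L' * L) with hC
  -- the estimate by the mass near the axis
  have key : ∀ᶠ s in 𝓝[>] 0, ‖(∫ ζ in P, G ζ * dbar k ζ).im‖ₑ ≤
      C * ∫⁻ ζ in openBox 0 s (-δ) δ, ‖G ζ‖ₑ ∂volume.restrict P + C * ennr (ε s) := by
    filter_upwards [htr, Ioo_mem_nhdsGT hδ] with s hs hs0
    obtain ⟨hs0, hsδ⟩ := hs0; set q : ℂ → ℝ := fun ζ => θ (ζ.re / s) with hq
    set q' : ℂ → ℝ := fun ζ => deriv θ (ζ.re / s) with hq'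
    have hqc := hθ.comp (reCLM.contDiff.div_const s)
    have hq'c : ContDiff ℝ ∞ q' :=
      (contDiff_infty_iff_deriv.1 hθ).2.comp (reCLM.contDiff.div_const s)
    have hres : ∀ ζ : ℂ, HasFDerivAt (fun ζ : ℂ => ζ.re / s) (s⁻¹ • reCLM) ζ := fun ζ => by
      refine (reCLM.hasFDerivAt.const_mul s⁻¹).congr_of_eventuallyEq
        (Eventually.of_forall fun ζ => ?_)
      simp [div_eq_inv_mul]
    have hqd : ∀ ζ, HasFDerivAt q ((q' ζ / s) • reCLM) ζ := fun ζ => by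
      refine (((hθ1.differentiable one_ne_zero (ζ.re / s)).hasDerivAt).comp_hasFDerivAt ζ
        (hres ζ)).congr_fderiv ?_
      simp only [hq', smul_smul, div_eq_mul_inv]
    have hq'd : ∀ ζ, ∃ c : ℝ, HasFDerivAt q' (c • reCLM) ζ := fun ζ => by
      have h1 := (((contDiff_infty_iff_deriv.1 hθ).2.differentiable (by simp) (ζ.re / s)).hasDerivAt).comp_hasFDerivAt
        ζ (hres ζ)
      rw [smul_smul] at h1; exact ⟨_, h1⟩
    set K := tsupport k ∩ {ζ : ℂ | s / 4 ≤ ζ.re} with hK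
    have hKc : IsCompact K := hc.isCompact.inter_right (isClosed_le continuous_const continuous_re)
    have hKP : K ⊆ P := fun ζ hζ => by
      obtain ⟨h1, h2, h3, h4⟩ := hD hζ.1
      exact ⟨by have : s / 4 ≤ ζ.re := hζ.2; linarith, h2, h3, h4⟩
    have hout : ∀ ζ ∈ P, ζ ∉ K → k ζ = 0 ∨ (q ζ = 1 ∧ q' ζ = 0) := fun ζ hζ hζK => by
      by_cases h1 : ζ ∈ tsupport k
      · right
        have h2 : ζ.re < s / 4 := by
          by_contra! h; exact hζK ⟨h1, h⟩
        refine hθin _ ?_; rw [abs_of_pos (div_pos hζ.1 hs0), div_lt_iff₀ hs0]; linarith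
      · exact Or.inl (image_eq_zero_of_notMem_tsupport h1)
    have hfar : ∀ ζ, s ≤ ζ.re → q ζ = 0 ∧ q' ζ = 0 := fun ζ h => by
      refine hθout _ ?_; have h1 : 1 ≤ ζ.re / s := by rwa [le_div_iff₀ hs0, one_mul]
      rw [abs_of_pos (by linarith)]; linarith
    have hGc : ContDiffOn ℝ 1 G P := (hG.contDiffOn hP).restrict_scalars ℝ
    -- The cut-off `q` equals 1 near the axis and 0 beyond distance `s`. The function `fa` is
    -- compactly supported in the half-box, so its `dbar` integrates to 0; what remains is supported
    -- within distance `s` of the axis.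
    set fa : ℂ → ℂ := fun ζ => G ζ * (k ζ * ((1 - q ζ : ℝ) : ℂ)) with hfa
    have hk1q : ContDiff ℝ 1 fun ζ => k ζ * ((1 - q ζ : ℝ) : ℂ) :=
      hk1.mul (ofRealCLM.contDiff.comp (contDiff_const.sub (hqc.of_le (by simp))))
    have hfa1 : ContDiffOn ℝ 1 fa P := hGc.mul hk1q.contDiffOn
    have hfa0 : ∀ ζ ∈ P, ζ ∉ K → fa ζ = 0 := fun ζ hζ hζK => by
      rcases hout ζ hζ hζK with h | ⟨h, -⟩ <;> simp [hfa, h]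
    -- The dangerous remainder is `q' Re k Im G / (2s)`. Since `Im G = -∂u/∂y` and `q'` does not
    -- depend on `y`, adding a multiple of the tangential derivative of `fc` trades `Im G` for `u -
    -- w`, which the trace bound controls. In the companion term `Re G Im k` the factor `Im k` is
    -- `O(s)`, as `k` is real on the axis.
    set fc : ℂ → ℝ := fun ζ => (q' ζ * (k ζ).re) * (u ζ - w) with hfc
    have hkre : ContDiff ℝ 1 fun ζ => (k ζ).re := reCLM.contDiff.comp hk1
    have hfc1 : ContDiffOn ℝ 1 fc P :=
      (((hq'c.of_le (by simp)).mul hkre).contDiffOn).mul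
        ((contDiffOn_of_hasFDerivAt_reMul hP hu hG.continuousOn).sub contDiffOn_const)
    have hfc0 : ∀ ζ ∈ P, ζ ∉ K → fc ζ = 0 := fun ζ hζ hζK => by
      rcases hout ζ hζ hζK with h | ⟨-, h⟩ <;> simp [hfc, h]
    obtain ⟨i1, z1⟩ := setIntegral_fderiv_eq_zero hP hKc hKP hfa1 hfa0 1
    obtain ⟨i2, z2⟩ := setIntegral_fderiv_eq_zero hP hKc hKP hfa1 hfa0 I
    obtain ⟨i3, z3⟩ := setIntegral_fderiv_eq_zero hP hKc hKP hfc1 hfc0 I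
    have i4 : IntegrableOn (dbar fa) P := (i1.add (i2.const_mul I)).div_const 2
    have z4 : ∫ ζ in P, dbar fa ζ = 0 := by
      unfold dbar; rw [integral_div, integral_add i1 (i2.const_mul I), integral_const_mul, z1, z2]
      simp
    set W : ℂ → ℝ := fun ζ => (G ζ * dbar k ζ - dbar fa ζ).im + (2 * s)⁻¹ * fderiv ℝ fc ζ I
      with hW
    have hWint : (∫ ζ in P, G ζ * dbar k ζ).im = ∫ ζ in P, W ζ := by
      have h1 : IntegrableOn (fun ζ => (G ζ * dbar k ζ - dbar fa ζ).im) P := (hIi.sub i4).im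
      rw [hW, integral_add h1 (i3.const_mul _), integral_const_mul, z3, mul_zero, add_zero]
      have h2 := integral_im (𝕜 := ℂ) (hIi.sub i4)
      simp only [RCLike.im_to_complex, Pi.sub_apply] at h2
      rw [h2, integral_sub hIi i4, z4, sub_zero]
    have hWeq : ∀ ζ ∈ P, W ζ = q ζ * (G ζ * dbar k ζ).im + (2 * s)⁻¹ * (q' ζ *
        ((G ζ).re * (k ζ).im + (fderiv ℝ k ζ I).re * (u ζ - w))) := fun ζ hζ => by
      have d1 : HasFDerivAt (fun ζ => ((1 - q ζ : ℝ) : ℂ))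
          (ofRealCLM.comp (-((q' ζ / s) • reCLM))) ζ :=
        ofRealCLM.hasFDerivAt.comp ζ ((hqd ζ).const_sub 1)
      have d2 := ((hk1.differentiable one_ne_zero ζ).hasFDerivAt).fun_mul d1
      have e1 : dbar fa ζ = G ζ * ((1 - q ζ) * dbar k ζ - (2 * s)⁻¹ * q' ζ * k ζ) := by
        rw [hfa, dbar_mul_of_differentiableAt ((hG ζ hζ).differentiableAt (hP.mem_nhds hζ))
          (hk1q.differentiable one_ne_zero ζ)]
        congr 1; simp only [dbar, d2.fderiv]; simp; ring
      obtain ⟨c, hc⟩ := hq'd ζ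
      have d3 : HasFDerivAt (fun ζ => (k ζ).re) (reCLM.comp (fderiv ℝ k ζ)) ζ :=
        reCLM.hasFDerivAt.comp ζ (hk1.differentiable one_ne_zero ζ).hasFDerivAt
      have d4 := (hc.fun_mul d3).fun_mul ((hu ζ hζ).sub_const w)
      have e2 : fderiv ℝ fc ζ I = q' ζ * ((fderiv ℝ k ζ I).re * (u ζ - w)
          - (k ζ).re * (G ζ).im) := by
        rw [hfc, d4.fderiv]; simp; ring
      simp only [hW]; rw [e1, e2]
      have e3 : G ζ * dbar k ζ - G ζ * ((1 - q ζ) * dbar k ζ - (2 * s)⁻¹ * q' ζ * k ζ) =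
          (q ζ : ℝ) * (G ζ * dbar k ζ) + (((2 * s)⁻¹ * q' ζ : ℝ) : ℂ) * (G ζ * k ζ) := by
        push_cast; ring
      rw [e3, add_im, im_ofReal_mul, im_ofReal_mul, mul_im (G ζ) (k ζ)]; ring
    have hWle : ∀ ζ ∈ P, ‖W ζ‖ₑ ≤ (openBox 0 s (-δ) δ).indicator
        (fun ζ => C * ‖G ζ‖ₑ + C * ennr s⁻¹ * ‖u ζ - w‖ₑ) ζ := fun ζ hζ => by
      by_cases h1 : s ≤ ζ.re
      · rw [hWeq ζ hζ, (hfar ζ h1).1, (hfar ζ h1).2]; simp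
      · push Not at h1; rw [indicator_of_mem (show ζ ∈ openBox 0 s (-δ) δ from ⟨hζ.1, h1, hζ.2.2⟩)]
        have b1 : |(k ζ).im| ≤ L * s := by
          have h2 := hL.dist_le_mul ζ (ζ.im * I)
          rw [dist_eq_norm, dist_eq_norm] at h2
          have h3 : ζ - ζ.im * I = ζ.re := by apply Complex.ext <;> simp
          have h4 : (k ζ).im = (k ζ - k (ζ.im * I)).im := by rw [sub_im, hre, sub_zero]
          rw [h3, norm_real, norm_eq_abs, abs_of_pos hζ.1] at h2; rw [h4]
          exact (abs_im_le_norm _).trans (h2.trans (by gcongr))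
        have b2 : |(fderiv ℝ k ζ I).re| ≤ L := (abs_re_le_norm _).trans (by
          simpa using hfd ζ I)
        have b3 : |(G ζ * dbar k ζ).im| ≤ ‖G ζ‖ * L := (abs_im_le_norm _).trans (by
          rw [norm_mul]; gcongr; exact hdb ζ)
        have b4 : |q ζ| ≤ 1 := by rw [abs_of_nonneg θ.nonneg]; exact θ.le_one
        have b5 : |(G ζ).re * (k ζ).im + (fderiv ℝ k ζ I).re * (u ζ - w)| ≤
            ‖G ζ‖ * (L * s) + L * |u ζ - w| := by
          refine (abs_add_le _ _).trans (add_le_add ?_ ?_)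
          · rw [abs_mul]; gcongr; exact abs_re_le_norm _
          · rw [abs_mul]; gcongr
        have b6 : ‖W ζ‖ ≤ (L + L' * L) * ‖G ζ‖ + (L + L' * L) * s⁻¹ * |u ζ - w| := by
          rw [hWeq ζ hζ, norm_eq_abs]
          calc _ ≤ |q ζ| * |(G ζ * dbar k ζ).im| + (2 * s)⁻¹ * (|q' ζ| *
                |(G ζ).re * (k ζ).im + (fderiv ℝ k ζ I).re * (u ζ - w)|) := by
                refine (abs_add_le _ _).trans_eq ?_
                rw [abs_mul, abs_mul, abs_mul, abs_of_pos (by positivity : 0 < (2 * s)⁻¹)]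
            _ ≤ 1 * (‖G ζ‖ * L) + s⁻¹ * (L' * (‖G ζ‖ * (L * s) + L * |u ζ - w|)) := by
                gcongr
                · linarith
                · exact hθ'b _
            _ = (L + L' * L) * ‖G ζ‖ + L' * L * s⁻¹ * |u ζ - w| := by field_simp; ring
            _ ≤ _ := by gcongr; exact le_add_of_nonneg_left L.2
        rw [← ofReal_norm, ← ofReal_norm, ← ofReal_norm, hC, ← ennr_mul (by positivity),
          ← ennr_mul (by positivity), ← ennr_mul (by positivity),
          ← ennr_add (by positivity) (by positivity), norm_eq_abs (u ζ - w)]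
        exact ofReal_le_ofReal b6
    rw [hWint]
    have hBm : MeasurableSet (openBox 0 s (-δ) δ) := (isOpen_openBox _ _ _ _).measurableSet
    refine (enorm_integral_le_lintegral_enorm _).trans ((setLIntegral_mono' hP.measurableSet hWle).trans ?_)
    rw [lintegral_indicator hBm, lintegral_add_left' ((hGi.aestronglyMeasurable.enorm.mono_measure
      Measure.restrict_le_self).const_mul C), lintegral_const_mul' _ _ ofReal_ne_top]
    gcongr; rw [lintegral_const_mul' _ _ (by finiteness), mul_assoc]
    gcongr
    calc ennr s⁻¹ * ∫⁻ ζ in openBox 0 s (-δ) δ, ‖u ζ - w‖ₑ ∂volume.restrict P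
        ≤ ennr s⁻¹ * ennr (s * ε s) := by
          gcongr
          exact (lintegral_mono' (Measure.restrict_mono_measure Measure.restrict_le_self _) le_rfl).trans hs
      _ = ennr (ε s) := by
          rw [← ennr_mul (by positivity), inv_mul_cancel_left₀ hs0.ne']
  have hvol : Tendsto (fun s => (volume.restrict P) (openBox 0 s (-δ) δ)) (𝓝[>] 0) (𝓝 0) := by
    have hfin : IsFiniteMeasure (volume.restrict P) := by
      refine ⟨?_⟩; rw [Measure.restrict_apply_univ]
      refine (isBounded_ball (x := (0:ℂ)) (r := 2 * δ)).subset (fun ζ hζ => ?_) |>.measure_lt_top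
      rw [mem_ball_zero_iff]; exact norm_lt_of_mem_openBox hζ
    rw [ENNReal.tendsto_nhds_zero]; intro η hη; by_cases hη' : η = ⊤
    · simp [hη']
    obtain ⟨s₀, hs₀, h1, -⟩ := exists_openBox_measure_lt (volume.restrict P) (-δ) δ
      (ε := η.toReal) (ENNReal.toReal_pos hη.ne' hη')
    filter_upwards [Ioo_mem_nhdsGT hs₀] with s hs
    have h2 : (volume.restrict P) (openBox 0 s (-δ) δ) ≤ (volume.restrict P) (openBox 0 s₀ (-δ) δ) :=
      measure_mono fun ζ hζ => ⟨hζ.1, hζ.2.1.trans hs.2, hζ.2.2⟩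
    refine h2.trans ?_; rw [← ofReal_toReal hη', ← ofReal_measureReal]; exact ofReal_le_ofReal h1.le
  have hlim : Tendsto (fun s => C * ∫⁻ ζ in openBox 0 s (-δ) δ, ‖G ζ‖ₑ ∂volume.restrict P +
      C * ennr (ε s)) (𝓝[>] 0) (𝓝 0) := by
    have h1 := tendsto_setLIntegral_zero (μ := volume.restrict P) (f := fun ζ => ‖G ζ‖ₑ)
      hGi.hasFiniteIntegral.ne hvol
    have h2 := (ENNReal.continuous_ofReal.tendsto 0).comp hε
    rw [ENNReal.ofReal_zero] at h2
    have h3 := (ENNReal.Tendsto.const_mul (a := C) h1 (Or.inr ofReal_ne_top)).add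
      (ENNReal.Tendsto.const_mul (a := C) h2 (Or.inr ofReal_ne_top))
    simpa using h3
  have h0 := le_of_tendsto_of_tendsto tendsto_const_nhds hlim key
  simpa using h0

theorem differentiableAt_integral_div_sub {μ : Measure ℂ} {F : ℂ → ℂ} (hF : Integrable F μ)
    {z : ℂ} {r : ℝ} (hr : 0 < r) (h : ∀ u, F u ≠ 0 → ∀ w ∈ ball z r, r ≤ ‖u - w‖) :
    (∀ w ∈ ball z r, Integrable (fun u => F u / (u - w)) μ) ∧
      DifferentiableAt ℂ (fun w => ∫ u, F u / (u - w) ∂μ) z := by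
  have hb : ∀ w ∈ ball z r, ∀ u, ∀ n : ℕ, ‖F u / (u - w) ^ n‖ ≤ ‖F u‖ * (1 / r ^ n) :=
    fun w hw u n => by
      by_cases h0 : F u = 0
      · simp [h0]
      · rw [norm_div, div_eq_mul_one_div, norm_pow]; have := h u h0 w hw
        gcongr
  have hm : ∀ w : ℂ, ∀ n : ℕ, AEStronglyMeasurable (fun u => F u / (u - w) ^ n) μ := fun w n =>
    (hF.aestronglyMeasurable.aemeasurable.div (by fun_prop)).aestronglyMeasurable
  have hint : ∀ w ∈ ball z r, Integrable (fun u => F u / (u - w)) μ := fun w hw => by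
    refine (hF.norm.mul_const (1 / r ^ 1)).mono' (by simpa using hm w 1) (ae_of_all _ fun u => ?_)
    simpa using hb w hw u 1
  refine ⟨hint, (hasDerivAt_integral_of_dominated_loc_of_deriv_le (F := fun w u => F u / (u - w))
    (F' := fun w u => F u / (u - w) ^ 2) (bound := fun u => ‖F u‖ * (1 / r ^ 2))
    (ball_mem_nhds z hr) ?_ (hint z (mem_ball_self hr)) (hm z 2) ?_
    (hF.norm.mul_const _) ?_).2.differentiableAt⟩
  · exact Eventually.of_forall fun w => by simpa using hm w 1
  · exact ae_of_all _ fun u w hw => hb w hw u 2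
  · refine ae_of_all _ fun u w hw => ?_
    by_cases h0 : F u = 0
    · simp [h0, hasDerivAt_const]
    · have h1 := norm_pos_iff.1 (hr.trans_le (h u h0 w hw))
      refine ((hasDerivAt_const w (F u)).div ((hasDerivAt_id w).const_sub u) h1).congr_deriv ?_
      simp

/-- Schwarz reflection principle, with the boundary values understood in the mean. -/
theorem exists_reflection {δ w : ℝ} {u : ℂ → ℝ} {G : ℂ → ℂ} {ε : ℝ → ℝ} (hδ : 0 < δ)
    (hu : ∀ v ∈ openBox 0 δ (-δ) δ, HasFDerivAt u (reMul (G v)) v)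
    (hG : DifferentiableOn ℂ G (openBox 0 δ (-δ) δ)) (hGi : IntegrableOn G (openBox 0 δ (-δ) δ))
    (hε : Tendsto ε (𝓝[>] 0) (𝓝 0))
    (htr : ∀ᶠ s in 𝓝[>] 0, ∫⁻ v in openBox 0 s (-δ) δ, ‖u v - w‖ₑ ≤ ennr (s * ε s)) :
    ∃ H : ℂ → ℂ, AnalyticAt ℂ H 0 ∧ (∀ᶠ v in 𝓝 0, 0 < v.re → G v = H v) ∧
      ∀ᶠ v in 𝓝 0, v.re = 0 → (H v).im = 0 := by
  set P := openBox 0 δ (-δ) δ with hPdef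
  have hP : IsOpen P := isOpen_openBox _ _ _ _
  set D := openBox (-δ) δ (-δ) δ with hDdef
  let b : ContDiffBump (0 : ℝ) := ⟨δ / 4, δ / 2, by positivity, by linarith⟩
  set χ : ℂ → ℂ := fun v => ((b v.re * b v.im : ℝ) : ℂ) with hχ
  have hχc : ContDiff ℝ ∞ χ := ofRealCLM.contDiff.comp
    ((b.contDiff.comp reCLM.contDiff).mul (b.contDiff.comp imCLM.contDiff))
  have hχ0 : ∀ v, χ v ≠ 0 → |v.re| ≤ δ / 2 ∧ |v.im| ≤ δ / 2 := fun v h => by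
    constructor
    · by_contra! hlt; refine h ?_; simp only [hχ]
      rw [b.zero_of_le_dist (x := v.re) (by rw [Real.dist_eq, sub_zero]; exact hlt.le)]
      simp
    · by_contra! hlt; refine h ?_; simp only [hχ]
      rw [b.zero_of_le_dist (x := v.im) (by rw [Real.dist_eq, sub_zero]; exact hlt.le)]
      simp
  have hχ1 : ∀ v ∈ ball (0:ℂ) (δ / 4), χ v = 1 := fun v h => by
    rw [mem_ball_zero_iff] at h; simp only [hχ]
    rw [b.one_of_mem_closedBall (x := v.re), b.one_of_mem_closedBall (x := v.im)]
    · simp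
    · rw [mem_closedBall_zero_iff]; exact (abs_im_le_norm v).trans h.le
    · rw [mem_closedBall_zero_iff]; exact (abs_re_le_norm v).trans h.le
  have hχs : ∀ v, χ (-conj v) = χ v := fun v => by simp [hχ, b.neg]
  have hχconj : ∀ v, conj (χ v) = χ v := fun v => conj_ofReal _
  set K := {v : ℂ | |v.re| ≤ δ / 2 ∧ |v.im| ≤ δ / 2} with hK
  have hKcl : IsClosed K := by
    rw [hK, ofPred_and]
    exact (isClosed_le (by fun_prop) continuous_const).inter (isClosed_le (by fun_prop) continuous_const)
  have hKc : IsCompact K := by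
    refine isCompact_of_isClosed_isBounded hKcl
      ((isBounded_ball (x := (0:ℂ)) (r := 2 * δ)).subset fun v hv => ?_)
    rw [mem_ball_zero_iff]; refine (norm_le_abs_re_add_abs_im v).trans_lt ?_; linarith [hv.1, hv.2]
  have hKD : K ⊆ D := fun v hv => by
    have h1 := abs_le.1 hv.1
    have h2 := abs_le.1 hv.2
    exact ⟨by linarith, by linarith, by linarith, by linarith⟩
  have hsupp : ∀ f : ℂ → ℂ, (∀ v, f v ≠ 0 → v ∈ K) → HasCompactSupport f ∧ tsupport f ⊆ D :=
    fun f hf => by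
      have h1 := closure_minimal (fun v hv => hf v hv) hKcl
      exact ⟨HasCompactSupport.intro hKc fun v hv => by by_contra h; exact hv (hf v h), h1.trans hKD⟩
  have hχ1c : ContDiff ℝ 1 χ := hχc.of_le (by simp)
  have hdχ : ∀ v ∈ ball (0:ℂ) (δ / 4), dbar χ v = 0 := fun v hv => by
    have : χ =ᶠ[𝓝 v] fun _ => 1 := by
      filter_upwards [isOpen_ball.mem_nhds hv] with w hw using hχ1 w hw
    simp [dbar, this.fderiv_eq]
  have hGb : ∀ f : ℂ → ℂ, ContDiff ℝ ∞ f → HasCompactSupport f →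
      IntegrableOn (fun v => G v * dbar f v) P := fun f hf hc => by
    have hf1 : ContDiff ℝ 1 f := hf.of_le (by simp)
    obtain ⟨M, hM⟩ := (hasCompactSupport_dbar hc).exists_bound_of_continuous (continuous_dbar hf1)
    exact Integrable.mul_bdd (c := M) hGi (continuous_dbar hf1).aestronglyMeasurable (ae_of_all _ hM)
  set F : ℂ → ℂ := fun v => G v * dbar χ v with hF
  have hFi := hGb χ hχc (hsupp χ hχ0).1
  set X : ℂ → ℂ := fun z => ∫ v in P, F v / (v - z) with hX
  have hfar : ∀ z ∈ ball (0:ℂ) (δ / 16), ∀ v, F v ≠ 0 → ∀ w ∈ ball z (δ / 16),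
      δ / 16 ≤ ‖v - w‖ := fun z hz v hv w hw => by
    have h1 : δ / 4 ≤ ‖v‖ := by
      by_contra! h
      exact hv (by rw [hF]; simp only; rw [hdχ v (by rwa [mem_ball_zero_iff]), mul_zero])
    rw [mem_ball_zero_iff] at hz; rw [mem_ball_iff_norm] at hw
    have h2 : ‖v‖ ≤ ‖v - w‖ + ‖w - z‖ + ‖z‖ := by
      calc ‖v‖ = ‖(v - w) + (w - z) + z‖ := by congr 1; ring
        _ ≤ _ := (norm_add_le _ _).trans (by gcongr; exact norm_add_le _ _)
    linarith
  have hδ16 : 0 < δ / 16 := by positivity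
  have hXi : ∀ z ∈ ball (0:ℂ) (δ / 16), IntegrableOn (fun v => F v / (v - z)) P := fun z hz =>
    (differentiableAt_integral_div_sub hFi hδ16 (hfar z hz)).1 z (mem_ball_self hδ16)
  have hXd : ∀ z ∈ ball (0:ℂ) (δ / 16), DifferentiableAt ℂ X z := fun z hz =>
    (differentiableAt_integral_div_sub hFi hδ16 (hfar z hz)).2
  have hball : ∀ z ∈ ball (0:ℂ) (δ / 16), -conj z ∈ ball (0:ℂ) (δ / 16) :=
    fun z hz => by
      rw [mem_ball_zero_iff] at hz ⊢; rwa [norm_neg, RCLike.norm_conj]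
  -- Here `X` is a Cauchy integral of `G dbar χ`, analytic near 0 because `dbar χ` vanishes there.
  -- The symmetrization under the reflection `z ↦ -conj z` makes the formula real on the imaginary
  -- axis; it remains to see that it equals `G` on the right.
  refine ⟨fun z => -(X z + conj (X (-conj z))) / π, ?_, ?_, ?_⟩
  · refine DifferentiableOn.analyticAt (s := ball 0 (δ / 16)) (fun z hz => ?_)
      (ball_mem_nhds 0 hδ16)
    refine DifferentiableAt.differentiableWithinAt (DifferentiableAt.div_const (DifferentiableAt.neg
      ((hXd z hz).add ?_)) _)
    have h1 := DifferentiableAt.comp (g := X) (f := fun w => -w) _ (hXd _ (hball z hz)) differentiableAt_id.neg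
    have h2 := h1.conj_conj
    rwa [conj_conj] at h2
  · filter_upwards [ball_mem_nhds 0 hδ16] with z hz hzre
    obtain ⟨r, hr, hrz⟩ : ∃ r > 0, ball z r ⊆ P ∩ ball 0 (δ / 4) := by
      refine Metric.mem_nhds_iff.1 ((hP.inter isOpen_ball).mem_nhds ⟨?_, ?_⟩)
      · rw [mem_ball_zero_iff] at hz; have h1 := (abs_re_le_norm z).trans_lt hz
        have h2 := (abs_im_le_norm z).trans_lt hz
        rw [abs_lt] at h1 h2; exact ⟨hzre, by linarith, by linarith, by linarith⟩
      · exact ball_subset_ball (by linarith) hz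
    obtain ⟨β, hβ, hβc, hβs, -, hβ1⟩ := exists_smooth_bump
      (isCompact_closedBall z (r / 2)) (isOpen_ball (x := z) (ε := r))
      (closedBall_subset_ball (by linarith))
    set B : ℂ → ℂ := fun v => (β v : ℂ) with hB
    have hBc := ofRealCLM.contDiff.comp hβ
    have hB1c : ContDiff ℝ 1 B := hBc.of_le (by simp)
    have hB0 : ∀ v, v ∉ tsupport β → B v = 0 := fun v h => by
      simp [hB, image_eq_zero_of_notMem_tsupport h]
    have hBP : ∀ v, B v ≠ 0 → v ∈ P ∧ χ v = 1 := fun v h => by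
      have h1 := hrz (hβs (by by_contra h2; exact h (hB0 v h2)))
      exact ⟨h1.1, hχ1 v h1.2⟩
    -- A Cauchy kernel at `z` made smooth by subtracting a bump at `z`. Pairing `G` with its `dbar`
    -- gives `X z + π G z`; pairing with that of its reflection `k₂` gives only `-X (-conj z)`,
    -- because the pole of `k₂` lies in the left half-plane.
    set k : ℂ → ℂ := fun v => (χ v - B v) / (v - z) with hk
    have hkc : ContDiff ℝ ∞ k := by
      rw [contDiff_iff_contDiffAt]; intro v; by_cases hv : v = z
      · rw [hv]; refine (contDiffAt_const (c := (0:ℂ))).congr_of_eventuallyEq ?_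
        filter_upwards [ball_mem_nhds z (half_pos hr)] with w hw
        have h1 := hβ1 w (ball_subset_closedBall hw)
        simp only [hk, hB]; rw [h1, hχ1 w (hrz (ball_subset_ball (by linarith) hw)).2]
        simp
      · simp only [hk, div_eq_mul_inv]
        exact (hχc.contDiffAt.sub hBc.contDiffAt).mul ((contDiffAt_id.sub contDiffAt_const).inv
          (sub_ne_zero.2 hv))
    have hk0 : ∀ v, k v ≠ 0 → v ∈ K := fun v h => by
      refine hχ0 v fun h1 => h ?_
      have h2 : B v = 0 := by
        by_contra h3
        rw [(hBP v h3).2] at h1; exact one_ne_zero h1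
      simp [hk, h1, h2]
    set k₂ : ℂ → ℂ := fun v => conj (k (-conj v)) with hk₂
    have hk₂c : ContDiff ℝ ∞ k₂ := conjCLE.contDiff.comp
      (hkc.comp (conjCLE.contDiff.neg))
    have hk₂0 : ∀ v, k₂ v ≠ 0 → v ∈ K := fun v h => by
      have h1 := hk0 _ (fun h2 : k (-conj v) = 0 => h (by simp [hk₂, h2]))
      simpa [hK] using h1
    have hdk := fun v => (hkc.differentiable (by simp)) v
    have hdk₂ := fun v => (hk₂c.differentiable (by simp)) v
    have hi1 := hGb k hkc (hsupp k hk0).1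
    have hi2 := hGb k₂ hk₂c (hsupp k₂ hk₂0).1
    set J := ∫ v in P, G v * dbar k v with hJ
    set J₂ := ∫ v in P, G v * dbar k₂ v with hJ₂
    have hax : ∀ η : ℝ, k₂ (η * I) = conj (k (η * I)) := fun η => by
      simp [hk₂]
    -- On the axis `k₂ = conj k`, so `k + k₂` and `I (k - k₂)` are both real there. The weak
    -- reflection statement applied to these two test functions gives the imaginary and the real
    -- part of the equation.
    have hJJ : J = conj J₂ := by
      have e1 := im_integral_mul_dbar_eq_zero hδ hu hG hGi hε htr (hkc.add hk₂c)
        (hsupp _ fun v h => by by_contra h1; exact h (by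
          rw [not_not.1 fun h2 => h1 (hk0 v h2), not_not.1 fun h2 => h1 (hk₂0 v h2), add_zero])).1
        (hsupp _ fun v h => by by_contra h1; exact h (by
          rw [not_not.1 fun h2 => h1 (hk0 v h2), not_not.1 fun h2 => h1 (hk₂0 v h2), add_zero])).2
        (fun η => by rw [hax]; simp)
      have e2 := im_integral_mul_dbar_eq_zero hδ hu hG hGi hε htr (k := fun v => I * (k v - k₂ v))
        (contDiff_const.mul (hkc.sub hk₂c))
        (hsupp _ fun v h => by by_contra h1; exact h (by
          rw [not_not.1 fun h2 => h1 (hk0 v h2), not_not.1 fun h2 => h1 (hk₂0 v h2), sub_zero, mul_zero])).1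
        (hsupp _ fun v h => by by_contra h1; exact h (by
          rw [not_not.1 fun h2 => h1 (hk0 v h2), not_not.1 fun h2 => h1 (hk₂0 v h2), sub_zero, mul_zero])).2
        (fun η => by rw [hax]; simp)
      have d1 : ∀ v, G v * dbar (fun v => k v + k₂ v) v = G v * dbar k v + G v * dbar k₂ v := fun v => by
        rw [dbar, fderiv_fun_add (hdk v) (hdk₂ v)]; simp [dbar]; ring
      have d2 : ∀ v, G v * dbar (fun v => I * (k v - k₂ v)) v =
          I * (G v * dbar k v - G v * dbar k₂ v) := fun v => by
        rw [dbar_mul_of_differentiableAt (f := fun _ => I) (k := fun v => k v - k₂ v)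
          (differentiableAt_const _) ((hdk v).sub (hdk₂ v)), dbar,
          fderiv_fun_sub (hdk v) (hdk₂ v)]; simp [dbar]; ring
      simp only [d1] at e1; simp only [d2] at e2; rw [integral_add hi1 hi2, add_im] at e1
      rw [integral_const_mul, integral_sub hi1 hi2, I_mul_im, sub_re] at e2; apply Complex.ext
      · rw [conj_re]; linarith
      · rw [conj_im]; linarith
    have hJ₂X : J₂ = -X (-conj z) := by
      rw [hX, ← integral_neg]; refine setIntegral_congr_fun hP.measurableSet fun v hv => ?_
      have h1 : k₂ =ᶠ[𝓝 v] fun v => (-1 / (v - -conj z)) * χ v := by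
        filter_upwards [hP.mem_nhds hv] with w hw
        have h2 : B (-conj w) = 0 := by
          by_contra h3
          have h4 := (hBP _ h3).1.1
          have h5 := hw.1
          simp at h4; linarith
        simp only [hk₂, hk]; rw [h2, sub_zero, hχs, map_div₀, hχconj]
        simp only [map_sub, map_neg, conj_conj]
        rw [show -w - conj z = -(w - -conj z) by ring, div_neg]
        ring
      have h3 : v - -conj z ≠ 0 := fun h4 => by
        have h5 := congrArg re h4
        have h6 := hv.1
        simp at h5; linarith
      rw [show dbar k₂ v = dbar (fun v => (-1 / (v - -conj z)) * χ v) v by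
        unfold dbar; rw [h1.fderiv_eq], dbar_mul_of_differentiableAt
        (f := fun v => -1 / (v - -conj z)) ((differentiableAt_const _).div (by fun_prop) h3) (hχ1c.differentiable one_ne_zero v)]
      simp only [hF]; ring
    have hJX : J = X z + π * G z := by
      have hne : ∀ᵐ v ∂volume.restrict P, v ≠ z := by
        refine ae_restrict_of_ae ?_; simp [ae_iff]
      have h1 : ∀ᵐ v ∂volume.restrict P, G v * dbar B v / (v - z) =
          F v / (v - z) - G v * dbar k v := by
        filter_upwards [hne] with v hv
        have h2 : k =ᶠ[𝓝 v] fun v => (1 / (v - z)) * (χ v - B v) := Eventually.of_forall fun v => by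
          simp only [hk]; ring
        have h3 := sub_ne_zero.2 hv
        rw [show dbar k v = dbar (fun v => (1 / (v - z)) * (χ v - B v)) v by
          unfold dbar; rw [h2.fderiv_eq], dbar_mul_of_differentiableAt
          (f := fun v => 1 / (v - z)) (k := fun v => χ v - B v)
          ((differentiableAt_const _).div (by fun_prop) h3)
          ((hχ1c.sub hB1c).differentiable one_ne_zero v), hF]
        have h4 : dbar (fun v => χ v - B v) v = dbar χ v - dbar B v := by
          rw [dbar, fderiv_fun_sub (hχ1c.differentiable one_ne_zero v) (hB1c.differentiable one_ne_zero v)]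
          simp [dbar]; ring
        rw [h4]; ring
      have h2 : ∫ v in P, G v * dbar B v / (v - z) = X z - J := by
        rw [integral_congr_ae h1, integral_sub (hXi z hz) hi1]
      have hTP : tsupport β ⊆ P := fun v h => (hrz (hβs h)).1
      have hGB0 : ∀ v ∈ P, v ∉ tsupport β → G v * B v = 0 := fun v _ h => by rw [hB0 v h, mul_zero]
      have h3 := contDiff_indicator hP (isClosed_tsupport β) hTP
        (f := fun v => G v * B v) (((hG.contDiffOn hP).restrict_scalars ℝ).mul hB1c.contDiffOn) hGB0
      have hsm : HasCompactSupport (P.indicator fun v => G v * B v) :=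
        HasCompactSupport.intro hβc fun v hv => by
          by_cases hvP : v ∈ P
          · rw [indicator_of_mem hvP, hGB0 v hvP hv]
          · exact indicator_of_notMem hvP _
      have h4 := integral_dbar_div h3 hsm z
      have hzP := (hrz (mem_ball_self hr)).1
      have hBz : B z = 1 := by
        simp only [hB]; rw [hβ1 z (mem_closedBall_self (by positivity))]; simp
      rw [indicator_of_mem hzP, hBz, mul_one] at h4
      have h5 : (fun v => dbar (P.indicator fun v => G v * B v) v / (z - v)) =
          P.indicator fun v => -(G v * dbar B v / (v - z)) := by
        ext v; by_cases hvP : v ∈ P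
        · rw [indicator_of_mem hvP]
          have h6 : (P.indicator fun v => G v * B v) =ᶠ[𝓝 v] fun v => G v * B v := by
            filter_upwards [hP.mem_nhds hvP] with w hw using indicator_of_mem hw _
          rw [dbar, h6.fderiv_eq, ← dbar, dbar_mul_of_differentiableAt
            ((hG v hvP).differentiableAt (hP.mem_nhds hvP)) (hB1c.differentiable one_ne_zero v),
            ← neg_sub v z, div_neg]
        · rw [indicator_of_notMem hvP, dbar_eq_zero_of_notMem_tsupport, zero_div]; intro h6
          refine hvP (hTP (closure_minimal (fun w hw => ?_) (isClosed_tsupport β) h6))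
          by_contra h7
          refine hw ?_; by_cases hwP : w ∈ P
          · rw [indicator_of_mem hwP, hGB0 w hwP h7]
          · exact indicator_of_notMem hwP _
      rw [h5, integral_indicator hP.measurableSet, integral_neg, h2] at h4; linear_combination h4
    have hpi : (π : ℂ) ≠ 0 := by exact_mod_cast pi_ne_zero
    rw [hJX, hJ₂X, map_neg] at hJJ; rw [eq_div_iff hpi]; linear_combination hJJ
  · refine Eventually.of_forall fun z hz => ?_
    have h1 : -conj z = z := by apply Complex.ext <;> simp [hz]
    simp only; rw [h1, add_conj, ← ofReal_neg, ← ofReal_div, ofReal_im]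

/-! ### Traces of the potential on an arc -/

section

variable {z₀ : ℂ} {e : OpenPartialHomeomorph ℂ ℂ}

/-- For `|w| ≤ |v|`, `log (|v|/|w|) = 2 log √(|v|/|w|) ≤ 2 (√(|v|/|w|) - 1) ≤ 2 √((|v| - |w|)/|w|)`.
The sum of two terms on the right makes the bound symmetric. -/
theorem enorm_log_sub_log_le (v w : ℂ) : ‖Real.log ‖v‖ - Real.log ‖w‖‖ₑ ≤
    2 * ‖v - w‖ₑ ^ (1 / 2 : ℝ) * (‖v‖ₑ ^ (-(1 / 2) : ℝ) + ‖w‖ₑ ^ (-(1 / 2) : ℝ)) := by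
  wlog hvw : ‖w‖ ≤ ‖v‖ generalizing v w
  · have := this w v (le_of_not_ge hvw)
    rwa [enorm_sub_rev, enorm_sub_rev v w, add_comm (‖v‖ₑ ^ _)]
  rcases eq_or_ne v w with h | h
  · simp [h]
  have hd : ‖v - w‖ₑ ^ (1 / 2 : ℝ) ≠ 0 := by
    rw [Ne, ENNReal.rpow_eq_zero_iff_of_pos (by norm_num), enorm_eq_zero]
    exact sub_ne_zero.2 h
  rcases eq_or_ne w 0 with h0 | h0
  · have h1 : ‖w‖ₑ ^ (-(1 / 2) : ℝ) = ⊤ := by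
      rw [h0, enorm_zero, ENNReal.zero_rpow_of_neg (by norm_num)]
    rw [h1, add_top, ENNReal.mul_top (mul_ne_zero (by norm_num) hd)]
    exact le_top
  have hw := norm_pos_iff.2 h0
  have hv := hw.trans_le hvw
  have h1 : |Real.log ‖v‖ - Real.log ‖w‖| ≤ 2 * (‖v - w‖ ^ (1 / 2 : ℝ) * ‖w‖ ^ (-(1 / 2) : ℝ)) := by
    rw [abs_of_nonneg (sub_nonneg.2 (log_le_log hw hvw)), ← log_div hv.ne' hw.ne']
    have h2 : Real.log (‖v‖ / ‖w‖) = 2 * Real.log √(‖v‖ / ‖w‖) := by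
      rw [log_sqrt (by positivity)]; ring
    have h3 := log_le_sub_one_of_pos (sqrt_pos.2 (div_pos hv hw))
    have h4 : √(‖v‖ / ‖w‖) - 1 ≤ √((‖v‖ - ‖w‖) / ‖w‖) := by
      rw [sub_div, div_self hw.ne', sub_le_iff_le_add]
      have h5 : 0 ≤ ‖v‖ / ‖w‖ - 1 := by rw [sub_nonneg, le_div_iff₀ hw]; linarith
      rw [sqrt_le_left (by positivity)]
      nlinarith [sq_sqrt h5, sqrt_nonneg (‖v‖ / ‖w‖ - 1)]
    have h5 : √((‖v‖ - ‖w‖) / ‖w‖) ≤ ‖v - w‖ ^ (1 / 2 : ℝ) * ‖w‖ ^ (-(1 / 2) : ℝ) := by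
      rw [rpow_neg hw.le, ← sqrt_eq_rpow, ← sqrt_eq_rpow, ← div_eq_mul_inv,
        ← sqrt_div (norm_nonneg _)]
      gcongr; exact norm_sub_norm_le v w
    linarith
  calc ‖Real.log ‖v‖ - Real.log ‖w‖‖ₑ
      ≤ ennr (2 * (‖v - w‖ ^ (1 / 2 : ℝ) * ‖w‖ ^ (-(1 / 2) : ℝ))) := by
        rw [enorm_eq_ofReal_abs]; exact ofReal_le_ofReal h1
    _ = 2 * ‖v - w‖ₑ ^ (1 / 2 : ℝ) * ‖w‖ₑ ^ (-(1 / 2) : ℝ) := by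
        rw [ennr_mul (by norm_num), ennr_mul (by positivity),
          ← ENNReal.ofReal_rpow_of_nonneg (norm_nonneg _) (by norm_num),
          ← ENNReal.ofReal_rpow_of_pos hw, ofReal_norm, ofReal_norm]
        simp [mul_assoc]
    _ ≤ _ := by gcongr; exact le_add_self

theorem lintegral_inv_sqrt_enorm_sub_le (t : ℝ) :
    ∫⁻ η in Ioo (-1) 1, ‖η - t‖ₑ ^ (-(1 / 2) : ℝ) ≤ ennr (5 * √2) := by
  have h1 : ∫⁻ η in Ioo (-1) 1, ‖η - t‖ₑ ^ (-(1 / 2) : ℝ) =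
      ∫⁻ η in Ioo (0:ℝ) 2, ‖(η - 1) - t‖ₑ ^ (-(1 / 2) : ℝ) := by
    rw [← lintegral_indicator measurableSet_Ioo, ← lintegral_indicator measurableSet_Ioo,
      ← lintegral_sub_right_eq_self (μ := (volume : Measure ℝ)) _ (1:ℝ)]
    congr 1; ext η; by_cases h : η ∈ Ioo (0:ℝ) 2
    · rw [indicator_of_mem h, indicator_of_mem (s := Ioo (-1:ℝ) 1) ⟨by linarith [h.1], by linarith [h.2]⟩]
    · rw [indicator_of_notMem h, indicator_of_notMem fun h2 => h ⟨by linarith [h2.1], by linarith [h2.2]⟩]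
  rw [h1]; refine le_trans ?_ (lintegral_inv_sqrt_abs_sub_le (t + 1) two_pos)
  refine (lintegral_mono_ae ?_).trans (lintegral_mono_set Ioo_subset_Icc_self)
  have h2 : ∀ᵐ η : ℝ ∂volume.restrict (Ioo 0 2), η ≠ t + 1 := ae_restrict_of_ae (by simp [ae_iff])
  filter_upwards [h2] with η hη
  have h3 : 0 < |t + 1 - η| := abs_pos.2 (sub_ne_zero.2 hη.symm)
  rw [← ENNReal.ofReal_rpow_of_pos h3, show η - 1 - t = -(t + 1 - η) by ring, enorm_neg,
    enorm_eq_ofReal_abs]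

theorem setLIntegral_openBox_im {f : ℝ → ℝ≥0∞} (hf : Measurable f) (a b c d : ℝ) :
    ∫⁻ u in openBox a b c d, f u.im = ennr (b - a) * ∫⁻ η in Ioo c d, f η := by
  have h1 : openBox a b c d = measurableEquivRealProd ⁻¹' (Ioo a b ×ˢ Ioo c d) := by
    ext z; simp [openBox, measurableEquivRealProd, and_assoc]
  have h2 := volume_preserving_equiv_real_prod.setLIntegral_comp_preimage_emb
    measurableEquivRealProd.measurableEmbedding (fun q : ℝ × ℝ => f q.2) (Ioo a b ×ˢ Ioo c d)
  rw [h1]; refine Eq.trans h2 ?_; rw [Measure.volume_eq_prod, ← Measure.prod_restrict,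
    lintegral_prod (fun q : ℝ × ℝ => f q.2) (hf.comp measurable_snd).aemeasurable]
  simp [mul_comm]

theorem rpow_neg_half_le {c x y : ℝ≥0∞} (hc : c ≠ 0) (hc' : c ≠ ⊤) (h : x ≤ c * y) :
    y ^ (-(1 / 2) : ℝ) ≤ c ^ (1 / 2 : ℝ) * x ^ (-(1 / 2) : ℝ) := by
  have h1 : x ^ (1 / 2 : ℝ) ≤ c ^ (1 / 2 : ℝ) * y ^ (1 / 2 : ℝ) := by
    rw [← ENNReal.mul_rpow_of_nonneg _ _ (by norm_num)]
    exact ENNReal.rpow_le_rpow h (by norm_num)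
  have h2 : c ^ (1 / 2 : ℝ) ≠ 0 := by
    rw [Ne, ENNReal.rpow_eq_zero_iff_of_pos (by norm_num)]; exact hc
  have h3 : c ^ (1 / 2 : ℝ) ≠ ⊤ := ENNReal.rpow_ne_top_of_nonneg (by norm_num) hc'
  rw [ENNReal.rpow_neg, ENNReal.rpow_neg]
  calc (y ^ (1 / 2 : ℝ))⁻¹ = c ^ (1 / 2 : ℝ) * ((c ^ (1 / 2 : ℝ))⁻¹ * (y ^ (1 / 2 : ℝ))⁻¹) := by
        rw [← mul_assoc, ENNReal.mul_inv_cancel h2 h3, one_mul]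
    _ = c ^ (1 / 2 : ℝ) * (c ^ (1 / 2 : ℝ) * y ^ (1 / 2 : ℝ))⁻¹ := by
        rw [ENNReal.mul_inv (Or.inl h2) (Or.inl h3)]
    _ ≤ _ := by gcongr

theorem IsHoloChart.exists_lipschitz (h : IsHoloChart z₀ e) :
    ∃ L : NNReal, 0 < L ∧ (∃ s ∈ 𝓝 z₀, LipschitzOnWith L e s) ∧
      ∃ s ∈ 𝓝 (e z₀), LipschitzOnWith L e.symm s := by
  obtain ⟨L₁, s₁, hs₁, h₁⟩ := (h.differentiableAt_symm.1.contDiffAt (n := 1)).restrict_scalars ℝ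
    |>.exists_lipschitzOnWith
  obtain ⟨L₂, s₂, hs₂, h₂⟩ := (h.differentiableAt_symm.2.contDiffAt (n := 1)).restrict_scalars ℝ
    |>.exists_lipschitzOnWith
  exact ⟨L₁ + L₂ + 1, by positivity, ⟨s₁, hs₁, h₁.weaken (by rw [add_assoc]; exact le_self_add)⟩,
    s₂, hs₂, h₂.weaken (by rw [add_comm L₁, add_assoc]; exact le_self_add)⟩

/-- Near a point of an analytic chart the potential of order `1/2` is dominated by a function of the
coordinate `Im e` that is integrable on `(-1, 1)`. -/
theorem IsHoloChart.exists_dominating {ν : Measure ℂ} [IsFiniteMeasure ν] (h : IsHoloChart z₀ e) :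
    ∃ M : ℝ → ℝ≥0∞, Measurable M ∧ ∫⁻ η in Ioo (-1) 1, M η ≠ ⊤ ∧
      ∀ᶠ p in 𝓝 z₀, ∫⁻ x, ‖p - x‖ₑ ^ (-(1 / 2) : ℝ) ∂ν ≤ M (e p).im := by
  obtain ⟨L, hL, ⟨s, hs, hLs⟩, -⟩ := h.exists_lipschitz
  obtain ⟨r, hr, hrs⟩ := Metric.mem_nhds_iff.1 (inter_mem hs (e.open_source.mem_nhds h.mem))
  classical
  set t : ℂ → ℝ := (ball z₀ r).piecewise (fun x => (e x).im) 0 with ht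
  have htm : Measurable t := by
    refine ContinuousOn.measurable_piecewise ?_ continuousOn_const measurableSet_ball
    exact continuous_im.comp_continuousOn (e.continuousOn.mono fun x hx => (hrs hx).2)
  have hL0 : (L : ℝ≥0∞) ≠ 0 := by exact_mod_cast hL.ne'
  set b : ℝ≥0∞ := ennr (r / 2) ^ (-(1 / 2) : ℝ) with hb
  have hbt : b ≠ ⊤ := by
    rw [hb, ENNReal.rpow_neg, Ne, ENNReal.inv_eq_top, ENNReal.rpow_eq_zero_iff_of_pos (by norm_num)]
    simpa using hr
  have hLt : (L : ℝ≥0∞) ^ (1 / 2 : ℝ) ≠ ⊤ := ENNReal.rpow_ne_top_of_nonneg (by norm_num) coe_ne_top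
  have hm : Measurable fun q : ℝ × ℂ => (L : ℝ≥0∞) ^ (1 / 2 : ℝ) * ‖q.1 - t q.2‖ₑ ^ (-(1 / 2) : ℝ) + b :=
    (((measurable_fst.sub (htm.comp measurable_snd)).enorm.pow_const _).const_mul _).add_const _
  -- Since `|Im e p - Im e x| ≤ L |p - x|` near `z₀`, the kernel is bounded by a one-dimensional one
  -- in `η = Im e p`; distant points contribute the constant `b`. The kernel `|η - t|^(-1/2)` is
  -- integrable uniformly in `t`, so Tonelli gives a finite integral.
  refine ⟨fun η => ∫⁻ x, ((L : ℝ≥0∞) ^ (1 / 2 : ℝ) * ‖η - t x‖ₑ ^ (-(1 / 2) : ℝ) + b) ∂ν,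
    hm.lintegral_prod_right', ?_, ?_⟩
  · rw [lintegral_lintegral_swap hm.aemeasurable]
    refine ne_top_of_le_ne_top (b := ∫⁻ _, ((L : ℝ≥0∞) ^ (1 / 2 : ℝ) * ennr (5 * √2) +
      b * volume (Ioo (-1:ℝ) 1)) ∂ν) ?_ (lintegral_mono fun x => ?_)
    · rw [lintegral_const]; refine mul_ne_top (ENNReal.add_ne_top.2 ⟨mul_ne_top hLt ofReal_ne_top,
        mul_ne_top hbt (by simp)⟩) (measure_ne_top _ _)
    · rw [lintegral_add_right _ measurable_const, lintegral_const_mul' _ _ hLt, lintegral_const,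
        Measure.restrict_apply_univ]
      gcongr; exact lintegral_inv_sqrt_enorm_sub_le _
  · filter_upwards [ball_mem_nhds z₀ (half_pos hr)] with p hp
    refine lintegral_mono fun x => ?_
    by_cases hx : x ∈ ball z₀ r
    · refine le_trans (rpow_neg_half_le hL0 coe_ne_top (x := ‖(e p).im - t x‖ₑ) ?_) le_self_add
      simp only [ht]; rw [piecewise_eq_of_mem _ _ _ hx, ← sub_im]
      have h1 := hLs (hrs (ball_subset_ball (by linarith) hp)).1 (hrs hx).1
      rw [edist_eq_enorm_sub, edist_eq_enorm_sub] at h1; refine le_trans ?_ h1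
      rw [enorm_eq_ofReal_abs, ← ofReal_norm]; exact ofReal_le_ofReal (abs_im_le_norm _)
    · refine le_trans ?_ le_add_self; rw [hb, ENNReal.rpow_neg, ENNReal.rpow_neg]; gcongr
      rw [← ofReal_norm]; refine ofReal_le_ofReal ?_; rw [mem_ball, dist_eq_norm] at hx hp
      push Not at hx; have : ‖x - z₀‖ ≤ ‖p - x‖ + ‖p - z₀‖ := by
        rw [norm_sub_rev p x]
        calc ‖x - z₀‖ = ‖(x - p) + (p - z₀)‖ := by congr 1; ring
          _ ≤ _ := norm_add_le _ _
      linarith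

/-- Integrated logarithmic estimate: a Hölder bound of exponent `1/2` for the potential, weighted by
potentials of order `1/2`. -/
theorem enorm_signedPotential_sub_le {ν : Measure ℂ} {σ : ℂ → ℝ} (hσ1 : ∀ x, |σ x| = 1)
    (hσ : Measurable σ) {p q : ℂ} (hp : Integrable (fun x => Real.log (1 / ‖p - x‖)) ν)
    (hq : Integrable (fun x => Real.log (1 / ‖q - x‖)) ν) :
    ‖signedPotential ν σ p - signedPotential ν σ q‖ₑ ≤ 2 * ‖p - q‖ₑ ^ (1 / 2 : ℝ) *
      (∫⁻ x, ‖p - x‖ₑ ^ (-(1 / 2) : ℝ) ∂ν + ∫⁻ x, ‖q - x‖ₑ ^ (-(1 / 2) : ℝ) ∂ν) := by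
  have hi : ∀ z, Integrable (fun x => Real.log (1 / ‖z - x‖)) ν →
      Integrable (fun x => σ x * Real.log (1 / ‖z - x‖)) ν := fun z hz =>
    hz.bdd_mul hσ.aestronglyMeasurable (ae_of_all _ fun x => (hσ1 x).le)
  have hm : ∀ z : ℂ, Measurable fun x => ‖z - x‖ₑ ^ (-(1 / 2) : ℝ) := fun z =>
    (measurable_const.sub measurable_id).enorm.pow_const _
  rw [signedPotential, signedPotential, ← integral_sub (hi p hp) (hi q hq)]
  refine (enorm_integral_le_lintegral_enorm _).trans ?_
  rw [← lintegral_add_left (hm p), ← lintegral_const_mul'' _ (by fun_prop)]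
  refine lintegral_mono fun x => ?_
  rw [← mul_sub, enorm_mul, enorm_eq_ofReal_abs, hσ1, ENNReal.ofReal_one, one_mul, one_div,
    one_div, Real.log_inv, Real.log_inv, neg_sub_neg, enorm_sub_rev]
  simpa using enorm_log_sub_log_le (p - x) (q - x)

/-- Traces on the arc `Re e = 0` of a potential which is constant on that arc. -/
theorem IsHoloChart.exists_trace {ν : Measure ℂ} [IsFiniteMeasure ν] {σ : ℂ → ℝ} (hσ : Measurable σ)
    (hσ1 : ∀ x, |σ x| = 1) (h : IsHoloChart z₀ e)
    (h0 : e z₀ = 0) (hint : ∀ᶠ z in 𝓝 z₀, Integrable (fun x => Real.log (1 / ‖z - x‖)) ν)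
    {Ψ : ℂ → ℝ} (hΨ : ContDiffAt ℝ 1 Ψ z₀) {w : ℝ}
    (hw : ∀ᶠ z in 𝓝 z₀, (e z).re = 0 → signedPotential ν σ z + Ψ z = w) :
    ∃ K : ℝ, ∀ᶠ δ : ℝ in 𝓝[>] 0, ∀ s : ℝ, 0 < s → s ≤ δ → ∫⁻ u in openBox 0 s (-δ) δ,
      ‖signedPotential ν σ (e.symm u) + Ψ (e.symm u) - w‖ₑ ≤ ennr (s * (K * √s)) := by
  obtain ⟨M, hM, hMt, hMp⟩ := h.exists_dominating (ν := ν)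
  obtain ⟨L, hL, -, t, ht, hLt⟩ := h.exists_lipschitz
  obtain ⟨L', t', ht', hLt'⟩ := hΨ.exists_lipschitzOnWith
  have hc : Tendsto e.symm (𝓝 0) (𝓝 z₀) := by
    have := e.continuousAt_symm (e.map_source h.mem)
    rwa [ContinuousAt, e.left_inv h.mem, h0] at this
  have htarg : ∀ᶠ u in 𝓝 (0:ℂ), u ∈ e.target := by
    rw [← h0]; exact e.open_target.mem_nhds (e.map_source h.mem)
  rw [h0] at ht; obtain ⟨R, hR, hRs⟩ := eventually_nhds_iff_ball.1
    ((hc.eventually (hMp.and (hint.and (hw.and ht')))).and (htarg.and ht))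
  set c : ℝ≥0∞ := 4 * (L : ℝ≥0∞) ^ (1 / 2 : ℝ) with hcdef
  have hpt : ∀ s : ℝ, s ≤ 1 → ∀ u : ℂ, ‖u‖ < R → 0 < u.re → u.re ≤ s →
      ‖signedPotential ν σ (e.symm u) + Ψ (e.symm u) - w‖ₑ ≤
        ennr √s * (c * M u.im + L' * L) := fun s hs1 u hu h1 h2 => by
    -- The projection of `u` to the axis, where the total potential equals `w`. It has the same
    -- imaginary part, so both endpoints share the dominating function, and the distance, at most
    -- `s`, supplies the factor `√s`.
    set u' : ℂ := u.im * I with hu'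
    have hn : ‖u'‖ ≤ ‖u‖ := by
      rw [hu', norm_mul, norm_I, mul_one, norm_real]; exact abs_im_le_norm u
    obtain ⟨⟨a1, a2, a3, a4⟩, a5, a6⟩ := hRs u (by rwa [mem_ball_zero_iff])
    obtain ⟨⟨b1, b2, b3, b4⟩, b5, b6⟩ := hRs u' (by rw [mem_ball_zero_iff]; linarith)
    rw [e.right_inv a5] at a1; rw [e.right_inv b5] at b1 b3
    rw [show u'.im = u.im by simp [hu']] at b1
    have e1 := b3 (by simp [hu'])
    have hsub : ‖u - u'‖ₑ ≤ ennr s := by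
      rw [← ofReal_norm]; refine ofReal_le_ofReal ?_
      rw [show u - u' = (u.re : ℂ) by apply Complex.ext <;> simp [hu'], norm_real,
        norm_of_nonneg h1.le]
      exact h2
    have hs0 : 0 ≤ s := h1.le.trans h2
    have e2 : ‖e.symm u - e.symm u'‖ₑ ≤ L * ennr s := by
      have := hLt a6 b6
      rw [edist_eq_enorm_sub, edist_eq_enorm_sub] at this; exact this.trans (by gcongr)
    have e3 : ‖e.symm u - e.symm u'‖ₑ ^ (1 / 2 : ℝ) ≤ (L : ℝ≥0∞) ^ (1 / 2 : ℝ) * ennr √s := by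
      refine (ENNReal.rpow_le_rpow e2 (by norm_num)).trans ?_
      rw [ENNReal.mul_rpow_of_nonneg _ _ (by norm_num), ENNReal.ofReal_rpow_of_nonneg hs0 (by norm_num),
        sqrt_eq_rpow]
    have hss : s ≤ √s := by
      exact le_sqrt_of_sq_le (by nlinarith)
    have e4 : ‖Ψ (e.symm u) - Ψ (e.symm u')‖ₑ ≤ L' * (L * ennr √s) := by
      have := hLt' a4 b4
      rw [edist_eq_enorm_sub, edist_eq_enorm_sub] at this
      refine this.trans (mul_le_mul_right (e2.trans (mul_le_mul_right ?_ _)) _)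
      exact ofReal_le_ofReal hss
    have e5 := (enorm_signedPotential_sub_le hσ1 hσ a2 b2).trans
      (mul_le_mul' (mul_le_mul_right e3 2) (add_le_add a1 b1))
    rw [show signedPotential ν σ (e.symm u) + Ψ (e.symm u) - w =
      (signedPotential ν σ (e.symm u) - signedPotential ν σ (e.symm u')) +
        (Ψ (e.symm u) - Ψ (e.symm u')) by rw [← e1]; ring]
    refine (enorm_add_le _ _).trans ((add_le_add e5 e4).trans (le_of_eq ?_)); rw [hcdef]; ring
  set I := ∫⁻ η in Ioo (-1) 1, (c * M η + L' * L) with hI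
  have hct : c ≠ ⊤ := mul_ne_top (by norm_num)
    (ENNReal.rpow_ne_top_of_nonneg (by norm_num) coe_ne_top)
  have hIt : I ≠ ⊤ := by
    rw [hI, lintegral_add_right _ measurable_const, lintegral_const_mul' _ _ hct]
    exact ENNReal.add_ne_top.2 ⟨mul_ne_top hct hMt, by simp [ENNReal.mul_eq_top]⟩
  refine ⟨I.toReal, ?_⟩; have hlim : ∀ᶠ δ : ℝ in 𝓝[>] 0, δ < min 1 (R / 2) :=
    nhdsWithin_le_nhds (gt_mem_nhds (by positivity))
  filter_upwards [hlim, self_mem_nhdsWithin] with δ hδ hδ0 s hs hsδ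
  have hδ0' : 0 < δ := hδ0
  rw [lt_min_iff] at hδ; have hfm : Measurable fun η => ennr √s * (c * M η + L' * L) := by fun_prop
  calc ∫⁻ u in openBox 0 s (-δ) δ, ‖signedPotential ν σ (e.symm u) + Ψ (e.symm u) - w‖ₑ
      ≤ ∫⁻ u in openBox 0 s (-δ) δ, ennr √s * (c * M u.im + L' * L) := by
        refine setLIntegral_mono' (isOpen_openBox _ _ _ _).measurableSet fun u hu =>
          hpt s (by linarith) u ?_ hu.1 hu.2.1.le
        exact norm_lt_of_mem_openBox hu
    _ = ennr (s - 0) * ∫⁻ η in Ioo (-δ) δ, ennr √s * (c * M η + L' * L) :=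
        setLIntegral_openBox_im hfm _ _ _ _
    _ ≤ ennr s * (ennr √s * I) := by
        rw [sub_zero, lintegral_const_mul' _ _ ofReal_ne_top]; gcongr
        exact lintegral_mono_set (Ioo_subset_Ioo (by linarith) (by linarith))
    _ = ennr (s * (I.toReal * √s)) := by
        rw [ennr_mul hs.le, ennr_mul ENNReal.toReal_nonneg, ofReal_toReal hIt]; ring

end

/-! ### Reflection and normal derivatives on one side of an arc -/

section

variable {z₀ : ℂ} {e : OpenPartialHomeomorph ℂ ℂ}

/-- A one-sided derivative is the limit of the derivatives. -/
theorem eq_of_hasDerivWithinAt_Ici_of_tendsto {f f' : ℝ → ℝ} {d l : ℝ}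
    (hd : HasDerivWithinAt f d (Ici 0) 0) (hf : ∀ᶠ s in 𝓝[>] 0, HasDerivAt f (f' s) s)
    (hl : Tendsto f' (𝓝[>] 0) (𝓝 l)) : d = l := by
  obtain ⟨r, hr, hrs⟩ := mem_nhdsGT_iff_exists_Ioo_subset.1 hf
  have h1 : HasDerivWithinAt f l (Ici 0) 0 := by
    refine hasDerivWithinAt_Ici_of_tendsto_deriv (s := Ioo 0 r)
      (fun x hx => (hrs hx).differentiableAt.differentiableWithinAt)
      (hd.continuousWithinAt.mono (Ioo_subset_Ioi_self.trans Ioi_subset_Ici_self))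
      (Ioo_mem_nhdsGT hr) (hl.congr' ?_)
    filter_upwards [hf] with s hs using hs.deriv.symm
  exact (uniqueDiffWithinAt_Ici 0).eq_deriv _ hd h1

/-- The negated chart exchanges the two sides of the arc, so one-sided results stated for `Re e > 0`
also serve on the other side. -/
theorem IsHoloChart.neg (h : IsHoloChart z₀ e) :
    IsHoloChart z₀ (e.transHomeomorph (Homeomorph.neg ℂ)) ∧
      ∀ z, deriv (e.transHomeomorph (Homeomorph.neg ℂ)) z = -deriv e z := by
  have hcoe : ⇑(e.transHomeomorph (Homeomorph.neg ℂ)) = fun z => -e z := rfl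
  have hsym : ⇑(e.transHomeomorph (Homeomorph.neg ℂ)).symm = fun w => e.symm (-w) := rfl
  have hd : ∀ z, deriv (e.transHomeomorph (Homeomorph.neg ℂ)) z = -deriv e z := fun z => by
    rw [hcoe, deriv.fun_neg]
  refine ⟨⟨h.mem, fun z hz => ?_, fun w hw => ?_⟩, hd⟩
  · rw [hd, hcoe]; exact ⟨(h.hasDerivAt z hz).1.fun_neg, neg_ne_zero.2 (h.hasDerivAt z hz).2⟩
  · rw [hd, hsym]; have h1 := HasDerivAt.comp w (h.hasDerivAt_symm (-w) hw) (hasDerivAt_neg w)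
    refine h1.congr_deriv ?_; rw [inv_neg, mul_neg_one]

/-- Transfer of the reflection principle to the right side `Re e > 0` of an analytic arc. -/
theorem IsHoloChart.exists_reflection {S : Set ℂ}
    (h : IsHoloChart z₀ e) (h0 : e z₀ = 0) (hS : ∀ᶠ z in 𝓝 z₀, z ∈ S → (e z).re = 0)
    {T : ℂ → ℝ} {g : ℂ → ℂ} (hgi : LocallyIntegrable g)
    (hT : ∀ᶠ z in 𝓝 z₀, z ∉ S → HasFDerivAt T (reMul (g z)) z ∧ DifferentiableAt ℂ g z) {w K : ℝ}
    (htr : ∀ᶠ δ : ℝ in 𝓝[>] 0, ∀ s : ℝ, 0 < s → s ≤ δ → ∫⁻ q in openBox 0 s (-δ) δ,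
      ‖T (e.symm q) - w‖ₑ ≤ ennr (s * (K * √s))) :
    ∃ H : ℂ → ℂ, AnalyticAt ℂ H 0 ∧ (∀ᶠ z in 𝓝 z₀, 0 < (e z).re → g z = H (e z) * deriv e z) ∧
      ∀ᶠ z in 𝓝 z₀, (e z).re = 0 → (H (e z)).im = 0 := by
  have hc : Tendsto e.symm (𝓝 0) (𝓝 z₀) := by
    have := e.continuousAt_symm (e.map_source h.mem)
    rwa [ContinuousAt, e.left_inv h.mem, h0] at this
  have hce : Tendsto e (𝓝 z₀) (𝓝 0) := by
    have := e.continuousAt h.mem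
    rwa [ContinuousAt, h0] at this
  have htarg : ∀ᶠ q in 𝓝 (0:ℂ), q ∈ e.target := by
    rw [← h0]; exact e.open_target.mem_nhds (e.map_source h.mem)
  obtain ⟨W, hW, hWi⟩ := hgi z₀; set B : ℝ := ‖deriv e z₀‖ + 1 with hB
  have hderiv : ∀ᶠ z in 𝓝 z₀, ‖deriv e z‖ < B ∧ ContinuousAt (deriv e) z := by
    have h1 := h.differentiableAt_symm.1.deriv
    exact (h1.continuousAt.norm.eventually (gt_mem_nhds (by linarith))).and
      h1.eventually_continuousAt
  obtain ⟨R, hR, hRs⟩ := eventually_nhds_iff_ball.1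
    ((hc.eventually (hT.and (hS.and (hderiv.and hW)))).and htarg)
  have hlim : ∀ᶠ δ : ℝ in 𝓝[>] 0, δ < R / 2 := nhdsWithin_le_nhds (gt_mem_nhds (half_pos hR))
  obtain ⟨δ, ⟨hδR, hδtr⟩, hδ0⟩ := ((hlim.and htr).and self_mem_nhdsWithin).exists; have hδ := hδ0
  set P := openBox 0 δ (-δ) δ with hPdef
  have hP : IsOpen P := isOpen_openBox _ _ _ _
  have hPR : ∀ q ∈ P, q ∈ ball 0 R := fun q hq => by
    rw [mem_ball_zero_iff]; exact norm_lt_of_mem_openBox hq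
  have hPt : ∀ q ∈ P, q ∈ e.target := fun q hq => (hRs q (hPR q hq)).2
  have hPS : ∀ q ∈ P, e.symm q ∉ S := fun q hq h1 => by
    have h2 := (hRs q (hPR q hq)).1.2.1 h1
    rw [e.right_inv (hPt q hq)] at h2; exact hq.1.ne' h2
  have hPT := fun q (hq : q ∈ P) => (hRs q (hPR q hq)).1.1 (hPS q hq)
  have hPd : ∀ q ∈ P, HasDerivAt e.symm (deriv e (e.symm q))⁻¹ q := fun q hq =>
    h.hasDerivAt_symm q (hPt q hq)
  have hne : ∀ q ∈ P, deriv e (e.symm q) ≠ 0 := fun q hq =>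
    (h.hasDerivAt _ (e.map_target (hPt q hq))).2
  have hde : ∀ q ∈ P, DifferentiableAt ℂ (deriv e) (e.symm q) := fun q hq =>
    (DifferentiableOn.analyticAt (fun z hz => (h.hasDerivAt z hz).1.differentiableAt.differentiableWithinAt)
      (e.open_source.mem_nhds (e.map_target (hPt q hq)))).deriv.differentiableAt
  have hdc : ∀ q ∈ P, DifferentiableAt ℂ (fun q => deriv e (e.symm q)) q := fun q hq =>
    DifferentiableAt.comp (g := deriv e) q (hde q hq) (hPd q hq).differentiableAt
  set G : ℂ → ℂ := fun q => g (e.symm q) * (deriv e (e.symm q))⁻¹ with hGdef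
  have hu : ∀ q ∈ P, HasFDerivAt (fun q => T (e.symm q)) (reMul (G q)) q := by
    intro q hq
    refine ((hPT q hq).1.comp q ((hPd q hq).hasFDerivAt.restrictScalars ℝ)).congr_fderiv ?_; ext v
    simp only [ContinuousLinearMap.comp_apply, reMul_apply, ContinuousLinearMap.coe_restrictScalars',
      ContinuousLinearMap.toSpanSingleton_apply, smul_eq_mul]
    congr 1; ring
  have hG : DifferentiableOn ℂ G P := by
    exact fun q hq => ((DifferentiableAt.comp (g := g) q (hPT q hq).2 (hPd q hq).differentiableAt).mul
      ((hdc q hq).inv (hne q hq))).differentiableWithinAt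
  have hGi : IntegrableOn G P := by
    have h1 : IntegrableOn g (e.symm '' P) := hWi.mono_set (by
      rintro _ ⟨q, hq, rfl⟩; exact (hRs q (hPR q hq)).1.2.2.2)
    rw [integrableOn_image_iff_integrableOn_abs_det_fderiv_smul volume hP.measurableSet
      (fun q hq => ((hPd q hq).hasFDerivAt.restrictScalars ℝ).hasFDerivWithinAt)
      (e.symm.injOn.mono hPt)] at h1
    -- The change of variables gives integrability of `g ∘ e⁻¹` times the Jacobian `|1/e'|²`;
    -- multiplying by the bounded function `conj e'` leaves exactly the factor `1/e'` of `G`.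
    have h2 : AEStronglyMeasurable (fun q => conj (deriv e (e.symm q))) (volume.restrict P) :=
      ContinuousOn.aestronglyMeasurable (fun q hq => (continuous_conj.continuousAt.comp
        (hdc q hq).continuousAt).continuousWithinAt) hP.measurableSet
    have h3 := Integrable.bdd_mul (c := B) h1 h2 ((ae_restrict_iff' hP.measurableSet).2
      (ae_of_all _ fun q hq => by rw [RCLike.norm_conj]; exact (hRs q (hPR q hq)).1.2.2.1.1.le))
    refine (integrableOn_congr_fun (fun q hq => ?_) hP.measurableSet).1 h3
    simp only [det_restrictScalars_smulRight, abs_of_nonneg (sq_nonneg ‖(deriv e (e.symm q))⁻¹‖),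
      real_smul]
    have h4 := hne q hq
    have h5 : conj (deriv e (e.symm q)) ≠ 0 := by simpa using h4
    rw [ofReal_pow, ← conj_mul', map_inv₀]; simp only [hGdef]; field_simp
  have hε : Tendsto (fun s : ℝ => K * √s) (𝓝[>] 0) (𝓝 0) := by
    have h1 : Continuous fun s : ℝ => K * √s := by fun_prop
    exact (h1.tendsto' 0 0 (by simp)).mono_left nhdsWithin_le_nhds
  have htr' : ∀ᶠ s in 𝓝[>] 0, ∫⁻ q in openBox 0 s (-δ) δ, ‖T (e.symm q) - w‖ₑ ≤
      ennr (s * (K * √s)) := by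
    filter_upwards [Ioo_mem_nhdsGT hδ] with s hs
    refine (lintegral_mono_set fun q hq => ?_).trans (hδtr s hs.1 hs.2.le)
    exact hq
  obtain ⟨H, hH, hHg, hHr⟩ := _root_.exists_reflection hδ hu hG hGi hε htr'
  refine ⟨H, hH, ?_, hce.eventually hHr⟩
  filter_upwards [hce.eventually hHg, e.open_source.mem_nhds h.mem] with z h1 h2 h3
  rw [← h1 h3, hGdef]; simp only; rw [e.left_inv h2, inv_mul_cancel_right₀ (h.hasDerivAt z h2).2]

/-- One-sided normal derivatives on an analytic arc. -/
theorem IsHoloChart.eventually_normal_deriv_eq {S : Set ℂ}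
    (h : IsHoloChart z₀ e) (h0 : e z₀ = 0) (hS : ∀ᶠ z in 𝓝 z₀, z ∈ S → (e z).re = 0)
    {g H : ℂ → ℂ} (hH : AnalyticAt ℂ H 0)
    (hg : ∀ᶠ z in 𝓝 z₀, 0 < (e z).re → g z = H (e z) * deriv e z) :
    ∀ᶠ w in 𝓝 z₀, (e w).re = 0 → ∀ T : ℂ → ℝ,
      (∀ᶠ x in 𝓝 w, x ∉ S → HasFDerivAt T (reMul (g x)) x) → ∀ d : ℝ,
      HasDerivWithinAt (fun s : ℝ => T (w + s * (‖deriv e w‖ / deriv e w))) d (Ici 0) 0 →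
      d = (H (e w)).re * ‖deriv e w‖ := by
  have hce : Tendsto e (𝓝 z₀) (𝓝 0) := by
    have := e.continuousAt h.mem
    rwa [ContinuousAt, h0] at this
  filter_upwards [hS.eventually_nhds, hg.eventually_nhds, hce.eventually hH.eventually_analyticAt,
    h.differentiableAt_symm.1.eventually_analyticAt, e.open_source.mem_nhds h.mem]
    with w h1 h2 h3 h4 h5 h6 T hT d hd
  -- The unit vector with `e'(w) m = ‖e'(w)‖ > 0`: normal to the arc and pointing to the side `Re e
  -- > 0`.
  set m : ℂ := ‖deriv e w‖ / deriv e w with hm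
  have hne := (h.hasDerivAt w h5).2
  have hem : deriv e w * m = ‖deriv e w‖ := by rw [hm]; field_simp
  have hline : ∀ s : ℝ, HasDerivAt (fun s : ℝ => w + s * m) m s := fun s => by
    simpa using ((ofRealCLM.hasDerivAt (x := s)).mul_const m).const_add w
  have hw0 : w + ((0:ℝ):ℂ) * m = w := by simp
  have hlt : Tendsto (fun s : ℝ => w + s * m) (𝓝 0) (𝓝 w) := by
    have := (hline 0).continuousAt.tendsto
    rwa [hw0] at this
  have hpos : ∀ᶠ s : ℝ in 𝓝[>] 0, 0 < (e (w + s * m)).re := by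
    have e1 : HasDerivAt (fun s : ℝ => e (w + s * m)) (‖deriv e w‖ : ℂ) 0 := by
      rw [← hem]; exact HasDerivAt.comp (0:ℝ) (by rw [hw0]; exact (h.hasDerivAt w h5).1) (hline 0)
    have e2 : HasDerivAt (fun s : ℝ => (e (w + s * m)).re) ‖deriv e w‖ 0 := by
      exact (reCLM.hasFDerivAt.comp_hasDerivAt (0:ℝ) e1).congr_deriv (by simp)
    have e3 := hasDerivAt_iff_tendsto_slope_zero.1 e2
    have e4 := (e3.mono_left (nhdsWithin_mono 0 (fun s (hs : 0 < s) => hs.ne'))).eventually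
      (lt_mem_nhds (norm_pos_iff.2 hne))
    filter_upwards [e4, self_mem_nhdsWithin] with s hs hs0
    rw [zero_add, hw0, h6, sub_zero, smul_eq_mul] at hs
    exact (mul_pos_iff_of_pos_left (inv_pos.2 hs0)).1 hs
  have hlt' : Tendsto (fun s : ℝ => w + s * m) (𝓝[>] 0) (𝓝 w) := hlt.mono_left nhdsWithin_le_nhds
  refine eq_of_hasDerivWithinAt_Ici_of_tendsto (f' := fun s : ℝ => (m * g (w + s * m)).re) hd ?_ ?_
  · filter_upwards [hpos, hlt'.eventually h1, hlt'.eventually hT] with s e1 e2 e3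
    have e4 := (e3 fun hs => e1.ne' (e2 hs)).comp_hasDerivAt s (hline s)
    exact e4
  · have e1 : Tendsto (fun s : ℝ => (m * (H (e (w + s * m)) * deriv e (w + s * m))).re) (𝓝[>] 0)
        (𝓝 (m * (H (e w) * deriv e w)).re) := by
      have e2 : ContinuousAt (fun x => (m * (H (e x) * deriv e x)).re) w :=
        continuous_re.continuousAt.comp (continuousAt_const.mul
          ((ContinuousAt.comp (g := H) h3.continuousAt h4.continuousAt).mul h4.deriv.continuousAt))
      exact e2.tendsto.comp hlt'
    rw [show m * (H (e w) * deriv e w) = H (e w) * (deriv e w * m) by ring, hem,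
      re_mul_ofReal] at e1
    refine e1.congr' ?_; filter_upwards [hpos, hlt'.eventually h2] with s e2 e3
    rw [e3 e2]

end

/-! ### Extension of the squared field across regular arcs -/

section

variable {z₀ : ℂ} {e : OpenPartialHomeomorph ℂ ℂ}

variable {n : ℕ} {a ρ : Fin n → ℂ} {μ : SignedMeasure ℂ} {σ : ℂ → ℝ}

/-- The sign of `dμ / d|μ|` for a measure of compact support. -/
structure IsSignOf (μ : SignedMeasure ℂ) (σ : ℂ → ℝ) : Prop where
  measurable : Measurable σ
  abs_eq_one : ∀ x, |σ x| = 1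
  compact_support : IsCompact (realSupport μ)
  logPotential_eq : logPotential μ = signedPotential μ.variation σ

theorem IsSignOf.hasFDerivAt_totalPotential (h : IsSignOf μ σ) {z₀ w : ℂ}
    (hφ : HasFDerivAt (fieldIncrement a ρ z₀) (reMul (fieldDeriv a ρ w)) w)
    (hw : w ∉ realSupport μ) :
    HasFDerivAt (totalPotential a ρ μ z₀) (reMul (totalField a ρ μ.variation σ w)) w := by
  have h1 := hasFDerivAt_signedPotential h.measurable h.abs_eq_one h.compact_support hw
  rw [← h.logPotential_eq] at h1; refine (h1.add hφ).congr_fderiv ?_; ext v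
  simp [totalField, mul_add]

theorem IsSignOf.eventually_hasFDerivAt (h : IsSignOf μ σ) {z₀ : ℂ}
    (hz₀ : ∀ k, ρ k ≠ 0 → z₀ ≠ a k) : ∀ᶠ w in 𝓝 z₀, w ∉ realSupport μ →
      HasFDerivAt (totalPotential a ρ μ z₀) (reMul (totalField a ρ μ.variation σ w)) w ∧
      DifferentiableAt ℂ (totalField a ρ μ.variation σ) w := by
  filter_upwards [eventually_hasFDerivAt_fieldIncrement a ρ hz₀, eventually_uncharged a ρ hz₀]
    with w hφ hwu hw
  exact ⟨h.hasFDerivAt_totalPotential hφ hw, (differentiableAt_cauchyTransform h.measurable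
    h.abs_eq_one hw).add (differentiableAt_fieldDeriv a ρ hwu)⟩

theorem integrable_log_of_notMem_support {ν : Measure ℂ} [IsFiniteMeasure ν]
    (hs : IsCompact ν.support) {z : ℂ} (hz : z ∉ ν.support) :
    Integrable (fun x => Real.log (1 / ‖z - x‖)) ν := by
  refine (integrable_and_continuousAt_signedPotential (σ := fun _ => 1) measurable_const (by simp) hs
    fun η hη => ?_).1
  obtain ⟨r, hr, hrs⟩ := Metric.mem_nhds_iff.1 (ν.isClosed_support.isOpen_compl.mem_nhds hz)
  refine ⟨r, hr, fun w hw => ?_⟩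
  have h1 := measure_mono_null hrs ν.measure_compl_support
  rw [Measure.restrict_eq_zero.2 h1, lintegral_zero_measure]; exact zero_le

/-- Near a regular point the support is a connected arc, hence part of one component, so constancy
along the component is constancy along the support. -/
theorem IsConstantOnComponents.eventually_eq_of_isRegularPoint (h : IsConstantOnComponents a ρ μ)
    {z₀ : ℂ} (hz₀ : z₀ ∈ realSupport μ) (hreg : IsRegularPoint (realSupport μ) z₀) :
    ∀ᶠ z in 𝓝 z₀, z ∈ realSupport μ →
      totalPotential a ρ μ z₀ z = totalPotential a ρ μ z₀ z₀ := by
  obtain ⟨γ, hγ0, -, -, hemb, B, hB, -, hzB, hBS⟩ := hreg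
  have hpre : IsPreconnected (γ '' Ioo (-1) 1) := by
    rw [image_eq_range]
    have : PreconnectedSpace (Ioo (-1:ℝ) 1) := isPreconnected_iff_preconnectedSpace.1 isPreconnected_Ioo
    exact isPreconnected_range hemb.continuous
  have hsub : B ∩ realSupport μ ⊆ connectedComponentIn (realSupport μ) z₀ := by
    rw [hBS]
    exact hpre.subset_connectedComponentIn ⟨0, by norm_num, hγ0⟩ (by rw [← hBS]; exact inter_subset_right)
  have h1 := (h z₀ hz₀ z₀ (mem_connectedComponentIn hz₀)).2
  rw [eventually_nhdsWithin_iff] at h1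
  filter_upwards [h1, hB.mem_nhds hzB] with z h2 h3 h4 using h2 (hsub ⟨h3, h4⟩)

theorem IsHoloChart.isRegularPoint {S : Set ℂ}
    (h : IsHoloChart z₀ e) (hs : ∀ᶠ z in 𝓝 z₀, z ∈ S ↔ (e z).re = 0) (hz : z₀ ∈ S) :
    IsRegularPoint S z₀ ∧ IsUnitNormal S z₀ (‖deriv e z₀‖ / deriv e z₀) := by
  obtain ⟨R, hR, hγ⟩ := h.exists_isLocalArc hs hz; have hne := (h.hasDerivAt z₀ h.mem).2
  refine ⟨⟨_, hγ⟩, ?_, _, hγ, ?_⟩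
  · rw [norm_div, norm_real, norm_norm, div_self (norm_ne_zero_iff.2 hne)]
  · have h1 : HasDerivAt (fun t : ℝ => e z₀ + t * ((R : ℝ) * I)) (R * I) 0 := by
      simpa using ((ofRealCLM.hasDerivAt (x := (0:ℝ))).mul_const (R * I)).const_add (e z₀)
    have h2 : HasDerivAt (fun t : ℝ => e.symm (e z₀ + t * ((R : ℝ) * I)))
        ((deriv e z₀)⁻¹ * (R * I)) 0 := by
      refine HasDerivAt.comp (0:ℝ) ?_ h1; have := h.hasDerivAt_symm (e z₀) (e.map_source h.mem)
      rw [e.left_inv h.mem] at this; simpa using this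
    rw [h2.deriv, Complex.inner]; have h3 : conj (deriv e z₀) ≠ 0 := by simpa using hne
    have h4 : conj (‖deriv e z₀‖ / deriv e z₀) * ((deriv e z₀)⁻¹ * (R * I)) =
        ((R / ‖deriv e z₀‖ : ℝ) : ℂ) * I := by
      have h5 : ((‖deriv e z₀‖ : ℝ) : ℂ) ≠ 0 := by simpa using hne
      rw [map_div₀, conj_ofReal, ofReal_div]; have h6 := conj_mul' (deriv e z₀)
      field_simp; linear_combination -(R : ℂ) * h6
    rw [mul_comm, h4, re_ofReal_mul, I_re, mul_zero]

/-- The square of the total field extends analytically across regular analytic arcs of the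
support. -/
theorem IsGoodPoint.exists_sq_extension (h : IsSignOf μ σ)
    (hconst : IsConstantOnComponents a ρ μ) (hS : HasSProperty a ρ μ) {z₀ : ℂ}
    (hz₀ : z₀ ∈ realSupport μ) (hgood : IsGoodPoint (realSupport μ) z₀) :
    ∃ Q : ℂ → ℂ, AnalyticAt ℂ Q z₀ ∧ ∀ᶠ z in 𝓝 z₀, z ∉ realSupport μ →
      totalField a ρ μ.variation σ z ^ 2 = Q z := by
  set S := realSupport μ with hSdef
  set g := totalField a ρ μ.variation σ with hgdef
  obtain ⟨e', he', hes'⟩ := hgood; have hre := hes'.self_of_nhds.1 hz₀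
  obtain ⟨e, he, he0, hes⟩ : ∃ e, IsHoloChart z₀ e ∧ e z₀ = 0 ∧ ∀ᶠ w in 𝓝 z₀, w ∈ S ↔ (e w).re = 0 := by
    set e := e'.transHomeomorph (Homeomorph.subRight (e' z₀)) with he
    have hcoe : ⇑e = fun z => e' z - e' z₀ := rfl
    have hsym : ⇑e.symm = fun w => e'.symm (w + e' z₀) := by
      ext w; simp [he, Homeomorph.subRight]
    have hd : ∀ z, deriv e z = deriv e' z := fun z => by rw [hcoe, deriv_sub_const_fun]
    refine ⟨e, ⟨he'.mem, fun z hz => ?_, fun w hw => ?_⟩, by rw [hcoe]; simp, ?_⟩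
    · rw [hd, hcoe]; exact ⟨(he'.hasDerivAt z hz).1.sub_const _, (he'.hasDerivAt z hz).2⟩
    · rw [hd, hsym]; have hw' : w + e' z₀ ∈ e'.target := by
        simpa [he, Homeomorph.subRight] using hw
      exact (he'.hasDerivAt_symm _ hw').comp_add_const w (e' z₀)
    · filter_upwards [hes'] with w hw
      rw [hw, hcoe]; simp [hre]
  have hdefS : ∀ z ∈ S, IsPotentialDefinedAt a ρ μ z := fun z hz =>
    (hconst z hz z (mem_connectedComponentIn hz)).1
  have hunch := (hdefS z₀ hz₀).1
  have hlog : ∀ z, Integrable (fun x => Real.log (1 / ‖z - x‖)) μ.variation := fun z => by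
    by_cases hz : z ∈ S
    · exact (hdefS z hz).2.2
    · exact integrable_log_of_notMem_support h.compact_support hz
  have hgl := locallyIntegrable_totalField (ν := μ.variation) a ρ h.measurable h.abs_eq_one
  have hΨ : ContDiffAt ℝ 1 (fieldIncrement a ρ z₀) z₀ := by
    obtain ⟨r, hr, hrs⟩ := eventually_nhds_iff_ball.1
      ((eventually_hasFDerivAt_fieldIncrement a ρ hunch).and (eventually_uncharged a ρ hunch))
    exact (contDiffOn_of_hasFDerivAt_reMul isOpen_ball (fun w hw => (hrs w hw).1) fun w hw =>
      (differentiableAt_fieldDeriv a ρ (hrs w hw).2).continuousAt.continuousWithinAt).contDiffAt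
      (ball_mem_nhds z₀ hr)
  have hT := h.eventually_hasFDerivAt hunch
  have hw0 := hconst.eventually_eq_of_isRegularPoint hz₀ (he.isRegularPoint hes hz₀).1
  have hhalf : ∀ f : OpenPartialHomeomorph ℂ ℂ, IsHoloChart z₀ f → f z₀ = 0 →
      (∀ᶠ w in 𝓝 z₀, w ∈ S ↔ (f w).re = 0) →
      ∃ H : ℂ → ℂ, AnalyticAt ℂ H 0 ∧ (∀ᶠ z in 𝓝 z₀, 0 < (f z).re → g z = H (f z) * deriv f z) ∧
        (∀ᶠ z in 𝓝 z₀, (f z).re = 0 → (H (f z)).im = 0) ∧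
        ∀ᶠ w in 𝓝 z₀, w ∈ S → ∀ d : ℝ, HasDerivWithinAt (fun s : ℝ => totalPotential a ρ μ w
          (w + s * (‖deriv f w‖ / deriv f w))) d (Ici 0) 0 → d = (H (f w)).re * ‖deriv f w‖ :=
    fun f hf hf0 hfs => by
      obtain ⟨K, hK⟩ := hf.exists_trace h.measurable h.abs_eq_one hf0
        (Eventually.of_forall hlog) hΨ (w := totalPotential a ρ μ z₀ z₀) (by
          filter_upwards [hw0, hfs] with z h1 h2 h3
          rw [← h1 (h2.2 h3), totalPotential, h.logPotential_eq])
      have hfs1 := hfs.mono fun z hz => hz.1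
      obtain ⟨H, hH, hHg, hHr⟩ := hf.exists_reflection hf0 hfs1 hgl hT
        (w := totalPotential a ρ μ z₀ z₀) (K := K) (by
          simpa only [totalPotential, h.logPotential_eq] using hK)
      refine ⟨H, hH, hHg, hHr, ?_⟩
      filter_upwards [hf.eventually_normal_deriv_eq hf0 hfs1 hH hHg, hfs1] with w h1 h2 h3 d hd
      exact h1 (h2 h3) _ ((h.eventually_hasFDerivAt (hdefS w h3).1).mono fun x hx hxS =>
        (hx hxS).1) d hd
  obtain ⟨H, hH, hHg, hHr, hHd⟩ := hhalf e he he0 hes; obtain ⟨hn, hnd⟩ := he.neg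
  set f := e.transHomeomorph (Homeomorph.neg ℂ) with hf
  have hfc : ∀ z, f z = -e z := fun z => rfl
  obtain ⟨N, hN, hNg, hNr, hNd⟩ := hhalf f hn (by rw [hfc, he0, neg_zero])
    (by filter_upwards [hes] with w hw; rw [hw, hfc, neg_re, neg_eq_zero])
  have hc : Tendsto e.symm (𝓝 0) (𝓝 z₀) := by
    have := e.continuousAt_symm (e.map_source he.mem)
    rwa [ContinuousAt, e.left_inv he.mem, he0] at this
  have hce : Tendsto e (𝓝 z₀) (𝓝 0) := by
    have := e.continuousAt he.mem
    rwa [ContinuousAt, he0] at this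
  have htarg : ∀ᶠ u in 𝓝 (0:ℂ), u ∈ e.target := by
    rw [← he0]; exact e.open_target.mem_nhds (e.map_source he.mem)
  -- `H` and `N` continue the field, in the coordinates `e` and `-e`, from the two sides. On the arc
  -- both are real by reflection, and the S-property equates their real parts, which are the normal
  -- derivatives divided by `|e'|`.
  have haxis : ∀ᶠ w in 𝓝 z₀, w ∈ S → H (e w) = N (-e w) := by
    filter_upwards [hHr, hHd, hNr, hNd, hes.eventually_nhds, e.open_source.mem_nhds he.mem]
      with w h1 h2 h3 h4 h5 h6 hwS
    have hwe : IsHoloChart w e := ⟨h6, he.hasDerivAt, he.hasDerivAt_symm⟩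
    obtain ⟨hreg, hnorm⟩ := hwe.isRegularPoint h5 hwS; obtain ⟨d, hd1, hd2⟩ := hS w hwS hreg _ hnorm
    have e0 := h5.self_of_nhds.1 hwS
    have e1 := h2 hwS d hd1
    have e2 := h4 hwS d (by rw [hnd, norm_neg, div_neg]; exact hd2)
    rw [hnd, norm_neg] at e2
    have e3 := mul_right_cancel₀ (norm_ne_zero_iff.2 (he.hasDerivAt w h6).2) (e1.symm.trans e2)
    rw [hfc] at e3 h3; have e4 := h1 e0
    have e5 := h3 (by rw [neg_re, e0, neg_zero])
    exact Complex.ext e3 (e4.trans e5.symm)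
  have hNneg : AnalyticAt ℂ (fun u => N (-u)) 0 :=
    AnalyticAt.fun_comp (g := N) (by rwa [neg_zero]) analyticAt_id.neg
  -- Analytic functions that agree on the imaginary axis agree near 0. Thus `g` is `H(e) e'` on one
  -- side and `-H(e) e'` on the other, and the squares match.
  have hHN : ∀ᶠ u in 𝓝 (0:ℂ), H u = N (-u) := by
    rw [← hH.frequently_eq_iff_eventually_eq hNneg]
    have h1 : Tendsto (fun t : ℝ => (t * I : ℂ)) (𝓝[≠] 0) (𝓝[≠] 0) := by
      refine tendsto_nhdsWithin_iff.2 ⟨?_, ?_⟩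
      · exact (Continuous.tendsto' (by fun_prop) _ _ (by simp)).mono_left nhdsWithin_le_nhds
      · filter_upwards [self_mem_nhdsWithin] with t ht
        simpa using ht
    refine h1.frequently (Eventually.frequently ?_); have h2 := h1.mono_right nhdsWithin_le_nhds
    filter_upwards [(hc.comp h2).eventually haxis, (hc.comp h2).eventually hes, h2.eventually htarg]
      with t h3 h4 h5
    simp only [Function.comp, e.right_inv h5] at h3 h4; exact h3 (h4.2 (by simp))
  refine ⟨fun z => (H (e z) * deriv e z) ^ 2, ?_, ?_⟩
  · exact ((AnalyticAt.fun_comp (g := H) (by rwa [he0]) he.differentiableAt_symm.1).mul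
      he.differentiableAt_symm.1.deriv).pow 2
  · filter_upwards [hes, hHg, hNg, hce.eventually hHN] with z h1 h2 h3 h4 h5
    rcases lt_trichotomy (e z).re 0 with h6 | h6 | h6
    · rw [h3 (by rw [hfc, neg_re]; linarith), hfc, hnd, ← h4]
      ring
    · exact absurd (h1.2 h6) h5
    · rw [h2 h6]

end

/-! ### Isolated singular points of the squared field -/

theorem exists_enorm_zero_le_lintegral : ∃ C : ℝ≥0∞, C ≠ ⊤ ∧ ∀ F : ℂ → ℂ,
    DifferentiableOn ℂ F (ball 0 1) → ‖F 0‖ₑ ≤ C * ∫⁻ w in ball 0 1, ‖F w‖ₑ := by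
  obtain ⟨β, hβ, hβc, hβs, -, hβ1⟩ := exists_smooth_bump (isCompact_closedBall (0:ℂ) (1 / 2))
    (isOpen_ball (x := (0:ℂ)) (ε := 1)) (closedBall_subset_ball (by norm_num))
  set B : ℂ → ℂ := fun u => (β u : ℂ) with hB
  have hBc : ContDiff ℝ 1 B := ofRealCLM.contDiff.comp (hβ.of_le (by simp))
  have hB0 : ∀ u, u ∉ tsupport β → B u = 0 := fun u h => by
    simp [hB, image_eq_zero_of_notMem_tsupport h]
  have hBs := HasCompactSupport.intro hβc hB0
  obtain ⟨M, hM⟩ := (hasCompactSupport_dbar hBs).exists_bound_of_continuous (continuous_dbar hBc)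
  have hdB : ∀ u ∈ ball (0:ℂ) (1 / 2), dbar B u = 0 := fun u hu => by
    have : B =ᶠ[𝓝 u] fun _ => 1 := by
      filter_upwards [isOpen_ball.mem_nhds hu] with w hw
      simp [hB, hβ1 w (ball_subset_closedBall hw)]
    simp [dbar, this.fderiv_eq]
  have hM0 := (norm_nonneg _).trans (hM 0)
  refine ⟨ennr (M * 2), ofReal_ne_top, fun F hF => ?_⟩
  set P := ball (0:ℂ) 1 with hP
  have hPo : IsOpen P := isOpen_ball
  have hFB0 : ∀ u ∈ P, u ∉ tsupport β → F u * B u = 0 := fun u _ h => by rw [hB0 u h, mul_zero]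
  have h3 := contDiff_indicator hPo (isClosed_tsupport β) hβs
    (f := fun u => F u * B u) (((hF.contDiffOn hPo).restrict_scalars ℝ).mul hBc.contDiffOn) hFB0
  have hsm : HasCompactSupport (P.indicator fun u => F u * B u) :=
    HasCompactSupport.intro hβc fun u hu => by
      by_cases huP : u ∈ P
      · rw [indicator_of_mem huP, hFB0 u huP hu]
      · exact indicator_of_notMem huP _
  have h4 := integral_dbar_div h3 hsm 0
  have hB1 : B 0 = 1 := by
    simp only [hB]; rw [hβ1 0 (mem_closedBall_self (by norm_num))]; simp
  rw [indicator_of_mem (mem_ball_self one_pos), hB1, mul_one] at h4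
  -- Since `F` is holomorphic, `dbar` falls on the bump only, whose `dbar` vanishes for `|u| < 1/2`;
  -- where it does not, the Cauchy kernel at 0 is at most 2.
  have h5 : ∀ u, ‖dbar (P.indicator fun u => F u * B u) u / (0 - u)‖ₑ ≤
      P.indicator (fun u => ennr (M * 2) * ‖F u‖ₑ) u := fun u => by
    by_cases huP : u ∈ P
    · rw [indicator_of_mem huP]
      have h6 : (P.indicator fun u => F u * B u) =ᶠ[𝓝 u] fun u => F u * B u := by
        filter_upwards [hPo.mem_nhds huP] with w hw using indicator_of_mem hw _
      rw [dbar, h6.fderiv_eq, ← dbar, dbar_mul_of_differentiableAt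
        ((hF u huP).differentiableAt (hPo.mem_nhds huP)) (hBc.differentiable one_ne_zero u),
        mul_div_assoc, enorm_mul, mul_comm]
      gcongr; rw [← ofReal_norm]; refine ofReal_le_ofReal ?_; by_cases h7 : u ∈ ball (0:ℂ) (1 / 2)
      · rw [hdB u h7, zero_div, norm_zero]; positivity
      · rw [mem_ball_zero_iff, not_lt] at h7
        rw [norm_div, zero_sub, norm_neg, div_le_iff₀ (by linarith)]
        nlinarith [hM u]
    · rw [dbar_eq_zero_of_notMem_tsupport, zero_div, enorm_zero]
      · exact zero_le
      intro h6; refine huP (hβs (closure_minimal (fun w hw => ?_) (isClosed_tsupport β) h6))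
      by_contra h7
      refine hw ?_; by_cases hwP : w ∈ P
      · rw [indicator_of_mem hwP, hFB0 w hwP h7]
      · exact indicator_of_notMem hwP _
  have h8 : ‖(π : ℂ) * F 0‖ₑ ≤ ennr (M * 2) * ∫⁻ w in P, ‖F w‖ₑ := by
    rw [← h4, ← lintegral_const_mul' _ _ ofReal_ne_top, ← lintegral_indicator hPo.measurableSet]
    exact (enorm_integral_le_lintegral_enorm _).trans (lintegral_mono h5)
  refine le_trans ?_ h8; rw [← ofReal_norm, ← ofReal_norm]; refine ofReal_le_ofReal ?_
  rw [norm_mul, norm_real, norm_of_nonneg pi_pos.le]; nlinarith [norm_nonneg (F 0), pi_gt_three]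

/-- The area mean value inequality. -/
theorem exists_norm_le_lintegral_ball : ∃ C : ℝ, 0 < C ∧ ∀ (F : ℂ → ℂ) (c : ℂ) (s I : ℝ), 0 < s →
    0 ≤ I → DifferentiableOn ℂ F (ball c s) →
    ∫⁻ w in ball c s, ‖F w‖ₑ ≤ ennr I → ‖F c‖ ≤ C * I / s ^ 2 := by
  obtain ⟨C, hC, h⟩ := exists_enorm_zero_le_lintegral
  refine ⟨C.toReal + 1, by positivity, fun F c s I hs hI0 hF hI => ?_⟩
  have hs0 : (s : ℂ) ≠ 0 := by exact_mod_cast hs.ne'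
  set ψ : ℂ → ℂ := fun u => c + s * u with hψ
  have hd : ∀ u, HasDerivAt ψ s u := fun u => by
    exact (((hasDerivAt_id u).const_mul (s:ℂ)).const_add c).congr_deriv (by simp)
  have him : ψ '' ball 0 1 = ball c s := by
    ext z; constructor
    · rintro ⟨u, hu, rfl⟩; rw [mem_ball_zero_iff] at hu; rw [mem_ball_iff_norm]
      simp only [hψ, add_sub_cancel_left, norm_mul, norm_real, norm_of_nonneg hs.le]; nlinarith
    · intro hz; refine ⟨(z - c) / s, ?_, ?_⟩
      · rw [mem_ball_zero_iff, norm_div, norm_real, norm_of_nonneg hs.le, div_lt_one hs]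
        rwa [mem_ball_iff_norm] at hz
      · simp only [hψ]; field_simp; ring
  have h1 : ∫⁻ w in ball c s, ‖F w‖ₑ =
      ennr (s ^ 2) * ∫⁻ u in ball 0 1, ‖F (ψ u)‖ₑ := by
    rw [← him, lintegral_image_eq_lintegral_abs_det_fderiv_mul volume measurableSet_ball
      (fun u _ => ((hd u).hasFDerivAt.restrictScalars ℝ).hasFDerivWithinAt)
      (fun x _ y _ hxy => by simpa [hψ, hs.ne'] using hxy), ← lintegral_const_mul' _ _ ofReal_ne_top]
    simp only [det_restrictScalars_smulRight, norm_real, norm_eq_abs, sq_abs, abs_sq]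
  have h2 := h (fun u => F (ψ u)) (hF.comp (fun u _ => (hd u).differentiableAt.differentiableWithinAt)
    (fun u hu => by rw [← him]; exact mem_image_of_mem _ hu))
  rw [show ψ 0 = c by simp [hψ]] at h2
  have h3 : ∫⁻ u in ball 0 1, ‖F (ψ u)‖ₑ ≤ ennr (I / s ^ 2) := by
    rw [ENNReal.ofReal_div_of_pos (by positivity), ENNReal.le_div_iff_mul_le (by simp [hs.ne']) (by simp),
      mul_comm, ← h1]
    exact hI
  have h4 : ‖F c‖ₑ ≤ ennr (C.toReal * (I / s ^ 2)) := by
    rw [ennr_mul ENNReal.toReal_nonneg, ofReal_toReal hC]; exact h2.trans (by gcongr)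
  rw [← ofReal_norm, ENNReal.ofReal_le_ofReal_iff (by positivity)] at h4
  refine h4.trans ?_; rw [mul_div_assoc]; have : 0 ≤ I / s ^ 2 := by positivity
  nlinarith

/-- A pointwise bound of a holomorphic function by an integral of its square root. -/
theorem exists_norm_le_of_lintegral_sqrt : ∃ C : ℝ, 0 < C ∧ ∀ (F : ℂ → ℂ) (z : ℂ) (d K : ℝ), 0 < d →
    0 ≤ K → DifferentiableOn ℂ F (ball z d) → ContinuousOn F (closedBall z d) →
    ∫⁻ w in ball z d, ennr √‖F w‖ ≤ ennr (K * d) →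
    ‖F z‖ ≤ C * K ^ 2 / d ^ 2 := by
  obtain ⟨C, hC, h⟩ := exists_norm_le_lintegral_ball
  refine ⟨(16 * C) ^ 2, by positivity, fun F z d K hd hK hF hFc hI => ?_⟩
  -- At a maximum point `w₀` of the weighted modulus, with distance `δ` to the boundary and maximum
  -- `M`, one has `√|F| ≤ 4√M/δ²` on the disc of radius `δ/2`. Hence `|F|` is bounded there by this
  -- constant times `√|F|`, and the area mean value inequality yields `M ≤ 16 C K d √M`.
  set φ : ℂ → ℝ := fun w => (d - ‖w - z‖) ^ 4 * ‖F w‖ with hφ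
  have hφc : ContinuousOn φ (closedBall z d) :=
    (Continuous.continuousOn (by fun_prop)).mul hFc.norm
  obtain ⟨w₀, hw₀, hmax⟩ := (isCompact_closedBall z d).exists_isMaxOn
    ⟨z, mem_closedBall_self hd.le⟩ hφc
  set M := φ w₀ with hM
  set δ := d - ‖w₀ - z‖ with hδ
  rw [mem_closedBall_iff_norm] at hw₀; have hzM : d ^ 4 * ‖F z‖ ≤ M := by
    have := hmax (mem_closedBall_self hd.le)
    simpa [hφ] using this
  have hM0 : 0 ≤ M := by positivity
  suffices hMb : M ≤ (16 * C * K * d) ^ 2 by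
    rw [le_div_iff₀ (by positivity)]
    have h1 : d ^ 2 * (‖F z‖ * d ^ 2) ≤ d ^ 2 * ((16 * C) ^ 2 * K ^ 2) := by nlinarith
    exact le_of_mul_le_mul_left h1 (by positivity)
  rcases hM0.eq_or_lt with h0 | hMpos
  · rw [← h0]; positivity
  have hδ0 : 0 < δ := by
    rcases (sub_nonneg.2 hw₀).eq_or_lt with h1 | h1
    · exfalso; refine hMpos.ne' ?_; rw [hM]; simp only [hφ]; rw [← h1]; simp
    · exact h1
  have hball : ∀ w ∈ ball w₀ (δ / 2), w ∈ ball z d ∧ ‖F w‖ ≤ (4 * √M / δ ^ 2) ^ 2 :=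
    fun w hw => by
      rw [mem_ball_iff_norm] at hw; have h1 := norm_sub_le_norm_sub_add_norm_sub w w₀ z
      have h2 : δ / 2 ≤ d - ‖w - z‖ := by rw [hδ] at hw ⊢; linarith
      have h3 : w ∈ ball z d := by rw [mem_ball_iff_norm]; linarith
      refine ⟨h3, ?_⟩; have h4 := hmax (ball_subset_closedBall h3)
      have h5 := le_trans (mul_le_mul_of_nonneg_right (pow_le_pow_left₀ (by positivity) h2 4) (norm_nonneg _)) h4
      rw [div_pow, mul_pow, sq_sqrt hM0, le_div_iff₀ (by positivity)]
      nlinarith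
  have hint : ∫⁻ w in ball w₀ (δ / 2), ‖F w‖ₑ ≤
      ennr (4 * √M / δ ^ 2 * (K * d)) := by
    rw [ennr_mul (by positivity)]
    refine le_trans ?_ (mul_le_mul_right hI _); rw [← lintegral_const_mul' _ _ ofReal_ne_top]
    refine (setLIntegral_mono' measurableSet_ball fun w hw => ?_).trans
      (lintegral_mono_set fun w hw => (hball w hw).1)
    rw [← ennr_mul (by positivity), ← ofReal_norm]
    refine ofReal_le_ofReal ?_; have h1 := sqrt_le_iff.2 ⟨by positivity, (hball w hw).2⟩
    calc ‖F w‖ = √‖F w‖ * √‖F w‖ := (mul_self_sqrt (norm_nonneg _)).symm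
      _ ≤ _ := by gcongr
  have h1 := h F w₀ (δ / 2) _ (by positivity) (by positivity)
    (hF.mono fun w hw => (hball w hw).1) hint
  have h2 : M ≤ 16 * C * K * d * √M := by
    have h3 : M = δ ^ 4 * ‖F w₀‖ := rfl
    calc M = δ ^ 4 * ‖F w₀‖ := h3
      _ ≤ δ ^ 4 * (C * (4 * √M / δ ^ 2 * (K * d)) / (δ / 2) ^ 2) := by gcongr
      _ = _ := by field_simp; ring
  have h3 : √M ≤ 16 * C * K * d := by
    have h4 : √M * √M ≤ 16 * C * K * d * √M := by rwa [mul_self_sqrt hM0]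
    exact le_of_mul_le_mul_right h4 (sqrt_pos.2 hMpos)
  calc M = √M ^ 2 := (sq_sqrt hM0).symm
    _ ≤ _ := by gcongr

/-- `f` coincides outside of `S` with a function that is analytic at `z`. -/
def HasExtension (S : Set ℂ) (f : ℂ → ℂ) (z : ℂ) : Prop :=
  ∃ Q : ℂ → ℂ, AnalyticAt ℂ Q z ∧ ∀ᶠ w in 𝓝 z, w ∉ S → f w = Q w

/-- Local extensions across a closed set without interior points glue together. -/
theorem exists_glued_extension {S U : Set ℂ} (hS : Dense Sᶜ) {f : ℂ → ℂ}
    (h : ∀ z ∈ U, HasExtension S f z) :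
    ∃ F : ℂ → ℂ, DifferentiableOn ℂ F U ∧ ∀ z ∈ U, z ∉ S → F z = f z := by
  have hne : ∀ z, (𝓝[Sᶜ] z).NeBot := fun z => mem_closure_iff_nhdsWithin_neBot.1 (hS z)
  have hlim : ∀ {z : ℂ} {Q : ℂ → ℂ}, AnalyticAt ℂ Q z → (∀ᶠ w in 𝓝 z, w ∉ S → f w = Q w) →
      limUnder (𝓝[Sᶜ] z) f = Q z := fun {z Q} hQ hf => by
    have := hne z
    refine Tendsto.limUnder_eq ((hQ.continuousAt.tendsto.mono_left nhdsWithin_le_nhds).congr' ?_)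
    exact (eventually_nhdsWithin_iff.2 hf).mono fun w hw => hw.symm
  -- The limit along the dense complement of `S` does not depend on the chosen local extension, so
  -- no compatibility has to be checked.
  refine ⟨fun z => limUnder (𝓝[Sᶜ] z) f, fun z hz => ?_, fun z hz hzS => ?_⟩
  · obtain ⟨Q, hQ, hf⟩ := h z hz
    refine (hQ.differentiableAt.congr_of_eventuallyEq ?_).differentiableWithinAt
    filter_upwards [hQ.eventually_analyticAt, hf.eventually_nhds] with w h1 h2 using hlim h1 h2
  · obtain ⟨Q, hQ, hf⟩ := h z hz; simp only; rw [hlim hQ hf, hf.self_of_nhds hzS]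

/-- A square extends over an isolated point up to a double pole if the function itself has a small
integral. -/
theorem hasExtension_of_lintegral_le {S : Set ℂ} (hS : Dense Sᶜ) (hS0 : volume S = 0) {g : ℂ → ℂ}
    {z₀ : ℂ} (h : ∀ᶠ z in 𝓝[≠] z₀, HasExtension S (fun w => g w ^ 2) z) {K : ℝ}
    (hK : ∀ᶠ r : ℝ in 𝓝[>] 0, ∫⁻ w in ball z₀ r, ‖g w‖ₑ ≤ ennr (K * r)) :
    ∃ P : ℂ → ℂ, AnalyticAt ℂ P z₀ ∧
      ∀ᶠ z in 𝓝[≠] z₀, z ∉ S → (z - z₀) ^ 2 * g z ^ 2 = P z := by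
  obtain ⟨C, hC, hCF⟩ := exists_norm_le_of_lintegral_sqrt; rw [eventually_nhdsWithin_iff] at h
  obtain ⟨r₀, hr₀, hr₀s⟩ := eventually_nhds_iff_ball.1 h
  obtain ⟨r₁, hr₁, hr₁s⟩ := mem_nhdsGT_iff_exists_Ioo_subset.1 hK
  obtain ⟨F, hF, hFg⟩ := exists_glued_extension (U := ball z₀ r₀ \ {z₀}) hS fun z hz =>
    hr₀s z hz.1 hz.2
  set p : ℂ → ℂ := fun z => (z - z₀) ^ 2 * F z with hp
  set r := min r₀ r₁ / 3 with hr
  have hr₁' := hr₁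
  have hm0 := lt_min hr₀ hr₁'
  have hr0 : 0 < r := by positivity
  -- On the disc about `z` of radius `d = |z - z₀|/2` one has `√|F| = |g|` almost everywhere, and
  -- this disc lies in the disc of radius `3d` about `z₀`. The integral bound then gives `|F z| ≤ C
  -- (3|K|)²/d²`, so `(z - z₀)² F` is bounded and its singularity removable.
  have hbound : ∀ z ∈ ball z₀ r \ {z₀}, ‖p z‖ ≤ 4 * (C * (3 * |K|) ^ 2) := by
    rintro z ⟨hz, hz0⟩; rw [mem_ball_iff_norm] at hz
    have hzpos := norm_pos_iff.2 (sub_ne_zero.2 hz0)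
    set d := ‖z - z₀‖ / 2 with hd
    have hdpos : 0 < d := by positivity
    have hsub : ∀ w ∈ closedBall z d, w ∈ ball z₀ r₀ \ {z₀} := fun w hw => by
      rw [mem_closedBall_iff_norm] at hw; have h1 := norm_sub_le_norm_sub_add_norm_sub w z z₀
      have h2 : min r₀ r₁ ≤ r₀ := min_le_left _ _
      refine ⟨by rw [mem_ball_iff_norm]; linarith, fun h3 => ?_⟩
      rw [mem_singleton_iff.1 h3, norm_sub_rev] at hw; linarith
    have hFd := hF.mono hsub
    have h1 := hCF F z d (3 * |K|) hdpos (by positivity) (hFd.mono ball_subset_closedBall)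
      hFd.continuousOn ?_
    · simp only [hp]; rw [norm_mul, norm_pow]
      calc ‖z - z₀‖ ^ 2 * ‖F z‖ ≤ ‖z - z₀‖ ^ 2 * (C * (3 * |K|) ^ 2 / d ^ 2) := by gcongr
        _ = _ := by rw [hd]; field_simp; ring
    · have h2 : ∫⁻ w in ball z d, ennr √‖F w‖ = ∫⁻ w in ball z d, ‖g w‖ₑ := by
        refine lintegral_congr_ae ((ae_restrict_iff' measurableSet_ball).2 ?_)
        filter_upwards [compl_mem_ae_iff.2 hS0] with w hwS hw
        rw [hFg w (hsub w (ball_subset_closedBall hw)) hwS, norm_pow, sqrt_sq (norm_nonneg _),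
          ofReal_norm]
      have h3 : ball z d ⊆ ball z₀ (3 * d) := ball_subset_ball' (by
        rw [dist_eq_norm]; linarith)
      have h4 : min r₀ r₁ ≤ r₁ := min_le_right _ _
      rw [h2]; refine (lintegral_mono_set h3).trans ((hr₁s ⟨by positivity, by linarith⟩).trans
        (ofReal_le_ofReal ?_))
      nlinarith [le_abs_self K]
  have hsub : ball z₀ r ⊆ ball z₀ r₀ :=
    ball_subset_ball (by have : min r₀ r₁ ≤ r₀ := min_le_left _ _; linarith)
  have hpd : DifferentiableOn ℂ p (ball z₀ r \ {z₀}) := fun z hz =>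
    ((Differentiable.differentiableAt (by fun_prop)).differentiableWithinAt).mul
      ((hF z ⟨hsub hz.1, hz.2⟩).mono (sdiff_subset_sdiff_left hsub))
  have hrem := differentiableOn_update_limUnder_of_bddAbove (ball_mem_nhds z₀ hr0) hpd
    ⟨_, by rintro _ ⟨z, hz, rfl⟩; exact hbound z hz⟩
  refine ⟨_, hrem.analyticAt (ball_mem_nhds z₀ hr0), ?_⟩; rw [eventually_nhdsWithin_iff]
  filter_upwards [ball_mem_nhds z₀ hr0] with z hz hz0 hzS
  rw [Function.update_of_ne hz0, hp]; simp only; rw [hFg z ⟨hsub hz, hz0⟩ hzS]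

/-- Near `z₀` the set `S` stays outside of a double cone around the line of direction `e`. -/
def IsFreeDirection (S : Set ℂ) (z₀ e : ℂ) : Prop :=
  ∃ c > 0, ∀ᶠ x in 𝓝 z₀, x ∈ S → c * ‖x - z₀‖ ≤ |(conj e * (x - z₀)).im|

theorem IsFreeDirection.neg {S : Set ℂ} {z₀ e : ℂ} (h : IsFreeDirection S z₀ e) :
    IsFreeDirection S z₀ (-e) := by
  obtain ⟨c, hc, hx⟩ := h; refine ⟨c, hc, hx.mono fun x h1 h2 => ?_⟩
  rw [map_neg, neg_mul, neg_im, abs_neg]; exact h1 h2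

/-- A point of `S` much closer to `z₀` than `s|e|` is far from `z₀ + s e` by the triangle
inequality. For the others near `z₀` the cone condition applies: passing from `x - z₀` to `x - z₀ -
s e` changes `conj e (x - z₀)` by a real number only, so its imaginary part is kept. -/
theorem IsFreeDirection.exists_le_norm_sub {S : Set ℂ} {z₀ e : ℂ} (h : IsFreeDirection S z₀ e)
    (he : e ≠ 0) : ∃ c > 0, ∀ᶠ s : ℝ in 𝓝[>] 0, ∀ x ∈ S, c * s ≤ ‖x - (z₀ + s * e)‖ := by
  obtain ⟨c, hc, hx⟩ := h; obtain ⟨r, hr, hrs⟩ := eventually_nhds_iff_ball.1 hx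
  have he' := norm_pos_iff.2 he
  refine ⟨min (c / 2) (min (‖e‖ / 2) 1), by positivity, ?_⟩
  filter_upwards [Ioo_mem_nhdsGT (show 0 < r / (1 + ‖e‖) by positivity)] with s hs x hxS
  have hs0 := hs.1
  have hsr := (lt_div_iff₀ (by positivity)).1 hs.2
  have hne : ‖(s:ℂ) * e‖ = s * ‖e‖ := by rw [norm_mul, norm_real, norm_of_nonneg hs0.le]
  have h1 : ‖x - z₀‖ - s * ‖e‖ ≤ ‖x - (z₀ + s * e)‖ := by
    rw [← hne, ← sub_sub]; exact norm_sub_norm_le _ _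
  have h2 : s * ‖e‖ - ‖x - z₀‖ ≤ ‖x - (z₀ + s * e)‖ := by
    rw [← hne, ← sub_sub, norm_sub_rev (x - z₀)]; exact norm_sub_norm_le _ _
  have m1 : min (c / 2) (min (‖e‖ / 2) 1) ≤ c / 2 := min_le_left _ _
  have m2 : min (c / 2) (min (‖e‖ / 2) 1) ≤ ‖e‖ / 2 := (min_le_right _ _).trans (min_le_left _ _)
  have m3 : min (c / 2) (min (‖e‖ / 2) 1) ≤ 1 := (min_le_right _ _).trans (min_le_right _ _)
  by_cases hxr : x ∈ ball z₀ r
  · rcases le_total (s * ‖e‖ / 2) ‖x - z₀‖ with h3 | h3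
    · have h4 := hrs x hxr hxS
      have h5 : (conj e * (x - z₀)).im = (conj e * (x - (z₀ + s * e))).im := by
        have h6 : conj e * (x - (z₀ + s * e)) =
            conj e * (x - z₀) - ((s * ‖e‖ ^ 2 : ℝ) : ℂ) := by
          push_cast; rw [← conj_mul']; ring
        rw [h6, sub_im, ofReal_im, sub_zero]
      have h6 : |(conj e * (x - z₀)).im| ≤ ‖e‖ * ‖x - (z₀ + s * e)‖ := by
        rw [h5]; refine (abs_im_le_norm _).trans (le_of_eq ?_); rw [norm_mul, RCLike.norm_conj]
      have h7 : ‖e‖ * (c / 2 * s) ≤ ‖e‖ * ‖x - (z₀ + s * e)‖ := by nlinarith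
      have h8 := le_of_mul_le_mul_left h7 he'
      nlinarith
    · nlinarith
  · rw [mem_ball_iff_norm, not_lt] at hxr; nlinarith

/-- The hypothesis says that `S` is tangent at `z₀` to the line `Re (b y) = 0`; any direction
transverse to this line is free. -/
theorem isFreeDirection_of_isLittleO {S : Set ℂ} {z₀ b e : ℂ}
    (h : (fun x => (b * (x - z₀)).re) =o[𝓝[S] z₀] fun x => x - z₀) (hbe : (b * e).re ≠ 0) :
    IsFreeDirection S z₀ e := by
  have he : 0 < ‖e‖ := norm_pos_iff.2 fun h0 => hbe (by simp [h0])
  have hB : 0 < |(b * e).re| := abs_pos.2 hbe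
  have hBn := abs_re_le_norm (b * e)
  have hBi := abs_im_le_norm (b * e)
  have hbe0 : 0 < ‖b * e‖ := hB.trans_le hBn
  refine ⟨|(b * e).re| * ‖e‖ / (4 * ‖b * e‖), by positivity, ?_⟩
  have h1 := h.def (show 0 < |(b * e).re| / (2 * ‖e‖) by positivity)
  rw [eventually_nhdsWithin_iff] at h1; filter_upwards [h1] with x hx hxS
  have h2 := hx hxS
  set y := conj e * (x - z₀) with hy
  have hyn : ‖y‖ = ‖e‖ * ‖x - z₀‖ := by rw [hy, norm_mul, RCLike.norm_conj]
  have h3 : (b * e * y).re = ‖e‖ ^ 2 * (b * (x - z₀)).re := by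
    have h4 : b * e * y = ((‖e‖ ^ 2 : ℝ) : ℂ) * (b * (x - z₀)) := by
      push_cast; rw [← conj_mul', hy]; ring
    rw [h4, re_ofReal_mul]
  rw [mul_re] at h3; rw [norm_eq_abs] at h2
  have h5 : |(b * e).re| * |y.re| ≤ ‖e‖ ^ 2 * |(b * (x - z₀)).re| + ‖b * e‖ * |y.im| := by
    rw [← abs_mul, show (b * e).re * y.re = ‖e‖ ^ 2 * (b * (x - z₀)).re + (b * e).im * y.im by linarith]
    refine (abs_add_le _ _).trans ?_; rw [abs_mul, abs_mul, abs_of_nonneg (sq_nonneg ‖e‖)]; gcongr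
  have h6 := norm_le_abs_re_add_abs_im y
  have h7 : ‖e‖ ^ 2 * |(b * (x - z₀)).re| ≤ |(b * e).re| / 2 * ‖y‖ := by
    calc ‖e‖ ^ 2 * |(b * (x - z₀)).re| ≤ ‖e‖ ^ 2 * (|(b * e).re| / (2 * ‖e‖) * ‖x - z₀‖) := by gcongr
      _ = _ := by rw [hyn]; field_simp
  have h8 : |(b * e).re| * ‖y‖ ≤ 4 * ‖b * e‖ * |y.im| := by
    nlinarith [mul_le_mul_of_nonneg_left h6 hB.le, mul_le_mul_of_nonneg_right hBn (abs_nonneg y.im)]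
  rw [div_mul_eq_mul_div, div_le_iff₀ (by positivity)]
  rw [hyn] at h8; linarith

/-- The unit normals to an arc are free directions. -/
theorem IsUnitNormal.isFreeDirection {S : Set ℂ} {z m : ℂ} (h : IsUnitNormal S z m) :
    IsFreeDirection S z m := by
  obtain ⟨hm, γ, hγ, hin⟩ := h; obtain ⟨-, hd, hne⟩ := hγ.eventually_mem
  obtain ⟨hγ0, -, -, hemb, B, hB, -, hzB, hBS⟩ := hγ
  refine isFreeDirection_of_isLittleO (b := conj m) ?_ ?_
  · have h1 : HasDerivAt (fun t => (conj m * (γ t - z)).re) 0 0 := by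
      refine (reCLM.hasFDerivAt.comp_hasDerivAt (0:ℝ)
        ((hd.sub_const z).const_mul (conj m))).congr_deriv ?_
      rw [Complex.inner] at hin; rw [reCLM_apply, mul_comm]; exact hin
    have h2 : (fun t => (conj m * (γ t - z)).re) =o[𝓝 0] fun t => γ t - z := by
      have h3 := h1.isLittleO
      simp only [hγ0, sub_self, mul_zero, zero_re, sub_zero, smul_zero] at h3
      have hp : Tendsto (fun t : ℝ => (t, (0:ℝ))) (𝓝 0) (𝓝 0 ×ˢ pure 0) :=
        tendsto_id.prodMk tendsto_const_pure
      have h4 := (hd.isTheta_sub hne).isBigO_symm.comp_tendsto hp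
      simp only [Function.comp_def, hγ0, sub_zero] at h4; exact h3.trans_isBigO h4
    rw [Asymptotics.isLittleO_iff] at h2 ⊢; intro ε hε
    have h3 := (continuous_subtype_val.tendsto' (⟨0, by norm_num⟩ : Ioo (-1:ℝ) 1) 0 rfl).eventually (h2 hε)
    rw [hemb.nhds_eq_comap, eventually_comap] at h3; simp only [hγ0] at h3
    rw [eventually_nhdsWithin_iff]; filter_upwards [h3, hB.mem_nhds hzB] with x hx hxB hxS
    obtain ⟨t, ht, htx⟩ := hBS.subset ⟨hxB, hxS⟩; have h4 := hx ⟨t, ht⟩ htx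
    simp only at h4; rwa [htx] at h4
  · rw [conj_mul', hm]; simp

/-- A finite union of analytic arcs has a free direction at each point. -/
theorem exists_isFreeDirection {k : ℕ} {Γ : Fin k → Set ℂ} (hΓ : ∀ j, IsAnalyticArc (Γ j)) (z₀ : ℂ) :
    ∃ e : ℂ, e ≠ 0 ∧ IsFreeDirection (⋃ j, Γ j) z₀ e := by
  have h1 : ∀ j, ∃ b : ℂ, b ≠ 0 ∧ ((fun x => (b * (x - z₀)).re) =o[𝓝[Γ j] z₀] fun x => x - z₀) := by
    intro j; by_cases hj : z₀ ∈ Γ j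
    · obtain ⟨e, t₀, -, he, he0, hiff⟩ := (hΓ j).exists_chart hj; have hd := he.hasDerivAt z₀ he.mem
      refine ⟨deriv e z₀, hd.2, ?_⟩
      have h2 := (hd.1.isLittleO).mono (nhdsWithin_le_nhds (s := Γ j))
      refine (Asymptotics.IsBigO.of_bound 1 ?_).trans_isLittleO h2
      filter_upwards [eventually_nhdsWithin_of_eventually_nhds hiff, self_mem_nhdsWithin] with x hx hxΓ
      rw [he0, sub_zero, one_mul, smul_eq_mul, mul_comm, norm_eq_abs]; have h3 := (hx.1 hxΓ).1
      have h4 := abs_re_le_norm (e x - (x - z₀) * deriv e z₀)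
      rwa [sub_re, h3, zero_sub, abs_neg] at h4
    · refine ⟨1, one_ne_zero, ?_⟩; have hcl : IsClosed (Γ j) := by
        obtain ⟨γ, hγ, -, -, h⟩ := hΓ j; rw [h]
        exact (isCompact_Icc.image_of_continuousOn fun t ht =>
          (hγ t ht).continuousAt.continuousWithinAt).isClosed
      have h2 : 𝓝[Γ j] z₀ = ⊥ := by
        rw [← notMem_closure_iff_nhdsWithin_eq_bot, hcl.closure_eq]; exact hj
      rw [h2]; exact Asymptotics.isLittleO_bot _ _
  choose b hb hbo using h1
  -- Among the directions `1 + t I` each arc excludes at most one, its tangent, so some direction is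
  -- transverse to all of them.
  have h2 : (⋃ j, {t : ℝ | (b j * (1 + t * I)).re = 0}).Finite := by
    refine finite_iUnion fun j => Subsingleton.finite fun s hs t ht => ?_
    simp at hs ht; by_contra hst
    have h3 : (b j).im * (s - t) = 0 := by linarith
    have h4 := (mul_eq_zero.1 h3).resolve_right (sub_ne_zero.2 hst)
    refine hb j (Complex.ext ?_ h4); rw [h4] at hs; simpa using hs
  obtain ⟨t, ht⟩ := h2.infinite_compl.nonempty; rw [mem_compl_iff, mem_iUnion, not_exists] at ht
  refine ⟨1 + t * I, fun h => by simpa using congrArg re h, ?_⟩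
  have h3 : ∀ j, IsFreeDirection (Γ j) z₀ (1 + t * I) := fun j =>
    isFreeDirection_of_isLittleO (hbo j) (ht j)
  choose c hc hcx using h3
  obtain ⟨c₀, hc₀, hc₀j⟩ : ∃ c₀ > 0, ∀ j, c₀ ≤ c j := by
    rcases isEmpty_or_nonempty (Fin k) with hk | hk
    · exact ⟨1, one_pos, fun j => isEmptyElim j⟩
    · obtain ⟨j₀, hj₀⟩ := Finite.exists_min c; exact ⟨c j₀, hc j₀, hj₀⟩
  refine ⟨c₀, hc₀, ?_⟩; filter_upwards [eventually_all.2 hcx] with x hx hxS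
  obtain ⟨j, hj⟩ := mem_iUnion.1 hxS
  exact (mul_le_mul_of_nonneg_right (hc₀j j) (norm_nonneg _)).trans (hx j hj)

/-- The kernel `s/(x - z₀ - s e)` is bounded by `1/c` on the support and tends to 0 except at `x =
z₀`, which has no mass. This rules out a double pole of the squared field. -/
theorem tendsto_mul_cauchyTransform {ν : Measure ℂ} [IsFiniteMeasure ν] {σ : ℂ → ℝ}
    (hσ : Measurable σ) (hσ1 : ∀ x, |σ x| = 1) {z₀ e : ℂ} (hpt : ν {z₀} = 0) {c : ℝ} (hc : 0 < c)
    (h : ∀ᶠ s : ℝ in 𝓝[>] 0, ∀ x ∈ ν.support, c * s ≤ ‖x - (z₀ + s * e)‖) :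
    Tendsto (fun s : ℝ => (s:ℂ) * cauchyTransform ν σ (z₀ + s * e)) (𝓝[>] 0) (𝓝 0) := by
  have h1 : ∀ s : ℝ, (s:ℂ) * cauchyTransform ν σ (z₀ + s * e) =
      ∫ x, (s:ℂ) * ((σ x : ℂ) / (x - (z₀ + s * e))) ∂ν := fun s => (integral_const_mul _ _).symm
  simp only [h1]
  have h2 := tendsto_integral_filter_of_dominated_convergence (μ := ν) (l := 𝓝[>] (0:ℝ))
    (F := fun (s : ℝ) x => (s:ℂ) * ((σ x : ℂ) / (x - (z₀ + s * e)))) (f := fun _ => (0:ℂ))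
    (fun _ => 1 / c) ?_ ?_ (integrable_const _) ?_
  · simpa using h2
  · exact Eventually.of_forall fun s => (measurable_const.mul ((measurable_ofReal.comp hσ).div
      (measurable_id.sub_const _))).aestronglyMeasurable
  · filter_upwards [h, self_mem_nhdsWithin] with s hs hs0
    have hs0' : 0 < s := hs0
    filter_upwards [ν.support_mem_ae] with x hx
    have h3 := hs x hx
    rw [norm_mul, norm_div, norm_real, norm_real, norm_eq_abs (σ x), hσ1,
      norm_of_nonneg hs0'.le, mul_one_div, div_le_div_iff₀ (lt_of_lt_of_le (by positivity) h3) hc]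
    linarith
  · have h3 : ∀ᵐ x ∂ν, x ≠ z₀ := by rwa [ae_iff, show {x | ¬x ≠ z₀} = {z₀} by ext; simp]
    filter_upwards [h3] with x hx
    have h4 : x - (z₀ + ((0:ℝ):ℂ) * e) ≠ 0 := by simpa [sub_eq_zero] using hx
    have h5 : ContinuousAt (fun s : ℝ => (s:ℂ) * ((σ x : ℂ) / (x - (z₀ + s * e)))) 0 :=
      continuous_ofReal.continuousAt.mul (continuousAt_const.div (by fun_prop) h4)
    have h6 := h5.tendsto
    simp only [ofReal_zero, zero_mul] at h6; exact h6.mono_left nhdsWithin_le_nhds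

/-- If `q > 0`, the mean value theorem gives `s (slope)² = s f'(ξ)² ≥ ξ f'(ξ)² > q/2` with `ξ < s`,
although the slope converges and so `s (slope)²` tends to 0. In other words, growth like `s^(-1/2)`
of the derivative contradicts one-sided differentiability. -/
theorem eq_zero_of_tendsto_mul_deriv_sq {f f' : ℝ → ℝ} {d q : ℝ}
    (hd : HasDerivWithinAt f d (Ici 0) 0) (hf : ∀ᶠ s in 𝓝[>] 0, HasDerivAt f (f' s) s)
    (hq : Tendsto (fun s => s * f' s ^ 2) (𝓝[>] 0) (𝓝 q)) : q = 0 := by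
  have hq0 := ge_of_tendsto hq (by
    filter_upwards [self_mem_nhdsWithin] with s hs
    have : (0:ℝ) < s := hs
    positivity)
  by_contra hne
  have hqpos := lt_of_le_of_ne hq0 (Ne.symm hne)
  obtain ⟨r, hr, hrs⟩ := mem_nhdsGT_iff_exists_Ioo_subset.1
    (hf.and (hq.eventually (lt_mem_nhds (half_lt_self hqpos))))
  have hslope : Tendsto (fun s => s⁻¹ * (f s - f 0)) (𝓝[>] 0) (𝓝 d) := by
    have h1 := (hasDerivWithinAt_iff_tendsto_slope' self_notMem_Ioi).1
      (hd.mono Ioi_subset_Ici_self)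
    refine h1.congr' (Eventually.of_forall fun s => ?_)
    simp [slope_def_field, div_eq_inv_mul]
  have hz := (tendsto_id.mono_left nhdsWithin_le_nhds).mul (hslope.pow 2)
  rw [zero_mul] at hz; have h2 : ∀ᶠ s in 𝓝[>] 0, q / 2 ≤ s * (s⁻¹ * (f s - f 0)) ^ 2 := by
    filter_upwards [Ioo_mem_nhdsGT hr] with s hs
    have hs0 := hs.1
    obtain ⟨ξ, hξ, hfξ⟩ := exists_hasDerivAt_eq_slope f f' hs0 (fun t ht => by
      rcases ht.1.eq_or_lt with h | h
      · rw [← h]; exact hd.continuousWithinAt.mono Icc_subset_Ici_self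
      · exact (hrs ⟨h, ht.2.trans_lt hs.2⟩).1.continuousAt.continuousWithinAt)
      fun t ht => (hrs ⟨ht.1, ht.2.trans hs.2⟩).1
    have h3 := (hrs ⟨hξ.1, hξ.2.trans hs.2⟩).2
    rw [sub_zero] at hfξ; rw [← div_eq_inv_mul, ← hfξ]
    have h4 : ξ * f' ξ ^ 2 ≤ s * f' ξ ^ 2 := mul_le_mul_of_nonneg_right hξ.2.le (sq_nonneg _)
    exact h3.le.trans h4
  have := ge_of_tendsto hz h2
  linarith

/-- One-sided differentiability of the potential in a free direction and its opposite excludes poles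
of the square of its gradient. -/
theorem hasExtension_of_isFreeDirection {S : Set ℂ} {z₀ : ℂ} (hz₀ : z₀ ∈ S) {g P : ℂ → ℂ}
    (hP : AnalyticAt ℂ P z₀) (hgP : ∀ᶠ z in 𝓝[≠] z₀, z ∉ S → (z - z₀) ^ 2 * g z ^ 2 = P z)
    {T : ℂ → ℝ} (hT : ∀ᶠ z in 𝓝 z₀, z ∉ S → HasFDerivAt T (reMul (g z)) z) {e : ℂ} (he : e ≠ 0)
    (hS : ∀ᶠ s : ℝ in 𝓝[>] 0, z₀ + s * e ∉ S) (hS' : ∀ᶠ s : ℝ in 𝓝[>] 0, z₀ + s * (-e) ∉ S)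
    (hg : Tendsto (fun s : ℝ => (s:ℂ) * g (z₀ + s * e)) (𝓝[>] 0) (𝓝 0)) {d d' : ℝ}
    (hd : HasDerivWithinAt (fun s : ℝ => T (z₀ + s * e)) d (Ici 0) 0)
    (hd' : HasDerivWithinAt (fun s : ℝ => T (z₀ + s * (-e))) d' (Ici 0) 0) :
    HasExtension S (fun z => g z ^ 2) z₀ := by
  have hline : ∀ v : ℂ, ∀ s : ℝ, HasDerivAt (fun s : ℝ => z₀ + s * v) v s := fun v s => by
    simpa using ((ofRealCLM.hasDerivAt (x := s)).mul_const v).const_add z₀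
  have hlt : ∀ v : ℂ, Tendsto (fun s : ℝ => z₀ + s * v) (𝓝[>] 0) (𝓝 z₀) := fun v => by
    have := (hline v 0).continuousAt.tendsto
    simp only [ofReal_zero, zero_mul, add_zero] at this; exact this.mono_left nhdsWithin_le_nhds
  have hlt' : ∀ v : ℂ, v ≠ 0 → Tendsto (fun s : ℝ => z₀ + s * v) (𝓝[>] 0) (𝓝[≠] z₀) := fun v hv => by
    refine tendsto_nhdsWithin_iff.2 ⟨hlt v, ?_⟩; filter_upwards [self_mem_nhdsWithin] with s hs
    have : s ≠ 0 := (show (0:ℝ) < s from hs).ne'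
    simp [this, hv]
  -- The coefficient of the double pole vanishes because `s g → 0` along the free direction.
  have hP0 : P z₀ = 0 := by
    have h1 : Tendsto (fun s : ℝ => P (z₀ + s * e)) (𝓝[>] 0) (𝓝 (P z₀)) :=
      hP.continuousAt.tendsto.comp (hlt e)
    have h2 : Tendsto (fun s : ℝ => e ^ 2 * ((s:ℂ) * g (z₀ + s * e)) ^ 2) (𝓝[>] 0) (𝓝 (e ^ 2 * 0 ^ 2)) :=
      (hg.pow 2).const_mul _
    rw [zero_pow two_ne_zero, mul_zero] at h2; refine tendsto_nhds_unique h1 (h2.congr' ?_)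
    filter_upwards [(hlt' e he).eventually hgP, hS] with s h3 h4
    rw [← h3 h4]; ring
  set P₁ := dslope P z₀ with hP₁
  have hP₁a : AnalyticAt ℂ P₁ z₀ := by
    obtain ⟨p, hp⟩ := hP; exact ⟨_, hp.has_fpower_series_dslope_fslope⟩
  have hPP₁ : ∀ z, P z = (z - z₀) * P₁ z := fun z => by
    have := sub_smul_dslope P z₀ z
    rw [hP0, sub_zero, smul_eq_mul] at this; exact this.symm
  -- With `ω = v g` and `v P₁ = s ω²`, the identity `(Re ω)² = (|ω|² + Re ω²)/2` shows that `s (Re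
  -- ω)²`, the quantity `s f'²` for the potential along `v`, tends to `(|v P₁| + Re (v P₁))/2`. Its
  -- vanishing for both `v = e` and `v = -e` leaves only `P₁ z₀ = 0`.
  have hdir : ∀ v : ℂ, v ≠ 0 → (∀ᶠ s : ℝ in 𝓝[>] 0, z₀ + s * v ∉ S) → ∀ d : ℝ,
      HasDerivWithinAt (fun s : ℝ => T (z₀ + s * v)) d (Ici 0) 0 →
      ‖v * P₁ z₀‖ + (v * P₁ z₀).re = 0 := fun v hv hvS d hvd => by
    have h1 : Tendsto (fun s : ℝ => (‖v * P₁ (z₀ + s * v)‖ + (v * P₁ (z₀ + s * v)).re) / 2) (𝓝[>] 0)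
        (𝓝 ((‖v * P₁ z₀‖ + (v * P₁ z₀).re) / 2)) := by
      have h2 := (hP₁a.continuousAt.tendsto.comp (hlt v)).const_mul v
      exact (h2.norm.add ((continuous_re.tendsto _).comp h2)).div_const 2
    have h3 : (‖v * P₁ z₀‖ + (v * P₁ z₀).re) / 2 = 0 := by
      refine eq_zero_of_tendsto_mul_deriv_sq (f' := fun s : ℝ => (v * g (z₀ + s * v)).re) hvd ?_
        (h1.congr' ?_)
      · filter_upwards [hvS, (hlt v).eventually hT] with s e2 e3
        exact (e3 e2).comp_hasDerivAt s (hline v s)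
      · filter_upwards [hvS, (hlt' v hv).eventually hgP, self_mem_nhdsWithin] with s e2 e3 e4
        have hs := e4
        have hs' : (s:ℂ) ≠ 0 := by exact_mod_cast hs.ne'
        have e5 : v * P₁ (z₀ + s * v) = s * (v * g (z₀ + s * v)) ^ 2 := by
          have e6 := e3 e2
          rw [hPP₁, add_sub_cancel_left] at e6; refine mul_left_cancel₀ hs' ?_
          rw [← mul_assoc, ← e6]; ring
        rw [e5, norm_mul, norm_pow, norm_real, norm_of_nonneg hs.le,
          re_ofReal_mul, ← normSq_eq_norm_sq, normSq_apply, pow_two,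
          mul_re (v * _) (v * _)]
        ring
    linarith
  have hc : P₁ z₀ = 0 := by
    have h1 := hdir e he hS d hd
    have h2 := hdir (-e) (neg_ne_zero.2 he) hS' d' hd'
    rw [neg_mul, norm_neg, neg_re] at h2; have h3 : ‖e * P₁ z₀‖ = 0 := by linarith
    exact (mul_eq_zero.1 (norm_eq_zero.1 h3)).resolve_left he
  refine ⟨dslope P₁ z₀, ?_, ?_⟩
  · obtain ⟨p, hp⟩ := hP₁a; exact ⟨_, hp.has_fpower_series_dslope_fslope⟩
  · rw [eventually_nhdsWithin_iff] at hgP; filter_upwards [hgP] with z h1 h2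
    have hz : z ≠ z₀ := fun h => h2 (h ▸ hz₀)
    have h3 := h1 hz h2
    have h4 := sub_smul_dslope P₁ z₀ z
    rw [hc, sub_zero, smul_eq_mul] at h4; rw [hPP₁, ← h4, ← mul_assoc, ← pow_two] at h3
    exact mul_left_cancel₀ (pow_ne_zero 2 (sub_ne_zero.2 hz)) h3

/-! ### Growth at infinity and the rational function -/

section

/-- Liouville's theorem for entire functions of polynomial growth. -/
theorem exists_polynomial_of_norm_le (N : ℕ) : ∀ {F : ℂ → ℂ}, Differentiable ℂ F → ∀ {K : ℝ},
    (∀ z, ‖F z‖ ≤ K * (1 + ‖z‖) ^ N) → ∃ p : Polynomial ℂ, ∀ z, F z = p.eval z := by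
  induction N with
  | zero =>
    intro F hF K hK; refine ⟨Polynomial.C (F 0), fun z => ?_⟩
    rw [Polynomial.eval_C]; refine hF.apply_eq_apply_of_bounded ?_ z 0
    refine (isBounded_closedBall (x := (0:ℂ)) (r := K)).subset ?_; rintro _ ⟨w, rfl⟩
    simpa using hK w
  | succ N ih =>
    -- The difference quotient at 0 is entire and grows one power more slowly, so the induction
    -- applies to it.
    intro F hF K hK; have hd : Differentiable ℂ (dslope F 0) := by
      rw [← differentiableOn_univ] at hF ⊢; exact (differentiableOn_dslope univ_mem).2 hF
    obtain ⟨M, hM⟩ := (isCompact_closedBall (0:ℂ) 1).exists_bound_of_continuousOn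
      hd.continuous.continuousOn
    have hK0 : 0 ≤ K := by simpa using (norm_nonneg _).trans (hK 0)
    have hb : ∀ z, ‖dslope F 0 z‖ ≤ (|M| + (2 * K + ‖F 0‖)) * (1 + ‖z‖) ^ N := fun z => by
      have h1 : 1 ≤ (1 + ‖z‖) ^ N := one_le_pow₀ (by linarith [norm_nonneg z])
      have hn := norm_nonneg (F 0)
      rcases le_total ‖z‖ 1 with hz | hz
      · have h2 := hM z (by rwa [mem_closedBall_zero_iff])
        have h3 := le_abs_self M
        nlinarith [abs_nonneg M]
      · have h2 := sub_smul_dslope F 0 z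
        rw [sub_zero, smul_eq_mul] at h2
        have h3 : ‖z‖ * ‖dslope F 0 z‖ ≤ K * (1 + ‖z‖) ^ (N + 1) + ‖F 0‖ := by
          rw [← norm_mul, h2]; exact (norm_sub_le _ _).trans (add_le_add_left (hK z) _)
        have h4 : ‖z‖ * ‖dslope F 0 z‖ ≤ ‖z‖ * ((2 * K + ‖F 0‖) * (1 + ‖z‖) ^ N) := by
          refine h3.trans ?_; rw [pow_succ]
          have h5 : K * (1 + ‖z‖) ^ N * (1 + ‖z‖) ≤ K * (1 + ‖z‖) ^ N * (2 * ‖z‖) := by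
            gcongr; linarith
          have h6 : ‖F 0‖ ≤ ‖z‖ * (‖F 0‖ * (1 + ‖z‖) ^ N) := by
            have : ‖F 0‖ * 1 ≤ ‖F 0‖ * (1 + ‖z‖) ^ N := by gcongr
            nlinarith
          nlinarith
        have h5 := le_of_mul_le_mul_left h4 (by linarith)
        nlinarith [abs_nonneg M]
    obtain ⟨p, hp⟩ := ih hd hb; refine ⟨Polynomial.C (F 0) + Polynomial.X * p, fun z => ?_⟩
    have h2 := sub_smul_dslope F 0 z
    rw [sub_zero, smul_eq_mul, hp] at h2; simp [h2]

theorem Polynomial.exists_norm_eval_le (p : Polynomial ℂ) :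
    ∃ (K : ℝ) (N : ℕ), 0 ≤ K ∧ ∀ z, ‖p.eval z‖ ≤ K * (1 + ‖z‖) ^ N := by
  refine ⟨∑ i ∈ Finset.range (p.natDegree + 1), ‖p.coeff i‖, p.natDegree, by positivity, fun z => ?_⟩
  rw [Polynomial.eval_eq_sum_range, Finset.sum_mul]; refine norm_sum_le_of_le _ fun i hi => ?_
  rw [norm_mul, norm_pow]; gcongr
  calc ‖z‖ ^ i ≤ (1 + ‖z‖) ^ i := by gcongr; linarith
    _ ≤ _ := pow_le_pow_right₀ (by linarith [norm_nonneg z]) (Nat.lt_succ_iff.1 (Finset.mem_range.1 hi))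

theorem eval_ratFunc_div {p q : Polynomial ℂ} {z : ℂ} (hq : q.eval z ≠ 0) :
    (algebraMap (Polynomial ℂ) (RatFunc ℂ) p / algebraMap (Polynomial ℂ) (RatFunc ℂ) q).eval
      (RingHom.id ℂ) z = p.eval z / q.eval z := by
  set r := algebraMap (Polynomial ℂ) (RatFunc ℂ) p / algebraMap (Polynomial ℂ) (RatFunc ℂ) q with hr
  have hq0 : q ≠ 0 := fun h => hq (by simp [h])
  have h1 := (RatFunc.num_mul_eq_mul_denom_iff hq0).2 hr
  have hd : r.denom.eval z ≠ 0 := fun h => hq (Polynomial.eval_eq_zero_of_dvd_of_eval_eq_zero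
    (RatFunc.denom_div_dvd p q) h)
  have h2 := congrArg (Polynomial.eval z) h1
  rw [Polynomial.eval_mul, Polynomial.eval_mul] at h2
  rw [RatFunc.eval, Polynomial.eval₂_id, Polynomial.eval₂_id, div_eq_div_iff hd hq, h2]

variable {n : ℕ} {a ρ : Fin n → ℂ} {μ : SignedMeasure ℂ} {σ : ℂ → ℝ}

theorem norm_cauchyTransform_le {ν : Measure ℂ} [IsFiniteMeasure ν] (hσ1 : ∀ x, |σ x| = 1) {z : ℂ}
    (h : ∀ x ∈ ν.support, 1 ≤ ‖x - z‖) : ‖cauchyTransform ν σ z‖ ≤ ν.real univ := by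
  have h1 : ∀ᵐ x ∂ν, ‖(σ x : ℂ) / (x - z)‖ ≤ 1 := by
    filter_upwards [ν.support_mem_ae] with x hx
    rw [norm_div, norm_real, norm_eq_abs, hσ1]; exact div_le_one_of_le₀ (h x hx) (norm_nonneg _)
  exact (norm_integral_le_of_norm_le_const h1).trans_eq (one_mul _)

/-- Off the support the principal value is an absolutely convergent integral. -/
theorem isCauchyPV_of_notMem_support {z : ℂ} (hz : z ∉ realSupport μ)
    (hμ : ∀ f : ℂ → ℂ, ∫ᵛ x, f x ∂<•μ = ∫ x, (σ x : ℂ) * f x ∂μ.variation) :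
    IsCauchyPV μ z (cauchyTransform μ.variation σ z) := by
  obtain ⟨r, hr, hrs⟩ := Metric.mem_nhds_iff.1
    (μ.variation.isClosed_support.isOpen_compl.mem_nhds hz)
  -- Once `ε` is below the distance to the support, the truncation discards only a null set and the
  -- truncated integral no longer changes.
  have h1 : ∀ᶠ ε : ℝ in 𝓝[>] 0, μ.restrict {x : ℂ | ε < ‖z - x‖} = μ := by
    filter_upwards [Ioo_mem_nhdsGT hr] with ε hε
    have hm : MeasurableSet {x : ℂ | ε < ‖z - x‖} :=
      (isOpen_lt continuous_const (by fun_prop)).measurableSet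
    ext i hi; rw [VectorMeasure.restrict_apply _ hm hi]
    have h2 : μ.variation (i \ {x : ℂ | ε < ‖z - x‖}) = 0 := by
      refine measure_mono_null (fun x hx => ?_) μ.variation.measure_compl_support
      refine hrs ?_; have h3 := hx.2
      rw [mem_ofPred_eq, not_lt] at h3; rw [mem_ball_iff_norm, norm_sub_rev]; exact h3.trans_lt hε.2
    have h3 := VectorMeasure.enorm_measure_le_variation μ (i \ {x : ℂ | ε < ‖z - x‖})
    rw [h2, nonpos_iff_eq_zero, enorm_eq_zero] at h3
    rw [← inter_union_sdiff i {x : ℂ | ε < ‖z - x‖}, VectorMeasure.of_union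
      (disjoint_sdiff_right.mono_left inter_subset_right) (hi.inter hm) (hi.diff hm), h3, add_zero,
      inter_union_sdiff]
  refine tendsto_const_nhds.congr' ?_; filter_upwards [h1] with ε hε
  rw [hε, hμ, cauchyTransform]; simp only [mul_one_div]

theorem IsAnalyticArc.isCompact {Γ : Set ℂ} (h : IsAnalyticArc Γ) : IsCompact Γ := by
  obtain ⟨γ, hγ, -, -, rfl⟩ := h
  exact isCompact_Icc.image_of_continuousOn fun t ht => (hγ t ht).continuousAt.continuousWithinAt

/-- The area integral of the Cauchy kernel over a disc of radius `r` is `O(r)` wherever its pole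
lies, so the same holds for any finite measure. The linear rate is what limits the square of the
field to a double pole. -/
theorem eventually_lintegral_totalField_le (hσ : Measurable σ) (hσ1 : ∀ x, |σ x| = 1) {z₀ : ℂ}
    (hz₀ : ∀ k, ρ k ≠ 0 → z₀ ≠ a k) : ∃ K : ℝ, ∀ᶠ r : ℝ in 𝓝[>] 0,
      ∫⁻ w in ball z₀ r, ‖totalField a ρ μ.variation σ w‖ₑ ≤ ennr (K * r) := by
  set ν := μ.variation with hν
  set B := ‖fieldDeriv a ρ z₀‖ + 1 with hB
  have h1 : ∀ᶠ w in 𝓝 z₀, ‖fieldDeriv a ρ w‖ < B :=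
    (differentiableAt_fieldDeriv a ρ hz₀).continuousAt.norm.eventually (gt_mem_nhds (by linarith))
  obtain ⟨r₀, hr₀, hr₀s⟩ := eventually_nhds_iff_ball.1 h1; refine ⟨6 * π * ν.real univ + B * π, ?_⟩
  filter_upwards [Ioo_mem_nhdsGT (lt_min hr₀ one_pos)] with r hr
  have hr0 : 0 < r := hr.1
  have hr1 := lt_min_iff.1 hr.2
  have hB0 : 0 ≤ B := by positivity
  calc ∫⁻ w in ball z₀ r, ‖totalField a ρ ν σ w‖ₑ
      ≤ ∫⁻ w in ball z₀ r, (‖cauchyTransform ν σ w‖ₑ + ennr B) := by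
        refine setLIntegral_mono' measurableSet_ball fun w hw => (enorm_add_le _ _).trans ?_
        gcongr; rw [← ofReal_norm]
        exact ofReal_le_ofReal (hr₀s w (ball_subset_ball hr1.1.le hw)).le
    _ = ennr (∫ w in ball z₀ r, ‖cauchyTransform ν σ w‖) +
          ennr B * volume (ball z₀ r) := by
        rw [lintegral_add_right _ measurable_const, lintegral_const, Measure.restrict_apply_univ,
          ofReal_integral_norm_eq_lintegral_enorm (integrableOn_ball_cauchyTransform hσ hσ1 z₀ r)]
    _ ≤ ennr (6 * π * r * ν.real univ) + ennr B * ennr (r * π) := by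
        gcongr
        · exact integral_norm_cauchyTransform_le hσ hσ1 z₀ hr0
        · rw [volume_ball, ← NNReal.coe_real_pi, ennr_mul hr0.le, ofReal_coe_nnreal]; gcongr
          rw [pow_two]; refine mul_le_of_le_one_right' ?_; simpa using hr1.2.le
    _ = _ := by
        rw [← ennr_mul hB0, ← ennr_add (by positivity) (by positivity)]
        congr 1; ring

/-- The square of the total field extends over every point of the support that is not a node. -/
theorem hasExtension_sq_totalField {k : ℕ} {Γ : Fin k → Set ℂ} (hΓ : ∀ j, IsAnalyticArc (Γ j))
    (hS : realSupport μ = ⋃ j, Γ j) (h : IsSignOf μ σ) (hconst : IsConstantOnComponents a ρ μ)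
    (hprop : HasSProperty a ρ μ) (hgrad : GradientVanishesAtNonregular a ρ μ) {z₀ : ℂ}
    (hz₀ : z₀ ∈ realSupport μ) :
    (∃ P : ℂ → ℂ, AnalyticAt ℂ P z₀ ∧ ∀ᶠ z in 𝓝[≠] z₀, z ∉ realSupport μ →
      (z - z₀) ^ 2 * totalField a ρ μ.variation σ z ^ 2 = P z) ∧
    ((∀ k, z₀ ≠ a k) →
      HasExtension (realSupport μ) (fun z => totalField a ρ μ.variation σ z ^ 2) z₀) := by
  have hdef := (hconst z₀ hz₀ z₀ (mem_connectedComponentIn hz₀)).1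
  have hnull : volume (realSupport μ) = 0 := by
    rw [hS]; exact measure_iUnion_null fun j => (hΓ j).volume_eq_zero
  have hdense := Measure.dense_of_ae (compl_mem_ae_iff.2 hnull)
  have hext : ∀ᶠ z in 𝓝[≠] z₀,
      HasExtension (realSupport μ) (fun z => totalField a ρ μ.variation σ z ^ 2) z := by
    have h1 := eventually_isGoodPoint hΓ z₀
    rw [← hS] at h1
    filter_upwards [h1, nhdsWithin_le_nhds (h.eventually_hasFDerivAt hdef.1).eventually_nhds] with z h2 h3
    by_cases hz : z ∈ realSupport μ
    · exact (h2 hz).exists_sq_extension h hconst hprop hz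
    · refine ⟨_, ?_, Eventually.of_forall fun w _ => rfl⟩
      refine AnalyticAt.pow ?_ 2; rw [analyticAt_iff_eventually_differentiableAt]
      filter_upwards [h3, μ.variation.isClosed_support.isOpen_compl.mem_nhds hz] with w h4 h5
      exact (h4 h5).2
  obtain ⟨K, hK⟩ := eventually_lintegral_totalField_le (μ := μ) h.measurable h.abs_eq_one hdef.1
  obtain ⟨P, hP, hPg⟩ := hasExtension_of_lintegral_le hdense hnull hext hK
  refine ⟨⟨P, hP, hPg⟩, fun hnode => ?_⟩
  -- At a regular point the direction is a unit normal, with derivatives from the S-property; at a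
  -- non-regular one it is any direction transverse to the arcs, with derivatives from the vanishing
  -- gradient.
  obtain ⟨e, he, hfree, d, d', hd, hd'⟩ : ∃ e : ℂ, e ≠ 0 ∧ IsFreeDirection (realSupport μ) z₀ e ∧
      ∃ d d' : ℝ, HasDerivWithinAt (fun s : ℝ => totalPotential a ρ μ z₀ (z₀ + s * e)) d (Ici 0) 0 ∧
        HasDerivWithinAt (fun s : ℝ => totalPotential a ρ μ z₀ (z₀ + s * (-e))) d' (Ici 0) 0 := by
    by_cases hreg : IsRegularPoint (realSupport μ) z₀
    · obtain ⟨γ, hγ⟩ := id hreg; have hne := hγ.eventually_mem.2.2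
      have hne' : (‖deriv γ 0‖ : ℂ) ≠ 0 := by simpa using hne
      set m := I * deriv γ 0 / ‖deriv γ 0‖ with hm
      have hm1 : ‖m‖ = 1 := by
        rw [hm, norm_div, norm_mul, norm_I, one_mul, norm_real, norm_norm,
          div_self (norm_ne_zero_iff.2 hne)]
      have hmn : IsUnitNormal (realSupport μ) z₀ m := by
        refine ⟨hm1, γ, hγ, ?_⟩; rw [Complex.inner, hm, map_div₀, map_mul, conj_I, conj_ofReal]
        have h1 : deriv γ 0 * (-I * conj (deriv γ 0) / ‖deriv γ 0‖) =
            ((-‖deriv γ 0‖ : ℝ) : ℂ) * I := by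
          have h2 := conj_mul' (deriv γ 0)
          field_simp; push_cast; linear_combination -h2
        rw [h1, re_ofReal_mul, I_re, mul_zero]
      obtain ⟨d, hd1, hd2⟩ := hprop z₀ hz₀ hreg m hmn
      exact ⟨m, norm_ne_zero_iff.1 (by rw [hm1]; exact one_ne_zero), hmn.isFreeDirection, d, d, hd1, hd2⟩
    · obtain ⟨e, he, hfree⟩ := exists_isFreeDirection hΓ z₀; rw [← hS] at hfree
      have hg := (hgrad z₀ hz₀ hnode hreg).hasFDerivAt
      have hline : ∀ v : ℂ, HasDerivWithinAt
          (fun s : ℝ => totalPotential a ρ μ z₀ (z₀ + s * v)) 0 (Ici 0) 0 := fun v => by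
        have h1 : HasDerivAt (fun s : ℝ => z₀ + s * v) v 0 := by
          simpa using ((ofRealCLM.hasDerivAt (x := (0:ℝ))).mul_const v).const_add z₀
        refine HasDerivAt.hasDerivWithinAt ?_
        have h2 := HasFDerivAt.comp_hasDerivAt (0:ℝ) (f := fun s : ℝ => z₀ + s * v)
          (l := totalPotential a ρ μ z₀) (by simpa using hg) h1
        exact h2.congr_deriv (by simp)
      exact ⟨e, he, hfree, 0, 0, hline e, hline (-e)⟩
  obtain ⟨c, hc, hcs⟩ := hfree.exists_le_norm_sub he
  obtain ⟨c', hc', hcs'⟩ := hfree.neg.exists_le_norm_sub (neg_ne_zero.2 he)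
  have hoff : ∀ {v : ℂ} {c : ℝ}, 0 < c → (∀ᶠ s : ℝ in 𝓝[>] 0, ∀ x ∈ realSupport μ,
      c * s ≤ ‖x - (z₀ + s * v)‖) → ∀ᶠ s : ℝ in 𝓝[>] 0, z₀ + s * v ∉ realSupport μ := fun hc h => by
    filter_upwards [h, self_mem_nhdsWithin] with s hs hs0 hmem
    have h1 := hs _ hmem
    rw [sub_self, norm_zero] at h1; have : 0 < s := hs0
    nlinarith [mul_pos hc this]
  refine hasExtension_of_isFreeDirection hz₀ hP hPg ((h.eventually_hasFDerivAt hdef.1).mono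
    fun z hz hzS => (hz hzS).1) he (hoff hc hcs) (hoff hc' hcs') ?_ hd hd'
  have h1 := tendsto_mul_cauchyTransform h.measurable h.abs_eq_one hdef.2.1 hc hcs
  have h2 : Tendsto (fun s : ℝ => (s:ℂ) * fieldDeriv a ρ (z₀ + s * e)) (𝓝[>] 0) (𝓝 0) := by
    have h3 : ContinuousAt (fun s : ℝ => (s:ℂ) * fieldDeriv a ρ (z₀ + s * e)) 0 :=
      continuous_ofReal.continuousAt.mul (ContinuousAt.comp (g := fieldDeriv a ρ)
        (by simpa using (differentiableAt_fieldDeriv a ρ hdef.1).continuousAt) (by fun_prop))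
    have h4 := h3.tendsto
    simp only [ofReal_zero, zero_mul] at h4; exact h4.mono_left nhdsWithin_le_nhds
  have h3 := h1.add h2
  rw [add_zero] at h3; exact h3.congr fun s => by rw [totalField, mul_add]

/-- The function `f = (A C^μ + A Φ')²`, with `A` the node polynomial, is `A² g²` off the nodes. It
extends to an entire function, and at distance at least 1 from the support the Cauchy transform is
bounded, so the extension grows polynomially and is a polynomial `p`. The rational function is `p /
A²`. -/
theorem exists_ratFunc_of_arcs {k : ℕ} {Γ : Fin k → Set ℂ} (hΓ : ∀ j, IsAnalyticArc (Γ j))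
    (hS : realSupport μ = ⋃ j, Γ j) (hconst : IsConstantOnComponents a ρ μ)
    (hprop : HasSProperty a ρ μ) (hgrad : GradientVanishesAtNonregular a ρ μ) :
    ∃ R : RatFunc ℂ, R.denom ∣ (∏ j, (Polynomial.X - Polynomial.C (a j))) ^ 2 ∧
      SatisfiesCauchyEquation a ρ μ R := by
  obtain ⟨σ, hσ, hσ1, hμ, hμ'⟩ := exists_sign_variation μ
  have hcs : IsCompact (realSupport μ) := by
    rw [hS]; exact isCompact_iUnion fun j => (hΓ j).isCompact
  have h : IsSignOf μ σ := ⟨hσ, fun x => by rcases hσ1 x with h | h <;> simp [h], hcs,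
    funext fun w => hμ _⟩
  have hnull : volume (realSupport μ) = 0 := by
    rw [hS]; exact measure_iUnion_null fun j => (hΓ j).volume_eq_zero
  have hdense : Dense (realSupport μ)ᶜ := Measure.dense_of_ae (compl_mem_ae_iff.2 hnull)
  set S := realSupport μ with hSdef
  set ν := μ.variation with hν
  set f : ℂ → ℂ := fun z => (nodeProd a z * cauchyTransform ν σ z + nodeField a ρ z) ^ 2 with hf
  have hfg : ∀ z, (∀ k, z ≠ a k) → f z = nodeProd a z ^ 2 * totalField a ρ ν σ z ^ 2 := fun z hz => by
    simp only [hf, totalField]; rw [nodeField_eq a ρ hz]; ring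
  -- At a node in the support the factor `A²` cancels the double pole that `g²` may have; at other
  -- points of the support `g²` itself extends; off the support `f` is analytic, even at charged
  -- nodes, since `A Φ'` is a polynomial.
  have hext : ∀ z ∈ univ, HasExtension S f z := fun z _ => by
    by_cases hz : z ∈ S
    · obtain ⟨⟨P, hP, hPg⟩, hreg⟩ := hasExtension_sq_totalField hΓ hS h hconst hprop hgrad hz
      have hA : AnalyticAt ℂ (nodeProd a) z := (differentiable_nodeProd a).analyticAt z
      by_cases hnode : ∀ k, z ≠ a k
      · obtain ⟨Q, hQ, hgQ⟩ := hreg hnode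
        refine ⟨fun w => nodeProd a w ^ 2 * Q w, (hA.pow 2).mul hQ, ?_⟩
        have h1 : ∀ᶠ w in 𝓝 z, ∀ k, w ≠ a k := eventually_all.2 fun k =>
          isOpen_ne.mem_nhds (hnode k)
        filter_upwards [hgQ, h1] with w h2 h3 h4
        rw [hfg w h3, h2 h4]
      · have hA0 : nodeProd a z = 0 := by
          push Not at hnode; obtain ⟨k, hk⟩ := hnode
          exact Finset.prod_eq_zero (Finset.mem_univ k) (by rw [hk, sub_self])
        refine ⟨fun w => dslope (nodeProd a) z w ^ 2 * P w, ?_, ?_⟩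
        · refine AnalyticAt.mul (AnalyticAt.pow ?_ 2) hP; obtain ⟨p, hp⟩ := hA
          exact ⟨_, hp.has_fpower_series_dslope_fslope⟩
        · have h1 : ∀ᶠ w in 𝓝 z, ∀ k, w ≠ z → w ≠ a k := eventually_all.2 fun k => by
            rcases eq_or_ne (a k) z with h2 | h2
            · exact Eventually.of_forall fun w hw => by rwa [h2]
            · filter_upwards [isOpen_ne.mem_nhds h2.symm] with w hw _ using hw
          rw [eventually_nhdsWithin_iff] at hPg; filter_upwards [hPg, h1] with w h2 h3 h4
          have hwz : w ≠ z := fun h5 => h4 (h5 ▸ hz)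
          rw [hfg w fun k => h3 k hwz, ← h2 hwz h4]
          have h5 := sub_smul_dslope (nodeProd a) z w
          rw [hA0, sub_zero, smul_eq_mul] at h5; rw [← h5]; ring
    · refine ⟨f, ?_, Eventually.of_forall fun w _ => rfl⟩
      rw [analyticAt_iff_eventually_differentiableAt]
      filter_upwards [ν.isClosed_support.isOpen_compl.mem_nhds hz] with w hw
      exact (((differentiable_nodeProd a w).mul (differentiableAt_cauchyTransform hσ h.abs_eq_one hw)).add
        (differentiable_nodeField a ρ w)).pow 2
  obtain ⟨F, hF, hFf⟩ := exists_glued_extension (U := univ) hdense hext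
  rw [differentiableOn_univ] at hF
  set pA : Polynomial ℂ := ∏ j, (Polynomial.X - Polynomial.C (a j)) with hpA
  have hAe : ∀ z, nodeProd a z = pA.eval z := fun z => by
    simp [hpA, nodeProd, Polynomial.eval_prod]
  have hBe : ∀ z, nodeField a ρ z = Polynomial.eval z (-∑ k, Polynomial.C (ρ k / 2) *
      ∏ j ∈ Finset.univ.erase k, (Polynomial.X - Polynomial.C (a j))) := fun z => by
    simp [nodeField, Polynomial.eval_prod, Polynomial.eval_finsetSum]
  obtain ⟨K₁, N₁, hK₁, hb₁⟩ := pA.exists_norm_eval_le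
  obtain ⟨K₂, N₂, hK₂, hb₂⟩ := Polynomial.exists_norm_eval_le (-∑ k, Polynomial.C (ρ k / 2) *
      ∏ j ∈ Finset.univ.erase k, (Polynomial.X - Polynomial.C (a j)))
  obtain ⟨r, hr⟩ := hcs.isBounded.subset_closedBall 0
  obtain ⟨M, hM⟩ := (isCompact_closedBall (0:ℂ) (r + 1)).exists_bound_of_continuousOn
    hF.continuous.continuousOn
  obtain ⟨p, hp⟩ := exists_polynomial_of_norm_le (2 * (N₁ + N₂)) hF
    (K := |M| + (K₁ * ν.real univ + K₂) ^ 2) fun z => by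
      have hz1 : 1 ≤ 1 + ‖z‖ := by linarith [norm_nonneg z]
      have h1 : 1 ≤ (1 + ‖z‖) ^ (2 * (N₁ + N₂)) := one_le_pow₀ hz1
      rw [add_mul]; by_cases hz : z ∈ closedBall (0:ℂ) (r + 1)
      · have h2 : |M| * 1 ≤ |M| * (1 + ‖z‖) ^ (2 * (N₁ + N₂)) := by gcongr
        have h3 : 0 ≤ (K₁ * ν.real univ + K₂) ^ 2 * (1 + ‖z‖) ^ (2 * (N₁ + N₂)) := by positivity
        linarith [hM z hz, le_abs_self M]
      · rw [mem_closedBall_zero_iff, not_le] at hz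
        have hfar : ∀ x ∈ S, 1 ≤ ‖x - z‖ := fun x hx => by
          have h2 := hr hx
          rw [mem_closedBall_zero_iff] at h2; have h3 := norm_sub_norm_le z x
          rw [norm_sub_rev] at h3; linarith
        have hzS : z ∉ S := fun hz' => by
          have := hfar z hz'
          rw [sub_self, norm_zero] at this; linarith
        rw [hFf z (mem_univ z) hzS]; simp only [hf]; rw [norm_pow]
        have h2 : ‖nodeProd a z * cauchyTransform ν σ z + nodeField a ρ z‖ ≤
            (K₁ * ν.real univ + K₂) * (1 + ‖z‖) ^ (N₁ + N₂) := by
          refine (norm_add_le _ _).trans ?_; rw [norm_mul, hAe, hBe, add_mul]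
          have e1 : (1 + ‖z‖) ^ N₁ ≤ (1 + ‖z‖) ^ (N₁ + N₂) := pow_le_pow_right₀ hz1 (by omega)
          have e2 : (1 + ‖z‖) ^ N₂ ≤ (1 + ‖z‖) ^ (N₁ + N₂) := pow_le_pow_right₀ hz1 (by omega)
          refine add_le_add ?_ ((hb₂ z).trans (by gcongr))
          calc ‖pA.eval z‖ * ‖cauchyTransform ν σ z‖ ≤ (K₁ * (1 + ‖z‖) ^ N₁) * ν.real univ := by
                gcongr
                · exact hb₁ z
                · exact norm_cauchyTransform_le h.abs_eq_one hfar
            _ ≤ (K₁ * (1 + ‖z‖) ^ (N₁ + N₂)) * ν.real univ := by gcongr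
            _ = _ := by ring
        have h3 : 0 ≤ |M| * (1 + ‖z‖) ^ (2 * (N₁ + N₂)) := by positivity
        calc ‖nodeProd a z * cauchyTransform ν σ z + nodeField a ρ z‖ ^ 2
            ≤ ((K₁ * ν.real univ + K₂) * (1 + ‖z‖) ^ (N₁ + N₂)) ^ 2 := by gcongr
          _ = (K₁ * ν.real univ + K₂) ^ 2 * (1 + ‖z‖) ^ (2 * (N₁ + N₂)) := by
              rw [mul_pow, ← pow_mul, mul_comm (N₁ + N₂)]
          _ ≤ _ := by linarith
  refine ⟨algebraMap (Polynomial ℂ) (RatFunc ℂ) p / algebraMap (Polynomial ℂ) (RatFunc ℂ) (pA ^ 2),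
    RatFunc.denom_div_dvd _ _, ?_⟩
  filter_upwards [ae_ne_nodes a, compl_mem_ae_iff.2 hnull] with z hz hzS
  refine ⟨_, isCauchyPV_of_notMem_support hzS hμ', ?_⟩; have hA0 := nodeProd_ne_zero a hz
  rw [eval_ratFunc_div (by rw [Polynomial.eval_pow, ← hAe]; exact pow_ne_zero 2 hA0),
    Polynomial.eval_pow, ← hAe, ← hp, hFf z (mem_univ z) hzS, hfg z hz,
    mul_div_cancel_left₀ _ (pow_ne_zero 2 hA0), totalField]

end

theorem mainTheorem7 (p : ℕ) (a : Fin (p + 1) → ℂ) (ha : Function.Injective a)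
    (ρ : Fin (p + 1) → ℂ) (μ : SignedMeasure ℂ) :
    (IsCriticalMeasure a ρ μ →
      IsConstantOnComponents a ρ μ ∧
      ((∀ k, (ρ k).im = 0) → ∀ x ∈ realSupport μ, ∃ w : ℝ,
        ∀ z ∈ connectedComponentIn (realSupport μ) x,
          logPotential μ z + externalField a ρ z = w) ∧
      HasSProperty a ρ μ ∧
      GradientVanishesAtNonregular a ρ μ) ∧
    (∀ (k : ℕ) (Γ : Fin k → Set ℂ), (∀ j, IsAnalyticArc (Γ j)) →
      realSupport μ = ⋃ j, Γ j →
      IsConstantOnComponents a ρ μ →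
      HasSProperty a ρ μ →
      GradientVanishesAtNonregular a ρ μ →
      ∃ R : RatFunc ℂ,
        R.denom ∣ (∏ j, (Polynomial.X - Polynomial.C (a j))) ^ 2 ∧
        SatisfiesCauchyEquation a ρ μ R) := by
  refine ⟨fun h => ⟨h.isConstantOnComponents ha, fun hρ x hx =>
    (h.isConstantOnComponents ha).exists_eq hρ hx, h.hasSProperty ha,
    h.gradientVanishesAtNonregular ha⟩, fun k Γ hΓ hS hconst hprop hgrad =>
    exists_ratFunc_of_arcs hΓ hS hconst hprop hgrad⟩

end
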